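/- **Conventions.** Let $R$ be a commutative ring and $A$ an $R$-algebra. Write $\mathrm{Mod}(A,R)$ for the exact category of (left) $A$-modules that are projective over $R$, and $\mathrm{mod}(A,R)$ for its full exact subcategory of modules that are finitely generated and projective over $R$; conflations are the short exact sequences of $A$-modules. Let $\mathbf{D}^b(\mathrm{mod}(A,R))$ be the bounded derived category of the exact category $\mathrm{mod}(A,R)$, i.e. the Verdier quotient of $\mathbf{K}^b(\mathrm{mod}(A,R))$ by its acyclic complexes. The algebra $A$ is a *Frobenius $R$-algebra* if it is finitely generated and projective as an $R$-module and $\mathrm{add}\,\mathrm{Hom}_R(A,R)=\mathrm{add}\,A$ in $\mathrm{Mod}\,A$. Let $\mathbf{K}(\mathrm{Proj}\,A)$ be the homotopy category of complexes of projective $A$-modules, let $\mathbf{K}^{+,b}(\mathrm{proj}\,A)$ be the class of complexes $X$ of finitely generated projective $A$-modules with $X^n=0$ for $n\ll 0$ that are acyclic in all degrees $n\gg 0$ with respect to the exact structure of $\mathrm{Mod}(A,R)$, and let $\mathbf{K}^{\mathrm{lf}}(\mathrm{Proj}\,A,R)$ be the localising subcategory of $\mathbf{K}(\mathrm{Proj}\,A)$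 generated by $\mathbf{K}^{+,b}(\mathrm{proj}\,A)$. The superscript $c$ denotes the full subcategory of compact objects. **(1)** Let $A$ be a Frobenius $R$-algebra. The triangulated category $\mathbf{K}^{\mathrm{lf}}(\mathrm{Proj}\,A,R)$ is compactly generated, and the canonical functor $\mathbf{K}^{\mathrm{lf}}(\mathrm{Proj}\,A,R)\to\mathbf{D}(\mathrm{Mod}\,A)$ induces a triangle equivalence $$\mathbf{K}^{\mathrm{lf}}(\mathrm{Proj}\,A,R)^{c}\xrightarrow{\ \sim\ }\mathbf{D}^b(\mathrm{mod}(A,R)).$$ Here the canonical functor $\mathbf{D}^b(\mathrm{mod}(A,R))\to\mathbf{D}(\mathrm{Mod}\,A)$ is fully faithful, and "induces" means that the equivalence followed by this functor is isomorphic, compatibly with the shifts, to the restriction of $\mathbf{K}^{\mathrm{lf}}(\mathrm{Proj}\,A,R)\to\mathbf{D}(\mathrm{Mod}\,A)$. **(2)** Suppose that $R$ is noetherian and that $G$ is a finite flat group scheme over $R$, that is, $G=\mathrm{Spec}\,R[G]$ with $R[G]$ a commutative Hopf $R$-algebra that is finitely generated and projective as an $R$-module. Let $RG=\mathrm{Hom}_R(R[G],R)$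 be its group algebra, a cocommutative Hopf algebra, and write $\mathbf{K}^{\mathrm{lf}}(\mathrm{Proj}\,G,R)=\mathbf{K}^{\mathrm{lf}}(\mathrm{Proj}\,RG,R)$. The tensor product $\otimes_R$ of complexes of $RG$-modules, with the diagonal action of $RG$, restricts to complexes in $\mathbf{K}^{\mathrm{lf}}(\mathrm{Proj}\,G,R)$ and induces on this category a symmetric tensor-triangulated structure (with the associativity, symmetry and shift isomorphisms coming from those of $\otimes_R$ on complexes) that is rigidly-compactly generated: the category is compactly generated, the tensor unit $\mathbb 1$ is compact, internal function objects $\mathcal Hom(-,-)$ exist, and an object $X$ is compact if and only if it is rigid, meaning that the natural map $\mathcal Hom(X,\mathbb 1)\otimes Y\to\mathcal Hom(X,Y)$ is an isomorphism for every $Y$. -/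

import Mathlib

open CategoryTheory Limits Pretriangulated MonoidalCategory

universe w v u

namespace FrobLF

section Triangulated

open scoped ZeroObject

variable {T : Type u} [Category.{v} T] [Preadditive T]

/-- `X` is compact: every morphism from `X` to a small coproduct `∐ Y j` is a finite sum of
morphisms `X ⟶ Y j ⟶ ∐ Y j` -/
def compacts (T : Type u) [Category.{v} T] [Preadditive T] : ObjectProperty T := fun X =>
  ∀ (J : Type v) (Y : J → T) (c : Cofan Y), IsColimit c → ∀ f : X ⟶ c.pt,
    ∃ (s : Finset J) (φ : ∀ j, X ⟶ Y j), f = ∑ j ∈ s, φ j ≫ c.inj j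

variable [HasZeroObject T] [HasShift T ℤ] [∀ n : ℤ, (shiftFunctor T n).Additive]
  [Pretriangulated T]

/-- `P` is (the class of objects of) a localising subcategory: a triangulated subcategory closed
under isomorphisms and small coproducts. -/
structure IsLocalising (P : ObjectProperty T) : Prop where
  isClosedUnderIsomorphisms : P.IsClosedUnderIsomorphisms
  isTriangulated : P.IsTriangulated
  coproducts : ∀ (J : Type v) (Y : J → T) (c : Cofan Y), IsColimit c → (∀ j, P (Y j)) → P c.pt

/-- The localising subcategory generated by the objects in `P`. -/
def localisingClosure (P : ObjectProperty T) : ObjectProperty T := fun X =>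
  ∀ Q : ObjectProperty T, IsLocalising Q → P ≤ Q → Q X

instance (P : ObjectProperty T) : (localisingClosure P).IsClosedUnderIsomorphisms where
  of_iso e hX Q hQ hP := hQ.isClosedUnderIsomorphisms.of_iso e (hX Q hQ hP)

instance (P : ObjectProperty T) : (localisingClosure P).IsTriangulated where
  exists_zero := ⟨0, isZero_zero T, fun Q hQ _ => by
    have := hQ.isTriangulated
    have := hQ.isClosedUnderIsomorphisms
    exact Q.prop_zero⟩
  isStableUnderShiftBy n := ⟨fun X hX Q hQ hP => by
    have := hQ.isTriangulated
    exact Q.le_shift n _ (hX Q hQ hP)⟩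
  toIsTriangulatedClosed₂ := .mk' fun D hD h₁ h₃ Q hQ hP => by
    have := hQ.isTriangulated
    have := hQ.isClosedUnderIsomorphisms
    exact Q.ext_of_isTriangulatedClosed₂ D hD (h₁ Q hQ hP) (h₃ Q hQ hP)

/-- `T` is compactly generated: it has small coproducts, and it is generated, as a localising
subcategory, by a (small) set of compact objects. -/
def IsCompactlyGeneratedTri (T : Type u) [Category.{v} T] [Preadditive T] [HasZeroObject T]
    [HasShift T ℤ] [∀ n : ℤ, (shiftFunctor T n).Additive] [Pretriangulated T] : Prop :=
  HasCoproducts.{v} T ∧ ∃ (ι : Type v) (S : ι → T), (∀ i, compacts T (S i)) ∧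
    ∀ X : T, localisingClosure (ObjectProperty.ofObj S) X

instance : (compacts T).IsClosedUnderIsomorphisms where
  of_iso {X Y} e hX J Z c hc f := by
    obtain ⟨s, φ, h⟩ := hX J Z c hc (e.hom ≫ f)
    refine ⟨s, fun j => e.inv ≫ φ j, ?_⟩
    rw [← cancel_epi e.hom, h, Preadditive.comp_sum]
    simp

instance : (compacts T).IsTriangulated where
  exists_zero := ⟨0, isZero_zero T, fun J Y c _ f =>
    ⟨∅, fun _ => 0, (isZero_zero T).eq_of_src _ _⟩⟩
  isStableUnderShiftBy n := ⟨fun X hX J Y c hc f => by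
    let F := shiftFunctor T (-n)
    let e : X ≅ F.obj (X⟦n⟧) := (shiftEquiv T n).unitIso.app X
    obtain ⟨s, φ, h⟩ := hX J _ _ (Cofan.isColimitMapCoconeEquiv F Y c (isColimitOfPreserves F hc))
      (e.hom ≫ F.map f)
    refine ⟨s, fun j => F.preimage (e.inv ≫ φ j), F.map_injective ?_⟩
    rw [← cancel_epi e.hom, h, F.map_sum, Preadditive.comp_sum]
    refine Finset.sum_congr rfl fun j _ => ?_
    rw [F.map_comp, F.map_preimage, Category.assoc, Iso.hom_inv_id_assoc]
    rfl⟩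
  toIsTriangulatedClosed₂ := .mk' fun D hD h₁ h₃ J Y c hc f => by
    classical
    obtain ⟨s, φ, h⟩ := h₁ J Y c hc (D.mor₁ ≫ f)
    let p : c.pt ⟶ c.pt := Cofan.IsColimit.desc hc (fun j => if j ∈ s then 0 else c.inj j)
    have hp : ∀ j, c.inj j ≫ p = if j ∈ s then 0 else c.inj j := fun j => by simp [p]
    obtain ⟨g, hg⟩ := Triangle.yoneda_exact₂ D hD (f ≫ p) (by
      rw [← Category.assoc, h, Preadditive.sum_comp]
      refine Finset.sum_eq_zero fun j hj => ?_
      rw [Category.assoc, hp, if_pos hj, comp_zero])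
    obtain ⟨s', φ', h'⟩ := h₃ J Y c hc g
    let r : ∀ j, c.pt ⟶ Y j := fun j => Cofan.IsColimit.desc hc
      (fun i => if h : i = j then eqToHom (by rw [h]) else 0)
    have hr : ∀ i j, c.inj i ≫ r j = if h : i = j then eqToHom (by rw [h]) else 0 :=
      fun i j => by simp [r]
    have hid : 𝟙 c.pt = p + ∑ j ∈ s, r j ≫ c.inj j := by
      refine Cofan.IsColimit.hom_ext hc _ _ fun i => ?_
      rw [Preadditive.comp_add, hp, Preadditive.comp_sum, Category.comp_id]
      simp only [← Category.assoc, hr]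
      by_cases hi : i ∈ s
      · rw [if_pos hi, zero_add, Finset.sum_eq_single i]
        · simp
        · intro j _ hj
          rw [dif_neg (Ne.symm hj), zero_comp]
        · exact fun h => (h hi).elim
      · rw [if_neg hi, Finset.sum_eq_zero, add_zero]
        intro j hj
        rw [dif_neg (by rintro rfl; exact hi hj), zero_comp]
    refine ⟨s ∪ s', fun j => (if j ∈ s' then D.mor₂ ≫ φ' j else 0) +
      (if j ∈ s then f ≫ r j else 0), ?_⟩
    have : f = f ≫ p + ∑ j ∈ s, f ≫ r j ≫ c.inj j := by
      rw [← Preadditive.comp_sum, ← Preadditive.comp_add, ← hid, Category.comp_id]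
    refine this.trans ?_
    rw [hg, h']
    simp only [Preadditive.add_comp, Finset.sum_add_distrib, Preadditive.comp_sum, ite_comp,
      zero_comp, Finset.sum_ite_mem, Category.assoc]
    rw [Finset.union_inter_cancel_right, Finset.union_inter_cancel_left]
    

end Triangulated


section Modules

variable (R : Type u) [CommRing R] (A : Type u) [Ring A] [Algebra R A]

/-- `Mod(A, R)`: the `A`-modules that are projective over `R`. -/
def modProj : ObjectProperty (ModuleCat.{u} A) := fun M =>
  Module.Projective R ((ModuleCat.restrictScalars (algebraMap R A)).obj M)

/-- `mod(A, R)`: the `A`-modules that are finitely generated and projective over `R`. -/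
def modFinProj : ObjectProperty (ModuleCat.{u} A) := fun M =>
  Module.Finite R ((ModuleCat.restrictScalars (algebraMap R A)).obj M) ∧ modProj R A M

/-- `Proj A`: the projective `A`-modules. -/
def proj (A : Type u) [Ring A] : ObjectProperty (ModuleCat.{u} A) := fun M => Module.Projective A M

/-- `proj A`: the finitely generated projective `A`-modules. -/
def finProj (A : Type u) [Ring A] : ObjectProperty (ModuleCat.{u} A) := fun M =>
  Module.Finite A M ∧ Module.Projective A M

end Modules

section Termwise

open scoped ZeroObject

variable {C : Type u} [Category.{v} C] [Preadditive C]

/-- The objects of the homotopy category whose terms satisfy `P`. -/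
def termwise (P : ObjectProperty C) : ObjectProperty (HomotopyCategory C (.up ℤ)) :=
  fun X => ∀ n, P (X.as.X n)

/-- The objects of the homotopy category with only finitely many nonzero terms. -/
def bounded (C : Type u) [Category.{v} C] [Preadditive C] :
    ObjectProperty (HomotopyCategory C (.up ℤ)) :=
  fun X => ∃ N : ℕ, ∀ n : ℤ, (N : ℤ) < |n| → IsZero (X.as.X n)

variable [HasZeroObject C] [HasBinaryBiproducts C]

lemma isTriangulated_of_mappingCone (P : ObjectProperty (HomotopyCategory C (.up ℤ)))
    (h0 : P ((HomotopyCategory.quotient C (.up ℤ)).obj 0))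
    (hs : ∀ (K : CochainComplex C ℤ) (n : ℤ), P ((HomotopyCategory.quotient C _).obj K) →
      P ((HomotopyCategory.quotient C _).obj (K⟦n⟧)))
    (hc : ∀ (K L : CochainComplex C ℤ) (f : K ⟶ L), P ((HomotopyCategory.quotient C _).obj K) →
      P ((HomotopyCategory.quotient C _).obj L) →
      P ((HomotopyCategory.quotient C _).obj (CochainComplex.mappingCone f))) :
    P.IsTriangulated := by
  have h1 : P.IsStableUnderShift ℤ :=
    ⟨fun n => ⟨fun K hK => by
      obtain ⟨K : CochainComplex C ℤ, rfl⟩ := K.quotient_obj_surjective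
      rw [ObjectProperty.prop_shift_iff, HomotopyCategory.shift_quotient_obj]
      exact hs K n hK⟩⟩
  have h3 : P.IsTriangulatedClosed₃ := by
    constructor
    intro T hT h₁ h₂
    obtain ⟨f : T.obj₁.as ⟶ T.obj₂.as, hf⟩ :=
      (HomotopyCategory.quotient C (.up ℤ)).map_surjective T.mor₁
    exact ⟨_, hc _ _ f h₁ h₂, ⟨Triangle.π₃.mapIso (isoTriangleOfIso₁₂ T _ hT
      (HomotopyCategory.mappingCone_triangleh_distinguished f)
        (Iso.refl _) (Iso.refl _)
      ((Category.comp_id _).trans (hf.symm.trans (Category.id_comp _).symm)))⟩⟩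
  exact
    { exists_zero := ⟨_, Functor.map_isZero _ (isZero_zero _), h0⟩
      toIsStableUnderShift := h1
      toIsTriangulatedClosed₂ := .of_isTriangulatedClosed₃ }

lemma isTriangulated_termwise (P : ObjectProperty C) [P.IsClosedUnderIsomorphisms]
    (h0 : P 0) (hb : ∀ X Y, P X → P Y → P (X ⊞ Y)) : (termwise P).IsTriangulated :=
  isTriangulated_of_mappingCone _
    (fun i => P.prop_of_iso (IsZero.iso (isZero_zero _)
      ((HomologicalComplex.eval C _ i).map_isZero (isZero_zero _))) h0) (fun K n h i => h (i + n))
    (fun K L f hK hL i => by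
      have := HomologicalComplex.HasHomotopyCofiber.hasBinaryBiproduct f i (i + 1) rfl
      exact P.prop_of_iso (HomologicalComplex.homotopyCofiber.XIsoBiprod f i (i + 1) rfl).symm
        (hb _ _ (hK _) (hL _)))

lemma isTriangulated_termwise_inf_bounded (P : ObjectProperty C) [P.IsClosedUnderIsomorphisms]
    (h0 : P 0) (hb : ∀ X Y, P X → P Y → P (X ⊞ Y)) :
    (termwise P ⊓ bounded C).IsTriangulated :=
  isTriangulated_of_mappingCone _
    ⟨fun i => P.prop_of_iso (IsZero.iso (isZero_zero _)
      ((HomologicalComplex.eval C _ i).map_isZero (isZero_zero _))) h0,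
      0, fun i _ => (HomologicalComplex.eval C _ i).map_isZero (isZero_zero _)⟩
    (fun K n h => ⟨fun i => h.1 (i + n), by
      obtain ⟨N, hN⟩ := h.2
      exact ⟨N + n.natAbs, fun i hi => hN (i + n) (by push_cast at hi; grind)⟩⟩)
    (fun K L f hK hL => ⟨fun i => by
      have := HomologicalComplex.HasHomotopyCofiber.hasBinaryBiproduct f i (i + 1) rfl
      exact P.prop_of_iso (HomologicalComplex.homotopyCofiber.XIsoBiprod f i (i + 1) rfl).symm
        (hb _ _ (hK.1 _) (hL.1 _)), by
      obtain ⟨N, hN⟩ := hK.2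
      obtain ⟨M, hM⟩ := hL.2
      exact ⟨N + M + 1, fun i hi => (CochainComplex.mappingCone.isZero_X_iff f i).2
        ⟨hN _ (by push_cast at hi; grind), hM _ (by push_cast at hi; grind)⟩⟩⟩)

end Termwise

section Klf

variable (R : Type u) [CommRing R] (A : Type u) [Ring A] [Algebra R A]

instance : (modProj R A).IsClosedUnderIsomorphisms where
  of_iso e h := by
    have : Module.Projective R _ := h
    exact Module.Projective.of_equiv
      ((ModuleCat.restrictScalars (algebraMap R A)).mapIso e).toLinearEquiv

instance : (modFinProj R A).IsClosedUnderIsomorphisms where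
  of_iso e h := ⟨by
    have : Module.Finite R _ := h.1
    exact Module.Finite.equiv
      ((ModuleCat.restrictScalars (algebraMap R A)).mapIso e).toLinearEquiv,
    (modProj R A).prop_of_iso e h.2⟩

instance : (proj A).IsClosedUnderIsomorphisms where
  of_iso e h := by
    have : Module.Projective A _ := h
    exact Module.Projective.of_equiv e.toLinearEquiv

open scoped ZeroObject

lemma modFinProj_zero : modFinProj R A 0 := by
  refine (modFinProj R A).prop_of_iso (IsZero.iso (ModuleCat.isZero_of_subsingleton
    (ModuleCat.of A PUnit)) (isZero_zero _)) ?_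
  have : Subsingleton ((ModuleCat.restrictScalars (algebraMap R A)).obj (ModuleCat.of A PUnit)) :=
    inferInstanceAs (Subsingleton PUnit)
  exact ⟨inferInstance, (inferInstance : Module.Projective R _)⟩

lemma modFinProj_biprod (X Y : ModuleCat.{u} A) (hX : modFinProj R A X) (hY : modFinProj R A Y) :
    modFinProj R A (X ⊞ Y) := by
  let F := ModuleCat.restrictScalars.{u} (algebraMap R A)
  have : PreservesBinaryBiproduct X Y F := preservesBinaryBiproduct_of_preservesBiproduct F X Y
  have e : F.obj (X ⊞ Y) ≃ₗ[R] F.obj X × F.obj Y :=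
    (F.mapBiprod X Y ≪≫ ModuleCat.biprodIsoProd _ _).toLinearEquiv
  have := hX.1
  have := hY.1
  have : Module.Projective R (F.obj X) := hX.2
  have : Module.Projective R (F.obj Y) := hY.2
  exact ⟨Module.Finite.equiv e.symm, (Module.Projective.of_equiv e.symm : Module.Projective R _)⟩

lemma proj_zero : proj A 0 := by
  refine (proj A).prop_of_iso (IsZero.iso (ModuleCat.isZero_of_subsingleton
    (ModuleCat.of A PUnit)) (isZero_zero _)) ?_
  exact (inferInstance : Module.Projective A PUnit.{u + 1})

lemma proj_biprod (X Y : ModuleCat.{u} A) (hX : proj A X) (hY : proj A Y) :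
    proj A (X ⊞ Y) := by
  have : Module.Projective A X := hX
  have : Module.Projective A Y := hY
  exact (Module.Projective.of_equiv (ModuleCat.biprodIsoProd X Y).toLinearEquiv.symm :
    Module.Projective A _)

/-- The objects of `K(Proj A)`: complexes of projective `A`-modules up to homotopy. -/
abbrev KProjProp : ObjectProperty (HomotopyCategory (ModuleCat.{u} A) (.up ℤ)) := termwise (proj A)

instance : (KProjProp A).IsTriangulated := isTriangulated_termwise _ (proj_zero A) (proj_biprod A)

/-- The triangulated category `K(Proj A)`. -/
abbrev KProj := (KProjProp A).FullSubcategory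

variable {A} in
/-- Acyclicity of `X` in degree `n` for the exact structure of the extension closed subcategory `P`
of `Mod A`: the differential `X (n - 1) ⟶ X n` is the composite of an admissible epimorphism
`X (n - 1) ⟶ Ker d n` (its kernel `Ker d (n - 1)` is in `P`) and an admissible monomorphism
`Ker d n ⟶ X n` (its cokernel `Im d n` is in `P`), with `Ker d n` in `P`. -/
def AcyclicAt (P : ObjectProperty (ModuleCat.{u} A)) (X : CochainComplex (ModuleCat.{u} A) ℤ)
    (n : ℤ) : Prop :=
  X.ExactAt n ∧ P (ModuleCat.of A (LinearMap.ker (X.d (n - 1) n).hom)) ∧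
    P (ModuleCat.of A (LinearMap.ker (X.d n (n + 1)).hom)) ∧
    P (ModuleCat.of A (LinearMap.range (X.d n (n + 1)).hom))

/-- `K^{+,b}(proj A)`, as a class of objects of `K(Proj A)`: the complexes of finitely generated
projective modules that are zero in degrees `n ≪ 0` and are acyclic in degrees `n ≫ 0` with respect
to the exact structure of `Mod(A, R)`. -/
def KPlusB : ObjectProperty (KProj A) := fun X =>
  ∃ Y : CochainComplex (ModuleCat.{u} A) ℤ, (∀ n, finProj A (Y.X n)) ∧
    (∃ N : ℤ, ∀ n < N, IsZero (Y.X n)) ∧ (∃ N : ℤ, ∀ n > N, AcyclicAt (modProj R A) Y n) ∧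
    Nonempty (X.obj ≅ (HomotopyCategory.quotient _ _).obj Y)

/-- The objects of `K^lf(Proj A, R)`: the localising subcategory of `K(Proj A)` generated by
`K^{+,b}(proj A)`. -/
abbrev KlfProp : ObjectProperty (KProj A) := localisingClosure (KPlusB R A)

/-- The triangulated category `K^lf(Proj A, R)`. -/
abbrev Klf := (KlfProp R A).FullSubcategory

noncomputable instance : Pretriangulated (Klf R A) := inferInstance
instance : IsTriangulated (Klf R A) := inferInstance

/-- The canonical functor `K^lf(Proj A, R) ⥤ D(Mod A)`. -/
noncomputable def Klf.q [HasDerivedCategory.{w} (ModuleCat.{u} A)] :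
    Klf R A ⥤ DerivedCategory (ModuleCat.{u} A) :=
  (KlfProp R A).ι ⋙ (KProjProp A).ι ⋙ DerivedCategory.Qh

noncomputable instance [HasDerivedCategory.{w} (ModuleCat.{u} A)] : (Klf.q R A).CommShift ℤ :=
  inferInstanceAs (((KlfProp R A).ι ⋙ (KProjProp A).ι ⋙ DerivedCategory.Qh).CommShift ℤ)

instance [HasDerivedCategory.{w} (ModuleCat.{u} A)] : (Klf.q R A).IsTriangulated :=
  inferInstanceAs (((KlfProp R A).ι ⋙ (KProjProp A).ι ⋙ DerivedCategory.Qh).IsTriangulated)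

/-- The objects of `K^b(mod(A, R))`: bounded complexes in `mod(A, R)`. -/
abbrev KbModProp : ObjectProperty (HomotopyCategory (ModuleCat.{u} A) (.up ℤ)) :=
  termwise (modFinProj R A) ⊓ bounded _

instance : (KbModProp R A).IsTriangulated :=
  isTriangulated_termwise_inf_bounded _ (modFinProj_zero R A) (modFinProj_biprod R A)

/-- The triangulated category `K^b(mod(A, R))`. -/
abbrev KbMod := (KbModProp R A).FullSubcategory

/-- The bounded complexes that are acyclic for the exact structure of `mod(A, R)`. -/
def AcbMod : ObjectProperty (KbMod R A) := fun X => ∀ n, AcyclicAt (modFinProj R A) X.obj.as n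


variable {R A} in
lemma modFinProj_ker {M N : ModuleCat.{u} A} (f : M →ₗ[A] N) (hf : Function.Surjective f)
    (hM : modFinProj R A M) (hN : modProj R A N) :
    modFinProj R A (ModuleCat.of A (LinearMap.ker f)) := by
  let F := ModuleCat.restrictScalars.{u} (algebraMap R A)
  have : Module.Finite R (F.obj M) := hM.1
  have : Module.Projective R (F.obj M) := hM.2
  have : Module.Projective R (F.obj N) := hN
  let i : F.obj (ModuleCat.of A (LinearMap.ker f)) →ₗ[R] F.obj M :=
    (F.map (ModuleCat.ofHom (LinearMap.ker f).subtype)).hom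
  let s : F.obj M →ₗ[R] F.obj N := (F.map (ModuleCat.ofHom f)).hom
  obtain ⟨σ, hσ⟩ := Module.projective_lifting_property s LinearMap.id hf
  have hσ' : ∀ y, s (σ y) = y := fun y => LinearMap.congr_fun hσ y
  let t : F.obj M →ₗ[R] F.obj M := LinearMap.id - σ ∘ₗ s
  have ht : ∀ x, s (t x) = 0 := fun x => by simp [t, hσ']
  let r : F.obj M →ₗ[R] F.obj (ModuleCat.of A (LinearMap.ker f)) :=
    { toFun := fun x => ⟨t x, ht x⟩
      map_add' := fun x y => Subtype.ext (map_add t x y)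
      map_smul' := fun a x => Subtype.ext (map_smul t a x) }
  have hri : r ∘ₗ i = LinearMap.id := by
    ext x
    apply Subtype.ext
    change i x - σ (s (i x)) = i x
    have : s (i x) = 0 := x.2
    rw [this, map_zero, sub_zero]
  refine ⟨Module.Finite.of_surjective r fun x => ⟨i x, LinearMap.congr_fun hri x⟩,
    Module.Projective.of_split i r hri⟩

/-- A bounded complex in `mod(A, R)` is acyclic for the exact structure of `mod(A, R)` if and only
if it is acyclic as a complex of `A`-modules. -/
lemma acbMod_iff (X : KbMod R A) :
    AcbMod R A X ↔ HomotopyCategory.subcategoryAcyclic _ X.obj := by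
  change _ ↔ HomotopyCategory.subcategoryAcyclic _
    ((HomotopyCategory.quotient _ (.up ℤ)).obj X.obj.as)
  rw [HomotopyCategory.quotient_obj_mem_subcategoryAcyclic_iff_exactAt]
  refine ⟨fun h n => (h n).1, fun h => ?_⟩
  let K : CochainComplex (ModuleCat.{u} A) ℤ := X.obj.as
  have hex : ∀ n : ℤ, LinearMap.range (K.d n (n + 1)).hom =
      LinearMap.ker (K.d (n + 1) (n + 1 + 1)).hom := fun n => by
    have := h (n + 1)
    rw [HomologicalComplex.exactAt_iff' _ n (n + 1) (n + 1 + 1) (by simp) (by simp),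
      ShortComplex.moduleCat_exact_iff_range_eq_ker] at this
    exact this
  obtain ⟨N, hN⟩ := X.property.2
  have step : ∀ n : ℤ, modFinProj R A (ModuleCat.of A (LinearMap.ker (K.d (n + 1) (n + 1 + 1)).hom)) →
      modFinProj R A (ModuleCat.of A (LinearMap.ker (K.d n (n + 1)).hom)) := fun n hn => by
    let f : K.X n →ₗ[A] LinearMap.ker (K.d (n + 1) (n + 1 + 1)).hom :=
      LinearMap.codRestrict _ (K.d n (n + 1)).hom fun x => by
        rw [← hex]; exact ⟨x, rfl⟩
    have hf : Function.Surjective f := fun ⟨y, hy⟩ => by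
      rw [← hex] at hy
      obtain ⟨x, hx⟩ := hy
      exact ⟨x, Subtype.ext hx⟩
    have := modFinProj_ker (N := ModuleCat.of A _) f hf (X.property.1 n) hn.2
    rwa [show LinearMap.ker f = LinearMap.ker (K.d n (n + 1)).hom from
      LinearMap.ker_codRestrict _ _ _] at this
  have key : ∀ (m : ℕ) (n : ℤ), N < n + m →
      modFinProj R A (ModuleCat.of A (LinearMap.ker (K.d n (n + 1)).hom)) := by
    intro m
    induction m with
    | zero =>
      intro n hn
      refine (modFinProj R A).prop_of_iso (IsZero.iso (isZero_zero _) ?_) (modFinProj_zero R A)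
      have := ModuleCat.subsingleton_of_isZero
        (hN n (lt_of_lt_of_le (by simpa using hn) (le_abs_self n)))
      exact ModuleCat.isZero_of_subsingleton _
    | succ m ih =>
      intro n hn
      exact step n (ih (n + 1) (by push_cast at hn; lia))
  have key' : ∀ n : ℤ, modFinProj R A (ModuleCat.of A (LinearMap.ker (K.d n (n + 1)).hom)) :=
    fun n => key (N + n.natAbs + 1) n (by omega)
  intro n
  refine ⟨h n, ?_, key' n, ?_⟩
  · have := key' (n - 1)
    rwa [sub_add_cancel] at this
  · have := key' (n + 1)
    rwa [← hex] at this

instance : (AcbMod R A).IsTriangulated := by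
  have : AcbMod R A = (HomotopyCategory.subcategoryAcyclic _).inverseImage (KbModProp R A).ι := by
    ext X
    exact acbMod_iff R A X
  rw [this]
  infer_instance

/-- `D^b(mod(A, R))`, the bounded derived category of the exact category `mod(A, R)`: the Verdier
quotient of `K^b(mod(A, R))` by the acyclic complexes. -/
abbrev DbMod := (AcbMod R A).trW.Localization

noncomputable instance : Pretriangulated (DbMod R A) := inferInstance
instance : IsTriangulated (DbMod R A) := inferInstance

section
variable [HasDerivedCategory.{w} (ModuleCat.{u} A)]

/-- The canonical functor `K^b(mod(A, R)) ⥤ D(Mod A)`. -/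
noncomputable def KbMod.q : KbMod R A ⥤ DerivedCategory (ModuleCat.{u} A) :=
  (KbModProp R A).ι ⋙ DerivedCategory.Qh

noncomputable instance : (KbMod.q R A).CommShift ℤ :=
  inferInstanceAs (((KbModProp R A).ι ⋙ DerivedCategory.Qh).CommShift ℤ)

instance : (KbMod.q R A).IsTriangulated :=
  inferInstanceAs (((KbModProp R A).ι ⋙ DerivedCategory.Qh).IsTriangulated)

lemma KbMod.q_inverts : (AcbMod R A).trW.IsInvertedBy (KbMod.q R A) := by
  have : AcbMod R A = (HomotopyCategory.subcategoryAcyclic _).inverseImage (KbModProp R A).ι := by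
    ext X
    exact acbMod_iff R A X
  rw [this]
  exact ObjectProperty.inverseImage_trW_isInverted _ _ _

/-- The canonical functor `D^b(mod(A, R)) ⥤ D(Mod A)`. -/
noncomputable def DbMod.can : DbMod R A ⥤ DerivedCategory (ModuleCat.{u} A) :=
  Localization.lift (KbMod.q R A) (KbMod.q_inverts R A) (AcbMod R A).trW.Q

noncomputable instance : Localization.Lifting (AcbMod R A).trW.Q (AcbMod R A).trW (KbMod.q R A)
    (DbMod.can R A) :=
  inferInstanceAs (Localization.Lifting _ _ _
    (Localization.lift (KbMod.q R A) (KbMod.q_inverts R A) (AcbMod R A).trW.Q))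

noncomputable instance : (DbMod.can R A).CommShift ℤ :=
  Functor.commShiftOfLocalization (AcbMod R A).trW.Q (AcbMod R A).trW ℤ (KbMod.q R A) _

end

end Klf

section GroupAlgebra
open TensorProduct

variable (R : Type u) [CommRing R] (B : Type u) [CommRing B] [HopfAlgebra R B]

/-- The group algebra `RG = Hom_R(R[G], R)` of the group scheme `G = Spec B` over `R`, where `B` is a
commutative Hopf algebra. Its product is the convolution product, dual to the coproduct of `B`. -/
def GroupAlgebra (R : Type u) [CommRing R] (B : Type u) [CommRing B] [HopfAlgebra R B] : Type u :=
  WithConv (B →ₗ[R] R)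

namespace GroupAlgebra

noncomputable instance : Ring (GroupAlgebra R B) := inferInstanceAs (Ring (WithConv (B →ₗ[R] R)))
noncomputable instance : Algebra R (GroupAlgebra R B) :=
  inferInstanceAs (Algebra R (WithConv (B →ₗ[R] R)))

/-- The functional underlying an element of the group algebra. -/
def toDual : GroupAlgebra R B ≃ₗ[R] Module.Dual R B := WithConv.linearEquiv R _

variable {R B}

lemma toDual_mul (f g : GroupAlgebra R B) (x : B) : toDual R B (f * g) x =
    TensorProduct.dualDistrib R B B (toDual R B f ⊗ₜ toDual R B g) (Coalgebra.comul x) := by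
  refine (LinearMap.convMul_apply (R := R) (A := R) f g x).trans ?_
  generalize (Coalgebra.comul x : B ⊗[R] B) = t
  induction t with
  | zero => simp
  | add a b ha hb => simp [ha, hb]
  | tmul a b => rfl

lemma toDual_one (x : B) : toDual R B 1 x = Coalgebra.counit (R := R) x := rfl

variable (R B) [Module.Finite R B] [Module.Projective R B]

instance : Module.Finite R (GroupAlgebra R B) := Module.Finite.equiv (toDual R B).symm
instance : Module.Projective R (GroupAlgebra R B) :=
  Module.Projective.of_equiv (toDual R B).symm

/-- The pairing `RG ⊗ RG ≃ (B ⊗ B)^*`, `(f ⊗ g) (x ⊗ y) = f x * g y`. -/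
noncomputable def pairing :
    GroupAlgebra R B ⊗[R] GroupAlgebra R B ≃ₗ[R] Module.Dual R (B ⊗[R] B) :=
  TensorProduct.congr (toDual R B) (toDual R B) ≪≫ₗ dualTensorHomEquiv R B (Module.Dual R B) ≪≫ₗ
    TensorProduct.lift.equiv (.id R) B B R

variable {R B}

@[simp] lemma pairing_tmul (f g : GroupAlgebra R B) (x y : B) :
    pairing R B (f ⊗ₜ g) (x ⊗ₜ y) = toDual R B f x * toDual R B g y := by
  simp [pairing]

/-- The coproduct of `RG` is dual to the product of `B`, and the counit is evaluation at `1`. -/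
noncomputable instance : CoalgebraStruct R (GroupAlgebra R B) where
  comul := (pairing R B).symm.toLinearMap ∘ₗ (LinearMap.mul' R B).dualMap ∘ₗ
    (toDual R B).toLinearMap
  counit := Module.Dual.eval R B 1 ∘ₗ (toDual R B).toLinearMap

@[simp] lemma pairing_comul (f : GroupAlgebra R B) (x y : B) :
    pairing R B (Coalgebra.comul (R := R) f) (x ⊗ₜ y) = toDual R B f (x * y) := by
  simp [Coalgebra.comul]

lemma counit_eq (f : GroupAlgebra R B) : Coalgebra.counit (R := R) f = toDual R B f 1 := rfl

variable (R B) in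
noncomputable def pairing₃ : GroupAlgebra R B ⊗[R] (GroupAlgebra R B ⊗[R] GroupAlgebra R B) ≃ₗ[R]
    Module.Dual R (B ⊗[R] (B ⊗[R] B)) :=
  TensorProduct.congr (toDual R B) (pairing R B) ≪≫ₗ dualTensorHomEquiv R B _ ≪≫ₗ
    TensorProduct.lift.equiv (.id R) B (B ⊗[R] B) R

@[simp] lemma pairing₃_tmul (f : GroupAlgebra R B) (t : GroupAlgebra R B ⊗[R] GroupAlgebra R B)
    (x : B) (y : B ⊗[R] B) :
    pairing₃ R B (f ⊗ₜ t) (x ⊗ₜ y) = toDual R B f x * pairing R B t y := by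
  simp [pairing₃]

lemma pairing₃_lTensor (t : GroupAlgebra R B ⊗[R] GroupAlgebra R B) (x y z : B) :
    pairing₃ R B (Coalgebra.comul.lTensor _ t) (x ⊗ₜ (y ⊗ₜ z)) =
      pairing R B t (x ⊗ₜ (y * z)) := by
  induction t with
  | zero => simp
  | add a b ha hb => simp [ha, hb]
  | tmul a b => simp

lemma pairing₃_assoc (t : GroupAlgebra R B ⊗[R] GroupAlgebra R B) (g : GroupAlgebra R B)
    (x y z : B) : pairing₃ R B (TensorProduct.assoc R _ _ _ (t ⊗ₜ g)) (x ⊗ₜ (y ⊗ₜ z)) =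
      pairing R B t (x ⊗ₜ y) * toDual R B g z := by
  induction t with
  | zero => simp
  | add a b ha hb => simp [ha, hb, add_mul, TensorProduct.add_tmul]
  | tmul a b => simp [mul_assoc]

lemma pairing₃_rTensor (t : GroupAlgebra R B ⊗[R] GroupAlgebra R B) (x y z : B) :
    pairing₃ R B (TensorProduct.assoc R _ _ _ (Coalgebra.comul.rTensor _ t)) (x ⊗ₜ (y ⊗ₜ z)) =
      pairing R B t ((x * y) ⊗ₜ z) := by
  induction t with
  | zero => simp
  | add a b ha hb => simp [ha, hb]
  | tmul a b => simp [pairing₃_assoc]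

lemma rTensor_counit (t : GroupAlgebra R B ⊗[R] GroupAlgebra R B) (x : B) :
    toDual R B (TensorProduct.lid R _ (Coalgebra.counit.rTensor _ t)) x =
      pairing R B t (1 ⊗ₜ x) := by
  induction t with
  | zero => simp
  | add a b ha hb => simp [ha, hb]
  | tmul a b => simp [counit_eq]

lemma lTensor_counit (t : GroupAlgebra R B ⊗[R] GroupAlgebra R B) (x : B) :
    toDual R B (TensorProduct.rid R _ (Coalgebra.counit.lTensor _ t)) x =
      pairing R B t (x ⊗ₜ 1) := by
  induction t with
  | zero => simp
  | add a b ha hb => simp [ha, hb]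
  | tmul a b => simp [counit_eq, mul_comm]

noncomputable instance : Coalgebra R (GroupAlgebra R B) where
  coassoc := by
    ext1 f
    apply (pairing₃ R B).injective
    ext x y z
    simp [pairing₃_rTensor, pairing₃_lTensor, mul_assoc]
  rTensor_counit_comp_comul := by
    ext1 f
    apply (TensorProduct.lid R _).injective
    apply (toDual R B).injective
    ext x
    simp [rTensor_counit]
  lTensor_counit_comp_comul := by
    ext1 f
    apply (TensorProduct.rid R _).injective
    apply (toDual R B).injective
    ext x
    simp [lTensor_counit]

lemma pairing_mul (s t : GroupAlgebra R B ⊗[R] GroupAlgebra R B) (x : B ⊗[R] B) :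
    pairing R B (s * t) x = TensorProduct.dualDistrib R _ _ (pairing R B s ⊗ₜ pairing R B t)
      (Coalgebra.comul x) := by
  induction s with
  | zero => simp
  | add a b ha hb => simp [ha, hb, add_mul, TensorProduct.add_tmul]
  | tmul a b =>
    induction t with
    | zero => simp
    | add a b ha hb => simp [ha, hb, mul_add, TensorProduct.tmul_add]
    | tmul c d =>
      induction x with
      | zero => simp
      | add a b ha hb => simp only [map_add, ha, hb]
      | tmul x y =>
        rw [Algebra.TensorProduct.tmul_mul_tmul, pairing_tmul, toDual_mul, toDual_mul,
          TensorProduct.comul_tmul]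
        generalize (Coalgebra.comul x : B ⊗[R] B) = p
        generalize (Coalgebra.comul y : B ⊗[R] B) = q
        induction p with
        | zero => simp
        | add a b ha hb => simp [ha, hb, add_mul, TensorProduct.add_tmul]
        | tmul p₁ p₂ =>
          induction q with
          | zero => simp
          | add a b ha hb => simp only [map_add, mul_add, TensorProduct.tmul_add, ha, hb]
          | tmul q₁ q₂ =>
            simp
            ring

noncomputable instance : Bialgebra R (GroupAlgebra R B) := Bialgebra.mk' R _
  (by simp [counit_eq, toDual_one])
  (fun {a b} => by simp [counit_eq, toDual_mul, Algebra.TensorProduct.one_def])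
  (by
    apply (pairing R B).injective
    ext x y
    simp [Algebra.TensorProduct.one_def, toDual_one])
  (fun {a b} => by
    apply (pairing R B).injective
    ext x y
    simp only [TensorProduct.AlgebraTensorModule.curry_apply, LinearMap.restrictScalars_self,
      TensorProduct.curry_apply, pairing_comul, toDual_mul, pairing_mul]
    rw [Bialgebra.comul_mul, TensorProduct.comul_tmul]
    generalize (Coalgebra.comul x : B ⊗[R] B) = p
    generalize (Coalgebra.comul y : B ⊗[R] B) = q
    induction p with
    | zero => simp
    | add a b ha hb => simp [ha, hb, add_mul, TensorProduct.add_tmul]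
    | tmul p₁ p₂ =>
      induction q with
      | zero => simp
      | add a b ha hb => simp [ha, hb, mul_add, TensorProduct.tmul_add]
      | tmul q₁ q₂ => simp)

instance : Coalgebra.IsCocomm R (GroupAlgebra R B) where
  comm_comp_comul := by
    have key : ∀ (t : GroupAlgebra R B ⊗[R] GroupAlgebra R B) (x y : B),
        pairing R B (TensorProduct.comm R _ _ t) (x ⊗ₜ y) = pairing R B t (y ⊗ₜ x) := by
      intro t x y
      induction t with
      | zero => simp
      | add a b ha hb => simp [ha, hb]
      | tmul a b => simp [mul_comm]
    ext1 f
    apply (pairing R B).injective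
    ext x y
    simp [key, mul_comm]

end GroupAlgebra
end GroupAlgebra

section Diagonal
open TensorProduct

variable (R : Type u) [CommRing R] (H : Type u) [Ring H] [Bialgebra R H]

namespace Diagonal

/-- The `R`-module underlying an `H`-module. -/
noncomputable abbrev U : ModuleCat.{u} H ⥤ ModuleCat.{u} R :=
  ModuleCat.restrictScalars.{u} (algebraMap R H)

variable {H}

/-- The action of `H` on the underlying `R`-module of an `H`-module. -/
noncomputable def act (M : ModuleCat.{u} H) : H →ₐ[R] Module.End R ((U R H).obj M) where
  toFun h :=
    { toFun := fun m => (h • (show M from m) : M)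
      map_add' := fun x y => smul_add h (show M from x) (show M from y)
      map_smul' := fun r x => by
        change h • algebraMap R H r • (show M from x) = algebraMap R H r • h • (show M from x)
        rw [smul_smul, smul_smul, Algebra.commutes] }
  map_one' := LinearMap.ext fun m => one_smul H (show M from m)
  map_mul' a b := LinearMap.ext fun m => mul_smul a b (show M from m)
  map_zero' := LinearMap.ext fun m => zero_smul H (show M from m)
  map_add' a b := LinearMap.ext fun m => add_smul a b (show M from m)
  commutes' _ := rfl

variable {R}

/-- The `H`-module given by an `R`-module with an action of `H`. -/
noncomputable def ofAct {V : Type u} [AddCommGroup V] [Module R V] (ρ : H →ₐ[R] Module.End R V) :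
    ModuleCat.{u} H :=
  @ModuleCat.of H _ V _ (Module.compHom V ρ.toRingHom)

/-- The underlying `R`-module of `ofAct ρ`. -/
noncomputable def ofActEquiv {V : Type u} [AddCommGroup V] [Module R V]
    (ρ : H →ₐ[R] Module.End R V) : V ≃ₗ[R] (U R H).obj (ofAct ρ) where
  toFun x := x
  invFun x := x
  left_inv _ := rfl
  right_inv _ := rfl
  map_add' _ _ := rfl
  map_smul' r x := by
    change r • x = ρ (algebraMap R H r) x
    rw [AlgHom.commutes]
    rfl

noncomputable def ofActIso {V : Type u} [AddCommGroup V] [Module R V]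
    (ρ : H →ₐ[R] Module.End R V) : ModuleCat.of R V ≅ (U R H).obj (ofAct ρ) :=
  (ofActEquiv ρ).toModuleIso

lemma act_ofAct {V : Type u} [AddCommGroup V] [Module R V] (ρ : H →ₐ[R] Module.End R V)
    (h : H) (x : V) : act R (ofAct ρ) h ((ofActIso ρ).hom x) = (ofActIso ρ).hom (ρ h x) := rfl

/-- An `R`-linear map commuting with the action of `H` is `H`-linear. -/
noncomputable def homOf {M N : ModuleCat.{u} H} (f : (U R H).obj M ⟶ (U R H).obj N)
    (hf : ∀ (h : H) m, f (act R M h m) = act R N h (f m)) : M ⟶ N :=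
  ModuleCat.ofHom
    { toFun := fun m => f m
      map_add' := fun x y => f.hom.map_add x y
      map_smul' := fun h x => hf h x }

lemma map_homOf {M N : ModuleCat.{u} H} (f : (U R H).obj M ⟶ (U R H).obj N)
    (hf : ∀ (h : H) m, f (act R M h m) = act R N h (f m)) : (U R H).map (homOf f hf) = f := rfl

lemma map_act {M N : ModuleCat.{u} H} (f : M ⟶ N) (h : H) (m : (U R H).obj M) :
    (U R H).map f (act R M h m) = act R N h ((U R H).map f m) := f.hom.map_smul h _

noncomputable def isoOf {M N : ModuleCat.{u} H} (e : (U R H).obj M ≅ (U R H).obj N)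
    (he : ∀ (h : H) m, e.hom (act R M h m) = act R N h (e.hom m)) : M ≅ N where
  hom := homOf e.hom he
  inv := homOf e.inv fun h n => by
    have := he h (e.inv n)
    rw [Iso.inv_hom_id_apply] at this
    rw [← this, Iso.hom_inv_id_apply]
  hom_inv_id := (U R H).map_injective e.hom_inv_id
  inv_hom_id := (U R H).map_injective e.inv_hom_id

variable (R) in
/-- The action of `H ⊗ H` on `M ⊗ N`. -/
noncomputable def act₂ (M N : ModuleCat.{u} H) :
    H ⊗[R] H →ₐ[R] Module.End R ((U R H).obj M ⊗[R] (U R H).obj N) :=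
  (Module.endTensorEndAlgHom).comp (Algebra.TensorProduct.map (act R M) (act R N))

lemma act₂_tmul (M N : ModuleCat.{u} H) (a b : H) (m : (U R H).obj M) (n : (U R H).obj N) :
    act₂ R M N (a ⊗ₜ b) (m ⊗ₜ n) = act R M a m ⊗ₜ act R N b n := rfl

variable (R) in
/-- The tensor product over `R` of two `H`-modules with the diagonal action. -/
noncomputable def tensorObj (M N : ModuleCat.{u} H) : ModuleCat.{u} H :=
  ofAct ((act₂ R M N).comp (Bialgebra.comulAlgHom R H))

variable (R) in
noncomputable def μIso (M N : ModuleCat.{u} H) :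
    (U R H).obj M ⊗ (U R H).obj N ≅ (U R H).obj (tensorObj R M N) := ofActIso _

lemma act_tensorObj (M N : ModuleCat.{u} H) (h : H) (x) :
    act R (tensorObj R M N) h ((μIso R M N).hom x) =
      (μIso R M N).hom (act₂ R M N (Coalgebra.comul h) x) := rfl

variable (R H) in
/-- `R` with the trivial action of `H`. -/
noncomputable def trivialRep : ModuleCat.{u} H :=
  ofAct ((Algebra.ofId R (Module.End R R)).comp (Bialgebra.counitAlgHom R H))

variable (R H) in
noncomputable def εIso : 𝟙_ (ModuleCat.{u} R) ≅ (U R H).obj (trivialRep R H) := ofActIso _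

lemma act_trivial (h : H) (x : R) :
    act R (trivialRep R H) h ((εIso R H).hom x) = (εIso R H).hom (Coalgebra.counit (R := R) h * x) := rfl

lemma equivariant_of_act₂ {M N P : ModuleCat.{u} H}
    (f : (U R H).obj M ⊗ (U R H).obj N ⟶ (U R H).obj P)
    (hf : ∀ (h : H) x, f (act₂ R M N (Coalgebra.comul h) x) = act R P h (f x))
    (h : H) (x) : ((μIso R M N).inv ≫ f) (act R (tensorObj R M N) h x) =
      act R P h (((μIso R M N).inv ≫ f) x) := hf h x

lemma map_act₂ {M N M' N' : ModuleCat.{u} H} (f : M ⟶ M') (g : N ⟶ N') (t : H ⊗[R] H)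
    (x : (U R H).obj M ⊗[R] (U R H).obj N) :
    TensorProduct.map ((U R H).map f).hom ((U R H).map g).hom (act₂ R M N t x) =
      act₂ R M' N' t (TensorProduct.map ((U R H).map f).hom ((U R H).map g).hom x) := by
  induction t with
  | zero => simp
  | add a b ha hb => simp [ha, hb]
  | tmul a b =>
    induction x with
    | zero => simp
    | add a b ha hb => simp only [map_add, ha, hb]
    | tmul m n =>
      simp only [act₂_tmul, TensorProduct.map_tmul]
      congr 1
      · exact map_act f a m
      · exact map_act g b n

noncomputable def tensorHom {M N M' N' : ModuleCat.{u} H} (f : M ⟶ M') (g : N ⟶ N') :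
    tensorObj R M N ⟶ tensorObj R M' N' :=
  homOf ((μIso R M N).inv ≫ ((U R H).map f ⊗ₘ (U R H).map g) ≫ (μIso R M' N').hom)
    (equivariant_of_act₂ _ fun _ x => map_act₂ f g _ x)



variable (R) in
noncomputable def act₃ (M N P : ModuleCat.{u} H) : H ⊗[R] (H ⊗[R] H) →ₐ[R]
    Module.End R ((U R H).obj M ⊗[R] ((U R H).obj N ⊗[R] (U R H).obj P)) :=
  (Module.endTensorEndAlgHom).comp (Algebra.TensorProduct.map (act R M) (act₂ R N P))

lemma act₃_tmul (M N P : ModuleCat.{u} H) (a : H) (t : H ⊗[R] H) (m : (U R H).obj M)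
    (x : (U R H).obj N ⊗[R] (U R H).obj P) :
    act₃ R M N P (a ⊗ₜ t) (m ⊗ₜ x) = act R M a m ⊗ₜ act₂ R N P t x := rfl

lemma act₃_assoc (M N P : ModuleCat.{u} H) (s : H ⊗[R] H) (b : H)
    (y : (U R H).obj M ⊗[R] (U R H).obj N) (p : (U R H).obj P) :
    act₃ R M N P (TensorProduct.assoc R _ _ _ (s ⊗ₜ b)) (TensorProduct.assoc R _ _ _ (y ⊗ₜ p)) =
      TensorProduct.assoc R _ _ _ (act₂ R M N s y ⊗ₜ act R P b p) := by
  induction s with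
  | zero => simp
  | add a b ha hb => simp only [map_add, TensorProduct.add_tmul, LinearMap.add_apply, ha, hb]
  | tmul s₁ s₂ =>
    induction y with
    | zero => simp
    | add a b ha hb => simp only [map_add, TensorProduct.add_tmul, ha, hb]
    | tmul m n => rfl

lemma assoc_act (M N P : ModuleCat.{u} H) (t : H ⊗[R] H)
    (x : (U R H).obj (tensorObj R M N) ⊗[R] (U R H).obj P) :
    TensorProduct.assoc R _ _ _ (TensorProduct.map (μIso R M N).inv.hom LinearMap.id
      (act₂ R (tensorObj R M N) P t x)) =
    act₃ R M N P (TensorProduct.assoc R _ _ _ (Coalgebra.comul.rTensor H t))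
      (TensorProduct.assoc R _ _ _ (TensorProduct.map (μIso R M N).inv.hom LinearMap.id x)) := by
  induction t with
  | zero => simp
  | add a b ha hb => simp only [map_add, LinearMap.add_apply, ha, hb]
  | tmul a b =>
    induction x with
    | zero => simp
    | add a b ha hb => simp only [map_add, ha, hb]
    | tmul y p =>
      exact (act₃_assoc M N P (Coalgebra.comul a) b ((μIso R M N).inv y) p).symm

lemma act_assoc (M N P : ModuleCat.{u} H) (t : H ⊗[R] H)
    (x : (U R H).obj M ⊗[R] ((U R H).obj N ⊗[R] (U R H).obj P)) :
    TensorProduct.map LinearMap.id (μIso R N P).hom.hom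
      (act₃ R M N P (Coalgebra.comul.lTensor H t) x) =
    act₂ R M (tensorObj R N P) t (TensorProduct.map LinearMap.id (μIso R N P).hom.hom x) := by
  induction t with
  | zero => simp
  | add a b ha hb => simp only [map_add, LinearMap.add_apply, ha, hb]
  | tmul a b =>
    induction x with
    | zero => simp
    | add a b ha hb => simp only [map_add, ha, hb]
    | tmul y p => rfl

lemma assoc_comul (M N P : ModuleCat.{u} H) (h : H)
    (x : (U R H).obj (tensorObj R M N) ⊗[R] (U R H).obj P) :
    TensorProduct.map LinearMap.id (μIso R N P).hom.hom (TensorProduct.assoc R _ _ _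
      (TensorProduct.map (μIso R M N).inv.hom LinearMap.id
        (act₂ R (tensorObj R M N) P (Coalgebra.comul h) x))) =
    act₂ R M (tensorObj R N P) (Coalgebra.comul h)
      (TensorProduct.map LinearMap.id (μIso R N P).hom.hom (TensorProduct.assoc R _ _ _
        (TensorProduct.map (μIso R M N).inv.hom LinearMap.id x))) := by
  rw [assoc_act, Coalgebra.coassoc_apply, act_assoc]

/-- The associator of `R`-modules is `H`-linear. -/
noncomputable def assocIso (M N P : ModuleCat.{u} H) :
    tensorObj R (tensorObj R M N) P ≅ tensorObj R M (tensorObj R N P) :=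
  isoOf (((μIso R _ _).symm ≪≫ ((μIso R _ _).symm ⊗ᵢ .refl _))
        ≪≫ α_ ((U R H).obj M) ((U R H).obj N) ((U R H).obj P)
        ≪≫ ((.refl _ ⊗ᵢ μIso R _ _) ≪≫ μIso R _ _)) fun h m =>
    congrArg (μIso R _ _).hom (assoc_comul M N P h ((μIso R _ _).inv m))

lemma leftUnitor_act (M : ModuleCat.{u} H) (t : H ⊗[R] H)
    (x : (U R H).obj (trivialRep R H) ⊗[R] (U R H).obj M) :
    TensorProduct.lid R _ (TensorProduct.map (εIso R H).inv.hom LinearMap.id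
      (act₂ R (trivialRep R H) M t x)) =
    act R M (TensorProduct.lid R _ (Coalgebra.counit.rTensor H t)) (TensorProduct.lid R _
      (TensorProduct.map (εIso R H).inv.hom LinearMap.id x)) := by
  induction t with
  | zero => simp
  | add a b ha hb => simp only [map_add, LinearMap.add_apply, ha, hb]
  | tmul a b =>
    induction x with
    | zero => simp
    | add a b ha hb => simp only [map_add, ha, hb]
    | tmul y p =>
      change (Coalgebra.counit (R := R) a * (εIso R H).inv y) • act R M b p =
        act R M (Coalgebra.counit (R := R) a • b) ((show R from (εIso R H).inv y) • p)
      rw [map_smul, map_smul, LinearMap.smul_apply, smul_smul, mul_comm]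

lemma rightUnitor_act (M : ModuleCat.{u} H) (t : H ⊗[R] H)
    (x : (U R H).obj M ⊗[R] (U R H).obj (trivialRep R H)) :
    TensorProduct.rid R _ (TensorProduct.map LinearMap.id (εIso R H).inv.hom
      (act₂ R M (trivialRep R H) t x)) =
    act R M (TensorProduct.rid R _ (Coalgebra.counit.lTensor H t)) (TensorProduct.rid R _
      (TensorProduct.map LinearMap.id (εIso R H).inv.hom x)) := by
  induction t with
  | zero => simp
  | add a b ha hb => simp only [map_add, LinearMap.add_apply, ha, hb]
  | tmul a b =>
    induction x with
    | zero => simp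
    | add a b ha hb => simp only [map_add, ha, hb]
    | tmul p y =>
      change (Coalgebra.counit (R := R) b * (εIso R H).inv y) • act R M a p =
        act R M (Coalgebra.counit (R := R) b • a) ((show R from (εIso R H).inv y) • p)
      rw [map_smul, map_smul, LinearMap.smul_apply, smul_smul, mul_comm]

lemma leftUnitor_comul (M : ModuleCat.{u} H) (h : H)
    (x : (U R H).obj (trivialRep R H) ⊗[R] (U R H).obj M) :
    TensorProduct.lid R _ (TensorProduct.map (εIso R H).inv.hom LinearMap.id
      (act₂ R (trivialRep R H) M (Coalgebra.comul h) x)) =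
    act R M h (TensorProduct.lid R _
      (TensorProduct.map (εIso R H).inv.hom LinearMap.id x)) := by
  rw [leftUnitor_act, Coalgebra.rTensor_counit_comul, TensorProduct.lid_tmul, one_smul]

lemma rightUnitor_comul (M : ModuleCat.{u} H) (h : H)
    (x : (U R H).obj M ⊗[R] (U R H).obj (trivialRep R H)) :
    TensorProduct.rid R _ (TensorProduct.map LinearMap.id (εIso R H).inv.hom
      (act₂ R M (trivialRep R H) (Coalgebra.comul h) x)) =
    act R M h (TensorProduct.rid R _
      (TensorProduct.map LinearMap.id (εIso R H).inv.hom x)) := by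
  rw [rightUnitor_act, Coalgebra.lTensor_counit_comul, TensorProduct.rid_tmul, one_smul]

noncomputable def leftUnitIso (M : ModuleCat.{u} H) : tensorObj R (trivialRep R H) M ≅ M :=
  isoOf (((μIso R _ _).symm ≪≫ ((εIso R H).symm ⊗ᵢ .refl _)) ≪≫ λ_ ((U R H).obj M)) fun h m =>
    leftUnitor_comul M h ((μIso R _ _).inv m)

noncomputable def rightUnitIso (M : ModuleCat.{u} H) : tensorObj R M (trivialRep R H) ≅ M :=
  isoOf (((μIso R _ _).symm ≪≫ (.refl _ ⊗ᵢ (εIso R H).symm)) ≪≫ ρ_ ((U R H).obj M)) fun h m =>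
    rightUnitor_comul M h ((μIso R _ _).inv m)

lemma braiding_act (M N : ModuleCat.{u} H) (t : H ⊗[R] H)
    (x : (U R H).obj M ⊗[R] (U R H).obj N) :
    TensorProduct.comm R _ _ (act₂ R M N t x) =
      act₂ R N M (TensorProduct.comm R _ _ t) (TensorProduct.comm R _ _ x) := by
  induction t with
  | zero => simp
  | add a b ha hb => simp only [map_add, LinearMap.add_apply, ha, hb]
  | tmul a b =>
    induction x with
    | zero => simp
    | add a b ha hb => simp only [map_add, ha, hb]
    | tmul y p => rfl

noncomputable def braidIso [Coalgebra.IsCocomm R H] (M N : ModuleCat.{u} H) :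
    tensorObj R M N ≅ tensorObj R N M :=
  isoOf ((μIso R _ _).symm ≪≫ β_ ((U R H).obj M) ((U R H).obj N) ≪≫ μIso R _ _) (by
    intro h m
    have := braiding_act M N (Coalgebra.comul h) ((μIso R _ _).inv m)
    rw [Coalgebra.comm_comul] at this
    exact congrArg (μIso R _ _).hom this)

variable (R H) in
/-- `- ⊗_R -` with the diagonal action of `H`. -/
@[reducible] noncomputable def monoidalStruct : MonoidalCategoryStruct (ModuleCat.{u} H) where
  tensorObj := tensorObj R
  whiskerLeft M _ _ f := tensorHom (𝟙 M) f
  whiskerRight f N := tensorHom f (𝟙 N)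
  tensorHom f g := tensorHom f g
  tensorUnit := trivialRep R H
  associator := assocIso
  leftUnitor := leftUnitIso
  rightUnitor := rightUnitIso

variable (R H) in
noncomputable def inducingData : letI := monoidalStruct R H; Monoidal.InducingFunctorData (U R H) :=
  letI := monoidalStruct R H
  { μIso := μIso R
    εIso := εIso R H
    whiskerLeft_eq _ _ _ _ := by
      refine (map_homOf _ _).trans ?_
      rw [CategoryTheory.Functor.map_id, id_tensorHom]
    whiskerRight_eq _ _ := by
      refine (map_homOf _ _).trans ?_
      rw [CategoryTheory.Functor.map_id, tensorHom_id]
    tensorHom_eq _ _ := map_homOf _ _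
    associator_eq _ _ _ := map_homOf _ _
    leftUnitor_eq _ := map_homOf _ _
    rightUnitor_eq _ := map_homOf _ _ }

end Diagonal

end Diagonal

section DiagonalGroupAlgebra

namespace GroupAlgebra

variable (R : Type u) [CommRing R] (B : Type u) [CommRing B] [HopfAlgebra R B] [Module.Finite R B]
  [Module.Projective R B]

noncomputable instance : MonoidalCategoryStruct (ModuleCat.{u} (GroupAlgebra R B)) :=
  Diagonal.monoidalStruct R (GroupAlgebra R B)

noncomputable instance : MonoidalCategory (ModuleCat.{u} (GroupAlgebra R B)) :=
  Monoidal.induced _ (Diagonal.inducingData R (GroupAlgebra R B))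

noncomputable instance : (Diagonal.U R (GroupAlgebra R B)).Monoidal :=
  Monoidal.fromInducedMonoidal _ (Diagonal.inducingData R (GroupAlgebra R B))

noncomputable instance : BraidedCategory (ModuleCat.{u} (GroupAlgebra R B)) :=
  BraidedCategory.ofFaithful (Diagonal.U R (GroupAlgebra R B)) (Diagonal.braidIso (R := R))
    fun X Y => show (Diagonal.μIso R X Y).hom ≫ (Diagonal.μIso R X Y).inv ≫
      (β_ ((Diagonal.U R _).obj X) ((Diagonal.U R _).obj Y)).hom ≫ (Diagonal.μIso R Y X).hom = _
      from Iso.hom_inv_id_assoc _ _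

noncomputable instance : (Diagonal.U R (GroupAlgebra R B)).Braided where
  braided X Y := show _ = (Diagonal.μIso R X Y).hom ≫ (Diagonal.μIso R X Y).inv ≫
      (β_ ((Diagonal.U R _).obj X) ((Diagonal.U R _).obj Y)).hom ≫ (Diagonal.μIso R Y X).hom
      from (Iso.hom_inv_id_assoc _ _).symm

noncomputable instance : SymmetricCategory (ModuleCat.{u} (GroupAlgebra R B)) :=
  SymmetricCategory.ofFaithful (Diagonal.U R (GroupAlgebra R B))

instance : MonoidalPreadditive (ModuleCat.{u} (GroupAlgebra R B)) :=
  monoidalPreadditive_of_faithful (Diagonal.U R (GroupAlgebra R B))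

instance : ReflectsColimits (Diagonal.U R (GroupAlgebra R B)) :=
  reflectsColimits_of_reflectsIsomorphisms

instance (X : ModuleCat.{u} (GroupAlgebra R B)) : PreservesColimits ((curriedTensor _).obj X) := by
  let F := Diagonal.U R (GroupAlgebra R B)
  have : PreservesColimits (tensorLeft X ⋙ F) :=
    preservesColimits_of_natIso (Functor.Monoidal.commTensorLeft F X)
  exact preservesColimits_of_reflects_of_preserves (tensorLeft X) F

instance (X : ModuleCat.{u} (GroupAlgebra R B)) :
    PreservesColimits ((curriedTensor _).flip.obj X) :=
  preservesColimits_of_natIso (BraidedCategory.tensorLeftIsoTensorRight X)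

instance (X : ModuleCat.{u} (GroupAlgebra R B)) :
    PreservesColimitsOfSize.{0, 0} ((curriedTensor _).obj X) :=
  preservesColimitsOfSize_shrink _

instance (X : ModuleCat.{u} (GroupAlgebra R B)) :
    PreservesColimitsOfSize.{0, 0} ((curriedTensor _).flip.obj X) :=
  preservesColimitsOfSize_shrink _

instance : HasColimitsOfSize.{0, 0} (ModuleCat.{u} (GroupAlgebra R B)) :=
  hasColimitsOfSizeShrink.{0, 0, u, u} _


end GroupAlgebra

end DiagonalGroupAlgebra

section Braiding

variable {C : Type u} [Category.{v} C] [MonoidalCategory C] [BraidedCategory C] [Preadditive C]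
  [MonoidalPreadditive C]

open HomologicalComplex in
/-- The braiding `x ⊗ y ↦ (-1)^{pq} y ⊗ x` of cochain complexes. -/
noncomputable def braidComplex (K L : CochainComplex C ℤ) [HasTensor K L] [HasTensor L K] :
    tensorObj K L ⟶ tensorObj L K where
  f n := mapBifunctorDesc fun p q h => (p * q).negOnePow •
    ((β_ (K.X p) (L.X q)).hom ≫ ιTensorObj L K q p n (by rw [add_comm]; exact h))
  comm' i j hij := by
    apply mapBifunctor.hom_ext
    intro p q h
    have hj : i + 1 = j := hij
    have h : p + q = i := h
    rw [ι_mapBifunctorDesc_assoc, mapBifunctor.d_eq, mapBifunctor.d_eq]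
    simp only [Preadditive.add_comp, Preadditive.comp_add, mapBifunctor.ι_D₁, mapBifunctor.ι_D₂,
      mapBifunctor.ι_D₁_assoc, mapBifunctor.ι_D₂_assoc, Linear.units_smul_comp, Category.assoc]
    rw [mapBifunctor.d₁_eq K L (curriedTensor C) _ (i₁' := p + 1) rfl q j
        (by change p + 1 + q = j; lia),
      mapBifunctor.d₂_eq K L (curriedTensor C) _ p (i₂' := q + 1) rfl j
        (by change p + (q + 1) = j; lia),
      mapBifunctor.d₁_eq L K (curriedTensor C) _ (i₁' := q + 1) rfl p j
        (by change q + 1 + p = j; lia),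
      mapBifunctor.d₂_eq L K (curriedTensor C) _ q (i₂' := p + 1) rfl j
        (by change q + (p + 1) = j; lia)]
    simp [add_mul, mul_add, Int.negOnePow_add, smul_smul]
    rw [mul_left_comm, Int.units_mul_self, mul_one, add_comm]

end Braiding

section Frobenius

/-- `add M`: the direct summands of finite direct sums of copies of `M`. -/
def addClosure {A : Type u} [Ring A] (M : ModuleCat.{u} A) : ObjectProperty (ModuleCat.{u} A) := fun X =>
  ∃ n : ℕ, Nonempty (Retract X (ModuleCat.of A (Fin n → M)))

/-- `ω_{A/R} = Hom_R(A, R)` -/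
def Dualising (R : Type u) [CommRing R] (A : Type u) [Ring A] [Algebra R A] : Type u := A →ₗ[R] R

variable (R : Type u) [CommRing R] (A : Type u) [Ring A] [Algebra R A]

instance : AddCommGroup (Dualising R A) := inferInstanceAs (AddCommGroup (A →ₗ[R] R))

/-- The left `A`-module structure `(a • f) x = f (x * a)`. -/
instance : Module A (Dualising R A) where
  smul a f := LinearMap.comp (show A →ₗ[R] R from f) (LinearMap.mulRight R a)
  one_smul f := LinearMap.ext fun x => congrArg (show A →ₗ[R] R from f) (mul_one x)
  mul_smul a b f := LinearMap.ext fun x =>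
    congrArg (show A →ₗ[R] R from f) (mul_assoc x a b).symm
  smul_zero _ := rfl
  smul_add _ _ _ := rfl
  add_smul a b f := LinearMap.ext fun x =>
    (congrArg (show A →ₗ[R] R from f) (mul_add x a b)).trans (map_add (show A →ₗ[R] R from f) _ _)
  zero_smul f := LinearMap.ext fun x =>
    (congrArg (show A →ₗ[R] R from f) (mul_zero x)).trans (map_zero (show A →ₗ[R] R from f))

/-- `A` is a Frobenius `R`-algebra: it is finite projective over `R` and
`add ω_{A/R} = add A`. -/
structure IsFrobenius : Prop where
  finite : Module.Finite R A
  projective : Module.Projective R A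
  add_eq : addClosure (ModuleCat.of A (Dualising R A)) = addClosure (ModuleCat.of A A)

end Frobenius

section Tensor

variable (R : Type u) [CommRing R] (A : Type u) [Ring A] [Algebra R A]

/-- The complexes of `A`-modules that belong to `K^lf(Proj A, R)`. -/
def lfComplex : ObjectProperty (CochainComplex (ModuleCat.{u} A) ℤ) := fun C =>
  ∃ h : KProjProp A ((HomotopyCategory.quotient _ _).obj C), KlfProp R A ⟨_, h⟩

lemma lfComplex_iff (C : CochainComplex (ModuleCat.{u} A) ℤ) (X : KProj A)
    (e : X.obj ≅ (HomotopyCategory.quotient _ _).obj C)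
    (h : KProjProp A ((HomotopyCategory.quotient _ _).obj C)) :
    lfComplex R A C ↔ KlfProp R A X :=
  ⟨fun ⟨_, h'⟩ => (KlfProp R A).prop_of_iso (ObjectProperty.isoMk _ e.symm) h',
    fun h' => ⟨h, (KlfProp R A).prop_of_iso (ObjectProperty.isoMk _ e) h'⟩⟩

instance : (lfComplex R A).IsStableUnderShift ℤ where
  isStableUnderShiftBy n := ⟨fun C hC => by
    obtain ⟨h, h'⟩ := hC
    let X : KProj A := ⟨_, h⟩
    exact (lfComplex_iff R A (C⟦n⟧) (X⟦n⟧)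
      (((KProjProp A).ι.commShiftIso n).app X ≪≫
        ((HomotopyCategory.quotient _ _).commShiftIso n).symm.app C) fun i => h (i + n)).2
          ((KlfProp R A).le_shift n _ h')⟩

/-- The functor sending a complex to the corresponding object of `K^lf(Proj A, R)`. -/
noncomputable def toKlf : (lfComplex R A).FullSubcategory ⥤ Klf R A :=
  (KlfProp R A).lift ((KProjProp A).lift ((lfComplex R A).ι ⋙ HomotopyCategory.quotient _ _)
    fun X => X.property.choose) fun X => X.property.choose_spec

noncomputable instance : (toKlf R A).CommShift ℤ :=
  inferInstanceAs (((KlfProp R A).lift ((KProjProp A).lift ((lfComplex R A).ι ⋙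
    HomotopyCategory.quotient _ _) fun X => X.property.choose)
      fun X => X.property.choose_spec).CommShift ℤ)

end Tensor

section TensorTriangulated

variable (K : Type u) [Category.{v} K] [Preadditive K] [HasZeroObject K] [HasShift K ℤ]
  [∀ n : ℤ, (shiftFunctor K n).Additive] [Pretriangulated K] [MonoidalCategory K]

/-- A tensor-triangulated category: the tensor product commutes with the shift in both variables
(with the usual sign rule, this is the assumption `CommShift₂Int`) and is exact in each variable. -/
class IsTensorTriangulated [(curriedTensor K).CommShift₂Int] : Prop where
  left (X : K) : ((curriedTensor K).obj X).IsTriangulated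
  right (Y : K) : ((curriedTensor K).flip.obj Y).IsTriangulated

variable {K} in
/-- The natural map `Hom(X, 𝟙) ⊗ Y ⟶ Hom(X, Y)`, adjoint to evaluation. -/
noncomputable def rigidityMap [MonoidalClosed K] (X Y : K) :
    (ihom X).obj (𝟙_ K) ⊗ Y ⟶ (ihom X).obj Y :=
  MonoidalClosed.curry ((α_ X _ Y).inv ≫ (ihom.ev X).app (𝟙_ K) ▷ Y ≫ (λ_ Y).hom)

variable {K} in
/-- `X` is rigid: the natural map `Hom(X, 𝟙) ⊗ Y ⟶ Hom(X, Y)` is an isomorphism for all `Y`. -/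
def IsRigid [MonoidalClosed K] (X : K) : Prop := ∀ Y : K, IsIso (rigidityMap X Y)

/-- `K` is rigidly-compactly generated: it is compactly generated, the unit is compact, it has internal
function objects, and the compact objects are the rigid objects. -/
def IsRigidlyCompactlyGenerated : Prop :=
  IsCompactlyGeneratedTri K ∧ compacts K (𝟙_ K) ∧
    ∃ _ : MonoidalClosed K, ∀ X : K, compacts K X ↔ IsRigid X

end TensorTriangulated

section Induced

variable (R : Type u) [CommRing R] (B : Type u) [CommRing B] [HopfAlgebra R B]
  [Module.Finite R B] [Module.Projective R B]

/-- The category of complexes of `RG`-modules that belong to `K^lf(Proj G, R)`. -/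
abbrev LfComplex := (lfComplex R (GroupAlgebra R B)).FullSubcategory

variable {R B} in
/-- The canonical isomorphism `X⟦n⟧ ⊗ Y ≅ (X ⊗ Y)⟦n⟧` of complexes. -/
noncomputable def shiftTensor (X Y : LfComplex R B) (n : ℤ) :
    (X⟦n⟧).obj ⊗ Y.obj ⟶ (X.obj ⊗ Y.obj)⟦n⟧ :=
  ((lfComplex R (GroupAlgebra R B)).ι.commShiftIso n).hom.app X ▷ Y.obj ≫
    (CochainComplex.mapBifunctorShift₁Iso X.obj Y.obj (curriedTensor _) n).hom

variable {R B} in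
/-- The canonical isomorphism `X ⊗ Y⟦n⟧ ≅ (X ⊗ Y)⟦n⟧` of complexes, `x ⊗ y ↦ (-1)^{pn} x ⊗ y`
for `x` of degree `p`. -/
noncomputable def tensorShift (X Y : LfComplex R B) (n : ℤ) :
    X.obj ⊗ (Y⟦n⟧).obj ⟶ (X.obj ⊗ Y.obj)⟦n⟧ :=
  X.obj ◁ ((lfComplex R (GroupAlgebra R B)).ι.commShiftIso n).hom.app Y ≫
    (CochainComplex.mapBifunctorShift₂Iso X.obj Y.obj (curriedTensor _) n).hom

/-- The symmetric monoidal structure on `K^lf(Proj G, R)` is the one induced by the tensor product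
`⊗_R` of complexes with the diagonal action. -/
structure IsInduced [MonoidalCategory (Klf R (GroupAlgebra R B))]
    [BraidedCategory (Klf R (GroupAlgebra R B))]
    [(curriedTensor (Klf R (GroupAlgebra R B))).CommShift₂Int] where
  /-- `K^lf(Proj G, R)` is closed under `⊗_R`. -/
  closed (X Y : LfComplex R B) : lfComplex R (GroupAlgebra R B) (X.obj ⊗ Y.obj)
  /-- The tensor product of `K^lf(Proj G, R)` is `⊗_R`. -/
  μ (X Y : LfComplex R B) :
    (toKlf R _).obj X ⊗ (toKlf R _).obj Y ≅ (toKlf R _).obj ⟨X.obj ⊗ Y.obj, closed X Y⟩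
  natural {X X' Y Y' : LfComplex R B} (f : X ⟶ X') (g : Y ⟶ Y') :
    ((toKlf R _).map f ⊗ₘ (toKlf R _).map g) ≫ (μ X' Y').hom =
      (μ X Y).hom ≫ (toKlf R _).map (ObjectProperty.homMk (f.hom ⊗ₘ g.hom))
  associator (X Y Z : LfComplex R B) :
    (μ X Y).hom ▷ (toKlf R _).obj Z ≫ (μ ⟨X.obj ⊗ Y.obj, closed X Y⟩ Z).hom ≫
        (toKlf R _).map (Y := ⟨X.obj ⊗ Y.obj ⊗ Z.obj, closed X ⟨_, closed Y Z⟩⟩)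
          (ObjectProperty.homMk (α_ X.obj Y.obj Z.obj).hom) =
      (α_ _ _ _).hom ≫ (toKlf R _).obj X ◁ (μ Y Z).hom ≫ (μ X ⟨Y.obj ⊗ Z.obj, closed Y Z⟩).hom
  braiding (X Y : LfComplex R B) :
    (μ X Y).hom ≫ (toKlf R _).map (Y := ⟨Y.obj ⊗ X.obj, closed Y X⟩)
        (ObjectProperty.homMk (braidComplex X.obj Y.obj)) =
      (β_ _ _).hom ≫ (μ Y X).hom
  shift_left (X Y : LfComplex R B) (n : ℤ) :
    (((curriedTensor _).flip.obj ((toKlf R _).obj Y)).commShiftIso n).hom.app ((toKlf R _).obj X) ≫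
        (μ X Y).hom⟦n⟧' ≫ ((toKlf R _).commShiftIso n).inv.app ⟨X.obj ⊗ Y.obj, closed X Y⟩ =
      ((toKlf R _).commShiftIso n).inv.app X ▷ (toKlf R _).obj Y ≫ (μ (X⟦n⟧) Y).hom ≫
        (toKlf R _).map (ObjectProperty.homMk (shiftTensor X Y n ≫
          ((lfComplex R _).ι.commShiftIso n).inv.app ⟨X.obj ⊗ Y.obj, closed X Y⟩))
  shift_right (X Y : LfComplex R B) (n : ℤ) :
    (((curriedTensor _).obj ((toKlf R _).obj X)).commShiftIso n).hom.app ((toKlf R _).obj Y) ≫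
        (μ X Y).hom⟦n⟧' ≫ ((toKlf R _).commShiftIso n).inv.app ⟨X.obj ⊗ Y.obj, closed X Y⟩ =
      (toKlf R _).obj X ◁ ((toKlf R _).commShiftIso n).inv.app Y ≫ (μ X (Y⟦n⟧)).hom ≫
        (toKlf R _).map (ObjectProperty.homMk (tensorShift X Y n ≫
          ((lfComplex R _).ι.commShiftIso n).inv.app ⟨X.obj ⊗ Y.obj, closed X Y⟩))

end Induced

end FrobLF

open FrobLF

/-!
Part (1). Over a Frobenius algebra `A` the projective modules are direct summands of modules
coinduced from `R`, hence they are injective relative to the extensions that split over `R`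
(`IsFrobenius.relInjective`). Consequently a complex that is contractible over `R` has no nonzero
morphisms to a complex of projective modules as soon as one of the two is bounded below
(`rContractible_hom_eq_zero`). On the other hand, the objects of `K^{+,b}(proj A)` and of
`K^b(mod(A, R))` agree up to maps with `R`-contractible cone: a canonical truncation of an object of
the first kind belongs to the second (`exists_truncation`), and an object of the second kind has a
coresolution by coinduced modules of the first kind (`IsFrobenius.exists_coresolution`). This yields

* that `K^{+,b}(proj A)` embeds in `D(Mod A)`, with essential image that of `D^b(mod(A, R))`, and
  that `D^b(mod(A, R))` embeds in `D(Mod A)` (`IsFrobenius.bijective_Qh_map_Kpb`,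
  `IsFrobenius.full_can`, `IsFrobenius.faithful_can`);
* that objects of `K^{+,b}(proj A)` are compact in `K(Proj A)`, because morphisms out of them are
  morphisms out of a bounded complex of finitely generated modules
  (`IsFrobenius.compacts_of_kPlusB`).

So `K^lf(Proj A, R)` is generated by compact objects, its compact objects are retracts of objects of
`K^{+,b}(proj A)` (`exists_retract_of_compacts`), and `K^{+,b}(proj A)` is closed under retracts:
being closed under the coproducts `⨁ Z⟦-2j⟧`, the class `K⁺(proj A)` allows an Eilenberg swindle
(`prop_of_retract_of_swindle`), and acyclicity in high degrees is inherited by retracts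
(`acyclicAt_of_retract`). The equivalence is `IsFrobenius.exists_equivalence`.

Part (2). The group algebra is a cocommutative Hopf algebra with involutive antipode, so modules that
are finitely generated and projective over `R` have duals (`exactPairingRep`). It follows formally
that the tensor product of such a module with a projective module is projective, and that the group
algebra is Frobenius (`isFrobenius_groupAlgebra`). The tensor product of complexes makes the
homotopy category of complexes a tensor triangulated category, and `K^lf(Proj G, R)` is closed under
it, which can be checked on generators (`klfProp_tensor`). Bounded below complexes in `mod(A, R)`
that are contractible over `R` are annihilated by tensoring with objects of `K^lf(Proj G, R)`
(`isZero_tensor_klf`). Therefore any coresolution of the trivial module is a tensor unit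
(`exists_unit`), and it is compact because it belongs to `K^{+,b}(proj A)`.

Function objects exist by Brown representability for compactly generated triangulated categories
(`isLeftAdjoint_of_isCompactlyGeneratedTri`). A compact object `X` receives a map `M ⟶ X` with
`R`-contractible cone from a bounded complex `M` in `mod(A, R)`; the complex `M` has a dual `D`
(`exactPairingDualComplex`), and `D ⊗ 𝟙` is a dual of `X` in `K^lf(Proj G, R)`
(`isRigid_of_compacts`). Conversely rigid objects are compact since the unit is
(`compacts_of_isRigid`).
-/

open CategoryTheory Limits Pretriangulated MonoidalCategory

namespace FrobLF

/-! ### Null-homotopies and relative injectivity -/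

section NullHomotopy

open CochainComplex HomComplex Preadditive

variable {C : Type u} [Category.{v} C] [Preadditive C]

/-- One step in the construction of a null-homotopy: a homotopy defined up to degree `n` extends
by one degree as soon as every map `K.X (n + 1) ⟶ L.X (n + 1)` vanishing on boundaries extends
along the differential. -/
lemma exists_nullHomotopy_step {K L : CochainComplex C ℤ}
    (f : K ⟶ L) (α : Cochain K L (-1)) (n m : ℤ) (hnm : n + 1 = m)
    (hext : ∀ (i j k : ℤ), i + 1 = j → j + 1 = k → ∀ u : K.X j ⟶ L.X j, K.d i j ≫ u = 0 →
      ∃ v : K.X k ⟶ L.X j, K.d j k ≫ v = u)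
    (hα : (δ (-1) 0 α).EqUpTo (Cochain.ofHom f) n) :
    ∃ (h : K.X (n + 2) ⟶ L.X (n + 1)),
      (δ (-1) 0 (α + Cochain.single h (-1))).EqUpTo (Cochain.ofHom f) m := by
  subst hnm
  let u := f.f (n + 1) - α.v (n + 1) n (by lia) ≫ L.d n (n + 1) -
    K.d (n + 1) (n + 2) ≫ α.v (n + 2) (n + 1) (by lia)
  have hu : K.d n (n + 1) ≫ u = 0 := by
    have eq := hα n n (add_zero n) (by rfl)
    simp only [δ_v (-1) 0 (neg_add_cancel 1) α n n (add_zero _) (n - 1) (n + 1)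
      (by lia) (by lia), Int.negOnePow_zero, one_smul, Cochain.ofHom_v] at eq
    simp only [u, comp_sub, HomologicalComplex.d_comp_d_assoc, zero_comp,
      ← f.comm, ← eq, add_comp, Category.assoc, L.d_comp_d, comp_zero, zero_add, sub_self]
  obtain ⟨β, hβ⟩ := hext n (n + 1) (n + 2) rfl (by lia) u hu
  refine ⟨β, ?_⟩
  intro p q hpq hp
  obtain rfl : p = q := by lia
  obtain hp | rfl := hp.lt_or_eq
  · rw [δ_add, Cochain.add_v, hα p p (by lia) (by lia), add_eq_left,
      δ_v (-1) 0 (neg_add_cancel 1) _ p p hpq (p - 1) (p + 1) rfl rfl,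
      Cochain.single_v_eq_zero _ _ _ _ _ (by lia),
      Cochain.single_v_eq_zero _ _ _ _ _ (by lia)]
    simp
  · rw [δ_v (-1) 0 (neg_add_cancel 1) _ (n + 1) (n + 1) (by lia) n (n + 2)
      (by lia) (by lia), Cochain.add_v,
      Cochain.single_v_eq_zero _ _ _ _ _ (by lia)]
    simp [hβ, u]

open Cochain.InductionUp in
/-- A chain map vanishing in low degrees is null-homotopic if maps that vanish on boundaries
extend along the differential of the source. -/
lemma nonempty_nullHomotopy {K L : CochainComplex C ℤ} (f : K ⟶ L) (d : ℤ)
    (hf : ∀ i < d, f.f i = 0)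
    (hext : ∀ (i j k : ℤ), i + 1 = j → j + 1 = k → ∀ u : K.X j ⟶ L.X j, K.d i j ≫ u = 0 →
      ∃ v : K.X k ⟶ L.X j, K.d j k ≫ v = u) :
    Nonempty (Homotopy f 0) := by
  let X (n : ℕ) : Set (Cochain K L (-1)) :=
    Set.ofPred (fun α => (δ (-1) 0 α).EqUpTo (Cochain.ofHom f) (n + d - 1))
  let x₀ : X 0 := ⟨0, fun p q hpq hp ↦ by
    obtain rfl : p = q := by lia
    have := hf p (by lia)
    simp [this]⟩
  let φ (n : ℕ) (α : X n) : X (n + 1) :=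
    ⟨_, (exists_nullHomotopy_step f α.1 (n + d - 1) ((n + 1 : ℕ) + d - 1)
      (by lia) hext α.2).choose_spec⟩
  have hφ (k : ℕ) (x : X k) : (φ k x).1.EqUpTo x.1 (d + k) := fun p q hpq hp => by
    dsimp [φ]
    rw [add_eq_left, Cochain.single_v_eq_zero _ _ _ _ _ (by lia)]
  refine ⟨(Cochain.equivHomotopy f 0).symm ⟨limitSequence φ hφ x₀, ?_⟩⟩
  rw [Cochain.ofHom_zero, add_zero]
  ext n
  let k₀ := (n - d + 1).toNat
  rw [← (sequence φ x₀ k₀).2 n n (add_zero n) (by lia),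
    δ_v (-1) 0 (neg_add_cancel 1) _ n n (by lia) (n - 1) (n + 1) rfl (by lia),
    δ_v (-1) 0 (neg_add_cancel 1) _ n n (by lia) (n - 1) (n + 1) rfl (by lia),
    limitSequence_eqUpTo φ hφ x₀ k₀ n (n - 1) (by lia) (by lia),
    limitSequence_eqUpTo φ hφ x₀ k₀ (n + 1) n (by lia) (by lia)]

end NullHomotopy

section RelativeInjectivity

variable (R : Type u) [CommRing R] {A : Type u} [Ring A] [Algebra R A]

/-- The restriction of scalars from `A`-modules to `R`-modules. -/
noncomputable abbrev resMod (R : Type u) [CommRing R] (A : Type u) [Ring A] [Algebra R A] :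
    ModuleCat.{u} A ⥤ ModuleCat.{u} R :=
  ModuleCat.restrictScalars.{u} (algebraMap R A)

/-- The coinduction functor `V ↦ Hom_R(A, V)`, right adjoint to `resMod R A`. -/
noncomputable abbrev coindMod (R : Type u) [CommRing R] (A : Type u) [Ring A] [Algebra R A] :
    ModuleCat.{u} R ⥤ ModuleCat.{u} A :=
  ModuleCat.coextendScalars.{u, u, u} (algebraMap R A)

/-- The adjunction between restriction and coinduction. -/
noncomputable abbrev resCoindAdj (R : Type u) [CommRing R] (A : Type u) [Ring A] [Algebra R A] :
    resMod R A ⊣ coindMod R A :=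
  ModuleCat.restrictCoextendScalarsAdj.{u, u, u} (algebraMap R A)

/-- `N` is `R`-relatively injective: an `A`-linear map `u : L ⟶ N` extends along an `A`-linear map
`d : L ⟶ L'` whenever it does so up to an `R`-linear map `s : L' ⟶ L` with `u ∘ s ∘ d = u`. For
injective `d` and `s` a retraction, this is the usual extension property along `R`-split
monomorphisms; the present form applies directly to the differentials of `R`-contractible
complexes. -/
def RelInjective (N : ModuleCat.{u} A) : Prop :=
  ∀ ⦃L L' : ModuleCat.{u} A⦄ (d : L ⟶ L') (u : L ⟶ N)
    (s : (resMod R A).obj L' ⟶ (resMod R A).obj L),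
    (resMod R A).map d ≫ s ≫ (resMod R A).map u = (resMod R A).map u → ∃ v : L' ⟶ N, d ≫ v = u

variable {R}

lemma RelInjective.of_retract {N N' : ModuleCat.{u} A} (h : Retract N N')
    (hN : RelInjective R N') : RelInjective R N := fun L L' d u s hs => by
  obtain ⟨v, hv⟩ := hN d (u ≫ h.i) s (by
    rw [Functor.map_comp, reassoc_of% hs])
  exact ⟨v ≫ h.r, by rw [reassoc_of% hv, h.retract, Category.comp_id]⟩

lemma relInjective_coind (V : ModuleCat.{u} R) : RelInjective R ((coindMod R A).obj V) :=
  fun L L' d u s hs => by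
    let adj := resCoindAdj R A
    refine ⟨adj.homEquiv _ _ (s ≫ (adj.homEquiv _ _).symm u), ?_⟩
    rw [← Adjunction.homEquiv_naturality_left, ← Equiv.eq_symm_apply,
      Adjunction.homEquiv_counit, reassoc_of% hs]

variable (R A) in
/-- The `A`-linear map from a direct sum of copies of `Hom_R(A, R)` to the module coinduced from
the free `R`-module. -/
noncomputable def finsuppDualising (I : Type u) :
    (I →₀ Dualising R A) →ₗ[A] (coindMod R A).obj (ModuleCat.of R (I →₀ R)) where
  toFun f := (ModuleCat.CoextendScalars.equiv (algebraMap R A) (ModuleCat.of R (I →₀ R))).symm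
    { toFun := fun a => f.mapRange (fun φ => (show A →ₗ[R] R from φ) a) rfl
      map_add' := fun a b => by
        ext i
        exact map_add (show A →ₗ[R] R from f i) _ _
      map_smul' := fun r a => by
        ext i
        refine (congrArg (show A →ₗ[R] R from f i) ?_).trans
          (map_smul (show A →ₗ[R] R from f i) r (show A from a))
        exact (Algebra.smul_def r (show A from a)).symm }
  map_add' f g := by
    refine (ModuleCat.CoextendScalars.equiv _ _).injective (LinearMap.ext fun a => ?_)
    ext i
    rfl
  map_smul' a f := by
    refine (ModuleCat.CoextendScalars.equiv _ _).injective (LinearMap.ext fun b => ?_)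
    ext i
    rfl

lemma finsuppDualising_bijective [Module.Finite R A] (I : Type u) :
    Function.Bijective (finsuppDualising R A I) := by
  constructor
  · intro f g h
    ext i
    refine LinearMap.ext (R := R) (M := A) fun a => ?_
    exact DFunLike.congr_fun (LinearMap.congr_fun (congrArg
      (ModuleCat.CoextendScalars.equiv (algebraMap R A) (ModuleCat.of R (I →₀ R))) h) a) i
  · intro g
    let g' : A →ₗ[R] (I →₀ R) :=
      { toFun := fun a => ModuleCat.CoextendScalars.equiv (algebraMap R A) _ g a
        map_add' := fun a b => map_add (ModuleCat.CoextendScalars.equiv (algebraMap R A) _ g) a b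
        map_smul' := fun r a => by
          rw [Algebra.smul_def]
          exact (ModuleCat.CoextendScalars.equiv (algebraMap R A) _ g).map_smul r
            (show (resMod R A).obj (ModuleCat.of A A) from a) }
    classical
    obtain ⟨s, hs⟩ := Module.Finite.fg_top (R := R) (M := A)
    -- The supports of the values of `g` on a finite generating set bound all supports.
    let T : Finset I := s.biUnion fun a => (g' a).support
    have hT : ∀ i ∉ T, ∀ a, g' a i = 0 := by
      intro i hi
      have : (Finsupp.lapply i : (I →₀ R) →ₗ[R] R) ∘ₗ g' = 0 := by
        refine LinearMap.ext_on_range (v := ((↑) : s → A)) (by simpa using hs) fun a => ?_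
        have : i ∉ (g' a).support := fun h => hi (Finset.mem_biUnion.2 ⟨a, a.2, h⟩)
        simpa using this
      exact fun a => LinearMap.congr_fun this a
    refine ⟨Finsupp.onFinset T (fun i => (show Dualising R A from Finsupp.lapply i ∘ₗ g'))
      fun i hi => ?_, ?_⟩
    · by_contra h
      exact hi (LinearMap.ext (hT i h))
    · refine (ModuleCat.CoextendScalars.equiv _ _).injective (LinearMap.ext fun b => ?_)
      ext i
      rfl

/-- A retract of a module yields a retract of the direct sums of copies. -/
noncomputable def finsuppRetract {M N : ModuleCat.{u} A} (h : Retract M N) (I : Type u) :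
    Retract (ModuleCat.of A (I →₀ M)) (ModuleCat.of A (I →₀ N)) where
  i := ModuleCat.ofHom (Finsupp.mapRange.linearMap h.i.hom)
  r := ModuleCat.ofHom (Finsupp.mapRange.linearMap h.r.hom)
  retract := by
    ext1
    refine LinearMap.ext fun f => Finsupp.ext fun i => ?_
    exact ConcreteCategory.congr_hom h.retract (f i)

/-- The direct sum of copies of `M ^ n` is a direct sum of copies of `M`. -/
noncomputable def finsuppPiIso (M : ModuleCat.{u} A) (I : Type u) (n : ℕ) :
    ModuleCat.of A (I →₀ ModuleCat.of A (Fin n → M)) ≅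
      ModuleCat.of A ((I × ULift.{u} (Fin n)) →₀ M) :=
  LinearEquiv.toModuleIso ((Finsupp.mapRange.linearEquiv
    ((Finsupp.linearEquivFunOnFinite A M (ULift.{u} (Fin n))).trans
      (LinearEquiv.funCongrLeft A M Equiv.ulift.symm)).symm).trans
        (Finsupp.curryLinearEquiv A).symm)

/-- Over a Frobenius algebra, projective modules are relatively injective. -/
lemma IsFrobenius.relInjective (hA : IsFrobenius R A) {P : ModuleCat.{u} A} (hP : proj A P) :
    RelInjective R P := by
  have := hA.finite
  have : Module.Projective A P := hP
  have h1 : addClosure (ModuleCat.of A (Dualising R A)) (ModuleCat.of A A) := by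
    rw [hA.add_eq]
    exact ⟨1, ⟨⟨ModuleCat.ofHom (LinearMap.pi fun _ => LinearMap.id),
      ModuleCat.ofHom (LinearMap.proj 0), rfl⟩⟩⟩
  -- `P` is a summand of a free module, hence of a direct sum of copies of `Hom_R(A, R)`, and such a
  -- direct sum is coinduced because `A` is finite over `R`
  obtain ⟨n, ⟨h⟩⟩ := h1
  obtain ⟨σ, hσ⟩ := Module.projective_def'.1 (inferInstance : Module.Projective A P)
  have r1 : Retract P (ModuleCat.of A (P →₀ A)) :=
    { i := ModuleCat.ofHom σ
      r := ModuleCat.ofHom (Finsupp.linearCombination A id)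
      retract := by ext1; exact hσ }
  have e : ModuleCat.of A ((P × ULift.{u} (Fin n)) →₀ Dualising R A) ≅
      (coindMod R A).obj (ModuleCat.of R ((P × ULift.{u} (Fin n)) →₀ R)) :=
    (LinearEquiv.ofBijective _ (finsuppDualising_bijective (R := R) (A := A)
      (P × ULift.{u} (Fin n)))).toModuleIso
  exact ((relInjective_coind _).of_retract
    (r1.trans (finsuppRetract h P) |>.trans (finsuppPiIso _ P n ≪≫ e).retract))

/-- The canonical embedding of an `A`-module in the coinduced module. -/
noncomputable abbrev toCoind (M : ModuleCat.{u} A) :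
    M ⟶ (coindMod R A).obj ((resMod R A).obj M) :=
  (resCoindAdj R A).unit.app M

lemma addClosure_retract {M X Y : ModuleCat.{u} A} (h : Retract X Y) (hY : addClosure M Y) :
    addClosure M X := by
  obtain ⟨n, ⟨r⟩⟩ := hY
  exact ⟨n, ⟨h.trans r⟩⟩

lemma finProj_of_addClosure {X : ModuleCat.{u} A} (h : addClosure (ModuleCat.of A A) X) :
    finProj A X := by
  obtain ⟨n, ⟨r⟩⟩ := h
  have hr : r.r.hom ∘ₗ r.i.hom = LinearMap.id := by
    have := r.retract
    exact ModuleCat.hom_ext_iff.1 this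
  refine ⟨Module.Finite.of_surjective (M := Fin n → A) r.r.hom fun x =>
    ⟨r.i.hom x, LinearMap.congr_fun hr x⟩, Module.Projective.of_split (M := Fin n → A) r.i.hom r.r.hom hr⟩

lemma exists_retract_pi {V : ModuleCat.{u} R} [Module.Finite R V] [Module.Projective R V] :
    ∃ n : ℕ, Nonempty (Retract V (ModuleCat.of R (Fin n → R))) := by
  obtain ⟨n, f, hf⟩ := Module.Finite.exists_fin' R V
  obtain ⟨σ, hσ⟩ := Module.projective_lifting_property f LinearMap.id hf
  exact ⟨n, ⟨⟨ModuleCat.ofHom σ, ModuleCat.ofHom f, by ext1; exact hσ⟩⟩⟩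

lemma addClosure_coind {V : ModuleCat.{u} R} [Module.Finite R V] [Module.Projective R V]
    [Module.Finite R A] :
    addClosure (ModuleCat.of A (Dualising R A)) ((coindMod R A).obj V) := by
  obtain ⟨n, ⟨r⟩⟩ := exists_retract_pi (V := V)
  refine addClosure_retract (r.map (coindMod R A)) ⟨n, ⟨Iso.retract ?_⟩⟩
  refine (coindMod R A).mapIso (LinearEquiv.toModuleIso
    ((Finsupp.linearEquivFunOnFinite R R (ULift.{u} (Fin n))).trans
      (LinearEquiv.funCongrLeft R R Equiv.ulift.symm)).symm) ≪≫
    (LinearEquiv.ofBijective _ (finsuppDualising_bijective (R := R) (A := A)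
      (ULift.{u} (Fin n)))).symm.toModuleIso ≪≫ LinearEquiv.toModuleIso ?_
  exact (Finsupp.linearEquivFunOnFinite A (Dualising R A) (ULift.{u} (Fin n))).trans
      (LinearEquiv.funCongrLeft A (Dualising R A) Equiv.ulift.symm)

/-- Over a Frobenius algebra, the module coinduced from a finitely generated projective
`R`-module is finitely generated projective. -/
lemma IsFrobenius.finProj_coind (hA : IsFrobenius R A) {M : ModuleCat.{u} A}
    (hM : modFinProj R A M) : finProj A ((coindMod R A).obj ((resMod R A).obj M)) := by
  have := hA.finite
  have : Module.Finite R ((resMod R A).obj M) := hM.1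
  have : Module.Projective R ((resMod R A).obj M) := hM.2
  apply finProj_of_addClosure
  rw [← hA.add_eq]
  exact addClosure_coind

/-- Projective modules over an algebra that is projective over `R` are projective over `R`. -/
lemma modProj_of_proj [Module.Projective R A] {P : ModuleCat.{u} A} (hP : proj A P) :
    modProj R A P := by
  have : Module.Projective A P := hP
  obtain ⟨σ, hσ⟩ := Module.projective_def'.1 (inferInstance : Module.Projective A P)
  have r1 : Retract P (ModuleCat.of A (P →₀ A)) :=
    { i := ModuleCat.ofHom σ
      r := ModuleCat.ofHom (Finsupp.linearCombination A id)
      retract := by ext1; exact hσ }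
  have r2 := r1.map (resMod R A)
  let e : (P →₀ A) ≃ₗ[R] (resMod R A).obj (ModuleCat.of A (P →₀ A)) :=
    { toFun := fun x => x
      invFun := fun x => x
      left_inv := fun _ => rfl
      right_inv := fun _ => rfl
      map_add' := fun _ _ => rfl
      map_smul' := fun r x => by
        refine Finsupp.ext fun i => ?_
        exact Algebra.smul_def r (x i) }
  have : Module.Projective R (P →₀ A) := by
    classical
    exact Module.Projective.of_equiv (finsuppLequivDFinsupp R).symm
  have : Module.Projective R ((resMod R A).obj (ModuleCat.of A (P →₀ A))) :=
    Module.Projective.of_equiv e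
  exact (Module.Projective.of_split r2.i.hom r2.r.hom (ModuleCat.hom_ext_iff.1 r2.retract) :
    Module.Projective R _)

lemma modFinProj_of_finProj [Module.Finite R A] [Module.Projective R A] {P : ModuleCat.{u} A}
    (hP : finProj A P) : modFinProj R A P := by
  refine ⟨?_, modProj_of_proj hP.2⟩
  have := hP.1
  obtain ⟨n, f, hf⟩ := Module.Finite.exists_fin' A P
  let e : (Fin n → A) ≃ₗ[R] (resMod R A).obj (ModuleCat.of A (Fin n → A)) :=
    { toFun := fun x => x
      invFun := fun x => x
      left_inv := fun _ => rfl
      right_inv := fun _ => rfl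
      map_add' := fun _ _ => rfl
      map_smul' := fun r x => funext fun i => Algebra.smul_def r (x i) }
  have := Module.Finite.equiv e
  exact Module.Finite.of_surjective ((resMod R A).map (ModuleCat.ofHom f)).hom hf

end RelativeInjectivity

/-! ### Complexes that are contractible over the base ring -/

section Contractible

open HomotopyCategory
open scoped ZeroObject

variable (R : Type u) [CommRing R] (A : Type u) [Ring A] [Algebra R A]

/-- The homotopy category of cochain complexes of `A`-modules. -/
abbrev KMod (A : Type u) [Ring A] := HomotopyCategory (ModuleCat.{u} A) (.up ℤ)

/-- The quotient functor from cochain complexes to the homotopy category. -/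
abbrev KMod.quot (A : Type u) [Ring A] : CochainComplex (ModuleCat.{u} A) ℤ ⥤ KMod A :=
  HomotopyCategory.quotient (ModuleCat.{u} A) (.up ℤ)

/-- Restriction of scalars `K(Mod A) ⥤ K(Mod R)`. -/
noncomputable abbrev resK : KMod A ⥤ KMod R :=
  (resMod R A).mapHomotopyCategory (.up ℤ)

/-- The complexes of `A`-modules that are contractible as complexes of `R`-modules. -/
def rContractible : ObjectProperty (KMod A) := fun X => IsZero ((resK R A).obj X)

instance : (rContractible R A).IsTriangulated := by
  let Z : ObjectProperty (KMod R) := fun X => IsZero X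
  have : Z.IsClosedUnderIsomorphisms := ⟨fun e h => IsZero.of_iso h e.symm⟩
  have : Z.IsTriangulated :=
    { exists_zero := ⟨0, isZero_zero _, isZero_zero _⟩
      isStableUnderShiftBy := fun n => ⟨fun X hX => (shiftFunctor _ n).map_isZero hX⟩
      toIsTriangulatedClosed₂ := .mk' fun T hT h₁ h₃ => Triangle.isZero₂_of_isZero₁₃ T hT h₁ h₃ }
  exact inferInstanceAs (Z.inverseImage (resK R A)).IsTriangulated

instance : (rContractible R A).IsClosedUnderIsomorphisms :=
  ⟨fun e h => IsZero.of_iso h ((resK R A).mapIso e.symm)⟩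

variable {R A}

/-- Chain maps that vanish in low degrees, from an `R`-contractible complex to a complex of
relatively injective modules, are null-homotopic. -/
lemma rContractible_map_eq_zero {X Y : CochainComplex (ModuleCat.{u} A) ℤ}
    (hX : rContractible R A ((KMod.quot A).obj X)) (hY : ∀ n, RelInjective R (Y.X n))
    (f : X ⟶ Y) (d : ℤ) (hf : ∀ i < d, f.f i = 0) : (KMod.quot A).map f = 0 := by
  have h0 : (KMod.quot R).map (𝟙 (((resMod R A).mapHomologicalComplex (.up ℤ)).obj X)) =
      (KMod.quot R).map 0 := by
    rw [CategoryTheory.Functor.map_id, Functor.map_zero]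
    exact hX.eq_of_src _ _
  let h := homotopyOfEq _ _ h0
  obtain ⟨H⟩ := nonempty_nullHomotopy f d hf fun i j k hij hjk u hu => by
    obtain ⟨a, b, h1⟩ : ∃ (a : (resMod R A).obj (X.X k) ⟶ (resMod R A).obj (X.X j))
        (b : (resMod R A).obj (X.X j) ⟶ (resMod R A).obj (X.X i)),
        𝟙 ((resMod R A).obj (X.X j)) = (resMod R A).map (X.d j k) ≫ a +
          b ≫ (resMod R A).map (X.d i j) + 0 := by
      refine ⟨h.hom k j, h.hom j i, ?_⟩
      have := h.comm j
      rwa [dNext_eq _ (show (ComplexShape.up ℤ).Rel j k from hjk),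
        prevD_eq _ (show (ComplexShape.up ℤ).Rel i j from hij)] at this
    refine hY j (X.d j k) u a ?_
    have h2 := congrArg (fun φ => φ ≫ (resMod R A).map u) h1
    have h3 := congrArg (resMod R A).map hu
    rw [Functor.map_comp, Functor.map_zero] at h3
    rw [Category.id_comp, add_zero, Preadditive.add_comp, Category.assoc, Category.assoc, h3,
      comp_zero, add_zero] at h2
    exact h2.symm
  rw [eq_of_homotopy _ _ H, Functor.map_zero]

/-- The objects of the homotopy category represented by complexes with zero terms in low
degrees. -/
def boundedBelow (C : Type u) [Category.{v} C] [Preadditive C] :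
    ObjectProperty (HomotopyCategory C (.up ℤ)) :=
  fun X => ∃ N : ℤ, ∀ n < N, IsZero (X.as.X n)

/-- The complexes of relatively injective modules. -/
abbrev termRelInj (R : Type u) [CommRing R] (A : Type u) [Ring A] [Algebra R A] :
    ObjectProperty (KMod A) := termwise (RelInjective R)

/-- An `R`-contractible complex has no nonzero morphisms to a complex of relatively injective
modules if one of the two is bounded below. -/
lemma rContractible_hom_eq_zero {X Y : KMod A} (hX : rContractible R A X)
    (hY : termRelInj R A Y) (hb : boundedBelow _ X ∨ boundedBelow _ Y) (f : X ⟶ Y) : f = 0 := by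
  obtain ⟨g, rfl⟩ : ∃ g, f = (KMod.quot A).map g :=
    ⟨_, (HomotopyCategory.quotient_map_out f).symm⟩
  obtain ⟨d, hd⟩ : ∃ d, ∀ i < d, g.f i = 0 := by
    obtain ⟨d, hd⟩ | ⟨d, hd⟩ := hb
    · exact ⟨d, fun i hi => (hd i hi).eq_of_src _ _⟩
    · exact ⟨d, fun i hi => (hd i hi).eq_of_tgt _ _⟩
  exact rContractible_map_eq_zero hX hY g d hd

/-- An exact bounded below complex of modules with projective cycles is contractible. -/
lemma isZero_of_exact_of_projective_cycles {X : CochainComplex (ModuleCat.{u} R) ℤ}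
    (d : ℤ) (hd : ∀ i < d, IsZero (X.X i)) (hex : ∀ i, X.ExactAt i)
    (hp : ∀ i, Module.Projective R (LinearMap.ker (X.d i (i + 1)).hom)) :
    IsZero ((KMod.quot R).obj X) := by
  have hex' : ∀ n : ℤ, LinearMap.range (X.d n (n + 1)).hom =
      LinearMap.ker (X.d (n + 1) (n + 1 + 1)).hom := fun n => by
    have := hex (n + 1)
    rwa [HomologicalComplex.exactAt_iff' _ n (n + 1) (n + 1 + 1) (by simp) (by simp),
      ShortComplex.moduleCat_exact_iff_range_eq_ker] at this
  have hs : ∀ n : ℤ, ∃ s : LinearMap.ker (X.d (n + 1) (n + 1 + 1)).hom →ₗ[R] X.X n,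
      ∀ y, X.d n (n + 1) (s y) = y := fun n => by
    let f : X.X n →ₗ[R] LinearMap.ker (X.d (n + 1) (n + 1 + 1)).hom :=
      LinearMap.codRestrict _ (X.d n (n + 1)).hom fun x => by rw [← hex']; exact ⟨x, rfl⟩
    have hf : Function.Surjective f := fun ⟨y, hy⟩ => by
      rw [← hex'] at hy
      obtain ⟨x, hx⟩ := hy
      exact ⟨x, Subtype.ext hx⟩
    have := hp (n + 1)
    obtain ⟨s, hs⟩ := Module.projective_lifting_property f LinearMap.id hf
    exact ⟨s, fun y => congrArg Subtype.val (LinearMap.congr_fun hs y)⟩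
  rw [IsZero.iff_id_eq_zero, ← (KMod.quot R).map_id, ← (KMod.quot R).map_zero]
  obtain ⟨H⟩ := nonempty_nullHomotopy (𝟙 X) d (fun i hi => (hd i hi).eq_of_src _ _) (by
    rintro i _ _ rfl rfl u hu
    obtain ⟨s, hs'⟩ := hs (i + 1)
    obtain ⟨t, ht⟩ := hs (i + 1 + 1)
    -- `d` followed by a section, as a map to the cycles
    let q : X.X (i + 1 + 1) →ₗ[R] LinearMap.ker (X.d (i + 1 + 1 + 1) (i + 1 + 1 + 1 + 1)).hom :=
      LinearMap.codRestrict _ (X.d (i + 1 + 1) (i + 1 + 1 + 1)).hom fun x => by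
        rw [← hex']; exact ⟨x, rfl⟩
    let p : X.X (i + 1 + 1) →ₗ[R] LinearMap.ker (X.d (i + 1 + 1) (i + 1 + 1 + 1)).hom :=
      LinearMap.codRestrict _ (LinearMap.id - t ∘ₗ q) fun x => by
        rw [LinearMap.mem_ker, LinearMap.sub_apply, map_sub]
        exact sub_eq_zero.2 (ht (q x)).symm
    refine ⟨ModuleCat.ofHom (u.hom ∘ₗ s ∘ₗ p), ?_⟩
    ext y
    have hq : q (X.d (i + 1) (i + 1 + 1) y) = 0 := Subtype.ext
      (ConcreteCategory.congr_hom (X.d_comp_d (i + 1) (i + 1 + 1) (i + 1 + 1 + 1)) y)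
    have hp : ((p (X.d (i + 1) (i + 1 + 1) y) : LinearMap.ker _) : X.X (i + 1 + 1)) =
        X.d (i + 1) (i + 1 + 1) y := by
      change X.d (i + 1) (i + 1 + 1) y - t (q _) = _
      rw [hq, map_zero, sub_zero]
    have hy : s (p (X.d (i + 1) (i + 1 + 1) y)) - y ∈
        LinearMap.ker (X.d (i + 1) (i + 1 + 1)).hom := by
      rw [LinearMap.mem_ker, map_sub, sub_eq_zero]
      exact (hs' _).trans hp
    rw [← hex'] at hy
    obtain ⟨z, hz⟩ := hy
    have : u (s (p (X.d (i + 1) (i + 1 + 1) y)) - y) = 0 := by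
      rw [← hz]
      exact ConcreteCategory.congr_hom hu z
    rw [map_sub, sub_eq_zero] at this
    exact this)
  exact eq_of_homotopy _ _ H

end Contractible

/-! ### Subcomplexes and truncations -/

section Subcomplex

open HomotopyCategory
open scoped ZeroObject

variable {A : Type u} [Ring A] (X : CochainComplex (ModuleCat.{u} A) ℤ)
  (p : ∀ i, Submodule A (X.X i)) (hp : ∀ i j, p i ≤ (p j).comap (X.d i j).hom)

/-- The subcomplex given by a family of submodules stable under the differential. -/
def subcomplex : CochainComplex (ModuleCat.{u} A) ℤ where
  X i := ModuleCat.of A (p i)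
  d i j := ModuleCat.ofHom ((X.d i j).hom.restrict (hp i j))
  shape i j h := by
    refine ModuleCat.hom_ext (LinearMap.ext fun x => Subtype.ext ?_)
    exact ConcreteCategory.congr_hom (X.shape i j h) (x : p i).1
  d_comp_d' i j k _ _ := by
    refine ModuleCat.hom_ext (LinearMap.ext fun x => Subtype.ext ?_)
    exact ConcreteCategory.congr_hom (X.d_comp_d i j k) (x : p i).1

/-- The quotient by the subcomplex given by a family of submodules. -/
def quotcomplex : CochainComplex (ModuleCat.{u} A) ℤ where
  X i := ModuleCat.of A (X.X i ⧸ p i)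
  d i j := ModuleCat.ofHom (Submodule.mapQ _ _ (X.d i j).hom (hp i j))
  shape i j h := by
    ext x
    exact congrArg (Submodule.mkQ (p j)) (ConcreteCategory.congr_hom (X.shape i j h) x)
  d_comp_d' i j k _ _ := by
    ext x
    exact congrArg (Submodule.mkQ (p k)) (ConcreteCategory.congr_hom (X.d_comp_d i j k) x)

/-- The inclusion of a subcomplex. -/
def subcomplexι : subcomplex X p hp ⟶ X where
  f i := ModuleCat.ofHom (p i).subtype
  comm' _ _ _ := rfl

/-- The projection to a quotient complex. -/
def quotcomplexπ : X ⟶ quotcomplex X p hp where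
  f i := ModuleCat.ofHom (p i).mkQ
  comm' _ _ _ := rfl

/-- The short exact sequence of complexes given by a subcomplex. -/
def subcomplexSequence : ShortComplex (CochainComplex (ModuleCat.{u} A) ℤ) :=
  .mk (subcomplexι X p hp) (quotcomplexπ X p hp) (by
    ext i x
    exact (Submodule.Quotient.mk_eq_zero _).2 x.2)

lemma subcomplexSequence_shortExact (i : ℤ) :
    ((subcomplexSequence X p hp).map (HomologicalComplex.eval _ _ i)).ShortExact where
  exact := by
    rw [ShortComplex.moduleCat_exact_iff]
    intro x hx
    exact ⟨⟨x, (Submodule.Quotient.mk_eq_zero (p i)).1 hx⟩, rfl⟩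
  mono_f := (ModuleCat.mono_iff_injective _).2 (p i).injective_subtype
  epi_g := (ModuleCat.epi_iff_surjective _).2 (p i).mkQ_surjective

/-- A degreewise split short exact sequence of complexes gives a distinguished triangle. -/
lemma exists_distinguished_of_splitting {C : Type u} [Category.{v} C] [Preadditive C]
    [HasZeroObject C] [HasBinaryBiproducts C] (S : ShortComplex (CochainComplex C ℤ))
    (h : ∀ n, Nonempty (S.map (HomologicalComplex.eval C _ n)).Splitting) :
    ∃ δ, Triangle.mk ((HomotopyCategory.quotient C (.up ℤ)).map S.f)
      ((HomotopyCategory.quotient C (.up ℤ)).map S.g) δ ∈ distTriang _ :=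
  ⟨_, (distinguished_iff_iso_trianglehOfDegreewiseSplit _).2
    ⟨S, fun n => (h n).some, ⟨Iso.refl _⟩⟩⟩

/-- The submodules defining the brutal truncation in degrees `> n`. -/
def stupidSub (n : ℤ) (i : ℤ) : Submodule A (X.X i) where
  carrier := {x | i ≤ n → x = 0}
  add_mem' ha hb h := by rw [ha h, hb h, add_zero]
  zero_mem' _ := rfl
  smul_mem' c x hx h := by rw [hx h, smul_zero]

lemma stupidSub_le (n i j : ℤ) : stupidSub X n i ≤ (stupidSub X n j).comap (X.d i j).hom := by
  intro x hx hj
  by_cases h : i + 1 = j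
  · rw [hx (by lia), map_zero]
  · exact ConcreteCategory.congr_hom (X.shape i j h) x

lemma stupidSub_of_le {n i : ℤ} (h : i ≤ n) : stupidSub X n i = ⊥ :=
  (Submodule.eq_bot_iff _).2 fun _ hx => hx h

lemma stupidSub_of_lt {n i : ℤ} (h : n < i) : stupidSub X n i = ⊤ :=
  Submodule.eq_top_iff'.2 fun _ h' => (not_le.2 h h').elim

/-- The brutal truncation `σ^{> n} X`. -/
abbrev stupidGT (n : ℤ) := subcomplex X (stupidSub X n) (stupidSub_le X n)

/-- The brutal truncation `σ^{≤ n} X`. -/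
abbrev stupidLE (n : ℤ) := quotcomplex X (stupidSub X n) (stupidSub_le X n)

lemma isZero_stupidGT {n i : ℤ} (h : i ≤ n) : IsZero ((stupidGT X n).X i) := by
  have : Subsingleton (stupidSub X n i) := by rw [stupidSub_of_le X h]; infer_instance
  exact ModuleCat.isZero_of_subsingleton (ModuleCat.of A (stupidSub X n i))

lemma isZero_stupidLE {n i : ℤ} (h : n < i) : IsZero ((stupidLE X n).X i) := by
  have : Subsingleton (X.X i ⧸ stupidSub X n i) := by
    rw [stupidSub_of_lt X h]; infer_instance
  exact ModuleCat.isZero_of_subsingleton (ModuleCat.of A (X.X i ⧸ stupidSub X n i))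

/-- The terms of `σ^{> n} X` in degrees `> n`. -/
def stupidGTXIso {n i : ℤ} (h : n < i) : (stupidGT X n).X i ≅ X.X i :=
  ((LinearEquiv.ofEq _ _ (stupidSub_of_lt X h)).trans Submodule.topEquiv).toModuleIso

/-- The terms of `σ^{≤ n} X` in degrees `≤ n`. -/
def stupidLEXIso {n i : ℤ} (h : i ≤ n) : (stupidLE X n).X i ≅ X.X i :=
  (Submodule.quotEquivOfEqBot _ (stupidSub_of_le X h)).toModuleIso

lemma nonempty_splitting_of_isZero {C : Type u} [Category.{v} C] [Abelian C]
    {S : ShortComplex C} (hS : S.ShortExact) (h : IsZero S.X₁ ∨ IsZero S.X₃) :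
    Nonempty S.Splitting := by
  obtain h | h := h
  · have : IsIso S.g := hS.isIso_g_iff.2 h
    exact ⟨.ofIsZeroOfIsIso S h this⟩
  · have : IsIso S.f := hS.isIso_f_iff.2 h
    exact ⟨.ofIsIsoOfIsZero S this h⟩

lemma exists_stupid_distinguished (n : ℤ) :
    ∃ δ, Triangle.mk ((KMod.quot A).map (subcomplexι X _ (stupidSub_le X n)))
      ((KMod.quot A).map (quotcomplexπ X _ (stupidSub_le X n))) δ ∈ distTriang _ :=
  exists_distinguished_of_splitting (subcomplexSequence X _ (stupidSub_le X n)) fun i =>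
    nonempty_splitting_of_isZero (subcomplexSequence_shortExact X _ _ i) (by
      obtain h | h := le_or_gt i n
      · exact .inl (isZero_stupidGT X h)
      · exact .inr (isZero_stupidLE X h))

variable {X} in
/-- A complex with a single nonzero term. -/
lemma nonempty_iso_single (n : ℤ) (h : ∀ i, i ≠ n → IsZero (X.X i)) :
    Nonempty (X ≅ (HomologicalComplex.single _ (.up ℤ) n).obj (X.X n)) := by
  let f : X ⟶ (HomologicalComplex.single _ (.up ℤ) n).obj (X.X n) :=
    HomologicalComplex.mkHomToSingle (𝟙 _) fun i hi => (h i (by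
      have : i + 1 = n := hi
      lia)).eq_of_src _ _
  have : ∀ i, IsIso (f.f i) := fun i => by
    by_cases hi : i = n
    · subst hi
      rw [HomologicalComplex.mkHomToSingle_f]
      infer_instance
    · exact ⟨0, (h i hi).eq_of_src _ _,
        (HomologicalComplex.isZero_single_obj_X _ _ _ _ hi).eq_of_src _ _⟩
  have := HomologicalComplex.Hom.isIso_of_components f
  exact ⟨asIso f⟩

/-- Dévissage: a triangulated subcategory containing the single complexes on modules in `P`
contains the bounded complexes with terms in `P`. -/
lemma bounded_induction (P : ObjectProperty (ModuleCat.{u} A)) [P.IsClosedUnderIsomorphisms]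
    (h0 : P 0) (Q : ObjectProperty (KMod A)) [Q.IsTriangulated] [Q.IsClosedUnderIsomorphisms]
    (hQ : ∀ M, P M → ∀ n : ℤ, Q ((KMod.quot A).obj ((HomologicalComplex.single _ (.up ℤ) n).obj M))) :
    termwise P ⊓ bounded _ ≤ Q := by
  have key : ∀ (k : ℕ) (a : ℤ) (X : CochainComplex (ModuleCat.{u} A) ℤ), (∀ i, P (X.X i)) →
      (∀ i, i < a ∨ a + k ≤ i → IsZero (X.X i)) → Q ((KMod.quot A).obj X) := by
    intro k
    induction k with
    | zero =>
      intro a X hX h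
      refine Q.prop_of_isZero ?_
      rw [IsZero.iff_id_eq_zero, ← (KMod.quot A).map_id, ← (KMod.quot A).map_zero]
      congr 1
      ext1 i
      refine (h i ?_).eq_of_src _ _
      simpa using lt_or_ge i a
    | succ k ih =>
      intro a X hX h
      obtain ⟨δ, hδ⟩ := exists_stupid_distinguished X a
      refine Q.ext_of_isTriangulatedClosed₂ _ hδ ?_ ?_
      · refine ih (a + 1) _ (fun i => ?_) (fun i hi => ?_)
        · obtain hi | hi := le_or_gt i a
          · exact P.prop_of_iso (IsZero.iso (isZero_zero _) (isZero_stupidGT X hi)) h0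
          · exact P.prop_of_iso (stupidGTXIso X hi).symm (hX i)
        · obtain hi' | hi' := le_or_gt i a
          · exact isZero_stupidGT X hi'
          · exact (h i (.inr (by push_cast; lia))).of_iso (stupidGTXIso X hi')
      · obtain ⟨e⟩ := nonempty_iso_single (X := stupidLE X a) a fun i hi => by
          obtain hi' | hi' := le_or_gt i a
          · exact (h i (.inl (by lia))).of_iso (stupidLEXIso X hi')
          · exact isZero_stupidLE X hi'
        exact Q.prop_of_iso ((KMod.quot A).mapIso e.symm)
          (hQ _ (P.prop_of_iso (stupidLEXIso X le_rfl).symm (hX a)) a)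
  rintro X ⟨h, N, hN⟩
  exact key (2 * N + 1) (-N) X.as h fun i hi => hN i (by push_cast at hi; grind)

end Subcomplex

section Truncation

open HomotopyCategory
open scoped ZeroObject

variable {R : Type u} [CommRing R] {A : Type u} [Ring A] [Algebra R A]

/-- A bounded below exact complex with cycles projective over `R` is `R`-contractible. -/
lemma rContractible_of_exact {X : CochainComplex (ModuleCat.{u} A) ℤ} (d : ℤ)
    (hd : ∀ i < d, IsZero (X.X i)) (hex : ∀ i, X.ExactAt i)
    (hp : ∀ i, modProj R A (ModuleCat.of A (LinearMap.ker (X.d i (i + 1)).hom))) :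
    rContractible R A ((KMod.quot A).obj X) := by
  refine isZero_of_exact_of_projective_cycles
    (X := ((resMod R A).mapHomologicalComplex (.up ℤ)).obj X) d
    (fun i hi => (resMod R A).map_isZero (hd i hi)) (fun i => ?_) fun i => ?_
  · have := hex i
    rw [HomologicalComplex.exactAt_iff' _ (i - 1) i (i + 1) (by simp) (by simp)] at this ⊢
    rw [ShortComplex.moduleCat_exact_iff] at this ⊢
    exact this
  · have : Module.Projective R _ := hp i
    let e : (resMod R A).obj (ModuleCat.of A (LinearMap.ker (X.d i (i + 1)).hom)) ≃ₗ[R]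
        LinearMap.ker ((((resMod R A).mapHomologicalComplex (.up ℤ)).obj X).d i (i + 1)).hom :=
      { toFun := fun x => ⟨x.1, x.2⟩
        invFun := fun x => ⟨x.1, x.2⟩
        left_inv := fun _ => rfl
        right_inv := fun _ => rfl
        map_add' := fun _ _ => rfl
        map_smul' := fun _ _ => rfl }
    exact Module.Projective.of_equiv e

variable (X : CochainComplex (ModuleCat.{u} A) ℤ) (n : ℤ)

/-- The submodules defining the canonical truncation in degrees `≤ n`. -/
def canonicalSub (i : ℤ) : Submodule A (X.X i) where
  carrier := {x | (n ≤ i → X.d i (i + 1) x = 0) ∧ (n < i → x = 0)}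
  add_mem' ha hb := ⟨fun h => by rw [map_add, ha.1 h, hb.1 h, add_zero],
    fun h => by rw [ha.2 h, hb.2 h, add_zero]⟩
  zero_mem' := ⟨fun _ => map_zero _, fun _ => rfl⟩
  smul_mem' c x hx := ⟨fun h => by
    have := (X.d i (i + 1)).hom.map_smul c x
    exact this.trans (by rw [show (X.d i (i + 1)).hom x = 0 from hx.1 h, smul_zero]),
    fun h => by rw [hx.2 h, smul_zero]⟩

lemma canonicalSub_le (i j : ℤ) :
    canonicalSub X n i ≤ (canonicalSub X n j).comap (X.d i j).hom := by
  intro x hx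
  by_cases h : i + 1 = j
  · subst h
    exact ⟨fun _ => ConcreteCategory.congr_hom (X.d_comp_d i (i + 1) (i + 1 + 1)) x,
      fun h => hx.1 (by lia)⟩
  · have : X.d i j x = 0 := ConcreteCategory.congr_hom (X.shape i j h) x
    change X.d i j x ∈ canonicalSub X n j
    rw [this]
    exact Submodule.zero_mem _

/-- The canonical truncation `τ^{≤ n} X`. -/
abbrev canonicalLE := subcomplex X (canonicalSub X n) (canonicalSub_le X n)

/-- The quotient of `X` by its canonical truncation. -/
abbrev canonicalGT := quotcomplex X (canonicalSub X n) (canonicalSub_le X n)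

variable {n} {i : ℤ}

lemma canonicalSub_of_lt (h : i < n) : canonicalSub X n i = ⊤ :=
  Submodule.eq_top_iff'.2 fun _ => ⟨fun h' => by lia, fun h' => by lia⟩

lemma canonicalSub_of_gt (h : n < i) : canonicalSub X n i = ⊥ :=
  (Submodule.eq_bot_iff _).2 fun _ hx => hx.2 h

lemma canonicalSub_self : canonicalSub X n n = LinearMap.ker (X.d n (n + 1)).hom :=
  Submodule.ext fun _ => ⟨fun h => h.1 le_rfl, fun h => ⟨fun _ => h, fun h' => (lt_irrefl _ h').elim⟩⟩

/-- The terms of the canonical truncation in degrees `< n`. -/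
def canonicalLEXIso (h : i < n) : (canonicalLE X n).X i ≅ X.X i :=
  ((LinearEquiv.ofEq _ _ (canonicalSub_of_lt X h)).trans Submodule.topEquiv).toModuleIso

/-- The term of the canonical truncation in degree `n`. -/
def canonicalLEXIsoSelf : (canonicalLE X n).X n ≅ ModuleCat.of A (LinearMap.ker (X.d n (n + 1)).hom) :=
  (LinearEquiv.ofEq _ _ (canonicalSub_self X)).toModuleIso

lemma isZero_canonicalLE (h : n < i) : IsZero ((canonicalLE X n).X i) := by
  have : Subsingleton (canonicalSub X n i) := by rw [canonicalSub_of_gt X h]; infer_instance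
  exact ModuleCat.isZero_of_subsingleton (ModuleCat.of A (canonicalSub X n i))

/-- The terms of the quotient by the canonical truncation in degrees `> n`. -/
def canonicalGTXIso (h : n < i) : (canonicalGT X n).X i ≅ X.X i :=
  (Submodule.quotEquivOfEqBot _ (canonicalSub_of_gt X h)).toModuleIso

lemma isZero_canonicalGT (h : i < n) : IsZero ((canonicalGT X n).X i) := by
  have : Subsingleton (X.X i ⧸ canonicalSub X n i) := by
    rw [canonicalSub_of_lt X h]; infer_instance
  exact ModuleCat.isZero_of_subsingleton (ModuleCat.of A (X.X i ⧸ canonicalSub X n i))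

lemma exactAt_iff_ker_le (i : ℤ) : X.ExactAt i ↔
    ∀ x, X.d i (i + 1) x = 0 → ∃ y, X.d (i - 1) i y = x := by
  rw [HomologicalComplex.exactAt_iff' _ (i - 1) i (i + 1) (by simp) (by simp),
    ShortComplex.moduleCat_exact_iff]
  rfl

lemma canonicalGT_eq_zero (h : i ≤ n) (x : (canonicalGT X n).X i)
    (hx : (canonicalGT X n).d i (i + 1) x = 0) : x = 0 := by
  obtain ⟨x, rfl⟩ := Submodule.mkQ_surjective _ x
  refine (Submodule.Quotient.mk_eq_zero _).2 ⟨fun h' => ?_, fun h' => by lia⟩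
  have : X.d i (i + 1) x ∈ canonicalSub X n (i + 1) := (Submodule.Quotient.mk_eq_zero _).1 hx
  exact this.2 (by lia)

lemma exactAt_canonicalGT (h : ∀ i > n, X.ExactAt i) (i : ℤ) : (canonicalGT X n).ExactAt i := by
  rw [exactAt_iff_ker_le]
  intro x hx
  obtain hi | hi := le_or_gt i n
  · exact ⟨0, by rw [canonicalGT_eq_zero X hi x hx, map_zero]⟩
  · obtain ⟨x, rfl⟩ := Submodule.mkQ_surjective _ x
    have : X.d i (i + 1) x ∈ canonicalSub X n (i + 1) := (Submodule.Quotient.mk_eq_zero _).1 hx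
    obtain ⟨y, rfl⟩ := (exactAt_iff_ker_le X i).1 (h i hi) x (this.2 (by lia))
    exact ⟨Submodule.mkQ _ y, rfl⟩

lemma modProj_zero : modProj R A 0 := (modFinProj_zero R A).2

lemma modProj_of_isZero {M : ModuleCat.{u} A} (h : IsZero M) : modProj R A M :=
  (modProj R A).prop_of_iso (IsZero.iso (isZero_zero _) h) modProj_zero

lemma modProj_cycles_canonicalGT
    (h : ∀ i > n, modProj R A (ModuleCat.of A (LinearMap.ker (X.d i (i + 1)).hom))) (i : ℤ) :
    modProj R A (ModuleCat.of A (LinearMap.ker ((canonicalGT X n).d i (i + 1)).hom)) := by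
  obtain hi | hi := le_or_gt i n
  · have : Subsingleton (LinearMap.ker ((canonicalGT X n).d i (i + 1)).hom) :=
      ⟨fun x y => Subtype.ext ((canonicalGT_eq_zero X hi x.1 x.2).trans
        (canonicalGT_eq_zero X hi y.1 y.2).symm)⟩
    exact modProj_of_isZero (ModuleCat.isZero_of_subsingleton
      (ModuleCat.of A (LinearMap.ker ((canonicalGT X n).d i (i + 1)).hom)))
  · let f : LinearMap.ker (X.d i (i + 1)).hom →ₗ[A]
        LinearMap.ker ((canonicalGT X n).d i (i + 1)).hom :=
      LinearMap.codRestrict _ ((canonicalSub X n i).mkQ ∘ₗ Submodule.subtype _) fun x =>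
        (congrArg (Submodule.mkQ _) x.2).trans (map_zero _)
    have hf : Function.Bijective f := by
      constructor
      · rw [injective_iff_map_eq_zero]
        intro x hx
        have : (x : X.X i) ∈ canonicalSub X n i :=
          (Submodule.Quotient.mk_eq_zero _).1 (congrArg Subtype.val hx)
        exact Subtype.ext (this.2 hi)
      · rintro ⟨x, hx⟩
        obtain ⟨x, rfl⟩ := Submodule.mkQ_surjective _ x
        have : X.d i (i + 1) x ∈ canonicalSub X n (i + 1) := (Submodule.Quotient.mk_eq_zero _).1 hx
        exact ⟨⟨x, this.2 (by lia)⟩, Subtype.ext rfl⟩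
    exact (modProj R A).prop_of_iso (LinearEquiv.ofBijective f hf).toModuleIso (h i hi)

/-- The quotient of an eventually acyclic complex by a canonical truncation is
`R`-contractible. -/
lemma rContractible_canonicalGT (h : ∀ i > n, AcyclicAt (modProj R A) X i) :
    rContractible R A ((KMod.quot A).obj (canonicalGT X n)) :=
  rContractible_of_exact n (fun _ hi => isZero_canonicalGT X hi)
    (exactAt_canonicalGT X fun i hi => (h i hi).1)
    (modProj_cycles_canonicalGT X fun i hi => (h i hi).2.2.1)

lemma modProj_canonicalGT (hX : ∀ i, modProj R A (X.X i)) (h : ∀ i > n, AcyclicAt (modProj R A) X i)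
    (i : ℤ) : modProj R A ((canonicalGT X n).X i) := by
  obtain hi | rfl | hi := lt_trichotomy i n
  · exact modProj_of_isZero (isZero_canonicalGT X hi)
  · have h1 := (h (i + 1) (by lia)).1
    rw [HomologicalComplex.exactAt_iff' _ i (i + 1) (i + 1 + 1) (by simp) (by simp),
      ShortComplex.moduleCat_exact_iff_range_eq_ker] at h1
    let e : (X.X i ⧸ canonicalSub X i i) ≃ₗ[A] LinearMap.ker (X.d (i + 1) (i + 1 + 1)).hom :=
      (Submodule.quotEquivOfEq _ _ (canonicalSub_self X)).trans
        ((LinearMap.quotKerEquivRange (X.d i (i + 1)).hom).trans (LinearEquiv.ofEq _ _ h1))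
    exact (modProj R A).prop_of_iso e.symm.toModuleIso (h (i + 1) (by lia)).2.2.1
  · exact (modProj R A).prop_of_iso (canonicalGTXIso X hi).symm (hX i)

end Truncation

/-! ### Bounded below complexes and their truncations -/

section BoundedBelow

open HomotopyCategory
open scoped ZeroObject

variable {C : Type u} [Category.{v} C] [Preadditive C] [HasZeroObject C] [HasBinaryBiproducts C]

lemma isTriangulated_termwise_inf_boundedBelow (P : ObjectProperty C)
    [P.IsClosedUnderIsomorphisms] (h0 : P 0) (hb : ∀ X Y, P X → P Y → P (X ⊞ Y)) :
    (termwise P ⊓ boundedBelow C).IsTriangulated :=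
  isTriangulated_of_mappingCone _
    ⟨fun i => P.prop_of_iso (IsZero.iso (isZero_zero _)
      ((HomologicalComplex.eval C _ i).map_isZero (isZero_zero _))) h0,
      0, fun i _ => (HomologicalComplex.eval C _ i).map_isZero (isZero_zero _)⟩
    (fun K n h => ⟨fun i => h.1 (i + n), by
      obtain ⟨N, hN⟩ := h.2
      exact ⟨N - n, fun i hi => hN (i + n) (by lia)⟩⟩)
    (fun K L f hK hL => ⟨fun i => by
      have := HomologicalComplex.HasHomotopyCofiber.hasBinaryBiproduct f i (i + 1) rfl
      exact P.prop_of_iso (HomologicalComplex.homotopyCofiber.XIsoBiprod f i (i + 1) rfl).symm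
        (hb _ _ (hK.1 _) (hL.1 _)), by
      obtain ⟨N, hN⟩ := hK.2
      obtain ⟨M, hM⟩ := hL.2
      exact ⟨min (N - 1) M, fun i hi => (CochainComplex.mappingCone.isZero_X_iff f i).2
        ⟨hN _ (by lia), hM _ (by lia)⟩⟩⟩)

instance : (boundedBelow C).IsTriangulated := by
  have h : termwise ⊤ ⊓ boundedBelow C = boundedBelow C := by
    ext X
    exact ⟨fun h => h.2, fun h => ⟨fun _ => trivial, h⟩⟩
  rw [← h]
  exact isTriangulated_termwise_inf_boundedBelow ⊤ trivial fun _ _ _ _ => trivial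

omit [HasZeroObject C] [HasBinaryBiproducts C] in
lemma bounded_le_boundedBelow : bounded C ≤ boundedBelow C := fun X ⟨N, hN⟩ =>
  ⟨-N, fun n hn => hN n (by grind)⟩

end BoundedBelow

section Classes

open HomotopyCategory
open scoped ZeroObject

variable (R : Type u) [CommRing R] (A : Type u) [Ring A] [Algebra R A]

/-- The `R`-contractible complexes that are homotopy equivalent to bounded below ones. -/
abbrev rContractiblePlus : ObjectProperty (KMod A) :=
  (boundedBelow _).isoClosure ⊓ rContractible R A

instance : (finProj A).IsClosedUnderIsomorphisms where
  of_iso e h := by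
    have : Module.Finite A _ := h.1
    exact ⟨Module.Finite.equiv e.toLinearEquiv, (proj A).prop_of_iso e h.2⟩

lemma finProj_zero : finProj A 0 := by
  refine (finProj A).prop_of_iso (IsZero.iso (ModuleCat.isZero_of_subsingleton
    (ModuleCat.of A PUnit)) (isZero_zero _)) ?_
  exact ⟨inferInstanceAs (Module.Finite A PUnit.{u + 1}),
    inferInstanceAs (Module.Projective A PUnit.{u + 1})⟩

lemma finProj_biprod (X Y : ModuleCat.{u} A) (hX : finProj A X) (hY : finProj A Y) :
    finProj A (X ⊞ Y) := by
  have := hX.1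
  have := hY.1
  exact ⟨Module.Finite.equiv (ModuleCat.biprodIsoProd X Y).toLinearEquiv.symm,
    proj_biprod A X Y hX.2 hY.2⟩

/-- The complexes homotopy equivalent to bounded below complexes of finitely generated projective
modules. -/
abbrev Kplus : ObjectProperty (KMod A) := (termwise (finProj A) ⊓ boundedBelow _).isoClosure

/-- The complexes of `R`-modules homotopy equivalent to bounded complexes of projective modules. -/
abbrev Kbp : ObjectProperty (KMod R) := (termwise (proj R) ⊓ bounded _).isoClosure

instance : (Kplus A).IsTriangulated := by
  have := isTriangulated_termwise_inf_boundedBelow (finProj A) (finProj_zero A) (finProj_biprod A)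
  infer_instance

instance : (Kbp R).IsTriangulated := by
  have := isTriangulated_termwise_inf_bounded (proj R) (proj_zero R) (proj_biprod R)
  infer_instance

/-- The complexes homotopy equivalent to bounded below complexes of finitely generated projective
`A`-modules whose restriction to `R` is homotopy equivalent to a bounded complex of projectives.
These are the objects of `K^{+,b}(proj A)`, in a form that is visibly triangulated. -/
abbrev Kpb : ObjectProperty (KMod A) := Kplus A ⊓ (Kbp R).inverseImage (resK R A)

variable {R A}

lemma rContractible_trW_iff {X Y : KMod A} (s : X ⟶ Y) :
    (rContractible R A).trW s ↔ IsIso ((resK R A).map s) := by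
  obtain ⟨Z, g, h, hT⟩ := distinguished_cocone_triangle s
  have h1 := (rContractible R A).trW_iff_of_distinguished _ hT
  exact h1.trans (Triangle.isZero₃_iff_isIso₁ _ ((resK R A).map_distinguished _ hT))

lemma rContractiblePlus_trW {X Y : KMod A} {s : X ⟶ Y} (hs : (rContractible R A).trW s)
    (hX : (boundedBelow _).isoClosure X) (hY : (boundedBelow _).isoClosure Y) :
    (rContractiblePlus R A).trW s := by
  obtain ⟨Z, g, h, hT, hZ⟩ := hs
  exact ⟨Z, g, h, hT, ObjectProperty.ext_of_isTriangulatedClosed₃ _ _ hT hX hY, hZ⟩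

lemma rContractiblePlus_rightOrthogonal {Y : KMod A} (hY : termRelInj R A Y) :
    (rContractiblePlus R A).rightOrthogonal Y := by
  rintro X f ⟨⟨X', hX', ⟨e⟩⟩, h⟩
  rw [← cancel_epi e.inv, comp_zero]
  exact rContractible_hom_eq_zero ((rContractible R A).prop_of_iso e h) hY (.inl hX') _

lemma rContractible_rightOrthogonal {Y : KMod A} (hY : (termRelInj R A ⊓ boundedBelow _) Y) :
    (rContractible R A).rightOrthogonal Y :=
  fun _ f h => rContractible_hom_eq_zero h hY.1 (.inr hY.2) f

/-- Maps with bounded below `R`-contractible cone become invertible under morphisms to complexes of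
relatively injective modules. -/
lemma bijective_precomp_of_rContractiblePlus {X X' Y : KMod A} {s : X ⟶ X'}
    (hs : (rContractiblePlus R A).trW s) (hY : termRelInj R A Y) :
    Function.Bijective fun f : X' ⟶ Y => s ≫ f := by
  have := rContractiblePlus_rightOrthogonal hY
  rw [← ObjectProperty.isLocal_trW] at this
  exact this s hs

lemma IsFrobenius.termRelInj (hA : IsFrobenius R A) {X : KMod A} (hX : termwise (proj A) X) :
    termRelInj R A X := fun n => hA.relInjective (hX n)

variable (R) in
lemma finite_range {M N : ModuleCat.{u} A} (f : M ⟶ N) (hM : modFinProj R A M) :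
    Module.Finite R ((resMod R A).obj (ModuleCat.of A (LinearMap.range f.hom))) := by
  have := hM.1
  exact Module.Finite.of_surjective
    ((resMod R A).map (ModuleCat.ofHom f.hom.rangeRestrict)).hom f.hom.surjective_rangeRestrict

lemma modProj_of_retract {M N : ModuleCat.{u} A} (hN : modProj R A N)
    (h : Retract ((resMod R A).obj M) ((resMod R A).obj N)) : modProj R A M := by
  have : Module.Projective R ((resMod R A).obj N) := hN
  exact (Module.Projective.of_split h.i.hom h.r.hom (ModuleCat.hom_ext_iff.1 h.retract) :
    Module.Projective R _)

/-- A complex of `R`-projective modules that is a homotopy retract over `R` of a bounded complex is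
acyclic in high degrees. -/
lemma acyclicAt_of_retract {Y : CochainComplex (ModuleCat.{u} A) ℤ}
    (hY : ∀ n, modProj R A (Y.X n)) {M : KMod R} (hM : bounded _ M)
    (h : Retract ((resK R A).obj ((KMod.quot A).obj Y)) M) :
    ∃ N : ℤ, ∀ n > N, AcyclicAt (modProj R A) Y n := by
  obtain ⟨N, hN⟩ := hM
  obtain ⟨f, hf⟩ := (KMod.quot R).map_surjective
    (X := ((resMod R A).mapHomologicalComplex (.up ℤ)).obj Y) (Y := M.as) h.i
  obtain ⟨g, hg⟩ := (KMod.quot R).map_surjective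
    (Y := ((resMod R A).mapHomologicalComplex (.up ℤ)).obj Y) (X := M.as) h.r
  have h1 : (KMod.quot R).map (𝟙 (((resMod R A).mapHomologicalComplex (.up ℤ)).obj Y)) =
      (KMod.quot R).map (f ≫ g) := by
    rw [CategoryTheory.Functor.map_id, Functor.map_comp, hf, hg]
    exact h.retract.symm
  -- in degrees where `M` vanishes, `H` contracts the restriction of `Y` to `R`
  let H := homotopyOfEq _ _ h1
  have key : ∀ n : ℤ, N < n → ∃ (a : (resMod R A).obj (Y.X (n + 1)) ⟶ (resMod R A).obj (Y.X n))
      (b : (resMod R A).obj (Y.X n) ⟶ (resMod R A).obj (Y.X (n - 1))),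
      𝟙 ((resMod R A).obj (Y.X n)) = (resMod R A).map (Y.d n (n + 1)) ≫ a +
        b ≫ (resMod R A).map (Y.d (n - 1) n) := by
    intro n hn
    refine ⟨H.hom (n + 1) n, H.hom n (n - 1), ?_⟩
    have := H.comm n
    rw [dNext_eq _ (show (ComplexShape.up ℤ).Rel n (n + 1) from rfl),
      prevD_eq _ (show (ComplexShape.up ℤ).Rel (n - 1) n from by simp),
      HomologicalComplex.comp_f, (hN n (by grind)).eq_of_tgt (f.f n) 0, zero_comp, add_zero] at this
    exact this
  have hb : ∀ n : ℤ, N < n → ∃ (b : (resMod R A).obj (Y.X n) ⟶ (resMod R A).obj (Y.X (n - 1))),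
      ∀ x : Y.X n, Y.d n (n + 1) x = 0 → Y.d (n - 1) n (b x : Y.X (n - 1)) = x := by
    intro n hn
    obtain ⟨a, b, hab⟩ := key n hn
    refine ⟨b, fun x hx => ?_⟩
    let y : Y.X n := a (Y.d n (n + 1) x)
    have h3 : x = y + Y.d (n - 1) n (b x : Y.X (n - 1)) := ConcreteCategory.congr_hom hab x
    have hy : y = 0 := (congrArg (fun z => a z) hx).trans (map_zero a.hom)
    rw [hy, zero_add] at h3
    exact h3.symm
  have hker : ∀ n : ℤ, N < n →
      modProj R A (ModuleCat.of A (LinearMap.ker (Y.d n (n + 1)).hom)) := by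
    intro n hn
    obtain ⟨b, hb⟩ := hb n hn
    refine modProj_of_retract (hY (n - 1)) ⟨(resMod R A).map (ModuleCat.ofHom
      (LinearMap.ker (Y.d n (n + 1)).hom).subtype) ≫ b, (resMod R A).map (ModuleCat.ofHom
        (LinearMap.codRestrict _ (Y.d (n - 1) n).hom fun x =>
          ConcreteCategory.congr_hom (Y.d_comp_d (n - 1) n (n + 1)) x)), ?_⟩
    ext x
    exact Subtype.ext (hb x.1 x.2)
  refine ⟨N + 1, fun n hn => ?_⟩
  have hex : ∀ n : ℤ, N < n → Y.ExactAt n := fun n hn => by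
    obtain ⟨b, hb⟩ := hb n hn
    exact (exactAt_iff_ker_le Y n).2 fun x hx => ⟨b x, hb x hx⟩
  refine ⟨hex n (by lia), ?_, hker n (by lia), ?_⟩
  · have := hker (n - 1) (by lia)
    rwa [sub_add_cancel] at this
  · have h1 := hex (n + 1) (by lia)
    rw [HomologicalComplex.exactAt_iff' _ n (n + 1) (n + 1 + 1) (by simp) (by simp),
      ShortComplex.moduleCat_exact_iff_range_eq_ker] at h1
    have h2 : LinearMap.range (Y.d n (n + 1)).hom = LinearMap.ker (Y.d (n + 1) (n + 1 + 1)).hom := h1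
    rw [h2]
    exact hker (n + 1) (by lia)

/-- The canonical truncation of an eventually acyclic complex of `R`-projective modules is an
`R`-homotopy equivalence. -/
lemma rContractible_trW_canonicalLE {Y : CochainComplex (ModuleCat.{u} A) ℤ}
    (hY : ∀ n, modProj R A (Y.X n)) {n : ℤ} (h : ∀ i > n, AcyclicAt (modProj R A) Y i) :
    (rContractible R A).trW ((KMod.quot A).map
      (subcomplexι Y (canonicalSub Y n) (canonicalSub_le Y n))) := by
  rw [rContractible_trW_iff]
  let F := (resMod R A).mapHomologicalComplex (.up ℤ)
  obtain ⟨δ, hδ⟩ := exists_distinguished_of_splitting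
    ((subcomplexSequence Y (canonicalSub Y n) (canonicalSub_le Y n)).map F) fun i => by
      have h1 := subcomplexSequence_shortExact Y (canonicalSub Y n) (canonicalSub_le Y n) i
      have h2 : (((subcomplexSequence Y (canonicalSub Y n) (canonicalSub_le Y n)).map F).map
          (HomologicalComplex.eval _ _ i)).ShortExact :=
        { exact := by
            have := h1.exact
            rw [ShortComplex.moduleCat_exact_iff] at this ⊢
            exact this
          mono_f := (ModuleCat.mono_iff_injective _).2
            ((ModuleCat.mono_iff_injective
              ((subcomplexSequence Y _ (canonicalSub_le Y n)).map (HomologicalComplex.eval _ _ i)).f).1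
                h1.mono_f)
          epi_g := (ModuleCat.epi_iff_surjective _).2
            ((ModuleCat.epi_iff_surjective
              ((subcomplexSequence Y _ (canonicalSub_le Y n)).map (HomologicalComplex.eval _ _ i)).g).1
                h1.epi_g) }
      have : Module.Projective R ((resMod R A).obj ((canonicalGT Y n).X i)) :=
        modProj_canonicalGT Y hY h i
      have : Projective (((subcomplexSequence Y (canonicalSub Y n) (canonicalSub_le Y n)).map F).map
          (HomologicalComplex.eval _ _ i)).X₃ :=
        (IsProjective.iff_projective (R := R) ((resMod R A).obj ((canonicalGT Y n).X i))).1 this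
      exact ⟨h2.splittingOfProjective⟩
  exact (Triangle.isZero₃_iff_isIso₁ _ hδ).1 (rContractible_canonicalGT Y h)

lemma modFinProj_of_isZero {M : ModuleCat.{u} A} (h : IsZero M) : modFinProj R A M :=
  (modFinProj R A).prop_of_iso (IsZero.iso (isZero_zero _) h) (modFinProj_zero R A)

lemma modFinProj_canonicalLE {Y : CochainComplex (ModuleCat.{u} A) ℤ}
    (hY : ∀ n, modFinProj R A (Y.X n)) {n : ℤ} (h : ∀ i ≥ n, AcyclicAt (modProj R A) Y i) (i : ℤ) :
    modFinProj R A ((canonicalLE Y n).X i) := by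
  obtain hi | rfl | hi := lt_trichotomy i n
  · exact (modFinProj R A).prop_of_iso (canonicalLEXIso Y hi).symm (hY i)
  · refine (modFinProj R A).prop_of_iso (canonicalLEXIsoSelf Y).symm ⟨?_, (h i le_rfl).2.2.1⟩
    have h1 := (h i le_rfl).1
    rw [HomologicalComplex.exactAt_iff' _ (i - 1) i (i + 1) (by simp) (by simp),
      ShortComplex.moduleCat_exact_iff_range_eq_ker] at h1
    have h2 : LinearMap.range (Y.d (i - 1) i).hom = LinearMap.ker (Y.d i (i + 1)).hom := h1
    rw [← h2]
    exact finite_range R _ (hY (i - 1))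
  · exact modFinProj_of_isZero (isZero_canonicalLE Y hi)

/-- Maps and homotopies from complexes concentrated in degrees `< n` factor through the canonical
truncation. -/
lemma bijective_comp_canonicalLE {Y : CochainComplex (ModuleCat.{u} A) ℤ} {n : ℤ}
    {M : CochainComplex (ModuleCat.{u} A) ℤ} (hM : ∀ i ≥ n, IsZero (M.X i)) :
    Function.Bijective fun f : (KMod.quot A).obj M ⟶ (KMod.quot A).obj (canonicalLE Y n) =>
      f ≫ (KMod.quot A).map (subcomplexι Y (canonicalSub Y n) (canonicalSub_le Y n)) := by
  let ι := subcomplexι Y (canonicalSub Y n) (canonicalSub_le Y n)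
  have hι : ∀ {Z : ModuleCat.{u} A} (i : ℤ) (f g : Z ⟶ (canonicalLE Y n).X i),
      f ≫ ι.f i = g ≫ ι.f i → f = g := fun i f g h => by
    ext x
    exact Subtype.ext (ConcreteCategory.congr_hom h x)
  constructor
  · intro f g hfg
    obtain ⟨f, rfl⟩ := (KMod.quot A).map_surjective f
    obtain ⟨g, rfl⟩ := (KMod.quot A).map_surjective g
    dsimp only at hfg
    rw [← Functor.map_comp, ← Functor.map_comp] at hfg
    let h := homotopyOfEq _ _ hfg
    have hs : ∀ i j, ∃ s : M.X i ⟶ (canonicalLE Y n).X j, (j + 1 = i → s ≫ ι.f j = h.hom i j) ∧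
        (¬ j + 1 = i → s = 0) := by
      intro i j
      by_cases hij : j + 1 = i
      · by_cases hi : n ≤ i
        · exact ⟨0, fun _ => (hM i hi).eq_of_src _ _, fun h => (h hij).elim⟩
        · refine ⟨h.hom i j ≫ (canonicalLEXIso Y (by lia)).inv, fun _ => ?_,
            fun h => (h hij).elim⟩
          have : (canonicalLEXIso Y (show j < n by lia)).inv ≫ ι.f j = 𝟙 _ := rfl
          rw [Category.assoc, this, Category.comp_id]
      · exact ⟨0, fun h => (hij h).elim, fun _ => rfl⟩
    choose s hs hs' using hs
    refine eq_of_homotopy _ _ ⟨s, fun i j hij => hs' i j hij, fun i => hι i _ _ ?_⟩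
    have := h.comm i
    rw [dNext_eq _ (show (ComplexShape.up ℤ).Rel i (i + 1) from rfl),
      prevD_eq _ (show (ComplexShape.up ℤ).Rel (i - 1) i from by simp)] at this ⊢
    rw [Preadditive.add_comp, Preadditive.add_comp, Category.assoc, Category.assoc, hs _ _ rfl,
      ← ι.comm, ← Category.assoc (s _ _), hs _ _ (by lia)]
    exact this
  · intro f
    obtain ⟨f, rfl⟩ := (KMod.quot A).map_surjective f
    have hs : ∀ i, ∃ s : M.X i ⟶ (canonicalLE Y n).X i, s ≫ ι.f i = f.f i := by
      intro i
      by_cases hi : n ≤ i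
      · exact ⟨0, (hM i hi).eq_of_src _ _⟩
      · refine ⟨f.f i ≫ (canonicalLEXIso Y (by lia)).inv, ?_⟩
        have : (canonicalLEXIso Y (show i < n by lia)).inv ≫ ι.f i = 𝟙 _ := rfl
        rw [Category.assoc, this, Category.comp_id]
    choose s hs using hs
    refine ⟨(KMod.quot A).map ⟨s, fun i j _ => hι j _ _ ?_⟩, ?_⟩
    · rw [Category.assoc, Category.assoc, ← ι.comm, ← Category.assoc, hs, hs]
      exact f.comm i j
    · dsimp only
      rw [← Functor.map_comp]
      congr 1
      ext1 i
      exact hs i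

end Classes

/-! ### Dévissage for morphisms to the derived category -/

section Universal

set_option linter.unusedSectionVars false

open scoped ZeroObject

universe v' u'

variable {T : Type u} [Category.{v} T] [Preadditive T] [HasZeroObject T] [HasShift T ℤ]
  [∀ n : ℤ, (shiftFunctor T n).Additive] [Pretriangulated T]
  {T' : Type u'} [Category.{v'} T'] [Preadditive T'] [HasZeroObject T'] [HasShift T' ℤ]
  [∀ n : ℤ, (shiftFunctor T' n).Additive] [Pretriangulated T']
  (F : T ⥤ T') [F.CommShift ℤ] [F.IsTriangulated] {Y : T} {Y' : T'} (ε : F.obj Y ⟶ Y')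

/-- The objects `X` such that, for all shifts of `X`, morphisms `X ⟶ Y` correspond to morphisms
`F X ⟶ Y'` through the morphism `ε : F Y ⟶ Y'`. -/
def bijectiveOn : ObjectProperty T := fun X =>
  ∀ n : ℤ, Function.Bijective fun f : X⟦n⟧ ⟶ Y => F.map f ≫ ε

omit [HasZeroObject T] [∀ n : ℤ, (shiftFunctor T n).Additive] [Pretriangulated T]
  [HasZeroObject T'] [∀ n : ℤ, (shiftFunctor T' n).Additive] [Pretriangulated T']
  [F.CommShift ℤ] [F.IsTriangulated] [HasShift T ℤ] [HasShift T' ℤ] [Preadditive T]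
  [Preadditive T'] in
variable {F ε} in
lemma bijective_of_iso {X X' : T} (e : X ≅ X')
    (h : Function.Bijective fun f : X ⟶ Y => F.map f ≫ ε) :
    Function.Bijective fun f : X' ⟶ Y => F.map f ≫ ε := by
  have : (fun f : X' ⟶ Y => F.map f ≫ ε) = (((F.mapIso e).homFromEquiv (Z := Y')) ∘
      (fun f : X ⟶ Y => F.map f ≫ ε)) ∘ (e.homFromEquiv (Z := Y)).symm := by
    funext f
    simp
  rw [this]
  exact ((Equiv.bijective _).comp h).comp (Equiv.bijective _)

instance : (bijectiveOn F ε).IsClosedUnderIsomorphisms where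
  of_iso e h n := bijective_of_iso ((shiftFunctor T n).mapIso e) (h n)

variable {F ε} in
lemma bijectiveOn_iff_shift (X : T) (m : ℤ) : bijectiveOn F ε X → bijectiveOn F ε (X⟦m⟧) :=
  fun h n => bijective_of_iso ((shiftFunctorAdd T m n).app X) (h (m + n))

variable {F ε} in
lemma bijectiveOn.bijective {X : T} (h : bijectiveOn F ε X) :
    Function.Bijective fun f : X ⟶ Y => F.map f ≫ ε :=
  bijective_of_iso ((shiftFunctorZero T ℤ).app X) (h 0)

/-- The five lemma for the maps `Hom(X, Y) ⟶ Hom(F X, Y')`. -/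
lemma bijective_of_distinguished (D : Triangle T) (hD : D ∈ distTriang T)
    (h₁ : bijectiveOn F ε D.obj₁) (h₃ : bijectiveOn F ε D.obj₃) :
    Function.Bijective fun f : D.obj₂ ⟶ Y => F.map f ≫ ε := by
  have hFD := F.map_distinguished D hD
  have z₁₂ : F.map D.mor₁ ≫ F.map D.mor₂ = 0 := by
    rw [← F.map_comp, comp_distTriang_mor_zero₁₂ D hD, F.map_zero]
  constructor
  · have : ∀ f : D.obj₂ ⟶ Y, F.map f ≫ ε = 0 → f = 0 := by
      intro f hf
      obtain ⟨g, rfl⟩ := Triangle.yoneda_exact₂ D hD f (h₁.bijective.1 (by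
        simp only [F.map_comp, Category.assoc, hf, F.map_zero, zero_comp, comp_zero]))
      obtain ⟨k, hk⟩ := Triangle.yoneda_exact₃ _ hFD (F.map g ≫ ε) (by
        change F.map D.mor₂ ≫ F.map g ≫ ε = 0
        rwa [F.map_comp, Category.assoc] at hf)
      replace hk : F.map g ≫ ε =
        (F.map D.mor₃ ≫ (F.commShiftIso (1 : ℤ)).hom.app D.obj₁) ≫ k := hk
      obtain ⟨l, hl⟩ := (h₁ 1).2 ((F.commShiftIso (1 : ℤ)).hom.app D.obj₁ ≫ k)
      have : g = D.mor₃ ≫ l := h₃.bijective.1 (by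
        dsimp only at hl ⊢
        rw [hk, F.map_comp, Category.assoc, hl]
        exact Category.assoc _ _ _)
      rw [this, comp_distTriang_mor_zero₂₃_assoc D hD, zero_comp]
    intro f g h
    rw [← sub_eq_zero]
    apply this
    rw [F.map_sub, Preadditive.sub_comp, sub_eq_zero]
    exact h
  · intro h
    obtain ⟨a, ha⟩ := h₁.bijective.2 (F.map D.mor₁ ≫ h)
    dsimp only at ha
    have hD' := inv_rot_of_distTriang D hD
    let z : D.obj₃⟦(-1 : ℤ)⟧ ⟶ D.obj₁ := D.invRotate.mor₁
    have hz : z ≫ D.mor₁ = 0 := comp_distTriang_mor_zero₁₂ _ hD'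
    have hza : z ≫ a = 0 := (h₃ (-1)).1 (by
      dsimp only
      rw [F.map_comp, Category.assoc, ha, ← Category.assoc, ← F.map_comp, hz, F.map_zero,
        zero_comp, F.map_zero, zero_comp])
    obtain ⟨b, hb'⟩ : ∃ b : D.obj₂ ⟶ Y, a = D.mor₁ ≫ b :=
      Triangle.yoneda_exact₂ D.invRotate hD' a hza
    obtain ⟨k, hk⟩ := Triangle.yoneda_exact₂ _ hFD (h - F.map b ≫ ε) (by
      change F.map D.mor₁ ≫ _ = 0
      rw [Preadditive.comp_sub, ← ha, hb', F.map_comp, Category.assoc, sub_self])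
    obtain ⟨c, hc⟩ := h₃.bijective.2 k
    refine ⟨b + D.mor₂ ≫ c, ?_⟩
    have hk' : h - F.map b ≫ ε = F.map D.mor₂ ≫ k := hk
    dsimp only at hc ⊢
    rw [F.map_add, Preadditive.add_comp, F.map_comp, Category.assoc, hc, ← hk', add_sub_cancel]

instance : (bijectiveOn F ε).IsTriangulated where
  exists_zero := ⟨0, isZero_zero _, fun n => by
    have h1 : IsZero ((0 : T)⟦n⟧) := Functor.map_isZero _ (isZero_zero _)
    have h2 := F.map_isZero h1
    exact ⟨fun f g _ => h1.eq_of_src _ _, fun f => ⟨0, h2.eq_of_src _ _⟩⟩⟩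
  isStableUnderShiftBy m := ⟨fun X h => bijectiveOn_iff_shift X m h⟩
  toIsTriangulatedClosed₂ := .mk' fun D hD h₁ h₃ n =>
    bijective_of_distinguished F ε _ (Triangle.shift_distinguished D hD n)
      (bijectiveOn_iff_shift _ n h₁) (bijectiveOn_iff_shift _ n h₃)

lemma bijectiveOn_coproduct (J : Type v) [PreservesColimitsOfShape (Discrete J) F] (X : J → T)
    (c : Cofan X) (hc : IsColimit c) (h : ∀ j, bijectiveOn F ε (X j)) :
    bijectiveOn F ε c.pt := by
  intro n
  have hc₁ : IsColimit (Cofan.mk (c.pt⟦n⟧) fun j => (c.inj j)⟦n⟧') :=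
    Cofan.isColimitMapCoconeEquiv (shiftFunctor T n) X c (isColimitOfPreserves _ hc)
  have hc₂ : IsColimit (Cofan.mk (F.obj (c.pt⟦n⟧)) fun j => F.map ((c.inj j)⟦n⟧')) :=
    Cofan.isColimitMapCoconeEquiv F _ _ (isColimitOfPreserves F hc₁)
  constructor
  · intro f g hfg
    refine Cofan.IsColimit.hom_ext hc₁ _ _ fun j => (h j n).1 ?_
    have := congrArg (fun φ => F.map ((c.inj j)⟦n⟧') ≫ φ) hfg
    simpa using this
  · intro f
    choose g hg using fun j => (h j n).2 (F.map ((c.inj j)⟦n⟧') ≫ f)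
    refine ⟨Cofan.IsColimit.desc hc₁ g, Cofan.IsColimit.hom_ext hc₂ _ _ fun j => ?_⟩
    have h1 : (c.inj j)⟦n⟧' ≫ Cofan.IsColimit.desc hc₁ g = g j := Cofan.IsColimit.fac hc₁ g j
    change F.map ((c.inj j)⟦n⟧') ≫ F.map _ ≫ ε = F.map ((c.inj j)⟦n⟧') ≫ f
    rw [← hg, ← Category.assoc, ← F.map_comp, h1]

/-- The objects `X` such that `Hom(X⟦n⟧, Y) ⟶ Hom(F (X⟦n⟧), Y')` is bijective for all `n` form a
localising subcategory, so that the bijectivity can be checked on generators. -/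
lemma isLocalising_bijectiveOn [∀ J : Type v, PreservesColimitsOfShape (Discrete J) F] :
    IsLocalising (bijectiveOn F ε) where
  isClosedUnderIsomorphisms := inferInstance
  isTriangulated := inferInstance
  coproducts J X c hc h := bijectiveOn_coproduct F ε J X c hc h

end Universal

section Derived

open HomotopyCategory
open scoped ZeroObject

variable {R : Type u} [CommRing R] {A : Type u} [Ring A] [Algebra R A]

lemma exactAt_res {Z : CochainComplex (ModuleCat.{u} A) ℤ} {i : ℤ} (h : Z.ExactAt i) :
    (((resMod R A).mapHomologicalComplex (.up ℤ)).obj Z).ExactAt i := by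
  rw [HomologicalComplex.exactAt_iff' _ (i - 1) i (i + 1) (by simp) (by simp)] at h ⊢
  rw [ShortComplex.moduleCat_exact_iff] at h ⊢
  exact h

/-- An acyclic complex whose restriction to `R` is K-projective is `R`-contractible. -/
lemma rContractible_of_acyclic {Z : KMod A} (hZ : subcategoryAcyclic _ Z)
    (h : (subcategoryAcyclic _).leftOrthogonal ((resK R A).obj Z)) : rContractible R A Z := by
  refine (IsZero.iff_id_eq_zero _).2 (h _ ?_)
  obtain ⟨Z, rfl⟩ := Z.quotient_obj_surjective
  rw [quotient_obj_mem_subcategoryAcyclic_iff_exactAt] at hZ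
  exact (quotient_obj_mem_subcategoryAcyclic_iff_exactAt
    (((resMod R A).mapHomologicalComplex (.up ℤ)).obj Z)).2 fun i => exactAt_res (hZ i)

lemma proj_iff_projective (M : ModuleCat.{u} A) : proj A M ↔ Projective M :=
  IsProjective.iff_projective (R := A) M

lemma leftOrthogonal_of_proj {Z : CochainComplex (ModuleCat.{u} R) ℤ} (d : ℤ)
    (hd : ∀ i, d < i → IsZero (Z.X i)) (h : ∀ i, proj R (Z.X i)) :
    (subcategoryAcyclic _).leftOrthogonal ((KMod.quot R).obj Z) := by
  have : Z.IsStrictlyLE d := (Z.isStrictlyLE_iff d).2 fun i hi => hd i hi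
  have : ∀ n, Projective (Z.X n) := fun n => (proj_iff_projective _).1 (h n)
  have := CochainComplex.isKProjective_of_projective Z d
  exact CochainComplex.IsKProjective.leftOrthogonal Z

/-- Bounded complexes of projective modules are K-projective. -/
lemma Kbp_le_leftOrthogonal : Kbp R ≤ (subcategoryAcyclic _).leftOrthogonal := by
  rintro X ⟨Y, ⟨h1, N, hN⟩, ⟨e⟩⟩
  exact ObjectProperty.prop_of_iso _ e.symm
    (leftOrthogonal_of_proj (Z := Y.as) N (fun i hi => hN i (by grind)) h1)

/-- The morphisms inverted in the derived category are those with acyclic cone. -/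
lemma isIso_Qh_iff [HasDerivedCategory.{w} (ModuleCat.{u} A)] {X Y : KMod A} (f : X ⟶ Y) :
    IsIso (DerivedCategory.Qh.map f) ↔ (subcategoryAcyclic (ModuleCat.{u} A)).trW f := by
  obtain ⟨X, rfl⟩ := X.quotient_obj_surjective
  obtain ⟨Y, rfl⟩ := Y.quotient_obj_surjective
  obtain ⟨f, rfl⟩ := (KMod.quot A).map_surjective f
  rw [← quasiIso_eq_trW_subcategoryAcyclic, quotient_map_mem_quasiIso_iff,
    HomologicalComplex.mem_quasiIso_iff, ← DerivedCategory.isIso_Q_map_iff_quasiIso]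
  exact (NatIso.isIso_map_iff (DerivedCategory.quotientCompQhIso _) f)

lemma rContractible_le_acyclic : rContractible R A ≤ subcategoryAcyclic _ := by
  intro X hX
  obtain ⟨X, rfl⟩ := X.quotient_obj_surjective
  rw [quotient_obj_mem_subcategoryAcyclic_iff_exactAt]
  intro i
  have h1 : subcategoryAcyclic _ ((KMod.quot R).obj
      (((resMod R A).mapHomologicalComplex (.up ℤ)).obj X)) :=
    ObjectProperty.prop_of_isZero _ hX
  rw [quotient_obj_mem_subcategoryAcyclic_iff_exactAt] at h1
  have h := h1 i
  rw [HomologicalComplex.exactAt_iff' _ (i - 1) i (i + 1) (by simp) (by simp)] at h ⊢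
  rw [ShortComplex.moduleCat_exact_iff] at h ⊢
  exact h

lemma isIso_Qh_of_rContractible [HasDerivedCategory.{w} (ModuleCat.{u} A)] {X Y : KMod A}
    {f : X ⟶ Y} (hf : (rContractible R A).trW f) : IsIso (DerivedCategory.Qh.map f) :=
  (isIso_Qh_iff f).2 (ObjectProperty.trW_monotone rContractible_le_acyclic _ hf)

lemma single_modProj (P : ObjectProperty (ModuleCat.{u} A)) [P.IsClosedUnderIsomorphisms]
    (h0 : P 0) {M : ModuleCat.{u} A} (hM : P M) (n i : ℤ) :
    P (((HomologicalComplex.single _ (.up ℤ) n).obj M).X i) := by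
  by_cases h : i = n
  · subst h
    exact P.prop_of_iso (HomologicalComplex.singleObjXSelf (.up ℤ) i M).symm hM
  · exact P.prop_of_iso (IsZero.iso (isZero_zero _)
      (HomologicalComplex.isZero_single_obj_X _ _ _ _ h)) h0

lemma biprod_modProj (X Y : ModuleCat.{u} A) (hX : modProj R A X) (hY : modProj R A Y) :
    modProj R A (X ⊞ Y) := by
  let F := ModuleCat.restrictScalars.{u} (algebraMap R A)
  have : PreservesBinaryBiproduct X Y F := preservesBinaryBiproduct_of_preservesBiproduct F X Y
  have e : F.obj (X ⊞ Y) ≃ₗ[R] F.obj X × F.obj Y :=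
    (F.mapBiprod X Y ≪≫ ModuleCat.biprodIsoProd _ _).toLinearEquiv
  have : Module.Projective R (F.obj X) := hX
  have : Module.Projective R (F.obj Y) := hY
  exact (Module.Projective.of_equiv e.symm : Module.Projective R _)

/-- A module that is projective over `R` has a K-projective resolution that is an `R`-homotopy
equivalence. -/
lemma exists_resolution_single [Module.Projective R A] {M : ModuleCat.{u} A} (hM : modProj R A M) :
    ∃ (P : KMod A) (s : P ⟶ (KMod.quot A).obj ((HomologicalComplex.single _ (.up ℤ) 0).obj M)),
      (subcategoryAcyclic _).leftOrthogonal P ∧ (rContractible R A).trW s := by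
  let ρ := projectiveResolution M
  let X := ρ.cochainComplex
  have hX : X.IsKProjective := CochainComplex.isKProjective_of_projective _ 0
  refine ⟨(KMod.quot A).obj X, (KMod.quot A).map ρ.π', CochainComplex.IsKProjective.leftOrthogonal X,
    _, _, _, mappingCone_triangleh_distinguished ρ.π', ?_⟩
  have hq : QuasiIso ρ.π' := inferInstance
  refine rContractible_of_acyclic ?_ ?_
  · have h1 : (HomotopyCategory.quasiIso (ModuleCat.{u} A) (.up ℤ)) ((KMod.quot A).map ρ.π') := by
      rwa [quotient_map_mem_quasiIso_iff, HomologicalComplex.mem_quasiIso_iff]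
    rw [quasiIso_eq_trW_subcategoryAcyclic] at h1
    exact ((subcategoryAcyclic _).trW_iff_of_distinguished _
      (mappingCone_triangleh_distinguished ρ.π')).1 h1
  · refine leftOrthogonal_of_proj (Z := ((resMod R A).mapHomologicalComplex (.up ℤ)).obj
      (CochainComplex.mappingCone ρ.π')) 0 (fun i hi => (resMod R A).map_isZero
        ((CochainComplex.mappingCone.isZero_X_iff ρ.π' i).2 ⟨?_, ?_⟩)) fun i => ?_
    · exact X.isZero_of_isStrictlyLE 0 _ (by lia)
    · exact HomologicalComplex.isZero_single_obj_X _ _ _ _ (by lia)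
    · have := HomologicalComplex.HasHomotopyCofiber.hasBinaryBiproduct ρ.π' i (i + 1) rfl
      refine (modProj R A).prop_of_iso
        (HomologicalComplex.homotopyCofiber.XIsoBiprod ρ.π' i (i + 1) rfl).symm
        (biprod_modProj _ _ (modProj_of_proj ((proj_iff_projective _).2 (inferInstance : Projective (X.X (i + 1))))) ?_)
      exact single_modProj (modProj R A) modProj_zero hM 0 i

/-- For a bounded complex `M` of `R`-projective modules and a bounded below complex `I` of
relatively injective modules, morphisms `M ⟶ I` in the homotopy and derived categories agree. -/
lemma bijective_Qh_map [HasDerivedCategory.{w} (ModuleCat.{u} A)] [Module.Projective R A]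
    {M I : KMod A} (hM : (termwise (modProj R A) ⊓ bounded _) M)
    (hI : (termRelInj R A ⊓ boundedBelow _) I) :
    Function.Bijective (DerivedCategory.Qh.map : (M ⟶ I) → _) := by
  let Q := bijectiveOn (DerivedCategory.Qh (C := ModuleCat.{u} A)) (𝟙 (DerivedCategory.Qh.obj I))
  have h0 : ∀ {X : KMod A}, Q X → Function.Bijective (DerivedCategory.Qh.map : (X ⟶ I) → _) :=
    fun h => by simpa using h.bijective
  refine h0 (bounded_induction (modProj R A) modProj_zero Q ?_ M hM)
  intro N hN n
  have h1 : Q ((KMod.quot A).obj ((HomologicalComplex.single _ (.up ℤ) 0).obj N)) := by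
    intro m
    obtain ⟨P, s, hP, hs⟩ := exists_resolution_single hN
    have hs' := ObjectProperty.trW.shift hs m
    have hP' := ObjectProperty.le_shift _ m _ hP
    have hI' := rContractible_rightOrthogonal hI
    rw [← ObjectProperty.isLocal_trW] at hI'
    have := isIso_Qh_of_rContractible (R := R) hs'
    have e1 := hP'.map_bijective_of_isTriangulated (DerivedCategory.Qh (C := ModuleCat.{u} A)) I
    have e2 := hI' _ hs'
    simp only [Category.comp_id]
    refine (Function.Bijective.of_comp_iff' (Iso.homFromEquiv
      (asIso (DerivedCategory.Qh.map (s⟦m⟧'))).symm (Z := DerivedCategory.Qh.obj I)).bijective _).1 ?_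
    convert! e1.comp e2 using 1
    funext f
    simp
  have := ObjectProperty.le_shift Q (-n) _ h1
  refine Q.prop_of_iso ?_ this
  exact ((KMod.quot A).commShiftIso (-n)).symm.app _ ≪≫ (KMod.quot A).mapIso
    (((CochainComplex.singleFunctors (ModuleCat.{u} A)).shiftIso (-n) n 0 (by lia)).app N)

end Derived

/-! ### Coresolutions and the bounded derived category -/

section Splice

variable {A : Type u} [Ring A] (Z D : ℤ → ModuleCat.{u} A) (j : ∀ i, Z i ⟶ D i)
  (p : ∀ i, D i ⟶ Z (i + 1)) (h : ∀ i, j i ≫ p i = 0)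

/-- The complex spliced from sequences `Z i ⟶ D i ⟶ Z (i + 1)`. -/
noncomputable def splice : CochainComplex (ModuleCat.{u} A) ℤ :=
  CochainComplex.of D (fun i => p i ≫ j (i + 1)) fun i => by
    rw [Category.assoc, reassoc_of% (h (i + 1)), zero_comp, comp_zero]

lemma splice_d (i : ℤ) : (splice Z D j p h).d i (i + 1) = p i ≫ j (i + 1) :=
  CochainComplex.of_d D (fun i => p i ≫ j (i + 1)) i

variable (hj : ∀ i, Function.Injective (j i)) (hp : ∀ i, Function.Surjective (p i))
  (hex : ∀ i x, p i x = 0 → ∃ y, j i y = x)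

include hj in
lemma splice_d_apply_eq_zero {i : ℤ} {x : D i} :
    (splice Z D j p h).d i (i + 1) x = 0 ↔ p i x = 0 := by
  rw [splice_d]
  refine ⟨fun hx => hj _ (hx.trans (map_zero (j (i + 1)).hom).symm), fun hx => ?_⟩
  change (j (i + 1)) (p i x) = 0
  rw [hx, map_zero]

include hj hp hex in
lemma exactAt_splice (i : ℤ) : (splice Z D j p h).ExactAt i := by
  obtain ⟨i, rfl⟩ : ∃ k, k + 1 = i := ⟨i - 1, by lia⟩
  rw [HomologicalComplex.exactAt_iff' _ i (i + 1) (i + 1 + 1) (by simp) (by simp),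
    ShortComplex.moduleCat_exact_iff]
  intro x hx
  obtain ⟨y, hy⟩ := hex (i + 1) x ((splice_d_apply_eq_zero Z D j p h hj).1 hx)
  obtain ⟨z, hz⟩ := hp i y
  refine ⟨z, ?_⟩
  change (splice Z D j p h).d i (i + 1) z = x
  rw [splice_d]
  change j (i + 1) (p i z) = x
  rw [hz, hy]

include hj hex in
lemma nonempty_cycles_splice_iso (i : ℤ) :
    Nonempty (Z i ≅ ModuleCat.of A (LinearMap.ker ((splice Z D j p h).d i (i + 1)).hom)) := by
  let f : Z i →ₗ[A] LinearMap.ker ((splice Z D j p h).d i (i + 1)).hom :=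
    LinearMap.codRestrict _ (j i).hom fun x => (splice_d_apply_eq_zero Z D j p h hj).2
      (ConcreteCategory.congr_hom (h i) x)
  refine ⟨(LinearEquiv.ofBijective f ⟨fun x y hxy => hj i (congrArg Subtype.val hxy), fun x => ?_⟩).toModuleIso⟩
  obtain ⟨y, hy⟩ := hex i x.1 ((splice_d_apply_eq_zero Z D j p h hj).1 x.2)
  exact ⟨y, Subtype.ext hy⟩

end Splice

section Coresolution

open scoped ZeroObject

variable {R : Type u} [CommRing R] {A : Type u} [Ring A] [Algebra R A]

variable (R) in
/-- The cokernel of the embedding of `M` in its coinduced module. -/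
noncomputable def cosyzygy (M : ModuleCat.{u} A) : ModuleCat.{u} A :=
  ModuleCat.of A ((coindMod R A).obj ((resMod R A).obj M) ⧸ LinearMap.range (toCoind (R := R) M).hom)

/-- The projection of the coinduced module to the cosyzygy. -/
noncomputable def toCosyzygy (M : ModuleCat.{u} A) :
    (coindMod R A).obj ((resMod R A).obj M) ⟶ cosyzygy R M :=
  ModuleCat.ofHom (Submodule.mkQ _)

lemma toCoind_injective (M : ModuleCat.{u} A) : Function.Injective (toCoind (R := R) M) := by
  have h := (resCoindAdj R A).left_triangle_components M
  intro x y hxy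
  have h1 : ∀ z, (resCoindAdj R A).counit.app ((resMod R A).obj M)
    ((resMod R A).map (toCoind (R := R) M) z) = z := fun z => ConcreteCategory.congr_hom h z
  exact (h1 x).symm.trans ((congrArg ((resCoindAdj R A).counit.app ((resMod R A).obj M)) hxy).trans
    (h1 y))

lemma toCoind_toCosyzygy (M : ModuleCat.{u} A) : toCoind (R := R) M ≫ toCosyzygy M = 0 := by
  ext x
  exact (Submodule.Quotient.mk_eq_zero _).2 ⟨x, rfl⟩

lemma exists_of_toCosyzygy_eq_zero {M : ModuleCat.{u} A}
    (x : (coindMod R A).obj ((resMod R A).obj M)) (h : toCosyzygy M x = 0) :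
    ∃ y, toCoind (R := R) M y = x :=
  (Submodule.Quotient.mk_eq_zero _).1 h

/-- Cosyzygies stay in `mod(A, R)`, since the embedding in the coinduced module splits over `R`. -/
lemma IsFrobenius.modFinProj_cosyzygy (hA : IsFrobenius R A) {M : ModuleCat.{u} A}
    (hM : modFinProj R A M) : modFinProj R A (cosyzygy R M) := by
  have := hA.finite
  have := hA.projective
  have h1 := modFinProj_of_finProj (R := R) (hA.finProj_coind hM)
  have hsurj : Function.Surjective (toCosyzygy (R := R) M) := Submodule.mkQ_surjective _
  refine ⟨?_, modProj_of_retract (R := R) h1.2 ?_⟩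
  · have := h1.1
    exact Module.Finite.of_surjective ((resMod R A).map (toCosyzygy (R := R) M)).hom hsurj
  · let S : ShortComplex (ModuleCat.{u} R) := .mk ((resMod R A).map (toCoind (R := R) M))
      ((resMod R A).map (toCosyzygy M)) (by
        rw [← Functor.map_comp, toCoind_toCosyzygy, Functor.map_zero])
    have hS : S.Exact := (ShortComplex.moduleCat_exact_iff _).2 exists_of_toCosyzygy_eq_zero
    have : Epi S.g := (ModuleCat.epi_iff_surjective _).2 hsurj
    let s := ShortComplex.Splitting.ofExactOfRetraction S hS
      ((resCoindAdj R A).counit.app ((resMod R A).obj M))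
      ((resCoindAdj R A).left_triangle_components M) this
    exact ⟨s.s, S.g, s.s_g⟩

variable (R) in
/-- The iterated cosyzygies. -/
noncomputable def cosyzygies (M : ModuleCat.{u} A) : ℕ → ModuleCat.{u} A
  | 0 => M
  | n + 1 => cosyzygy R (cosyzygies M n)

variable (R) in
/-- The cocycles of the coresolution of `M`. -/
noncomputable def coresZ (M : ModuleCat.{u} A) : ℤ → ModuleCat.{u} A
  | Int.ofNat n => cosyzygies R M n
  | Int.negSucc _ => 0

variable (R) in
/-- The terms of the complex `0 ⟶ M ⟶ coind M ⟶ …`, with `M` in degree `-1`. -/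
noncomputable def coresD (M : ModuleCat.{u} A) : ℤ → ModuleCat.{u} A
  | Int.ofNat n => (coindMod R A).obj ((resMod R A).obj (cosyzygies R M n))
  | Int.negSucc 0 => M
  | Int.negSucc (_ + 1) => 0

/-- The embeddings of the cocycles in the terms of the coresolution. -/
noncomputable def coresJ (M : ModuleCat.{u} A) : ∀ i, coresZ R M i ⟶ coresD R M i
  | Int.ofNat n => toCoind (cosyzygies R M n)
  | Int.negSucc _ => 0

/-- The projections of the terms of the coresolution to the next cocycles. -/
noncomputable def coresP (M : ModuleCat.{u} A) : ∀ i, coresD R M i ⟶ coresZ R M (i + 1)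
  | Int.ofNat n => toCosyzygy (cosyzygies R M n)
  | Int.negSucc 0 => 𝟙 M
  | Int.negSucc (_ + 1) => 0

lemma coresJ_P (M : ModuleCat.{u} A) : ∀ i, coresJ (R := R) M i ≫ coresP M i = 0
  | Int.ofNat n => toCoind_toCosyzygy (cosyzygies R M n)
  | Int.negSucc _ => zero_comp

/-- A coresolution of `M` by coinduced modules, augmented by `M` in degree `-1`. -/
noncomputable def cores (R : Type u) [CommRing R] {A : Type u} [Ring A] [Algebra R A]
    (M : ModuleCat.{u} A) : CochainComplex (ModuleCat.{u} A) ℤ :=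
  splice (coresZ R M) (coresD R M) (coresJ M) (coresP M) (coresJ_P M)

lemma coresJ_injective (M : ModuleCat.{u} A) : ∀ i, Function.Injective (coresJ (R := R) M i)
  | Int.ofNat n => toCoind_injective (cosyzygies R M n)
  | Int.negSucc _ => fun _ _ _ => (ModuleCat.subsingleton_of_isZero (isZero_zero _)).elim _ _

lemma coresP_surjective (M : ModuleCat.{u} A) : ∀ i, Function.Surjective (coresP (R := R) M i)
  | Int.ofNat n => Submodule.mkQ_surjective _
  | Int.negSucc 0 => fun x => ⟨x, rfl⟩
  | Int.negSucc (n + 1) => fun _ => ⟨0, by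
      have : Subsingleton (coresZ R M (Int.negSucc (n + 1) + 1)) :=
        ModuleCat.subsingleton_of_isZero (isZero_zero _)
      exact this.elim _ _⟩

lemma cores_exact (M : ModuleCat.{u} A) : ∀ i x, coresP (R := R) M i x = 0 →
    ∃ y, coresJ (R := R) M i y = x
  | Int.ofNat _ => exists_of_toCosyzygy_eq_zero
  | Int.negSucc 0 => fun x hx => ⟨0, ((map_zero (coresJ (R := R) M (Int.negSucc 0)).hom)).trans hx.symm⟩
  | Int.negSucc (n + 1) => fun x _ => ⟨0, (by
      have : Subsingleton (coresD R M (Int.negSucc (n + 1))) :=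
        ModuleCat.subsingleton_of_isZero (isZero_zero _)
      exact this.elim _ _)⟩

lemma isZero_cores (M : ModuleCat.{u} A) (i : ℤ) (hi : i < -1) : IsZero ((cores R M).X i) := by
  obtain ⟨n, rfl⟩ : ∃ n : ℕ, i = Int.negSucc (n + 1) := ⟨(- i - 2).toNat, by lia⟩
  exact isZero_zero _

variable (hA : IsFrobenius R A) {M : ModuleCat.{u} A} (hM : modFinProj R A M)
include hA hM

lemma IsFrobenius.modFinProj_cosyzygies : ∀ n, modFinProj R A (cosyzygies R M n)
  | 0 => hM
  | n + 1 => hA.modFinProj_cosyzygy (modFinProj_cosyzygies n)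

lemma IsFrobenius.rContractible_cores : rContractible R A ((KMod.quot A).obj (cores R M)) := by
  refine rContractible_of_exact (-1) (isZero_cores M)
    (exactAt_splice _ _ _ _ _ (coresJ_injective M) (coresP_surjective M) (cores_exact M))
    fun i => (modProj R A).prop_of_iso (nonempty_cycles_splice_iso _ _ _ _ (coresJ_P M)
      (coresJ_injective M) (cores_exact M) i).some ?_
  match i with
  | Int.ofNat n => exact (hA.modFinProj_cosyzygies hM n).2
  | Int.negSucc n => exact modProj_zero

lemma IsFrobenius.finProj_cores (i : ℤ) (hi : -1 < i) : finProj A ((cores R M).X i) := by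
  obtain ⟨n, rfl⟩ : ∃ n : ℕ, i = Int.ofNat n := ⟨i.toNat, by simp; lia⟩
  exact hA.finProj_coind (hA.modFinProj_cosyzygies hM n)

end Coresolution

section Truncation

open scoped ZeroObject

lemma bijective_of_eq {α β : Type*} {f g : α → β} (hf : Function.Bijective f)
    (h : ∀ x, f x = g x) : Function.Bijective g :=
  (funext h : f = g) ▸ hf

variable {R : Type u} [CommRing R] {A : Type u} [Ring A] [Algebra R A]

/-- Objects of `Kpb R A` are represented by the complexes that define `K^{+,b}(proj A)`. -/
lemma exists_complex_of_Kpb [Module.Projective R A] {X : KMod A} (hX : Kpb R A X) :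
    ∃ Y : CochainComplex (ModuleCat.{u} A) ℤ, (∀ n, finProj A (Y.X n)) ∧
    (∃ N : ℤ, ∀ n < N, IsZero (Y.X n)) ∧ (∃ N : ℤ, ∀ n > N, AcyclicAt (modProj R A) Y n) ∧
    Nonempty (X ≅ (KMod.quot A).obj Y) := by
  obtain ⟨⟨Y, ⟨hY, hb⟩, ⟨e⟩⟩, M, ⟨_, hM⟩, ⟨e'⟩⟩ := hX
  refine ⟨Y.as, hY, hb, acyclicAt_of_retract (fun n => modProj_of_proj (hY n).2) hM
    (Iso.retract ?_), ⟨e⟩⟩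
  exact (resK R A).mapIso e.symm ≪≫ e'

/-- Objects of `K^{+,b}(proj A)` are `R`-homotopy equivalent to bounded complexes in `mod(A, R)`,
by canonical truncation in high degrees. -/
lemma exists_truncation [Module.Finite R A] [Module.Projective R A] {X : KMod A} (hX : Kpb R A X)
    (n : ℤ) : ∃ (T : KMod A) (s : T ⟶ X), KbModProp R A T ∧ (rContractible R A).trW s ∧
      ∀ M : CochainComplex (ModuleCat.{u} A) ℤ, (∀ i ≥ n, IsZero (M.X i)) →
        Function.Bijective fun f : (KMod.quot A).obj M ⟶ T => f ≫ s := by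
  obtain ⟨Y, hY, ⟨N₁, hN₁⟩, ⟨N₂, hN₂⟩, ⟨e⟩⟩ := exists_complex_of_Kpb hX
  -- `Y` is acyclic in degrees `≥ m`, and `τ^{≤ m} Y` agrees with `Y` in degrees `< n`
  let m := max n (N₂ + 1)
  let ι := subcomplexι Y (canonicalSub Y m) (canonicalSub_le Y m)
  have hY' : ∀ n, modFinProj R A (Y.X n) := fun n => modFinProj_of_finProj (hY n)
  refine ⟨(KMod.quot A).obj (canonicalLE Y m), (KMod.quot A).map ι ≫ e.inv,
    ⟨modFinProj_canonicalLE hY' fun i hi => hN₂ i (by grind), ?_⟩, ?_, fun M hM => ?_⟩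
  · refine ⟨N₁.natAbs + m.natAbs, fun i hi => ?_⟩
    obtain h | h : m < i ∨ (i < m ∧ i < N₁) := by push_cast at hi; grind
    · exact isZero_canonicalLE Y h
    · exact (hN₁ i h.2).of_iso (canonicalLEXIso Y h.1)
  · have h1 := rContractible_trW_canonicalLE (R := R) (n := m) (fun n => (hY' n).2)
      fun i hi => hN₂ i (by grind)
    rw [rContractible_trW_iff] at h1 ⊢
    rw [Functor.map_comp]
    infer_instance
  · have h1 := bijective_comp_canonicalLE (Y := Y) (n := m) (M := M) fun i hi => hM i (by grind)
    exact bijective_of_eq ((e.symm.homToEquiv (Z := (KMod.quot A).obj M)).bijective.comp h1)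
      fun f => by simp [ι]

/-- An object of `K(Proj A)` is in `K^{+,b}(proj A)` if and only if it is homotopy equivalent to a
bounded below complex of finitely generated projective modules, and over `R` to a bounded complex
of projective modules. The second description visibly defines a triangulated subcategory. -/
lemma kPlusB_iff [Module.Finite R A] [Module.Projective R A] (X : KProj A) :
    KPlusB R A X ↔ Kpb R A X.obj := by
  refine ⟨?_, exists_complex_of_Kpb⟩
  rintro ⟨Y, hY, hb, ⟨N, hN⟩, ⟨e⟩⟩
  have hY' : ∀ n, modFinProj R A (Y.X n) := fun n => modFinProj_of_finProj (hY n)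
  refine ObjectProperty.prop_of_iso _ e.symm ⟨⟨_, ⟨hY, hb⟩, ⟨Iso.refl _⟩⟩, ?_⟩
  have h1 := rContractible_trW_canonicalLE (R := R) (n := N + 1) (fun n => (hY' n).2)
      fun i hi => hN i (by grind)
  rw [rContractible_trW_iff] at h1
  change Kbp R ((resK R A).obj ((KMod.quot A).obj Y))
  refine ObjectProperty.prop_of_iso _ (asIso ((resK R A).map ((KMod.quot A).map
    (subcomplexι Y (canonicalSub Y (N + 1)) (canonicalSub_le Y (N + 1)))))) ?_
  have h2 := modFinProj_canonicalLE hY' (n := N + 1) fun i hi => hN i (by grind)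
  refine ⟨(KMod.quot R).obj (((resMod R A).mapHomologicalComplex (.up ℤ)).obj
    (canonicalLE Y (N + 1))), ⟨fun i => (h2 i).2, ?_⟩, ⟨Iso.refl _⟩⟩
  obtain ⟨N₁, hN₁⟩ := hb
  refine ⟨N₁.natAbs + (N + 1).natAbs, fun i hi => (resMod R A).map_isZero ?_⟩
  obtain h | h : N + 1 < i ∨ (i < N + 1 ∧ i < N₁) := by push_cast at hi; grind
  · exact isZero_canonicalLE Y h
  · exact (hN₁ i h.2).of_iso (canonicalLEXIso Y h.1)

variable [HasDerivedCategory.{w} (ModuleCat.{u} A)]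

lemma IsFrobenius.bijective_Qh_map_of_Kplus (hA : IsFrobenius R A) {M I : KMod A}
    (hM : KbModProp R A M) (hI : Kplus A I) :
    Function.Bijective (DerivedCategory.Qh.map : (M ⟶ I) → _) := by
  have := hA.projective
  obtain ⟨J, ⟨hJ, hb⟩, ⟨e⟩⟩ := hI
  have h1 := bijective_Qh_map (M := M) (I := J) ⟨fun n => (hM.1 n).2, hM.2⟩
    ⟨hA.termRelInj fun n => (hJ n).2, hb⟩
  refine bijective_of_eq (((DerivedCategory.Qh.mapIso e.symm).homToEquiv
    (Z := DerivedCategory.Qh.obj M)).bijective.comp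
    (h1.comp (e.homToEquiv (Z := M)).bijective)) fun f => ?_
  simp [← Functor.map_comp]

omit [HasDerivedCategory.{w} (ModuleCat.{u} A)] in
lemma Kplus_le_boundedBelow : Kplus A ≤ (boundedBelow _).isoClosure :=
  ObjectProperty.monotone_isoClosure inf_le_right

omit [HasDerivedCategory.{w} (ModuleCat.{u} A)] in
/-- `bijective_precomp_of_rContractiblePlus` for objects homotopy equivalent to bounded below
complexes of finitely generated projective modules. -/
lemma IsFrobenius.bijective_precomp_of_Kplus (hA : IsFrobenius R A) {X X' Y : KMod A} {s : X ⟶ X'}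
    (hs : (rContractiblePlus R A).trW s) (hY : Kplus A Y) :
    Function.Bijective fun f : X' ⟶ Y => s ≫ f := by
  obtain ⟨J, ⟨hJ, hb⟩, ⟨e⟩⟩ := hY
  have h1 := bijective_precomp_of_rContractiblePlus hs (hA.termRelInj fun n => (hJ n).2)
  refine bijective_of_eq ((e.symm.homToEquiv (Z := X)).bijective.comp
    (h1.comp (e.homToEquiv (Z := X')).bijective)) fun f => ?_
  simp

omit [HasDerivedCategory.{w} (ModuleCat.{u} A)] in
lemma rContractiblePlus_trW_of_Kpb {T X : KMod A} {s : T ⟶ X} (hs : (rContractible R A).trW s)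
    (hT : KbModProp R A T) (hX : Kpb R A X) : (rContractiblePlus R A).trW s :=
  rContractiblePlus_trW hs (ObjectProperty.le_isoClosure _ _ (bounded_le_boundedBelow _ hT.2))
    (Kplus_le_boundedBelow _ hX.1)

/-- The projection to `D(Mod A)` is fully faithful on `K^{+,b}(proj A)`. Both sides do not change
when `X` is replaced by a truncation in `K^b(mod(A, R))`, where `bijective_Qh_map` applies. -/
lemma IsFrobenius.bijective_Qh_map_Kpb (hA : IsFrobenius R A) {X Y : KMod A}
    (hX : Kpb R A X) (hY : Kplus A Y) :
    Function.Bijective (DerivedCategory.Qh.map : (X ⟶ Y) → _) := by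
  have := hA.projective
  have := hA.finite
  obtain ⟨T, s, hT, hs, -⟩ := exists_truncation hX 0
  have := isIso_Qh_of_rContractible hs
  have h1 := hA.bijective_Qh_map_of_Kplus hT hY
  have h2 := hA.bijective_precomp_of_Kplus (rContractiblePlus_trW_of_Kpb hs hT hX) hY
  refine bijective_of_eq (((asIso (DerivedCategory.Qh.map s)).homFromEquiv
    (Z := DerivedCategory.Qh.obj Y)).bijective.comp
    (Function.Bijective.comp (f := fun f : X ⟶ Y => s ≫ f) h1 h2)) fun f => ?_
  simp

lemma isZero_Qh_of_rContractible {X : KMod A} (hX : rContractible R A X) :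
    IsZero (DerivedCategory.Qh.obj X) := by
  have := isIso_Qh_of_rContractible (R := R) (f := (0 : 0 ⟶ X))
    (ObjectProperty.trW.mk _ (contractible_distinguished₁ X) hX)
  exact (DerivedCategory.Qh.map_isZero (isZero_zero _)).of_iso
    (asIso (DerivedCategory.Qh.map (0 : 0 ⟶ X))).symm

/-- Every object of `D^b(mod(A, R))` is isomorphic in `D(Mod A)` to an object of
`K^{+,b}(proj A)`. -/
lemma IsFrobenius.exists_iso_Kpb (hA : IsFrobenius R A) {M : KMod A} (hM : KbModProp R A M) :
    ∃ I, Kpb R A I ∧ Nonempty (DerivedCategory.Qh.obj I ≅ DerivedCategory.Qh.obj M) := by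
  have := hA.projective
  have := hA.finite
  let F := (Kpb R A).ι ⋙ DerivedCategory.Qh
  have : F.Full := ⟨fun {X Y} f => by
    obtain ⟨g, hg⟩ := (hA.bijective_Qh_map_Kpb X.property Y.property.1).2 f
    exact ⟨ObjectProperty.homMk g, hg⟩⟩
  -- the essential image of `F` is a triangulated subcategory, so single complexes suffice
  let Q := F.essImage.inverseImage DerivedCategory.Qh
  suffices h : KbModProp R A ≤ Q by
    obtain ⟨I, ⟨e⟩⟩ := h M hM
    exact ⟨I.obj, I.property, ⟨e⟩⟩
  refine bounded_induction (modFinProj R A) (modFinProj_zero R A) Q fun N hN n => ?_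
  -- the brutal truncation of the contractible augmented coresolution in degree `-1` is `N`, and the
  -- other one is the coresolution
  have h1 : Q ((KMod.quot A).obj (stupidLE (cores R N) (-1))) := by
    obtain ⟨δ, hδ⟩ := exists_stupid_distinguished (cores R N) (-1)
    have hC := hA.rContractible_cores hN
    refine ObjectProperty.ext_of_isTriangulatedClosed₃ Q _ hδ ?_
      (ObjectProperty.prop_of_isZero F.essImage (isZero_Qh_of_rContractible hC))
    refine ⟨⟨(KMod.quot A).obj (stupidGT (cores R N) (-1)), ⟨_, ⟨fun i => ?_, -1, fun i hi =>
      isZero_stupidGT _ (by lia)⟩, ⟨Iso.refl _⟩⟩, ?_⟩, ⟨Iso.refl _⟩⟩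
    · obtain hi | hi := le_or_gt i (-1)
      · exact (finProj A).prop_of_iso (IsZero.iso (isZero_zero _) (isZero_stupidGT _ hi))
          (finProj_zero A)
      · exact (finProj A).prop_of_iso (stupidGTXIso _ hi).symm (hA.finProj_cores hN i hi)
    · refine ObjectProperty.ext_of_isTriangulatedClosed₁ (Kbp R) _
        ((resK R A).map_distinguished _ hδ) (ObjectProperty.prop_of_isZero _ hC)
        ⟨(KMod.quot R).obj (((resMod R A).mapHomologicalComplex (.up ℤ)).obj
          (stupidLE (cores R N) (-1))), ⟨fun i => ?_, 1, fun i hi => ?_⟩, ⟨Iso.refl _⟩⟩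
      · change modProj R A ((stupidLE (cores R N) (-1)).X i)
        obtain hi | rfl | hi := lt_trichotomy i (-1)
        · exact modProj_of_isZero ((isZero_cores N i hi).of_iso (stupidLEXIso _ hi.le))
        · exact (modProj R A).prop_of_iso (stupidLEXIso _ le_rfl).symm hN.2
        · exact modProj_of_isZero (isZero_stupidLE _ hi)
      · refine (resMod R A).map_isZero ?_
        obtain h | h : i < -1 ∨ -1 < i := by grind
        · exact (isZero_cores N i h).of_iso (stupidLEXIso _ h.le)
        · exact isZero_stupidLE _ h
  have h2 := ObjectProperty.le_shift Q (-1 - n) _ h1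
  obtain ⟨e⟩ := nonempty_iso_single (X := stupidLE (cores R N) (-1)) (-1) fun i hi => by
    obtain h | h : i < -1 ∨ -1 < i := by grind
    · exact (isZero_cores N i h).of_iso (stupidLEXIso _ h.le)
    · exact isZero_stupidLE _ h
  refine Q.prop_of_iso ?_ h2
  exact (shiftFunctor _ (-1 - n)).mapIso ((KMod.quot A).mapIso
      (e ≪≫ (HomologicalComplex.single _ (.up ℤ) (-1)).mapIso (stupidLEXIso _ le_rfl))) ≪≫
    ((KMod.quot A).commShiftIso (-1 - n)).symm.app _ ≪≫ (KMod.quot A).mapIso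
    (((CochainComplex.singleFunctors (ModuleCat.{u} A)).shiftIso (-1 - n) n (-1) (by lia)).app N)

/-- An object of `K^b(mod(A, R))` has an `R`-homotopy equivalence to an object of
`K^{+,b}(proj A)`. -/
lemma IsFrobenius.exists_coresolution (hA : IsFrobenius R A) {M : KMod A} (hM : KbModProp R A M) :
    ∃ (I : KMod A) (g : M ⟶ I), Kpb R A I ∧ (rContractible R A).trW g := by
  have := hA.projective
  obtain ⟨I, hI, ⟨e⟩⟩ := hA.exists_iso_Kpb hM
  obtain ⟨g, hg⟩ := (hA.bijective_Qh_map_of_Kplus hM hI.1).2 e.inv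
  have h1 : IsIso (DerivedCategory.Qh.map g) := by rw [hg]; infer_instance
  rw [isIso_Qh_iff] at h1
  obtain ⟨Z, a, b, hT, hZ⟩ := h1
  refine ⟨I, g, hI, Z, a, b, hT, rContractible_of_acyclic hZ (Kbp_le_leftOrthogonal _ ?_)⟩
  exact ObjectProperty.ext_of_isTriangulatedClosed₃ (Kbp R) _ ((resK R A).map_distinguished _ hT)
    ⟨(resK R A).obj M, ⟨fun i => (hM.1 i).2, hM.2.imp fun N hN i hi =>
      (resMod R A).map_isZero (hN i hi)⟩, ⟨Iso.refl _⟩⟩ hI.2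

/-- For bounded `M` and `M'` in `mod(A, R)`, there is a quasi-isomorphism `M ⟶ T` in
`K^b(mod(A, R))` such that morphisms `M' ⟶ T` in the homotopy category and in the derived
category agree. -/
lemma IsFrobenius.exists_roof (hA : IsFrobenius R A) {M M' : KMod A} (hM : KbModProp R A M)
    (hM' : KbModProp R A M') : ∃ (T : KMod A) (t : M ⟶ T), KbModProp R A T ∧
      IsIso (DerivedCategory.Qh.map t) ∧
      Function.Bijective (DerivedCategory.Qh.map : (M' ⟶ T) → _) := by
  have := hA.finite
  have := hA.projective
  obtain ⟨I, g, hI, hg⟩ := hA.exists_coresolution hM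
  obtain ⟨N, hN⟩ := hM.2
  obtain ⟨N', hN'⟩ := hM'.2
  -- truncate the coresolution of `M` above the degrees where `M` and `M'` live
  obtain ⟨T, s, hT, hs, h⟩ := exists_truncation hI (N + N' + 1)
  have hs' := isIso_Qh_of_rContractible hs
  have hg' := isIso_Qh_of_rContractible hg
  obtain ⟨t, rfl⟩ := (h M.as fun i hi => hN i (by grind)).2 g
  refine ⟨T, t, hT, ?_, ?_⟩
  · replace hg' : IsIso (DerivedCategory.Qh.map t ≫ DerivedCategory.Qh.map s) := by
      rw [← Functor.map_comp]; exact hg'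
    exact @IsIso.of_isIso_comp_right _ _ _ _ _ _ (DerivedCategory.Qh.map s) hs' hg'
  · have h1 := h M'.as fun i hi => hN' i (by grind)
    have h2 := hA.bijective_Qh_map_of_Kplus hM' hI.1
    refine bijective_of_eq (((asIso (DerivedCategory.Qh.map s)).symm.homToEquiv
      (Z := DerivedCategory.Qh.obj M')).bijective.comp
      (Function.Bijective.comp (f := fun f : M' ⟶ T => f ≫ s) h2 h1)) fun f => ?_
    simp

lemma isIso_Qh_map_iff_trW {X Y : KbMod R A} (f : X ⟶ Y) :
    IsIso (DerivedCategory.Qh.map f.hom) ↔ (AcbMod R A).trW f := by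
  have : AcbMod R A = (HomotopyCategory.subcategoryAcyclic _).inverseImage (KbModProp R A).ι := by
    ext X
    exact acbMod_iff R A X
  rw [isIso_Qh_iff, this, ObjectProperty.inverseImage_trW_iff]
  rfl

variable (R A) in
/-- The restriction of `DbMod.can` along the localization functor is `KbMod.q`. -/
noncomputable abbrev DbMod.canIso : (AcbMod R A).trW.Q ⋙ DbMod.can R A ≅ KbMod.q R A :=
  Localization.Lifting.iso _ (AcbMod R A).trW _ _

/-- The canonical functor `D^b(mod(A, R)) ⥤ D(Mod A)` is full: a morphism `X₁ ⟶ X₂` in `D(Mod A)`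
is a roof `X₁ ⟶ T ⟵ X₂` in `K^b(mod(A, R))`. -/
lemma IsFrobenius.full_can (hA : IsFrobenius R A) : (DbMod.can R A).Full := by
  let L := (AcbMod R A).trW.Q
  have : L.EssSurj := Localization.essSurj L (AcbMod R A).trW
  let e := DbMod.canIso R A
  refine Functor.full_of_comp_essSurj _ L fun X₁ X₂ φ => ?_
  obtain ⟨T, t, hT, ht, h⟩ := hA.exists_roof X₂.property X₁.property
  obtain ⟨a, ha⟩ := h.2 (e.inv.app X₁ ≫ φ ≫ e.hom.app X₂ ≫ DerivedCategory.Qh.map t)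
  let t' : X₂ ⟶ ⟨T, hT⟩ := ObjectProperty.homMk t
  let a' : X₁ ⟶ ⟨T, hT⟩ := ObjectProperty.homMk a
  have : IsIso (L.map t') := Localization.inverts L (AcbMod R A).trW t'
    ((isIso_Qh_map_iff_trW t').1 ht)
  refine ⟨L.map a' ≫ inv (L.map t'), ?_⟩
  rw [← cancel_mono ((DbMod.can R A).map (L.map t')), ← Functor.map_comp, Category.assoc,
    IsIso.inv_hom_id, Category.comp_id, ← cancel_mono (e.hom.app _)]
  have h1 := e.hom.naturality a'
  have h2 := e.hom.naturality t'
  dsimp only [Functor.comp_map] at h1 h2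
  rw [h1, Category.assoc, h2]
  change e.hom.app X₁ ≫ DerivedCategory.Qh.map a = φ ≫ e.hom.app X₂ ≫ DerivedCategory.Qh.map t
  rw [ha]
  exact e.hom_inv_id_app_assoc X₁ _

/-- The canonical functor `D^b(mod(A, R)) ⥤ D(Mod A)` is faithful. -/
lemma IsFrobenius.faithful_can (hA : IsFrobenius R A) : (DbMod.can R A).Faithful := by
  let L := (AcbMod R A).trW.Q
  let e := DbMod.canIso R A
  have : (DbMod.can R A).Additive := by
    rw [Localization.functor_additive_iff L (AcbMod R A).trW]
    exact Functor.additive_of_iso e.symm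
  refine Functor.faithful_of_comp_cancel_zero_of_hasLeftCalculusOfFractions L
    (AcbMod R A).trW _ fun X₁ X₂ f hf => ?_
  obtain ⟨T, t, hT, ht, h⟩ := hA.exists_roof X₂.property X₁.property
  have hf' : DerivedCategory.Qh.map f.hom = 0 := by
    have := e.inv.naturality f
    rw [Functor.comp_map, hf, comp_zero] at this
    exact (cancel_mono (e.inv.app X₂)).1 (this.trans zero_comp.symm)
  let t' : X₂ ⟶ ⟨T, hT⟩ := ObjectProperty.homMk t
  have : IsIso (L.map t') := Localization.inverts L (AcbMod R A).trW t'
    ((isIso_Qh_map_iff_trW t').1 ht)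
  have h1 : f.hom ≫ t = 0 := h.1 (by rw [Functor.map_comp, hf', zero_comp, Functor.map_zero])
  have h2 : f ≫ t' = 0 := by
    ext1
    exact h1
  rw [← cancel_mono (L.map t'), zero_comp, ← L.map_comp, h2, L.map_zero]

end Truncation

/-! ### Coproducts in the homotopy category and compactness of bounded complexes -/

section FullSubcategory

variable {T : Type u} [Category.{v} T] (P : ObjectProperty T) {J : Type*}

/-- A colimit cofan in a full subcategory from one in the ambient category. -/
def isColimitFullSubcategory (X : J → P.FullSubcategory) (c : Cofan fun j => (X j).obj)
    (hc : IsColimit c) (h : P c.pt) :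
    IsColimit (Cofan.mk (⟨c.pt, h⟩ : P.FullSubcategory) fun j =>
      (ObjectProperty.homMk (c.inj j) : X j ⟶ ⟨c.pt, h⟩)) :=
  Cofan.IsColimit.mk _ (fun s => ObjectProperty.homMk (Cofan.IsColimit.desc hc fun j => (s.inj j).hom))
    (fun s j => by
      ext1
      exact Cofan.IsColimit.fac hc _ j)
    fun s m hm => by
      ext1
      refine Cofan.IsColimit.hom_ext hc _ _ fun j => ?_
      exact (congrArg InducedCategory.Hom.hom (hm j)).trans
        (Cofan.IsColimit.fac hc (fun j => (s.inj j).hom) j).symm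

/-- The inclusion of a full subcategory closed under coproducts preserves coproducts. -/
lemma nonempty_isColimit_map_ι
    (h : ∀ X : J → P.FullSubcategory, ∃ c : Cofan fun j => (X j).obj, Nonempty (IsColimit c) ∧ P c.pt)
    (X : J → P.FullSubcategory) (c : Cofan X) (hc : IsColimit c) :
    Nonempty (IsColimit (Cofan.mk c.pt.obj fun j => (c.inj j).hom)) := by
  obtain ⟨d, ⟨hd⟩, hP⟩ := h X
  let e := hc.coconePointUniqueUpToIso (isColimitFullSubcategory P X d hd hP)
  refine ⟨IsColimit.ofIsoColimit hd (Cofan.ext (P.ι.mapIso e.symm) fun j => ?_)⟩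
  have := hc.comp_coconePointUniqueUpToIso_inv (isColimitFullSubcategory P X d hd hP) ⟨j⟩
  exact congrArg InducedCategory.Hom.hom this

lemma preservesCoproducts_ι
    (h : ∀ X : J → P.FullSubcategory, ∃ c : Cofan fun j => (X j).obj, Nonempty (IsColimit c) ∧ P c.pt) :
    PreservesColimitsOfShape (Discrete J) P.ι := by
  suffices ∀ X : J → P.FullSubcategory, PreservesColimit (Discrete.functor X) P.ι from
    preservesColimitsOfShape_of_discrete P.ι
  intro X
  obtain ⟨d, ⟨hd⟩, hP⟩ := h X
  exact preservesColimit_of_preserves_colimit_cocone (isColimitFullSubcategory P X d hd hP)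
    ((Cofan.isColimitMapCoconeEquiv P.ι X _).symm hd)

lemma hasCoproducts_fullSubcategory
    (h : ∀ (J : Type w) (X : J → P.FullSubcategory),
      ∃ c : Cofan fun j => (X j).obj, Nonempty (IsColimit c) ∧ P c.pt) :
    HasCoproducts.{w} P.FullSubcategory := by
  choose c hc hP using h
  exact hasCoproducts_of_colimit_cofans _ fun {J} X =>
    isColimitFullSubcategory P X (c J X) (hc J X).some (hP J X)

end FullSubcategory

section Quotient

variable {C : Type u} [Category.{v} C] [Preadditive C] {J : Type w} [HasCoproductsOfShape J C]

instance {ι : Type*} (c : ComplexShape ι) : HasCoproductsOfShape J (HomologicalComplex C c) :=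
  inferInstance

/-- The quotient functor to the homotopy category preserves coproducts. -/
lemma nonempty_isColimit_quotient (X : J → CochainComplex C ℤ) (c : Cofan X) (hc : IsColimit c) :
    Nonempty (IsColimit (Cofan.mk ((HomotopyCategory.quotient C (.up ℤ)).obj c.pt) fun j =>
      (HomotopyCategory.quotient C (.up ℤ)).map (c.inj j))) := by
  have hev : ∀ i, IsColimit (Cofan.mk (c.pt.X i) fun j => (c.inj j).f i) := fun i =>
    Cofan.isColimitMapCoconeEquiv (HomologicalComplex.eval C (.up ℤ) i) X c (isColimitOfPreserves _ hc)
  let Q := HomotopyCategory.quotient C (.up ℤ)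
  have hdesc : ∀ (Y : HomotopyCategory C (.up ℤ)) (f : ∀ j, Q.obj (X j) ⟶ Y),
      ∃ g : Q.obj c.pt ⟶ Y, ∀ j, Q.map (c.inj j) ≫ g = f j := by
    intro Y f
    obtain ⟨Y, rfl⟩ := Y.quotient_obj_surjective
    choose f' hf' using fun j => Q.map_surjective (f j)
    refine ⟨Q.map (Cofan.IsColimit.desc hc f'), fun j => ?_⟩
    rw [← Q.map_comp, Cofan.IsColimit.fac, hf']
  have huniq : ∀ (Y : HomotopyCategory C (.up ℤ)) (g : Q.obj c.pt ⟶ Y),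
      (∀ j, Q.map (c.inj j) ≫ g = 0) → g = 0 := by
    intro Y g hg
    obtain ⟨Y, rfl⟩ := Y.quotient_obj_surjective
    obtain ⟨g, rfl⟩ := Q.map_surjective g
    have h : ∀ j, Nonempty (Homotopy (c.inj j ≫ g) 0) := fun j =>
      ⟨HomotopyCategory.homotopyOfEq _ _ (by rw [Functor.map_comp]; exact (hg j).trans (Functor.map_zero _ _ _).symm)⟩
    let H := fun j => (h j).some
    rw [← Q.map_zero]
    refine HomotopyCategory.eq_of_homotopy _ _
      { hom := fun i k => Cofan.IsColimit.desc (hev i) fun j => (H j).hom i k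
        zero := fun i k hik => Cofan.IsColimit.hom_ext (hev i) _ _ fun j => ?_
        comm := fun i => Cofan.IsColimit.hom_ext (hev i) _ _ fun j => ?_ }
    · rw [Cofan.IsColimit.fac, (H j).zero i k hik, comp_zero]
    · have h1 := (H j).comm i
      have hd : ∀ i k, (c.inj j).f i ≫ Cofan.IsColimit.desc (hev i) (fun j => (H j).hom i k) =
        (H j).hom i k := fun i k => Cofan.IsColimit.fac (hev i) _ j
      change (c.inj j).f i ≫ g.f i = (c.inj j).f i ≫ _
      rw [HomologicalComplex.comp_f] at h1
      rw [h1]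
      simp only [Preadditive.comp_add, dNext_eq _ (show (ComplexShape.up ℤ).Rel i (i + 1) by simp),
        prevD_eq _ (show (ComplexShape.up ℤ).Rel (i - 1) i by simp), HomologicalComplex.zero_f,
        add_zero]
      rw [reassoc_of% (hd i (i - 1)), HomologicalComplex.Hom.comm_assoc (c.inj j), hd]
  choose g hg using hdesc
  refine ⟨Cofan.IsColimit.mk _ (fun s => g _ s.inj) (fun s j => hg _ _ j) fun s m hm => ?_⟩
  rw [← sub_eq_zero]
  refine huniq _ _ fun j => ?_
  rw [Preadditive.comp_sub, hg, sub_eq_zero]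
  exact hm j

lemma exists_cofan_quotient (X : J → HomotopyCategory C (.up ℤ)) : ∃ (c : Cofan fun j => (X j).as),
    Nonempty (IsColimit c) ∧ Nonempty (IsColimit (Cofan.mk
      (f := X) ((HomotopyCategory.quotient C (.up ℤ)).obj c.pt) fun j =>
      (HomotopyCategory.quotient C (.up ℤ)).map (c.inj j))) :=
  ⟨_, ⟨coproductIsCoproduct fun j => (X j).as⟩,
    nonempty_isColimit_quotient _ _ (coproductIsCoproduct fun j => (X j).as)⟩

end Quotient

lemma hasCoproducts_homotopyCategory {C : Type u} [Category.{v} C] [Preadditive C]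
    [HasCoproducts.{w} C] : HasCoproducts.{w} (HomotopyCategory C (.up ℤ)) := by
  choose c hc h using fun (J : Type w) X => exists_cofan_quotient (C := C) (J := J) X
  exact hasCoproducts_of_colimit_cofans _ fun {J} X => (h J X).some

section Modules

variable {A : Type u} [Ring A]

instance : HasCoproducts.{u} (KMod A) := hasCoproducts_homotopyCategory

open Classical in
/-- The projection from a coproduct to one of the summands. -/
noncomputable def cofanProj {C : Type*} [Category C] [HasZeroMorphisms C] {J : Type*} {Y : J → C}
    {c : Cofan Y} (hc : IsColimit c) (j : J) : c.pt ⟶ Y j :=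
  Cofan.IsColimit.desc hc fun i => if h : i = j then eqToHom (by rw [h]) else 0

@[simp]
lemma inj_cofanProj_self {C : Type*} [Category C] [HasZeroMorphisms C] {J : Type*} {Y : J → C}
    {c : Cofan Y} (hc : IsColimit c) (j : J) : c.inj j ≫ cofanProj hc j = 𝟙 _ := by
  simp [cofanProj]

lemma inj_cofanProj_of_ne {C : Type*} [Category C] [HasZeroMorphisms C] {J : Type*} {Y : J → C}
    {c : Cofan Y} (hc : IsColimit c) {i j : J} (h : i ≠ j) : c.inj i ≫ cofanProj hc j = 0 := by
  simp [cofanProj, h]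

/-- Every element of a coproduct of modules lies in a finite partial sum. -/
lemma exists_finset_of_cofan {J : Type*} {Y : J → ModuleCat.{u} A} {c : Cofan Y}
    (hc : IsColimit c) (x : c.pt) : ∃ s : Finset J, ∀ t, s ⊆ t →
      (∑ j ∈ t, cofanProj hc j ≫ c.inj j) x = x := by
  classical
  let p : Submodule A c.pt :=
    { carrier := {x | ∃ s : Finset J, ∀ t, s ⊆ t → (∑ j ∈ t, cofanProj hc j ≫ c.inj j) x = x}
      add_mem' := by
        rintro x y ⟨s, hs⟩ ⟨s', hs'⟩
        exact ⟨s ∪ s', fun t ht => by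
          rw [map_add, hs t (Finset.union_subset_left ht), hs' t (Finset.union_subset_right ht)]⟩
      zero_mem' := ⟨∅, fun t _ => map_zero _⟩
      smul_mem' := by
        rintro a x ⟨s, hs⟩
        exact ⟨s, fun t ht => by
          have := (∑ j ∈ t, cofanProj hc j ≫ c.inj j).hom.map_smul a x
          exact this.trans (congrArg (a • ·) (hs t ht))⟩ }
  have hp : ModuleCat.ofHom p.mkQ = 0 := by
    refine Cofan.IsColimit.hom_ext hc _ _ fun j => ?_
    ext y
    rw [comp_zero]
    refine (Submodule.Quotient.mk_eq_zero p).2 ⟨{j}, fun t ht => ?_⟩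
    have : c.inj j ≫ (∑ j ∈ t, cofanProj hc j ≫ c.inj j) = c.inj j := by
      rw [Preadditive.comp_sum, Finset.sum_eq_single j]
      · rw [← Category.assoc, inj_cofanProj_self, Category.id_comp]
      · intro i _ hi
        rw [← Category.assoc, inj_cofanProj_of_ne hc (Ne.symm hi), zero_comp]
      · exact fun h => (h (ht (Finset.mem_singleton_self j))).elim
    exact ConcreteCategory.congr_hom this y
  exact (Submodule.Quotient.mk_eq_zero p).1 (ConcreteCategory.congr_hom hp x)

/-- A finitely generated module, viewed as a complex in a single degree, is compact. -/
lemma compacts_single (M : ModuleCat.{u} A) [hM : Module.Finite A M] (n : ℤ) :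
    compacts (KMod A) ((KMod.quot A).obj ((HomologicalComplex.single _ (.up ℤ) n).obj M)) := by
  classical
  intro J Y c hc f
  obtain ⟨d, ⟨hd⟩, ⟨hd'⟩⟩ := exists_cofan_quotient Y
  obtain ⟨g, hg⟩ := (KMod.quot A).map_surjective (f ≫ (hc.coconePointUniqueUpToIso hd').hom)
  have hev : IsColimit (Cofan.mk (d.pt.X n) fun j => (d.inj j).f n) :=
    Cofan.isColimitMapCoconeEquiv (HomologicalComplex.eval _ (.up ℤ) n) _ d
      (isColimitOfPreserves _ hd)
  have hproj : ∀ j, cofanProj hev j = (cofanProj hd j).f n := fun j => by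
    refine Cofan.IsColimit.hom_ext hev _ _ fun i => ?_
    by_cases h : i = j
    · subst h
      rw [inj_cofanProj_self]
      have := congrArg (HomologicalComplex.Hom.f · n) (inj_cofanProj_self hd i)
      exact this.symm
    · rw [inj_cofanProj_of_ne hev h]
      have := congrArg (HomologicalComplex.Hom.f · n) (inj_cofanProj_of_ne hd h)
      exact this.symm
  let gn := (HomologicalComplex.singleObjXSelf (.up ℤ) n M).inv ≫ g.f n
  obtain ⟨S, hS⟩ := hM.fg_top
  choose σ hσ using exists_finset_of_cofan hev
  let s := S.biUnion fun x => σ (gn x)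
  have h1 : gn ≫ (∑ j ∈ s, cofanProj hev j ≫ (d.inj j).f n) = gn := by
    ext1
    refine LinearMap.ext_on hS fun x hx => ?_
    exact hσ (gn x) s (Finset.subset_biUnion_of_mem (fun x => σ (gn x)) hx)
  have h2 : g = ∑ j ∈ s, (g ≫ cofanProj hd j) ≫ d.inj j := by
    refine HomologicalComplex.from_single_hom_ext ?_
    rw [← cancel_epi (HomologicalComplex.singleObjXSelf (.up ℤ) n M).inv]
    refine h1.symm.trans ?_
    have h3 : ∀ φ : J → ((HomologicalComplex.single _ (.up ℤ) n).obj M ⟶ d.pt),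
        (∑ j ∈ s, φ j).f n = ∑ j ∈ s, (φ j).f n :=
      fun φ => (HomologicalComplex.eval _ (.up ℤ) n).map_sum φ s
    rw [Preadditive.comp_sum, h3, Preadditive.comp_sum]
    refine Finset.sum_congr rfl fun j _ => ?_
    rw [hproj]
    simp [gn]
  refine ⟨s, fun j => (KMod.quot A).map (g ≫ cofanProj hd j), ?_⟩
  rw [← cancel_mono (hc.coconePointUniqueUpToIso hd').hom, ← hg, Preadditive.sum_comp]
  refine (congrArg (KMod.quot A).map h2).trans ((Functor.map_sum _ _ _).trans
    (Finset.sum_congr rfl fun j _ => ?_))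
  refine ((KMod.quot A).map_comp (g ≫ cofanProj hd j) (d.inj j)).trans (Eq.trans ?_
    (Category.assoc _ _ _).symm)
  exact congrArg ((KMod.quot A).map (g ≫ cofanProj hd j) ≫ ·)
    (hc.comp_coconePointUniqueUpToIso_hom hd' ⟨j⟩).symm

variable (R : Type u) [CommRing R] [Algebra R A]

lemma compacts_of_KbMod {M : KMod A} (hM : KbModProp R A M) : compacts (KMod A) M := by
  refine bounded_induction (modFinProj R A) (modFinProj_zero R A) _ (fun N hN n => ?_) M hM
  have := hN.1
  have : Module.Finite A N := by
    obtain ⟨S, hS⟩ := hN.1.fg_top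
    refine ⟨S, eq_top_iff.2 fun x _ => ?_⟩
    have h : (x : (resMod R A).obj N) ∈ Submodule.span R (S : Set ((resMod R A).obj N)) := by
      rw [hS]; trivial
    induction h using Submodule.span_induction with
    | mem x h => exact Submodule.subset_span h
    | zero => exact zero_mem _
    | add x y _ _ hx hy => exact add_mem (hx trivial) (hy trivial)
    | smul a x _ hx => exact Submodule.smul_mem _ (algebraMap R A a) (hx trivial)
  exact compacts_single N n

end Modules

/-! ### Compact objects and retracts -/

section Localising

open scoped ZeroObject

variable {T : Type u} [Category.{v} T] [Preadditive T] [HasZeroObject T] [HasShift T ℤ]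
  [∀ n : ℤ, (shiftFunctor T n).Additive] [Pretriangulated T]

lemma le_localisingClosure (G : ObjectProperty T) : G ≤ localisingClosure G :=
  fun _ hX _ _ h => h _ hX

lemma isLocalising_localisingClosure (G : ObjectProperty T) : IsLocalising (localisingClosure G) where
  isClosedUnderIsomorphisms := inferInstance
  isTriangulated := inferInstance
  coproducts J Y c hc h Q hQ hG := hQ.coproducts J Y c hc fun j => h j Q hQ hG

variable [HasCoproducts.{v} T]

lemma exists_cofan_of_isLocalising {P : ObjectProperty T} (hP : IsLocalising P) (J : Type v)
    (X : J → P.FullSubcategory) :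
    ∃ c : Cofan fun j => (X j).obj, Nonempty (IsColimit c) ∧ P c.pt :=
  ⟨_, ⟨coproductIsCoproduct fun j => (X j).obj⟩,
    hP.coproducts J _ _ (coproductIsCoproduct fun j => (X j).obj) fun j => (X j).property⟩

omit [HasZeroObject T] [HasShift T ℤ] [∀ n : ℤ, (shiftFunctor T n).Additive] [Pretriangulated T]
  [HasCoproducts.{v} T] in
lemma compacts_fullSubcategory {P : ObjectProperty T}
    (h : ∀ (J : Type v) (X : J → P.FullSubcategory),
      ∃ c : Cofan fun j => (X j).obj, Nonempty (IsColimit c) ∧ P c.pt)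
    (X : P.FullSubcategory) (hX : compacts T X.obj) : compacts P.FullSubcategory X := by
  intro J Y c hc f
  obtain ⟨hc'⟩ := nonempty_isColimit_map_ι P (h J) Y c hc
  obtain ⟨s, φ, hφ⟩ := hX J _ _ hc' f.hom
  refine ⟨s, fun j => ObjectProperty.homMk (φ j), P.ι.map_injective ?_⟩
  rw [P.ι.map_sum]
  exact hφ

omit [HasCoproducts.{v} T] in
/-- A localising subcategory is generated by its generators also when viewed as a triangulated
category in its own right. -/
lemma localisingClosure_inverseImage (G : ObjectProperty T)
    (X : (localisingClosure G).FullSubcategory) :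
    localisingClosure (G.inverseImage (localisingClosure G).ι) X := by
  intro Q hQ hG
  let P := localisingClosure G
  have := hQ.isTriangulated
  have := hQ.isClosedUnderIsomorphisms
  have hQ' : IsLocalising (Q.map P.ι) :=
    { isClosedUnderIsomorphisms := inferInstance
      isTriangulated := inferInstance
      coproducts := fun J Y c hc h => by
        choose Z hZ e using h
        let e j := (e j).some
        have hc' : IsColimit (Cofan.mk (f := fun j => (Z j).obj) c.pt fun j => (e j).hom ≫ c.inj j) :=
          Cofan.IsColimit.mk _ (fun s => Cofan.IsColimit.desc hc fun j => (e j).inv ≫ s.inj j)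
            (fun s j => by simp) fun s m hm => Cofan.IsColimit.hom_ext hc _ _ fun j => by
              have := hm j
              rw [Cofan.IsColimit.fac, Iso.eq_inv_comp]
              simpa using this
        have hP : P c.pt := (isLocalising_localisingClosure G).coproducts J (fun j => (Z j).obj) _ hc'
          fun j => (Z j).property
        exact ⟨⟨c.pt, hP⟩, hQ.coproducts J Z _ (isColimitFullSubcategory P Z _ hc' hP) hZ,
          ⟨Iso.refl _⟩⟩ }
  obtain ⟨Y, hY, ⟨e⟩⟩ := X.property _ hQ' fun Y hY =>
    ⟨⟨Y, le_localisingClosure G Y hY⟩, hG _ hY, ⟨Iso.refl _⟩⟩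
  exact Q.prop_of_iso (P.isoMk e) hY

end Localising

section Compact

open scoped ZeroObject

variable {T : Type u} [Category.{v} T] [Preadditive T] [HasZeroObject T] [HasShift T ℤ]
  [∀ n : ℤ, (shiftFunctor T n).Additive] [Pretriangulated T] (S : ObjectProperty T)

/-- The objects `Z` such that every morphism from a compact object to `Z` factors through an object
of `S`. -/
def factorsThrough : ObjectProperty T := fun Z => ∀ (c : T), compacts T c → ∀ f : c ⟶ Z,
  ∃ (s : T) (a : c ⟶ s) (b : s ⟶ Z), S s ∧ a ≫ b = f

variable {S} [S.IsTriangulated] [S.IsClosedUnderIsomorphisms]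

lemma exists_factorization_add {c Z s s' : T} (hs : S s) (hs' : S s') (a : c ⟶ s) (b : s ⟶ Z)
    (a' : c ⟶ s') (b' : s' ⟶ Z) :
    ∃ (t : T) (x : c ⟶ t) (y : t ⟶ Z), S t ∧ x ≫ y = a ≫ b + a' ≫ b' :=
  ⟨s ⊞ s', biprod.lift a a', biprod.desc b b', S.ext_of_isTriangulatedClosed₂ _
    (binaryBiproductTriangle_distinguished s s') hs hs', by simp⟩

omit [HasZeroObject T] [HasShift T ℤ] [∀ n : ℤ, (shiftFunctor T n).Additive]
  [Pretriangulated T] [S.IsTriangulated] [S.IsClosedUnderIsomorphisms] in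
lemma factorsThrough_of_iso {Z Z' : T} (e : Z ≅ Z') (h : factorsThrough S Z) :
    factorsThrough S Z' := fun c hc f => by
  obtain ⟨s, a, b, hs, hab⟩ := h c hc (f ≫ e.inv)
  exact ⟨s, a, b ≫ e.hom, hs, by rw [reassoc_of% hab]; simp⟩

instance : (factorsThrough S).IsClosedUnderIsomorphisms := ⟨factorsThrough_of_iso⟩

/-- Morphisms from compact objects that factor through `S` can be lifted along distinguished
triangles, by replacing the compact source `c` with the fibre of `c ⟶ s₃` and gluing the two
factorizations. -/
lemma isLocalising_factorsThrough (hS : S ≤ compacts T) : IsLocalising (factorsThrough S) where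
  isClosedUnderIsomorphisms := inferInstance
  isTriangulated :=
    { exists_zero := ⟨0, isZero_zero T, fun c _ f => ⟨0, 0, 0, S.prop_zero,
        (isZero_zero T).eq_of_tgt _ _⟩⟩
      isStableUnderShiftBy := fun n => ⟨fun Z hZ c hc f => by
        let e : (c⟦-n⟧)⟦n⟧ ≅ c := (shiftEquiv T n).counitIso.app c
        obtain ⟨g, hg⟩ := (shiftFunctor T n).map_surjective (e.hom ≫ f)
        obtain ⟨s, a, b, hs, hab⟩ := hZ _ (ObjectProperty.le_shift _ (-n) _ hc) g
        refine ⟨s⟦n⟧, e.inv ≫ a⟦n⟧', b⟦n⟧', ObjectProperty.le_shift _ n _ hs, ?_⟩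
        rw [Category.assoc, ← Functor.map_comp, hab, hg, Iso.inv_hom_id_assoc]⟩
      toIsTriangulatedClosed₂ := .mk' fun D hD h₁ h₃ c hc f => by
        -- `f` is corrected by a morphism through the weak pushout `s₂` so as to factor through `s₃`
        obtain ⟨s₃, a, b, hs₃, hab⟩ := h₃ c hc (f ≫ D.mor₂)
        -- the fibre `w` of `a : c ⟶ s₃` is compact, and `i ≫ f` factors through `D.obj₁`
        obtain ⟨w, i, k, hT⟩ := distinguished_cocone_triangle₁ a
        have hw : compacts T w := ObjectProperty.ext_of_isTriangulatedClosed₁ _ _ hT hc (hS _ hs₃)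
        have hia : i ≫ a = 0 := comp_distTriang_mor_zero₁₂ _ hT
        obtain ⟨g, hg⟩ : ∃ g : w ⟶ D.obj₁, i ≫ f = g ≫ D.mor₁ :=
          Triangle.coyoneda_exact₂ D hD (i ≫ f) (by
            rw [Category.assoc, ← hab, reassoc_of% hia, zero_comp])
        obtain ⟨s₁, p, q, hs₁, hpq⟩ := h₁ w hw g
        -- `s₂` is the extension of `s₃` by `s₁` that is pushed out from `w ⟶ c ⟶ s₃`
        obtain ⟨s₂, x, y, hT'⟩ := distinguished_cocone_triangle₂ (k ≫ p⟦1⟧')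
        have hs₂ : S s₂ := S.ext_of_isTriangulatedClosed₂ _ hT' hs₁ hs₃
        obtain ⟨r, hr₁, hr₂⟩ : ∃ r : c ⟶ s₂, i ≫ r = p ≫ x ∧ a = r ≫ y := by
          obtain ⟨r, h1, h2⟩ := complete_distinguished_triangle_morphism₂ _ _ hT hT' p (𝟙 s₃)
            (Category.id_comp _).symm
          exact ⟨r, h1, (Category.comp_id a).symm.trans h2⟩
        obtain ⟨h, hh⟩ : ∃ h : s₂ ⟶ D.obj₂, q ≫ D.mor₁ = x ≫ h := by
          obtain ⟨h', hh'⟩ : ∃ h' : s₂⟦(1 : ℤ)⟧ ⟶ D.obj₂⟦(1 : ℤ)⟧,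
              (q ≫ D.mor₁)⟦(1 : ℤ)⟧' = (-x⟦(1 : ℤ)⟧') ≫ h' := Triangle.yoneda_exact₃ _ (rot_of_distTriang _ hT') ((q ≫ D.mor₁)⟦(1 : ℤ)⟧') (by
            change (k ≫ p⟦(1 : ℤ)⟧') ≫ (q ≫ D.mor₁)⟦(1 : ℤ)⟧' = 0
            have hki : k ≫ i⟦(1 : ℤ)⟧' = 0 := comp_distTriang_mor_zero₃₁ _ hT
            rw [Category.assoc, ← Functor.map_comp, ← Category.assoc, hpq, ← hg, Functor.map_comp,
              reassoc_of% hki, zero_comp])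
          obtain ⟨h, hh⟩ := (shiftFunctor T (1 : ℤ)).map_surjective (-h')
          refine ⟨h, (shiftFunctor T (1 : ℤ)).map_injective ?_⟩
          rw [hh', Functor.map_comp, hh, Preadditive.neg_comp, Preadditive.comp_neg]
        -- `f` and the morphism through `s₂` agree on `w`, so they differ by a morphism through `s₃`
        obtain ⟨l, hl⟩ : ∃ l : s₃ ⟶ D.obj₂, f - r ≫ h = a ≫ l :=
          Triangle.yoneda_exact₂ _ hT (f - r ≫ h) (by
            change i ≫ _ = 0
            rw [Preadditive.comp_sub, hg, ← hpq, reassoc_of% hr₁, ← hh, Category.assoc, sub_self])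
        obtain ⟨t, x', y', ht, hxy⟩ := exists_factorization_add hs₂ hs₃ r h a l
        exact ⟨t, x', y', ht, by rw [hxy, ← hl, add_sub_cancel]⟩ }
  coproducts J Y c hc h d hd f := by
    classical
    obtain ⟨s, φ, rfl⟩ := hd J Y c hc f
    induction s using Finset.induction_on with
    | empty => exact ⟨0, 0, 0, S.prop_zero, by simp⟩
    | insert j s hj ih =>
      obtain ⟨t, a, b, ht, hab⟩ := ih
      obtain ⟨t', a', b', ht', hab'⟩ := h j d hd (φ j)
      obtain ⟨t'', x, y, ht'', hxy⟩ := exists_factorization_add ht' ht a' (b' ≫ c.inj j) a b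
      exact ⟨t'', x, y, ht'', by
        rw [hxy, hab, Finset.sum_insert hj, reassoc_of% hab']⟩

/-- In a triangulated category generated by a class `S` of compact objects that is closed under
shifts and extensions, the compact objects are the retracts of objects of `S`. -/
lemma exists_retract_of_compacts (hS : S ≤ compacts T) (h : ∀ X, localisingClosure S X) {X : T}
    (hX : compacts T X) : ∃ Y, S Y ∧ Nonempty (Retract X Y) := by
  obtain ⟨Y, a, b, hY, hab⟩ := h X _ (isLocalising_factorsThrough hS)
    (fun Y hY c _ f => ⟨Y, f, 𝟙 Y, hY, Category.comp_id f⟩) X hX (𝟙 X)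
  exact ⟨Y, hY, ⟨⟨a, b, hab⟩⟩⟩

end Compact

section Swindle

open scoped ZeroObject

variable {T : Type u} [Category.{v} T] [Preadditive T] [HasZeroObject T] [HasShift T ℤ]
  [∀ n : ℤ, (shiftFunctor T n).Additive] [Pretriangulated T]

/-- A product indexed by `Bool` is a biproduct. -/
noncomputable def isLimitBool (f : Bool → T) : IsLimit (Fan.mk (f false ⊞ f true)
    fun j => match j with | false => biprod.fst | true => biprod.snd) :=
  Fan.IsLimit.mk _ (fun s => biprod.lift (s.proj false) (s.proj true))
    (fun s j => by cases j <;> simp) fun s m hm => by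
      have h1 := hm false
      have h2 := hm true
      apply biprod.hom_ext <;> simp_all

instance (f : Bool → T) : HasProduct f := ⟨⟨_, isLimitBool f⟩⟩

/-- The product of a family indexed by `Bool` as a biproduct. -/
noncomputable def prodBoolIso (f : Bool → T) : ∏ᶜ f ≅ f false ⊞ f true :=
  (limit.isLimit _).conePointUniqueUpToIso (isLimitBool f)

instance (n : ℤ) (X Y : T) : PreservesBinaryBiproduct X Y (shiftFunctor T n) :=
  preservesBinaryBiproduct_of_preservesBiproduct _ X Y

/-- A zero summand can be dropped. -/
noncomputable def biprodIsoOfIsZero (X : T) {Y : T} (hY : IsZero Y) : X ⊞ Y ≅ X where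
  hom := biprod.fst
  inv := biprod.inl
  hom_inv_id := biprod.hom_ext _ _ (by simp) (hY.eq_of_tgt _ _)

variable {P : ObjectProperty T} [P.IsTriangulated] [P.IsClosedUnderIsomorphisms]

/-- If `X` is a retract of `s`, then `X ⊞ X⟦1⟧` is an extension of `s` and `s⟦1⟧`. -/
lemma prop_biprod_shift_of_retract {X s : T} (hs : P s) (h : Retract X s) :
    P (X ⊞ X⟦(1 : ℤ)⟧) := by
  obtain ⟨X', g, d, hT⟩ := distinguished_cocone_triangle h.i
  have hd : d = 0 := by
    have h1 : d ≫ h.i⟦1⟧' = 0 := comp_distTriang_mor_zero₃₁ _ hT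
    have h2 : h.i⟦(1 : ℤ)⟧' ≫ h.r⟦(1 : ℤ)⟧' = 𝟙 _ := by
      rw [← Functor.map_comp, h.retract, CategoryTheory.Functor.map_id]
    rw [← Category.comp_id d, ← h2, reassoc_of% h1, zero_comp]
  obtain ⟨e, -⟩ := exists_iso_binaryBiproduct_of_distTriang _ hT hd
  -- the sum of `X ⟶ X ⊞ X⟦1⟧ ⟶ X⟦1⟧` and `X' ⟶ 0 ⟶ X'⟦1⟧` has outer terms `s` and `s⟦1⟧`
  let D : Bool → Triangle T := fun b => match b with
    | false => binaryBiproductTriangle X (X⟦(1 : ℤ)⟧)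
    | true => (contractibleTriangle X').rotate
  have hD := productTriangle_distinguished D fun b => match b with
    | false => binaryBiproductTriangle_distinguished _ _
    | true => rot_of_distTriang _ (contractible_distinguished X')
  have h2 := P.ext_of_isTriangulatedClosed₂ _ hD
    (P.prop_of_iso (e ≪≫ (prodBoolIso fun b => (D b).obj₁).symm) hs)
    (P.prop_of_iso ((shiftFunctor T (1 : ℤ)).mapIso e ≪≫ (shiftFunctor T (1 : ℤ)).mapBiprod _ _ ≪≫
      (prodBoolIso fun b => (D b).obj₃).symm) (P.le_shift 1 _ hs))
  have h3 : IsZero (D true).obj₂ := isZero_zero T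
  exact P.prop_of_iso (prodBoolIso (fun b => (D b).obj₂) ≪≫ biprodIsoOfIsZero _ h3) h2

variable [HasCoproductsOfShape ℕ T]

/-- The shifts `X⟦1⟧, X, X⟦-1⟧, …`. -/
abbrev downShifts (X : T) (n : ℕ) : T := X⟦(1 - n : ℤ)⟧

lemma nonempty_sigma_downShifts_iso (X : T) :
    Nonempty (∐ downShifts X ≅ X⟦(1 : ℤ)⟧ ⊞ (∐ downShifts X)⟦(-1 : ℤ)⟧) := by
  let hc : IsColimit (Cofan.mk ((∐ downShifts X)⟦(-1 : ℤ)⟧) fun n =>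
      (Sigma.ι (downShifts X) n)⟦(-1 : ℤ)⟧') :=
    Cofan.isColimitMapCoconeEquiv (shiftFunctor T (-1 : ℤ)) _ _
      (isColimitOfPreserves _ (coproductIsCoproduct (downShifts X)))
  let ι' : ∀ n, (downShifts X n)⟦(-1 : ℤ)⟧ ⟶ (∐ downShifts X)⟦(-1 : ℤ)⟧ := fun n =>
    (Sigma.ι (downShifts X) n)⟦(-1 : ℤ)⟧'
  have hι' : ∀ {W : T} (g : ∀ n, (downShifts X n)⟦(-1 : ℤ)⟧ ⟶ W) (n),
      ι' n ≫ Cofan.IsColimit.desc hc g = g n := fun g n => Cofan.IsColimit.fac hc g n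
  let e₀ : downShifts X 0 ≅ X⟦(1 : ℤ)⟧ := (shiftFunctor T _).mapIso (Iso.refl X) ≪≫
    eqToIso (by simp)
  let e : ∀ n : ℕ, downShifts X (n + 1) ≅ (downShifts X n)⟦(-1 : ℤ)⟧ := fun n =>
    (shiftFunctorAdd' T (1 - n : ℤ) (-1) (1 - (n + 1 : ℕ)) (by push_cast; ring)).app X
  refine ⟨
    { hom := Sigma.desc fun n => match n with
        | 0 => e₀.hom ≫ biprod.inl
        | n + 1 => (e n).hom ≫ ι' n ≫ biprod.inr
      inv := biprod.desc (e₀.inv ≫ Sigma.ι _ 0)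
        (Cofan.IsColimit.desc hc fun n => (e n).inv ≫ Sigma.ι _ (n + 1))
      hom_inv_id := Sigma.hom_ext _ _ fun n => ?_
      inv_hom_id := biprod.hom_ext' _ _ ?_ ?_ }⟩
  · cases n with
    | zero => simp
    | succ n => simp [hι']
  · simp
  · refine Cofan.IsColimit.hom_ext hc _ _ fun n => ?_
    change ι' n ≫ _ = ι' n ≫ _
    simp [reassoc_of% (hι' (W := ∐ downShifts X))]

/-- A triangulated subcategory that is closed under the coproducts `⨁ Z⟦-2j⟧` is closed under
retracts. For a retract `X` of `s`, the sum of `X` and its shift is an extension of `s` and its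
shift. The coproduct `V` of all `X⟦1 - n⟧` is therefore in `P`, and `V ≅ X⟦1⟧ ⊞ V⟦-1⟧`. -/
lemma prop_of_retract_of_swindle
    (hP : ∀ Z, P Z → ∃ c : Cofan fun j : ℕ => Z⟦(-2 * j : ℤ)⟧, Nonempty (IsColimit c) ∧ P c.pt)
    {X s : T} (hs : P s) (h : Retract X s) : P X := by
  obtain ⟨c, ⟨hc⟩, hPc⟩ := hP _ (prop_biprod_shift_of_retract hs h)
  -- `ε` sorts `ℕ` into even and odd numbers: `(false, j) ↦ 2 * j` and `(true, j) ↦ 2 * j + 1`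
  let ε := Equiv.boolProdNatEquivNat
  let Y := downShifts X
  have : HasColimitsOfShape (Discrete (Bool × ℕ)) T :=
    hasColimitsOfShape_of_equivalence (Discrete.equivalence ε.symm)
  have hV : P (∐ (Y ∘ ε)) := by
    let e : ∀ j : ℕ, (X ⊞ X⟦(1 : ℤ)⟧)⟦(-2 * j : ℤ)⟧ ≅ (Y ∘ ε) (true, j) ⊞ (Y ∘ ε) (false, j) := fun j =>
      (shiftFunctor T (-2 * j : ℤ)).mapBiprod _ _ ≪≫ biprod.mapIso
        ((shiftFunctorAdd' T (0 : ℤ) (-2 * j) (1 - (ε (true, j) : ℕ)) (by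
          change (0 : ℤ) + _ = 1 - ((2 * j + 1 : ℕ) : ℤ)
          push_cast; ring)).app X ≪≫ (shiftFunctor T _).mapIso ((shiftFunctorZero T ℤ).app X)).symm
        ((shiftFunctorAdd' T (1 : ℤ) (-2 * j) (1 - (ε (false, j) : ℕ)) (by
          change (1 : ℤ) + _ = 1 - ((2 * j : ℕ) : ℤ)
          push_cast; ring)).app X).symm
    let φ : ∀ (s : Cofan fun j : ℕ => (X ⊞ X⟦(1 : ℤ)⟧)⟦(-2 * j : ℤ)⟧) (k : Bool × ℕ),
        (Y ∘ ε) k ⟶ s.pt := fun s k => match k with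
      | (true, j) => biprod.inl ≫ (e j).inv ≫ s.inj j
      | (false, j) => biprod.inr ≫ (e j).inv ≫ s.inj j
    have hc' : IsColimit (Cofan.mk (f := fun j : ℕ => (X ⊞ X⟦(1 : ℤ)⟧)⟦(-2 * j : ℤ)⟧) (∐ (Y ∘ ε))
        fun j => (e j).hom ≫ biprod.desc (Sigma.ι (Y ∘ ε) (true, j)) (Sigma.ι (Y ∘ ε) (false, j))) :=
      Cofan.IsColimit.mk _ (fun s => Sigma.desc (φ s))
        (fun s j => by
          change ((e j).hom ≫ biprod.desc _ _) ≫ _ = _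
          rw [Category.assoc, ← Iso.eq_inv_comp]
          apply biprod.hom_ext' <;> simp [φ])
        fun s m hm => by
          refine Limits.Sigma.hom_ext (f := Y ∘ ε) _ _ fun k => ?_
          obtain ⟨b, j⟩ := k
          have := hm j
          change ((e j).hom ≫ biprod.desc _ _) ≫ m = _ at this
          rw [Category.assoc, ← Iso.eq_inv_comp] at this
          cases b
          · simpa [φ] using congrArg (biprod.inr ≫ ·) this
          · simpa [φ] using congrArg (biprod.inl ≫ ·) this
    exact P.prop_of_iso (hc.coconePointUniqueUpToIso hc') hPc
  obtain ⟨e⟩ := nonempty_sigma_downShifts_iso X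
  have hV' : P (∐ Y) := P.prop_of_iso (Sigma.reindex ε Y) hV
  have h1 := P.ext_of_isTriangulatedClosed₁ _ (binaryBiproductTriangle_distinguished (X⟦(1 : ℤ)⟧)
    ((∐ Y)⟦(-1 : ℤ)⟧)) (P.prop_of_iso e hV') (P.le_shift _ _ hV')
  exact P.prop_of_iso ((shiftEquiv T (1 : ℤ)).unitIso.app X).symm (P.le_shift (-1) _ h1)

end Swindle

/-! ### Compact objects of `K^lf(Proj A, R)` -/

section Coproducts

variable {A : Type u} [Ring A]

lemma proj_coproduct {J : Type*} {Y : J → ModuleCat.{u} A} {c : Cofan Y} (hc : IsColimit c)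
    (h : ∀ j, proj A (Y j)) : proj A c.pt := by
  rw [proj_iff_projective]
  have : ∀ j, Projective (Y j) := fun j => (proj_iff_projective _).1 (h j)
  refine ⟨fun {E X} f e _ => ⟨Cofan.IsColimit.desc hc fun j => Projective.factorThru (c.inj j ≫ f) e,
    Cofan.IsColimit.hom_ext hc _ _ fun j => ?_⟩⟩
  rw [← Category.assoc, Cofan.IsColimit.fac, Projective.factorThru_comp]

lemma isZero_coproduct {J : Type*} {Y : J → ModuleCat.{u} A} {c : Cofan Y} (hc : IsColimit c)
    (h : ∀ j, IsZero (Y j)) : IsZero c.pt :=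
  (IsZero.iff_id_eq_zero _).2 (Cofan.IsColimit.hom_ext hc _ _ fun j => (h j).eq_of_src _ _)

/-- A coproduct with finitely many nonzero summands is a retract of a finite product. -/
lemma exists_retract_of_finset {J : Type} {Y : J → ModuleCat.{u} A} {c : Cofan Y}
    (hc : IsColimit c) (s : Finset J) (hs : ∀ j ∉ s, IsZero (Y j)) :
    Nonempty (Retract c.pt (ModuleCat.of A (∀ j : s, Y j))) := by
  classical
  refine ⟨⟨ModuleCat.ofHom (LinearMap.pi fun j : s => (cofanProj hc j.1).hom),
    ModuleCat.ofHom (∑ j : s, (c.inj j.1).hom ∘ₗ LinearMap.proj j), ?_⟩⟩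
  refine Cofan.IsColimit.hom_ext hc _ _ fun j => ?_
  by_cases hj : j ∈ s
  · ext x
    change (∑ i : s, (c.inj i.1).hom ∘ₗ LinearMap.proj i : (∀ j : s, Y j) →ₗ[A] c.pt)
      (fun i => cofanProj hc i.1 (c.inj j x)) = c.inj j x
    rw [LinearMap.sum_apply, Finset.sum_eq_single (⟨j, hj⟩ : s)]
    · exact congrArg (c.inj j) (ConcreteCategory.congr_hom (inj_cofanProj_self hc j) x)
    · intro i _ hi
      have h := ConcreteCategory.congr_hom (inj_cofanProj_of_ne hc
        (fun h => hi (Subtype.ext h.symm) : j ≠ i.1)) x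
      exact (congrArg (c.inj i.1) h).trans (map_zero (c.inj i.1).hom)
    · exact fun h => (h (Finset.mem_univ _)).elim
  · exact (hs j hj).eq_of_src _ _

lemma finProj_coproduct {J : Type} {Y : J → ModuleCat.{u} A} {c : Cofan Y} (hc : IsColimit c)
    (s : Finset J) (hs : ∀ j ∉ s, IsZero (Y j)) (h : ∀ j, finProj A (Y j)) : finProj A c.pt := by
  obtain ⟨r⟩ := exists_retract_of_finset hc s hs
  have := fun j => (h j).1
  have : ∀ j, Module.Projective A (Y j) := fun j => (h j).2
  have hr : r.r.hom ∘ₗ r.i.hom = LinearMap.id := ModuleCat.hom_ext_iff.1 r.retract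
  have hP : Module.Projective A (ModuleCat.of A (∀ j : s, Y j)) :=
    Module.Projective.of_equiv (DFinsupp.linearEquivFunOnFintype (R := A) (M := fun j : s => Y j))
  exact ⟨Module.Finite.of_surjective (M := ∀ j : s, Y j) r.r.hom fun x =>
      ⟨r.i.hom x, LinearMap.congr_fun hr x⟩,
    Module.Projective.of_split r.i.hom r.r.hom hr⟩

lemma KProj_exists_cofan {J : Type u} (X : J → KProj A) :
    ∃ c : Cofan fun j => (X j).obj, Nonempty (IsColimit c) ∧ KProjProp A c.pt := by
  obtain ⟨d, ⟨hd⟩, hd'⟩ := exists_cofan_quotient fun j => (X j).obj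
  refine ⟨_, hd', fun i => ?_⟩
  exact proj_coproduct (Cofan.isColimitMapCoconeEquiv (HomologicalComplex.eval _ (.up ℤ) i) _ d
      (isColimitOfPreserves _ hd)) fun j => (X j).property i

instance : HasCoproducts.{u} (KProj A) :=
  hasCoproducts_fullSubcategory _ fun _ X => KProj_exists_cofan X

instance (J : Type u) : PreservesColimitsOfShape (Discrete J) (KProjProp A).ι :=
  preservesCoproducts_ι _ KProj_exists_cofan

instance : HasCoproductsOfShape ℕ (KMod A) :=
  have := hasCoproducts_shrink.{0, u} (C := KMod A)
  inferInstance

/-- `K⁺(proj A)` is closed under retracts. -/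
lemma Kplus_of_retract {X Y : KMod A} (hY : Kplus A Y) (h : Retract X Y) : Kplus A X := by
  refine prop_of_retract_of_swindle (fun Z hZ => ?_) hY h
  obtain ⟨C, ⟨hC, N, hN⟩, ⟨e⟩⟩ := hZ
  let F : ℕ → KMod A := fun j => (KMod.quot A).obj (C.as⟦(-2 * j : ℤ)⟧)
  let φ : ∀ j : ℕ, Z⟦(-2 * j : ℤ)⟧ ≅ F j := fun j => (shiftFunctor _ (-2 * j : ℤ)).mapIso e ≪≫
    ((KMod.quot A).commShiftIso (-2 * j : ℤ)).symm.app C.as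
  have := hasCoproducts_shrink.{0, u} (C := ModuleCat.{u} A)
  let D := coproductIsCoproduct fun j : ℕ => C.as⟦(-2 * j : ℤ)⟧
  obtain ⟨hD⟩ := nonempty_isColimit_quotient _ _ D
  have hev := fun i => Cofan.isColimitMapCoconeEquiv (HomologicalComplex.eval _ (.up ℤ) i) _ _
      (isColimitOfPreserves _ D)
  refine ⟨Cofan.mk _ fun j => (φ j).hom ≫ (KMod.quot A).map
    (Sigma.ι (fun j : ℕ => C.as⟦(-2 * j : ℤ)⟧) j), ⟨?_⟩,
    (KMod.quot A).obj (∐ fun j : ℕ => C.as⟦(-2 * j : ℤ)⟧), ⟨fun i => ?_, N, fun i hi => ?_⟩,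
      ⟨Iso.refl _⟩⟩
  · exact Cofan.IsColimit.mk _ (fun s => Cofan.IsColimit.desc hD fun j => (φ j).inv ≫ s.inj j)
      (fun s j => by
        change ((φ j).hom ≫ (KMod.quot A).map
          (Sigma.ι (fun j : ℕ => C.as⟦(-2 * j : ℤ)⟧) j)) ≫ _ = _
        rw [Category.assoc, ← Iso.eq_inv_comp]
        exact Cofan.IsColimit.fac hD _ j) fun s m hm => Cofan.IsColimit.hom_ext hD _ _ fun j => by
          rw [Cofan.IsColimit.fac, Iso.eq_inv_comp, ← hm j]
          exact (Category.assoc _ _ _).symm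
  · refine finProj_coproduct (hev i) (Finset.range (i.natAbs + N.natAbs + 1)) (fun j hj => ?_)
      fun j => hC (i + (-2 * j))
    exact hN (i + (-2 * j)) (by simp at hj; grind)
  · exact isZero_coproduct (hev i) fun j => hN (i + (-2 * j)) (by lia)

end Coproducts

section Klf

variable {R : Type u} [CommRing R] {A : Type u} [Ring A] [Algebra R A]

lemma Klf_exists_cofan (J : Type u) (X : J → Klf R A) :
    ∃ c : Cofan fun j => (X j).obj, Nonempty (IsColimit c) ∧ KlfProp R A c.pt :=
  exists_cofan_of_isLocalising (isLocalising_localisingClosure _) J X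

instance : HasCoproducts.{u} (Klf R A) := hasCoproducts_fullSubcategory _ Klf_exists_cofan

instance (J : Type u) : PreservesColimitsOfShape (Discrete J) (KlfProp R A).ι :=
  preservesCoproducts_ι _ (Klf_exists_cofan J)

variable (R A) in
/-- The objects of `K^lf(Proj A, R)` that belong to `K^{+,b}(proj A)`. -/
abbrev Klf.plusB : ObjectProperty (Klf R A) := (KPlusB R A).inverseImage (KlfProp R A).ι

/-- `K^{+,b}(proj A)` is closed under retracts. -/
lemma kPlusB_of_retract [Module.Finite R A] [Module.Projective R A] {X Y : KProj A}
    (hY : KPlusB R A Y) (h : Retract X Y) : KPlusB R A X := by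
  rw [kPlusB_iff] at hY
  obtain ⟨C, ⟨hC, hb⟩, ⟨e⟩⟩ := Kplus_of_retract hY.1 (h.map (KProjProp A).ι)
  obtain ⟨M, ⟨_, hM⟩, ⟨e'⟩⟩ := hY.2
  refine ⟨C.as, hC, hb, acyclicAt_of_retract (fun n => modProj_of_proj (hC n).2) hM
    (Retract.trans (Iso.retract ((resK R A).mapIso e.symm))
      (((h.map (KProjProp A).ι).map (resK R A)).trans (Iso.retract e'))), ⟨e⟩⟩

lemma kPlusB_eq [Module.Finite R A] [Module.Projective R A] :
    KPlusB R A = (Kpb R A).inverseImage (KProjProp A).ι :=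
  funext fun X => propext (kPlusB_iff X)

/-- Objects of `K^{+,b}(proj A)` are compact, being `R`-homotopy equivalent to bounded complexes of
finitely generated modules. -/
lemma IsFrobenius.compacts_of_kPlusB (hA : IsFrobenius R A) {X : KProj A} (hX : KPlusB R A X) :
    compacts (KProj A) X := by
  have := hA.finite
  have := hA.projective
  rw [kPlusB_iff] at hX
  obtain ⟨T, s, hT, hs, -⟩ := exists_truncation hX 0
  have hs' := rContractiblePlus_trW_of_Kpb hs hT hX
  intro J Y c hc f
  -- morphisms from `X` and from its truncation `T` to complexes of projective modules agree
  have hbij : ∀ Z : KProj A, Function.Bijective fun g : X.obj ⟶ Z.obj => s ≫ g := fun Z =>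
    bijective_precomp_of_rContractiblePlus hs' (hA.termRelInj Z.property)
  obtain ⟨hc'⟩ := nonempty_isColimit_map_ι _ (KProj_exists_cofan (J := J)) Y c hc
  obtain ⟨t, φ, hφ⟩ := compacts_of_KbMod R hT J _ _ hc' (s ≫ f.hom)
  choose ψ hψ using fun j => (hbij (Y j)).2 (φ j)
  refine ⟨t, fun j => ObjectProperty.homMk (ψ j), (KProjProp A).ι.map_injective ?_⟩
  rw [(KProjProp A).ι.map_sum]
  refine (hbij c.pt).1 ?_
  dsimp only at hψ ⊢
  refine hφ.trans ?_
  rw [Preadditive.comp_sum]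
  refine Finset.sum_congr rfl fun j _ => ?_
  rw [← hψ]
  exact Category.assoc _ _ _

lemma IsFrobenius.plusB_le_compacts (hA : IsFrobenius R A) :
    Klf.plusB R A ≤ compacts (Klf R A) := fun X hX =>
  compacts_fullSubcategory Klf_exists_cofan X (hA.compacts_of_kPlusB hX)

/-- The compact objects of `K^lf(Proj A, R)` are the objects of `K^{+,b}(proj A)`. -/
lemma IsFrobenius.compacts_iff (hA : IsFrobenius R A) (X : Klf R A) :
    compacts (Klf R A) X ↔ KPlusB R A X.obj := by
  have := hA.finite
  have := hA.projective
  refine ⟨fun hX => ?_, fun hX => hA.plusB_le_compacts X hX⟩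
  have : (KPlusB R A).IsTriangulated := by rw [kPlusB_eq]; infer_instance
  have : (KPlusB R A).IsClosedUnderIsomorphisms := by rw [kPlusB_eq]; infer_instance
  -- a compact object is a retract of an object of `K^{+,b}(proj A)`
  obtain ⟨Y, hY, ⟨r⟩⟩ := exists_retract_of_compacts hA.plusB_le_compacts
    (localisingClosure_inverseImage (KPlusB R A)) hX
  exact kPlusB_of_retract hY (r.map (KlfProp R A).ι)

/-- Complexes whose terms are quotients of the modules `A ^ n`, as a small set of data. -/
structure ComplexData (A : Type u) [Ring A] : Type u where
  rank : ℤ → ℕ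
  rel : ∀ i, Submodule A (Fin (rank i) → A)
  d : ∀ i, ((Fin (rank i) → A) ⧸ rel i) →ₗ[A] ((Fin (rank (i + 1)) → A) ⧸ rel (i + 1))
  d_comp_d : ∀ i, d (i + 1) ∘ₗ d i = 0

/-- The complex given by such data. -/
noncomputable def ComplexData.complex (D : ComplexData A) : CochainComplex (ModuleCat.{u} A) ℤ :=
  CochainComplex.of (fun i => ModuleCat.of A ((Fin (D.rank i) → A) ⧸ D.rel i))
    (fun i => ModuleCat.ofHom (D.d i)) fun i => ModuleCat.hom_ext (D.d_comp_d i)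

lemma exists_complexData (C : CochainComplex (ModuleCat.{u} A) ℤ) (h : ∀ i, Module.Finite A (C.X i)) :
    ∃ D : ComplexData A, Nonempty (C ≅ D.complex) := by
  choose n f hf using fun i => Module.Finite.exists_fin' A (C.X i)
  let e : ∀ i, ((Fin (n i) → A) ⧸ LinearMap.ker (f i)) ≃ₗ[A] C.X i := fun i =>
    (f i).quotKerEquivOfSurjective (hf i)
  let D : ComplexData A :=
    { rank := n
      rel := fun i => LinearMap.ker (f i)
      d := fun i => (e (i + 1)).symm.toLinearMap ∘ₗ (C.d i (i + 1)).hom ∘ₗ (e i).toLinearMap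
      d_comp_d := fun i => by
        ext x
        have : ∀ x, C.d (i + 1) (i + 1 + 1) (C.d i (i + 1) x) = 0 := fun x =>
          ConcreteCategory.congr_hom (C.d_comp_d i (i + 1) (i + 1 + 1)) x
        simp [this] }
  refine ⟨D, ⟨HomologicalComplex.Hom.isoOfComponents (fun i => (e i).symm.toModuleIso) ?_⟩⟩
  rintro i j rfl
  have : D.complex.d i (i + 1) = ModuleCat.ofHom (D.d i) :=
    CochainComplex.of_d (fun i => ModuleCat.of A ((Fin (D.rank i) → A) ⧸ D.rel i))
      (fun i => ModuleCat.ofHom (D.d i)) i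
  rw [this]
  ext x
  change (e (i + 1)).symm (C.d i (i + 1) (e i ((e i).symm x))) = _
  rw [LinearEquiv.apply_symm_apply]
  rfl

/-- The objects of `K^{+,b}(proj A)` generate `K^lf(Proj A, R)`; up to isomorphism they are
described by the small type `ComplexData A`. -/
lemma IsFrobenius.isCompactlyGeneratedTri (hA : IsFrobenius R A) :
    IsCompactlyGeneratedTri (Klf R A) := by
  refine ⟨inferInstance, { D : ComplexData A // ∃ (h : KProjProp A ((KMod.quot A).obj D.complex))
    (h' : KlfProp R A ⟨_, h⟩), Klf.plusB R A ⟨⟨_, h⟩, h'⟩ }, fun D => ⟨⟨_, D.2.choose⟩,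
      D.2.choose_spec.choose⟩, fun D => hA.plusB_le_compacts _ D.2.choose_spec.choose_spec,
    fun X Q hQ hS => localisingClosure_inverseImage (KPlusB R A) X Q hQ fun Y hY => ?_⟩
  have := hQ.isClosedUnderIsomorphisms
  obtain ⟨C, hC, hb, hac, ⟨e⟩⟩ := id hY
  obtain ⟨D, ⟨i⟩⟩ := exists_complexData C fun i => (hC i).1
  have h1 : KProjProp A ((KMod.quot A).obj D.complex) := fun j => (proj A).prop_of_iso
    ((HomologicalComplex.eval _ _ j).mapIso i) (hC j).2
  let e' : Y.obj ≅ (⟨_, h1⟩ : KProj A) := (KProjProp A).isoMk (e ≪≫ (KMod.quot A).mapIso i)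
  have h2 : KlfProp R A ⟨_, h1⟩ := (KlfProp R A).prop_of_iso e' Y.property
  have h3 : Klf.plusB R A ⟨⟨_, h1⟩, h2⟩ := ⟨C, hC, hb, hac, ⟨(KMod.quot A).mapIso i.symm⟩⟩
  exact Q.prop_of_iso ((KlfProp R A).isoMk e'.symm) (hS _ ⟨⟨D, h1, h2, h3⟩⟩)

end Klf

section Equivalence

variable {R : Type u} [CommRing R] {A : Type u} [Ring A] [Algebra R A]
  [HasDerivedCategory.{w} (ModuleCat.{u} A)]

instance : NatTrans.CommShift (DbMod.canIso R A).hom ℤ := by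
  unfold DbMod.canIso
  infer_instance

instance : (DbMod.can R A).IsTriangulated := by
  have : (AcbMod R A).trW.Q.mapArrow.EssSurj :=
    Localization.essSurj_mapArrow _ (AcbMod R A).trW
  exact Functor.isTriangulated_of_precomp_iso (DbMod.canIso R A)

/-- Both `K^lf(Proj A, R)^c` and `D^b(mod(A, R))` embed in `D(Mod A)`, with the same essential
image. -/
lemma IsFrobenius.exists_equivalence (hA : IsFrobenius R A) :
    ∃ (E : (compacts (Klf R A)).FullSubcategory ≌ DbMod R A) (_ : E.functor.CommShift ℤ)
        (e : E.functor ⋙ DbMod.can R A ≅ (compacts (Klf R A)).ι ⋙ Klf.q R A),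
        E.functor.IsTriangulated ∧ NatTrans.CommShift e.hom ℤ := by
  have := hA.finite
  have := hA.projective
  have := hA.full_can
  have := hA.faithful_can
  let H := (compacts (Klf R A)).ι ⋙ Klf.q R A
  let G := DbMod.can R A
  have hKpb : ∀ X : (compacts (Klf R A)).FullSubcategory, Kpb R A X.obj.obj.obj := fun X =>
    (kPlusB_iff _).1 ((hA.compacts_iff X.obj).1 X.property)
  have hbij : ∀ X Y : (compacts (Klf R A)).FullSubcategory,
      Function.Bijective (DerivedCategory.Qh.map : (X.obj.obj.obj ⟶ Y.obj.obj.obj) → _) :=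
    fun X Y => hA.bijective_Qh_map_Kpb (hKpb X) (hKpb Y).1
  have : H.Faithful := ⟨fun {X Y f g} h => by
    ext1; ext1; ext1
    exact (hbij X Y).1 h⟩
  have : H.Full := ⟨fun {X Y} f => by
    obtain ⟨g, hg⟩ := (hbij X Y).2 f
    exact ⟨ObjectProperty.homMk (ObjectProperty.homMk (ObjectProperty.homMk g)), hg⟩⟩
  have hG : ∀ X, G.essImage (H.obj X) := fun X => by
    obtain ⟨T, s, hT, hs, -⟩ := exists_truncation (hKpb X) 0
    have hs' := isIso_Qh_of_rContractible hs
    exact ⟨(AcbMod R A).trW.Q.obj ⟨T, hT⟩, ⟨(DbMod.canIso R A).app ⟨T, hT⟩ ≪≫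
      @asIso _ _ _ _ _ hs'⟩⟩
  let F := Functor.essImage.liftFunctor H G hG
  let e : F ⋙ G ≅ H := Functor.essImage.liftFunctorCompIso H G hG
  have : F.Faithful := Functor.Faithful.of_comp_iso e
  have : F.Full := Functor.Full.of_comp_faithful_iso e
  have : F.EssSurj := ⟨fun Z => by
    obtain ⟨M, ⟨i⟩⟩ : (AcbMod R A).trW.Q.essImage Z :=
      (Localization.essSurj (AcbMod R A).trW.Q (AcbMod R A).trW).mem_essImage Z
    obtain ⟨I, g, hI, hg⟩ := hA.exists_coresolution M.property
    have hg' := isIso_Qh_of_rContractible hg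
    obtain ⟨C, ⟨hC, hb⟩, ⟨k⟩⟩ := hI.1
    let X₁ : KProj A := ⟨C, fun n => (hC n).2⟩
    have hX₁ : KPlusB R A X₁ := (kPlusB_iff X₁).2 ((Kpb R A).prop_of_iso k hI)
    let X₂ : Klf R A := ⟨X₁, le_localisingClosure _ _ hX₁⟩
    let X : (compacts (Klf R A)).FullSubcategory := ⟨X₂, (hA.compacts_iff X₂).2 hX₁⟩
    refine ⟨X, ⟨G.preimageIso (e.app X ≪≫ (?_ : H.obj X ≅ _) ≪≫ G.mapIso i)⟩⟩
    exact DerivedCategory.Qh.mapIso k.symm ≪≫ (@asIso _ _ _ _ _ hg').symm ≪≫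
      ((DbMod.canIso R A).app M).symm⟩
  have : F.IsEquivalence := {}
  let E := F.asEquivalence
  let i1 : F.CommShift ℤ := Functor.CommShift.ofComp e ℤ
  have i2 : NatTrans.CommShift e.hom ℤ := Functor.CommShift.ofComp_compatibility e ℤ
  exact ⟨E, i1, e, (Functor.isTriangulated_iff_comp_right e).2 inferInstance, i2⟩

end Equivalence

/-! ### Brown representability -/

section Brown

set_option linter.unusedSectionVars false

open scoped ZeroObject

universe u'

variable {T : Type u} [Category.{v} T] [Preadditive T] [HasZeroObject T] [HasShift T ℤ]
  [∀ n : ℤ, (shiftFunctor T n).Additive] [Pretriangulated T]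
  {T' : Type u'} [Category.{v} T'] [Preadditive T'] [HasZeroObject T'] [HasShift T' ℤ]
  [∀ n : ℤ, (shiftFunctor T' n).Additive] [Pretriangulated T']

/-- For a sequence `X 0 ⟶ X 1 ⟶ ⋯` and a compact object `C`, the map
`1 - shift : ∐ X k ⟶ ∐ X k` induces an injection on `Hom(C, -)`. -/
lemma eq_zero_of_comp_shift {C : T} (hC : compacts T C) {X : ℕ → T}
    (u : ∀ k, X k ⟶ X (k + 1)) {c : Cofan fun k : ULift.{v} ℕ => X k.down} (hc : IsColimit c)
    {σ : c.pt ⟶ c.pt} (hσ : ∀ k : ℕ, c.inj ⟨k⟩ ≫ σ = u k ≫ c.inj ⟨k + 1⟩) {f : C ⟶ c.pt}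
    (hf : f ≫ σ = f) : f = 0 := by
  classical
  have h0 : σ ≫ cofanProj hc ⟨0⟩ = 0 := by
    refine Cofan.IsColimit.hom_ext hc _ _ fun ⟨k⟩ => ?_
    rw [← Category.assoc, hσ, Category.assoc, inj_cofanProj_of_ne hc (by simp), comp_zero, comp_zero]
  have h1 : ∀ n, σ ≫ cofanProj hc ⟨n + 1⟩ = cofanProj hc ⟨n⟩ ≫ u n := fun n => by
    refine Cofan.IsColimit.hom_ext hc _ _ fun ⟨k⟩ => ?_
    rw [← Category.assoc, hσ, Category.assoc]
    by_cases h : k = n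
    · subst h
      rw [inj_cofanProj_self hc ⟨k + 1⟩, ← Category.assoc, inj_cofanProj_self hc ⟨k⟩]
      exact (Category.comp_id _).trans (Category.id_comp _).symm
    · rw [inj_cofanProj_of_ne hc (by simpa using h), ← Category.assoc,
        inj_cofanProj_of_ne hc (by simpa using h), comp_zero, zero_comp]
  have h : ∀ n, f ≫ cofanProj hc ⟨n⟩ = 0 := by
    intro n
    induction n with
    | zero => rw [← hf, Category.assoc, h0, comp_zero]
    | succ n ih => rw [← hf, Category.assoc, h1, ← Category.assoc, ih, zero_comp]
  obtain ⟨s, φ, hφ⟩ := hC _ _ c hc f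
  have h2 : ∀ j ∈ s, φ j = 0 := fun j hj => by
    rw [← h j.down, hφ, Preadditive.sum_comp, Finset.sum_eq_single j]
    · rw [Category.assoc, inj_cofanProj_self]
      exact (Category.comp_id _).symm
    · intro i _ hi
      rw [Category.assoc, inj_cofanProj_of_ne hc hi, comp_zero]
    · exact fun h => (h hj).elim
  rw [hφ]
  exact Finset.sum_eq_zero fun j hj => by rw [h2 j hj, zero_comp]

variable (F : T ⥤ T') [F.CommShift ℤ] [F.IsTriangulated]

/-- A morphism `F Y ⟶ Y'` can be modified so as to kill all morphisms `C j ⟶ Y` that become zero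
in `Y'`. -/
lemma exists_kill [HasCoproducts.{v} T] [∀ J : Type v, PreservesColimitsOfShape (Discrete J) F]
    {J : Type v} (C : J → T) {Y' : T'} (a : CostructuredArrow F Y') :
    ∃ (b : CostructuredArrow F Y') (v : a ⟶ b), ∀ (j : J) (g : C j ⟶ a.left),
      F.map g ≫ a.hom = 0 → g ≫ v.left = 0 := by
  -- the cone of the coproduct of all morphisms to be killed
  let I := Σ j : J, { g : C j ⟶ a.left // F.map g ≫ a.hom = 0 }
  let N : I → T := fun i => C i.1
  let hN := coproductIsCoproduct N
  let p : ∐ N ⟶ a.left := Sigma.desc fun i => i.2.1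
  obtain ⟨Z, q, r, h⟩ := distinguished_cocone_triangle p
  have hFN : IsColimit (Cofan.mk (F.obj (∐ N)) fun j => F.map (Sigma.ι N j)) :=
    Cofan.isColimitMapCoconeEquiv F _ _ (isColimitOfPreserves F hN)
  have h0 : F.map p ≫ a.hom = 0 := Cofan.IsColimit.hom_ext hFN _ _ fun i => by
    change F.map (Sigma.ι N i) ≫ F.map p ≫ a.hom = F.map (Sigma.ι N i) ≫ 0
    rw [← F.map_comp_assoc, Sigma.ι_desc, comp_zero]
    exact i.2.2
  obtain ⟨e, he⟩ : ∃ e : F.obj Z ⟶ Y', a.hom = F.map q ≫ e :=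
    Triangle.yoneda_exact₂ _ (F.map_distinguished _ h) a.hom h0
  refine ⟨CostructuredArrow.mk e, CostructuredArrow.homMk q he.symm, fun j g hg => ?_⟩
  have h1 : p ≫ q = 0 := comp_distTriang_mor_zero₁₂ _ h
  change g ≫ q = 0
  rw [show g = Sigma.ι N ⟨j, g, hg⟩ ≫ p from (Sigma.ι_desc (f := N) (fun i : I => i.2.1) ⟨j, g, hg⟩).symm, Category.assoc, h1,
    comp_zero]

/-- Every object of `T'` receives a morphism `F Y ⟶ Y'` that is universal with respect to a given
set of compact objects of `T`. -/
lemma exists_universal_of_compacts [HasCoproducts.{v} T]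
    [∀ J : Type v, PreservesColimitsOfShape (Discrete J) F] {J : Type v} (C : J → T)
    (hC : ∀ j, compacts T (C j)) (Y' : T') : ∃ (Y : T) (ε : F.obj Y ⟶ Y'),
      ∀ j, Function.Bijective fun f : C j ⟶ Y => F.map f ≫ ε := by
  choose next v hv using exists_kill F C (Y' := Y')
  let I := Σ j : J, (F.obj (C j) ⟶ Y')
  let N : I → T := fun i => C i.1
  have hFN : IsColimit (Cofan.mk (F.obj (∐ N)) fun j => F.map (Sigma.ι N j)) :=
    Cofan.isColimitMapCoconeEquiv F _ _ (isColimitOfPreserves F (coproductIsCoproduct N))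
  -- `a₀` is surjective on morphisms from the `F (C j)`; killing the kernels successively and passing
  -- to the homotopy colimit `Y`, the cone of `1 - σ`, makes it injective as well
  let a₀ : CostructuredArrow F Y' := CostructuredArrow.mk
    (Cofan.IsColimit.desc hFN fun i => i.2 : F.obj (∐ N) ⟶ Y')
  let a : ℕ → CostructuredArrow F Y' := fun n => Nat.rec a₀ (fun _ b => next b) n
  let w : ∀ n, a n ⟶ a (n + 1) := fun n => v (a n)
  let X : ℕ → T := fun n => (a n).left
  let u : ∀ k, X k ⟶ X (k + 1) := fun k => (w k).left
  have hu : ∀ k, F.map (u k) ≫ (a (k + 1)).hom = (a k).hom := fun k => CostructuredArrow.w (w k)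
  let c := Cofan.mk _ (Sigma.ι fun k : ULift.{v} ℕ => X k.down)
  have hc : IsColimit c := coproductIsCoproduct _
  have hFc : IsColimit (Cofan.mk (F.obj c.pt) fun j => F.map (c.inj j)) :=
    Cofan.isColimitMapCoconeEquiv F _ _ (isColimitOfPreserves F hc)
  let σ : c.pt ⟶ c.pt := Cofan.IsColimit.desc hc fun k => u k.down ≫ c.inj ⟨k.down + 1⟩
  have hσ : ∀ k : ℕ, c.inj ⟨k⟩ ≫ σ = u k ≫ c.inj ⟨k + 1⟩ := fun k =>
    Cofan.IsColimit.fac hc _ ⟨k⟩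
  obtain ⟨Y, p, δ, hY⟩ := distinguished_cocone_triangle (𝟙 c.pt - σ)
  have hp : σ ≫ p = p := by
    have : (𝟙 c.pt - σ) ≫ p = 0 := comp_distTriang_mor_zero₁₂ _ hY
    rw [Preadditive.sub_comp, Category.id_comp, sub_eq_zero] at this
    exact this.symm
  let ε' : F.obj c.pt ⟶ Y' := Cofan.IsColimit.desc hFc fun k => (a k.down).hom
  have hε' : ∀ k, F.map (c.inj ⟨k⟩) ≫ ε' = (a k).hom := fun k => Cofan.IsColimit.fac hFc _ ⟨k⟩
  have hσε : F.map (𝟙 c.pt - σ) ≫ ε' = 0 := Cofan.IsColimit.hom_ext hFc _ _ fun ⟨k⟩ => by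
    change F.map (c.inj ⟨k⟩) ≫ F.map (𝟙 c.pt - σ) ≫ ε' = F.map (c.inj ⟨k⟩) ≫ 0
    rw [← F.map_comp_assoc, Preadditive.comp_sub, Category.comp_id, hσ, F.map_sub,
      Preadditive.sub_comp, F.map_comp, Category.assoc, hε', hε', hu, sub_self, comp_zero]
  obtain ⟨ε, hε⟩ : ∃ ε : F.obj Y ⟶ Y', ε' = F.map p ≫ ε :=
    Triangle.yoneda_exact₂ _ (F.map_distinguished _ hY) ε' hσε
  refine ⟨Y, ε, fun j => ⟨?_, fun f => ?_⟩⟩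
  · have hinj : ∀ g : C j ⟶ Y, F.map g ≫ ε = 0 → g = 0 := by
      intro g hg
      have h1 : g ≫ δ = 0 := by
        have hc₁ : IsColimit (Cofan.mk (c.pt⟦(1 : ℤ)⟧) fun j => (c.inj j)⟦(1 : ℤ)⟧') :=
          Cofan.isColimitMapCoconeEquiv (shiftFunctor T (1 : ℤ)) _ c (isColimitOfPreserves _ hc)
        refine eq_zero_of_comp_shift (hC j) (X := fun k => (X k)⟦(1 : ℤ)⟧) (fun k => (u k)⟦1⟧') hc₁
          (σ := σ⟦1⟧') (fun k => ?_) ?_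
        · change (c.inj ⟨k⟩)⟦(1 : ℤ)⟧' ≫ σ⟦1⟧' = (u k)⟦1⟧' ≫ (c.inj ⟨k + 1⟩)⟦1⟧'
          rw [← Functor.map_comp, hσ, Functor.map_comp]
        · have h2 : δ ≫ (𝟙 c.pt - σ)⟦1⟧' = 0 := comp_distTriang_mor_zero₃₁ _ hY
          rw [Functor.map_sub, CategoryTheory.Functor.map_id, Preadditive.comp_sub,
            Category.comp_id, sub_eq_zero] at h2
          rw [Category.assoc]
          exact congrArg (g ≫ ·) h2.symm
      obtain ⟨h, hh⟩ : ∃ h : C j ⟶ c.pt, g = h ≫ p := Triangle.coyoneda_exact₃ _ hY g h1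
      have hpush : ∀ m n, m ≤ n → ∃ t : X m ⟶ X n, c.inj ⟨m⟩ ≫ p = t ≫ c.inj ⟨n⟩ ≫ p := by
        intro m n hmn
        induction n, hmn using Nat.le_induction with
        | base => exact ⟨𝟙 _, (Category.id_comp _).symm⟩
        | succ n _ ih =>
          obtain ⟨t, ht⟩ := ih
          refine ⟨t ≫ u n, ?_⟩
          rw [ht, Category.assoc, ← Category.assoc (u n), ← hσ, Category.assoc, hp]
      -- by compactness, `h` factors through a finite stage `X m`
      obtain ⟨m, ψ, hm⟩ : ∃ (m : ℕ) (ψ : C j ⟶ X m), h ≫ p = ψ ≫ c.inj ⟨m⟩ ≫ p := by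
        obtain ⟨s, φ, hs⟩ := hC j _ _ c hc h
        rw [hs]
        refine Finset.sum_induction _ (fun h : C j ⟶ c.pt => ∃ (m : ℕ) (ψ : C j ⟶ X m),
          h ≫ p = ψ ≫ c.inj ⟨m⟩ ≫ p) ?_ ⟨0, 0, by simp⟩ ?_
        · rintro h₁ h₂ ⟨m₁, ψ₁, e₁⟩ ⟨m₂, ψ₂, e₂⟩
          obtain ⟨t₁, ht₁⟩ := hpush m₁ (max m₁ m₂) (le_max_left _ _)
          obtain ⟨t₂, ht₂⟩ := hpush m₂ (max m₁ m₂) (le_max_right _ _)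
          refine ⟨max m₁ m₂, ψ₁ ≫ t₁ + ψ₂ ≫ t₂, ?_⟩
          rw [Preadditive.add_comp, Preadditive.add_comp, e₁, e₂, ht₁, ht₂, Category.assoc,
            Category.assoc]
        · exact fun i _ => ⟨i.down, φ i, Category.assoc _ _ _⟩
      -- the morphism `ψ` becomes zero in `Y'`, so it is killed in the next stage
      have h3 : ψ ≫ u m = 0 := hv (a m) j ψ (by
        rw [← hε', ← F.map_comp_assoc, hε, ← F.map_comp_assoc, Category.assoc, ← hm, ← hh, hg])
      rw [hh, hm, ← hp, ← Category.assoc (c.inj _), hσ, Category.assoc, ← Category.assoc ψ, h3,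
        zero_comp]
    intro g₁ g₂ h
    rw [← sub_eq_zero]
    apply hinj
    rw [F.map_sub, Preadditive.sub_comp, sub_eq_zero]
    exact h
  · refine ⟨(Sigma.ι N ⟨j, f⟩ : C j ⟶ X 0) ≫ c.inj ⟨0⟩ ≫ p, ?_⟩
    change F.map _ ≫ ε = f
    rw [F.map_comp, F.map_comp, Category.assoc, Category.assoc, ← hε, hε']
    exact Cofan.IsColimit.fac hFN _ ⟨j, f⟩

/-- Brown representability: a triangulated functor that preserves coproducts has a right adjoint if
its source is compactly generated. -/
lemma isLeftAdjoint_of_isCompactlyGeneratedTri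
    [∀ J : Type v, PreservesColimitsOfShape (Discrete J) F] (hT : IsCompactlyGeneratedTri T) :
    F.IsLeftAdjoint := by
  obtain ⟨h, ι, S, hS, hgen⟩ := hT
  have key : ∀ Y' : T', ∃ (Y : T) (ε : F.obj Y ⟶ Y'),
      ∀ X, Function.Bijective fun f : X ⟶ Y => F.map f ≫ ε := fun Y' => by
    obtain ⟨Y, ε, hY⟩ := exists_universal_of_compacts F
      (fun i : ι × ULift.{v} ℤ => (S i.1)⟦i.2.down⟧)
      (fun i => (compacts T).le_shift i.2.down _ (hS i.1)) Y'
    refine ⟨Y, ε, fun X => (hgen X _ (isLocalising_bijectiveOn F ε) ?_).bijective⟩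
    rintro _ ⟨i⟩ n
    exact hY (i, ⟨n⟩)
  have : ∀ Y' : T', HasTerminal (CostructuredArrow F Y') := fun Y' => by
    obtain ⟨Y, ε, hY⟩ := key Y'
    refine IsTerminal.hasTerminal (X := CostructuredArrow.mk ε)
      (IsTerminal.ofUniqueHom (fun a => CostructuredArrow.homMk ((hY a.left).2 a.hom).choose
        ((hY a.left).2 a.hom).choose_spec) fun a m => ?_)
    ext
    apply (hY a.left).1
    exact (CostructuredArrow.w m).trans ((hY a.left).2 a.hom).choose_spec.symm
  exact isLeftAdjoint_of_costructuredArrowTerminals F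

end Brown

/-! ### The symmetric monoidal category of complexes -/

section TensorComplex

variable {C : Type u} [Category.{v} C] [MonoidalCategory C] [Preadditive C] [MonoidalPreadditive C]
  [HasZeroObject C] [HasColimitsOfSize.{0, 0} C]
  [∀ X : C, PreservesColimitsOfSize.{0, 0} ((curriedTensor C).obj X)]
  [∀ X : C, PreservesColimitsOfSize.{0, 0} ((curriedTensor C).flip.obj X)]

-- Shortcuts, since the search for these instances from colimits in `C` is slow.

instance (X Y : CochainComplex C ℤ) : HomologicalComplex.HasTensor X Y := inferInstance

noncomputable instance : MonoidalCategoryStruct (CochainComplex C ℤ) := inferInstance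

noncomputable instance : MonoidalCategory (CochainComplex C ℤ) := inferInstance

/-- The inclusion of the summand `X p ⊗ Y q` of the degree `n` part of `X ⊗ Y`. -/
noncomputable def tensorι (X Y : CochainComplex C ℤ) (p q n : ℤ) (h : p + q = n) :
    X.X p ⊗ Y.X q ⟶ (X ⊗ Y).X n :=
  HomologicalComplex.ιTensorObj X Y p q n h

variable {X Y Z X' Y' : CochainComplex C ℤ}

lemma tensor_hom_ext {n : ℤ} {A : C} {f g : (X ⊗ Y).X n ⟶ A}
    (h : ∀ p q (h : p + q = n), tensorι X Y p q n h ≫ f = tensorι X Y p q n h ≫ g) : f = g :=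
  HomologicalComplex.mapBifunctor.hom_ext h

lemma tensorι_tensorHom (f : X ⟶ X') (g : Y ⟶ Y') (p q n : ℤ) (h : p + q = n) :
    tensorι X Y p q n h ≫ (f ⊗ₘ g).f n = (f.f p ⊗ₘ g.f q) ≫ tensorι X' Y' p q n h := by
  refine (HomologicalComplex.ι_mapBifunctorMap f g (curriedTensor C) (.up ℤ) p q n h).trans ?_
  rw [MonoidalCategory.tensorHom_def, Category.assoc]
  rfl

lemma tensorι_whiskerRight (f : X ⟶ X') (p q n : ℤ) (h : p + q = n) :
    tensorι X Y p q n h ≫ (f ▷ Y).f n = f.f p ▷ Y.X q ≫ tensorι X' Y p q n h := by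
  rw [← tensorHom_id, tensorι_tensorHom, HomologicalComplex.id_f, tensorHom_id]

lemma tensorι_whiskerLeft (g : Y ⟶ Y') (p q n : ℤ) (h : p + q = n) :
    tensorι X Y p q n h ≫ (X ◁ g).f n = X.X p ◁ g.f q ≫ tensorι X Y' p q n h := by
  rw [← id_tensorHom, tensorι_tensorHom, HomologicalComplex.id_f, id_tensorHom]

lemma tensorι_associator (p q r a b n : ℤ) (ha : p + q = a) (hb : q + r = b) (h : a + r = n) :
    tensorι X Y p q a ha ▷ Z.X r ≫ tensorι (X ⊗ Y) Z a r n h ≫ (α_ X Y Z).hom.f n =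
      (α_ _ _ _).hom ≫ X.X p ◁ tensorι Y Z q r b hb ≫ tensorι X (Y ⊗ Z) p b n (by lia) := by
  have := GradedObject.Monoidal.ιTensorObj₃'_associator_hom (X₁ := X.X) (X₂ := Y.X) (X₃ := Z.X)
    p q r n (by lia)
  rw [GradedObject.Monoidal.ιTensorObj₃'_eq _ _ _ p q r n _ a ha,
    GradedObject.Monoidal.ιTensorObj₃_eq _ _ _ p q r n _ b hb, Category.assoc] at this
  exact this

lemma tensorι_associator_inv (p q r a b n : ℤ) (ha : p + q = a) (hb : q + r = b) (h : p + b = n) :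
    X.X p ◁ tensorι Y Z q r b hb ≫ tensorι X (Y ⊗ Z) p b n h ≫ (α_ X Y Z).inv.f n =
      (α_ _ _ _).inv ≫ tensorι X Y p q a ha ▷ Z.X r ≫ tensorι (X ⊗ Y) Z a r n (by lia) := by
  rw [Iso.eq_inv_comp, ← reassoc_of% tensorι_associator p q r a b n ha hb (by lia),
    ← HomologicalComplex.comp_f, Iso.hom_inv_id, HomologicalComplex.id_f, Category.comp_id]

lemma tensor₃_hom_ext {n : ℤ} {A : C} {f g : (X ⊗ Y ⊗ Z).X n ⟶ A}
    (h : ∀ p q r b (hb : q + r = b) (h : p + b = n),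
      X.X p ◁ tensorι Y Z q r b hb ≫ tensorι X (Y ⊗ Z) p b n h ≫ f =
        X.X p ◁ tensorι Y Z q r b hb ≫ tensorι X (Y ⊗ Z) p b n h ≫ g) : f = g := by
  refine GradedObject.Monoidal.tensorObj₃_ext (X₁ := X.X) (X₂ := Y.X) (X₃ := Z.X) f g
    fun p q r hn => ?_
  have := h p q r (q + r) rfl (by lia)
  rw [← Category.assoc, ← Category.assoc] at this
  exact this

lemma tensor₃_hom_ext' {n : ℤ} {A : C} {f g : ((X ⊗ Y) ⊗ Z).X n ⟶ A}
    (h : ∀ p q r a (ha : p + q = a) (h : a + r = n),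
      tensorι X Y p q a ha ▷ Z.X r ≫ tensorι (X ⊗ Y) Z a r n h ≫ f =
        tensorι X Y p q a ha ▷ Z.X r ≫ tensorι (X ⊗ Y) Z a r n h ≫ g) : f = g := by
  refine GradedObject.Monoidal.tensorObj₃'_ext (X₁ := X.X) (X₂ := Y.X) (X₃ := Z.X) f g
    fun p q r hn => ?_
  have := h p q r (p + q) rfl (by lia)
  rw [← Category.assoc, ← Category.assoc] at this
  exact this

lemma tensorι_d (p q n m : ℤ) (h : p + q = n) (hm : n + 1 = m) :
    tensorι X Y p q n h ≫ (X ⊗ Y).d n m =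
      X.d p (p + 1) ▷ Y.X q ≫ tensorι X Y (p + 1) q m (by lia) +
        p.negOnePow • X.X p ◁ Y.d q (q + 1) ≫ tensorι X Y p (q + 1) m (by lia) := by
  have h1 := HomologicalComplex.mapBifunctor.ι_D₁ X Y (curriedTensor C) (.up ℤ) n m p q h
  have h2 := HomologicalComplex.mapBifunctor.ι_D₂ X Y (curriedTensor C) (.up ℤ) n m p q h
  have h3 := HomologicalComplex.mapBifunctor.d_eq X Y (curriedTensor C) (.up ℤ) n m
  rw [HomologicalComplex.mapBifunctor.d₁_eq X Y (curriedTensor C) _ (i₁' := p + 1) rfl q m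
      (by change p + 1 + q = m; lia)] at h1
  rw [HomologicalComplex.mapBifunctor.d₂_eq X Y (curriedTensor C) _ p (i₂' := q + 1) rfl m
      (by change p + (q + 1) = m; lia)] at h2
  refine (congrArg (HomologicalComplex.ιTensorObj X Y p q n h ≫ ·) h3).trans ?_
  refine (Preadditive.comp_add _ _ _ _ _ _).trans ?_
  refine congrArg₂ (· + ·) (h1.trans ?_) (h2.trans ?_)
  · change (1 : ℤˣ) • _ = _
    rw [one_smul]
    rfl
  · rfl

lemma leftUnitor_inv_f (n : ℤ) : (λ_ X).inv.f n = (λ_ (X.X n)).inv ≫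
    (HomologicalComplex.singleObjXSelf (.up ℤ) 0 (𝟙_ C)).inv ▷ X.X n ≫
      tensorι (𝟙_ (CochainComplex C ℤ)) X 0 n n (zero_add n) :=
  HomologicalComplex.leftUnitor'_inv X n

lemma rightUnitor_inv_f (n : ℤ) : (ρ_ X).inv.f n = (ρ_ (X.X n)).inv ≫
    X.X n ◁ (HomologicalComplex.singleObjXSelf (.up ℤ) 0 (𝟙_ C)).inv ≫
      tensorι X (𝟙_ (CochainComplex C ℤ)) n 0 n (add_zero n) :=
  HomologicalComplex.rightUnitor'_inv X n

end TensorComplex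

section Braided

set_option linter.unusedSectionVars false

variable {C : Type u} [Category.{v} C] [MonoidalCategory C] [Preadditive C] [MonoidalPreadditive C]
  [HasZeroObject C] [HasColimitsOfSize.{0, 0} C]
  [∀ X : C, PreservesColimitsOfSize.{0, 0} ((curriedTensor C).obj X)]
  [∀ X : C, PreservesColimitsOfSize.{0, 0} ((curriedTensor C).flip.obj X)]

/-- The braiding `x ⊗ y ↦ (-1)^{pq} y ⊗ x`, as a morphism of the monoidal category of complexes. -/
noncomputable def braidHom [BraidedCategory C] (X Y : CochainComplex C ℤ) : X ⊗ Y ⟶ Y ⊗ X :=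
  braidComplex X Y

lemma units_smul_whiskerRight (s : ℤˣ) {A B : C} (f : A ⟶ B) (W : C) :
    (s • f) ▷ W = s • (f ▷ W) :=
  ((curriedTensor C).flip.obj W).map_units_smul s f

lemma whiskerLeft_units_smul (s : ℤˣ) {A B : C} (f : A ⟶ B) (W : C) :
    W ◁ (s • f) = s • (W ◁ f) :=
  ((curriedTensor C).obj W).map_units_smul s f

lemma tensorι_braidHom [BraidedCategory C] (X Y : CochainComplex C ℤ) (p q n : ℤ)
    (h : p + q = n) :
    tensorι X Y p q n h ≫ (braidHom X Y).f n = (p * q).negOnePow •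
      ((β_ (X.X p) (Y.X q)).hom ≫ tensorι Y X q p n (by lia)) :=
  HomologicalComplex.ι_mapBifunctorDesc (K₁ := X) (K₂ := Y) (F := curriedTensor C) (c := .up ℤ) (j := n)
    (fun p q h => (p * q).negOnePow •
      ((β_ (X.X p) (Y.X q)).hom ≫ HomologicalComplex.ιTensorObj Y X q p n (by rw [add_comm]; exact h)))
    p q h

lemma braidHom_comp [SymmetricCategory C] (X Y : CochainComplex C ℤ) :
    braidHom X Y ≫ braidHom Y X = 𝟙 (X ⊗ Y) := by
  ext n
  refine tensor_hom_ext fun p q h => ?_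
  rw [HomologicalComplex.comp_f, reassoc_of% tensorι_braidHom, Linear.units_smul_comp, Category.assoc,
    tensorι_braidHom, Linear.comp_units_smul, smul_smul, mul_comm q p, Int.units_mul_self,
    one_smul, SymmetricCategory.symmetry_assoc, HomologicalComplex.id_f, Category.comp_id]

/-- The braiding of complexes, with the usual sign. -/
noncomputable def braidIsoComplex [SymmetricCategory C] (X Y : CochainComplex C ℤ) :
    X ⊗ Y ≅ Y ⊗ X where
  hom := braidHom X Y
  inv := braidHom Y X
  hom_inv_id := braidHom_comp X Y
  inv_hom_id := braidHom_comp Y X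

lemma braidHom_hexagon_forward [BraidedCategory C] (X Y Z : CochainComplex C ℤ) :
    (α_ X Y Z).hom ≫ braidHom X (Y ⊗ Z) ≫ (α_ Y Z X).hom =
      braidHom X Y ▷ Z ≫ (α_ Y X Z).hom ≫ Y ◁ braidHom X Z := by
  ext n
  refine tensor₃_hom_ext' fun p q r a ha h => ?_
  simp only [HomologicalComplex.comp_f]
  rw [reassoc_of% tensorι_associator p q r a (q + r) n ha rfl h, reassoc_of% tensorι_braidHom,
    reassoc_of% tensorι_whiskerRight, ← comp_whiskerRight_assoc, tensorι_braidHom]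
  simp only [Linear.comp_units_smul, Linear.units_smul_comp, Category.assoc]
  rw [BraidedCategory.braiding_naturality_right_assoc,
    tensorι_associator q r p (q + r) (p + r) n rfl (by lia) (by lia)]
  rw [units_smul_whiskerRight, Linear.units_smul_comp, comp_whiskerRight_assoc,
    reassoc_of% tensorι_associator q p r a (p + r) n (by lia) rfl (by lia), tensorι_whiskerLeft,
    ← whiskerLeft_comp_assoc, tensorι_braidHom, whiskerLeft_units_smul, Linear.units_smul_comp,
    Linear.comp_units_smul, Linear.comp_units_smul, smul_smul, ← Int.negOnePow_add, ← mul_add,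
    whiskerLeft_comp_assoc, BraidedCategory.hexagon_forward_assoc]

lemma braidHom_hexagon_reverse [BraidedCategory C] (X Y Z : CochainComplex C ℤ) :
    (α_ X Y Z).inv ≫ braidHom (X ⊗ Y) Z ≫ (α_ Z X Y).inv =
      X ◁ braidHom Y Z ≫ (α_ X Z Y).inv ≫ braidHom X Z ▷ Y := by
  ext n
  refine tensor₃_hom_ext fun p q r b hb h => ?_
  simp only [HomologicalComplex.comp_f]
  rw [reassoc_of% tensorι_associator_inv p q r (p + q) b n rfl hb h, reassoc_of% tensorι_braidHom,
    reassoc_of% tensorι_whiskerLeft, ← whiskerLeft_comp_assoc, tensorι_braidHom]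
  simp only [Linear.comp_units_smul, Linear.units_smul_comp, Category.assoc]
  rw [BraidedCategory.braiding_naturality_left_assoc,
    tensorι_associator_inv r p q (p + r) (p + q) n (by lia) rfl (by lia)]
  rw [whiskerLeft_units_smul, Linear.units_smul_comp, whiskerLeft_comp_assoc,
    reassoc_of% tensorι_associator_inv p r q (p + r) b n rfl (by lia) (by lia), tensorι_whiskerRight,
    ← comp_whiskerRight_assoc, tensorι_braidHom, units_smul_whiskerRight, Linear.units_smul_comp,
    Linear.comp_units_smul, Linear.comp_units_smul, smul_smul, ← Int.negOnePow_add, mul_comm q r,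
    mul_comm p r, ← mul_add, add_comm q p, mul_comm r, comp_whiskerRight_assoc,
    BraidedCategory.hexagon_reverse_assoc]

/-- The symmetric monoidal category of complexes in a symmetric monoidal preadditive category. -/
noncomputable instance [SymmetricCategory C] : SymmetricCategory (CochainComplex C ℤ) where
  braiding X Y := braidIsoComplex X Y
  braiding_naturality_right X Y Z f := by
    ext n
    refine tensor_hom_ext fun p q h => ?_
    change _ ≫ (X ◁ f ≫ braidHom X Z).f n = _ ≫ (braidHom X Y ≫ f ▷ X).f n
    rw [HomologicalComplex.comp_f, HomologicalComplex.comp_f, reassoc_of% tensorι_whiskerLeft,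
      tensorι_braidHom, reassoc_of% tensorι_braidHom, Linear.comp_units_smul,
      Linear.units_smul_comp, Category.assoc, tensorι_whiskerRight,
      BraidedCategory.braiding_naturality_right_assoc]
  braiding_naturality_left f Z := by
    ext n
    refine tensor_hom_ext fun p q h => ?_
    change _ ≫ (f ▷ Z ≫ braidHom _ Z).f n = _ ≫ (braidHom _ Z ≫ Z ◁ f).f n
    rw [HomologicalComplex.comp_f, HomologicalComplex.comp_f, reassoc_of% tensorι_whiskerRight,
      tensorι_braidHom, reassoc_of% tensorι_braidHom, Linear.comp_units_smul,
      Linear.units_smul_comp, Category.assoc, tensorι_whiskerLeft,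
      BraidedCategory.braiding_naturality_left_assoc]
  hexagon_forward := braidHom_hexagon_forward
  hexagon_reverse := braidHom_hexagon_reverse
  symmetry X Y := braidHom_comp X Y

end Braided

/-! ### The tensor product on the homotopy category -/

section Descent

set_option linter.unusedSectionVars false

lemma eq_iff_eq_of_comp_eq {D : Type*} [Category* D] {X Y Z W X' Z' : D} {a : X ⟶ Y} [IsIso a]
    {c : Z ⟶ W} [IsIso c] {t : X ⟶ X'} [IsIso t] {b : Z' ⟶ W} [IsIso b] {f g : Y ⟶ Z}
    {f' g' : X' ⟶ Z'} (h₁ : a ≫ f ≫ c = t ≫ f' ≫ b) (h₂ : a ≫ g ≫ c = t ≫ g' ≫ b) :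
    f = g ↔ f' = g' := by
  rw [← cancel_epi a, ← cancel_mono c, Category.assoc, Category.assoc, h₁, h₂, cancel_epi,
    cancel_mono]

variable {C₁ C₂ C₃ D₁ D₂ D₃ : Type*} [Category* C₁] [Category* C₂] [Category* C₃]
  [Category* D₁] [Category* D₂] [Category* D₃] [HasShift C₁ ℤ] [HasShift C₂ ℤ] [HasShift C₃ ℤ]
  [HasShift D₁ ℤ] [HasShift D₂ ℤ] [HasShift D₃ ℤ] [Preadditive C₃] [Preadditive D₃]
  [∀ n : ℤ, (shiftFunctor C₃ n).Additive] [∀ n : ℤ, (shiftFunctor D₃ n).Additive]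
  (Q₁ : C₁ ⥤ D₁) [Q₁.CommShift ℤ] (Q₂ : C₂ ⥤ D₂) [Q₂.CommShift ℤ] (Q₃ : C₃ ⥤ D₃) [Q₃.CommShift ℤ]
  [Q₃.Additive]
  (G : C₁ ⥤ C₂ ⥤ C₃) (G' : D₁ ⥤ D₂ ⥤ D₃)
  [∀ X, (G.obj X).CommShift ℤ] [∀ Y, (G.flip.obj Y).CommShift ℤ]
  [∀ X, (G'.obj X).CommShift ℤ] [∀ Y, (G'.flip.obj Y).CommShift ℤ]

/-- Compatibility of the commutation of two bifunctors with the shifts in the two variables is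
transported along functors that commute with the shifts and intertwine the bifunctors. -/
lemma commShift₂_comm_iff
    [∀ {X Y : D₁} (f : X ⟶ Y), NatTrans.CommShift (G'.map f) ℤ]
    [∀ {X Y : D₂} (f : X ⟶ Y), NatTrans.CommShift (G'.flip.map f) ℤ]
    (θ : ∀ X Y, (G'.obj (Q₁.obj X)).obj (Q₂.obj Y) ≅ Q₃.obj ((G.obj X).obj Y))
    (hl : ∀ X Y (n : ℤ), (G'.obj (Q₁.obj X)).map ((Q₂.commShiftIso n).hom.app Y) ≫
      ((G'.obj (Q₁.obj X)).commShiftIso n).hom.app (Q₂.obj Y) ≫ (θ X Y).hom⟦n⟧' =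
      (θ X (Y⟦n⟧)).hom ≫ Q₃.map (((G.obj X).commShiftIso n).hom.app Y) ≫
        (Q₃.commShiftIso n).hom.app ((G.obj X).obj Y))
    (hr : ∀ X Y (n : ℤ), (G'.map ((Q₁.commShiftIso n).hom.app X)).app (Q₂.obj Y) ≫
      ((G'.flip.obj (Q₂.obj Y)).commShiftIso n).hom.app (Q₁.obj X) ≫ (θ X Y).hom⟦n⟧' =
      (θ (X⟦n⟧) Y).hom ≫ Q₃.map (((G.flip.obj Y).commShiftIso n).hom.app X) ≫
        (Q₃.commShiftIso n).hom.app ((G.obj X).obj Y))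
    (X : C₁) (Y : C₂) (m n : ℤ) :
    (((G'.obj ((Q₁.obj X)⟦m⟧)).commShiftIso n).hom.app (Q₂.obj Y) ≫
      (((G'.flip.obj (Q₂.obj Y)).commShiftIso m).hom.app (Q₁.obj X))⟦n⟧' =
        ((G'.flip.obj ((Q₂.obj Y)⟦n⟧)).commShiftIso m).hom.app (Q₁.obj X) ≫
          (((G'.obj (Q₁.obj X)).commShiftIso n).hom.app (Q₂.obj Y))⟦m⟧' ≫
            (shiftComm ((G'.obj (Q₁.obj X)).obj (Q₂.obj Y)) m n).inv ≫
              ((m * n).negOnePow • 𝟙 _)) ↔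
    Q₃.map (((G.obj (X⟦m⟧)).commShiftIso n).hom.app Y ≫
      (((G.flip.obj Y).commShiftIso m).hom.app X)⟦n⟧') =
    Q₃.map (((G.flip.obj (Y⟦n⟧)).commShiftIso m).hom.app X ≫
          (((G.obj X).commShiftIso n).hom.app Y)⟦m⟧' ≫
            (shiftComm ((G.obj X).obj Y) m n).inv ≫ ((m * n).negOnePow • 𝟙 _)) := by
  let a : (G'.obj (Q₁.obj (X⟦m⟧))).obj (Q₂.obj (Y⟦n⟧)) ⟶
      (G'.obj ((Q₁.obj X)⟦m⟧)).obj ((Q₂.obj Y)⟦n⟧) :=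
    (G'.obj (Q₁.obj (X⟦m⟧))).map ((Q₂.commShiftIso n).hom.app Y) ≫
      (G'.map ((Q₁.commShiftIso m).hom.app X)).app ((Q₂.obj Y)⟦n⟧)
  have ha : a = (G'.map ((Q₁.commShiftIso m).hom.app X)).app (Q₂.obj (Y⟦n⟧)) ≫
      (G'.obj ((Q₁.obj X)⟦m⟧)).map ((Q₂.commShiftIso n).hom.app Y) := by simp [a]
  have : IsIso a := by dsimp only [a]; infer_instance
  let b : Q₃.obj (((G.obj X).obj Y)⟦m⟧⟦n⟧) ⟶ (Q₃.obj ((G.obj X).obj Y))⟦m⟧⟦n⟧ :=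
    (Q₃.commShiftIso n).hom.app _ ≫ ((Q₃.commShiftIso m).hom.app _)⟦n⟧'
  have : IsIso b := by dsimp only [b]; infer_instance
  have h1 : a ≫ (((G'.obj ((Q₁.obj X)⟦m⟧)).commShiftIso n).hom.app (Q₂.obj Y) ≫
      (((G'.flip.obj (Q₂.obj Y)).commShiftIso m).hom.app (Q₁.obj X))⟦n⟧') ≫
        (θ X Y).hom⟦m⟧'⟦n⟧' =
      (θ _ _).hom ≫ Q₃.map (((G.obj (X⟦m⟧)).commShiftIso n).hom.app Y ≫
      (((G.flip.obj Y).commShiftIso m).hom.app X)⟦n⟧') ≫ b := by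
    have e1 := NatTrans.shift_app_comm (G'.map ((Q₁.commShiftIso m).hom.app X)) n (Q₂.obj Y)
    have e2 := hl (X⟦m⟧) Y n
    have e3 := congrArg (fun f => f⟦n⟧') (hr X Y m)
    have e4 := (Q₃.commShiftIso_hom_naturality (((G.flip.obj Y).commShiftIso m).hom.app X) n)
    simp only [Functor.map_comp] at e3
    dsimp at e3 e4
    simp only [a, b, Category.assoc, Functor.map_comp]
    rw [← reassoc_of% e1, e3, reassoc_of% e2, reassoc_of% e4]
  have h2 : a ≫ (((G'.flip.obj ((Q₂.obj Y)⟦n⟧)).commShiftIso m).hom.app (Q₁.obj X) ≫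
          (((G'.obj (Q₁.obj X)).commShiftIso n).hom.app (Q₂.obj Y))⟦m⟧' ≫
            (shiftComm ((G'.obj (Q₁.obj X)).obj (Q₂.obj Y)) m n).inv ≫
              ((m * n).negOnePow • 𝟙 _)) ≫ (θ X Y).hom⟦m⟧'⟦n⟧' =
      (θ _ _).hom ≫ Q₃.map (((G.flip.obj (Y⟦n⟧)).commShiftIso m).hom.app X ≫
          (((G.obj X).commShiftIso n).hom.app Y)⟦m⟧' ≫
            (shiftComm ((G.obj X).obj Y) m n).inv ≫ ((m * n).negOnePow • 𝟙 _)) ≫ b := by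
    have e1 := NatTrans.shift_app_comm (G'.flip.map ((Q₂.commShiftIso n).hom.app Y)) m (Q₁.obj X)
    have e2 := hr X (Y⟦n⟧) m
    have e3 := congrArg (fun f => f⟦m⟧') (hl X Y n)
    have e4 := (Q₃.commShiftIso_hom_naturality (((G.obj X).commShiftIso n).hom.app Y) m)
    have e5 : (shiftComm ((G'.obj (Q₁.obj X)).obj (Q₂.obj Y)) m n).inv ≫ (θ X Y).hom⟦m⟧'⟦n⟧' =
      (θ X Y).hom⟦n⟧'⟦m⟧' ≫ (shiftComm (Q₃.obj ((G.obj X).obj Y)) m n).inv :=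
      ((shiftFunctorComm D₃ m n).inv.naturality (θ X Y).hom).symm
    have e6 : Q₃.map (shiftComm ((G.obj X).obj Y) m n).inv ≫ b =
      (Q₃.commShiftIso m).hom.app _ ≫ ((Q₃.commShiftIso n).hom.app _)⟦m⟧' ≫
        (shiftComm (Q₃.obj ((G.obj X).obj Y)) m n).inv := by
      have e7 := Q₃.map_shiftFunctorComm_hom_app ((G.obj X).obj Y) n m
      have e8 : (shiftComm ((G.obj X).obj Y) m n).inv =
        (shiftFunctorComm C₃ n m).hom.app ((G.obj X).obj Y) := by
          rw [← shiftFunctorComm_symm]; rfl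
      have e9 : (shiftComm (Q₃.obj ((G.obj X).obj Y)) m n).inv =
        (shiftFunctorComm D₃ n m).hom.app (Q₃.obj ((G.obj X).obj Y)) := by
          rw [← shiftFunctorComm_symm]; rfl
      rw [e8, e9, e7]
      simp only [b, Category.assoc, Iso.inv_hom_id_app_assoc]
      rw [← Functor.map_comp, Iso.inv_hom_id_app]
      simp
    simp only [Functor.map_comp] at e3
    dsimp at e1 e3 e4
    rw [ha]
    simp only [Category.assoc, Functor.map_comp, Linear.comp_units_smul, Linear.units_smul_comp,
      Category.comp_id, Functor.map_units_smul]
    rw [← reassoc_of% e1, e5, reassoc_of% e3, reassoc_of% e2, e6, reassoc_of% e4]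
  exact eq_iff_eq_of_comp_eq h1 h2

omit [∀ Y, (G.flip.obj Y).CommShift ℤ] [∀ Y, (G'.flip.obj Y).CommShift ℤ] in
/-- The commutation with shifts in the second variable is natural in the first one for the image of
a morphism under the functors `Q` if this holds for the given morphism. -/
lemma commShift_naturality_left_iff
    (θ : ∀ X Y, (G'.obj (Q₁.obj X)).obj (Q₂.obj Y) ≅ Q₃.obj ((G.obj X).obj Y))
    (hl : ∀ X Y (n : ℤ), (G'.obj (Q₁.obj X)).map ((Q₂.commShiftIso n).hom.app Y) ≫
      ((G'.obj (Q₁.obj X)).commShiftIso n).hom.app (Q₂.obj Y) ≫ (θ X Y).hom⟦n⟧' =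
      (θ X (Y⟦n⟧)).hom ≫ Q₃.map (((G.obj X).commShiftIso n).hom.app Y) ≫
        (Q₃.commShiftIso n).hom.app ((G.obj X).obj Y))
    (hθ : ∀ {X X'} (f : X ⟶ X') Y, (G'.map (Q₁.map f)).app (Q₂.obj Y) ≫ (θ X' Y).hom =
      (θ X Y).hom ≫ Q₃.map ((G.map f).app Y))
    {X X' : C₁} (f : X ⟶ X') (Y : C₂) (n : ℤ) :
    ((G'.obj (Q₁.obj X)).commShiftIso n).hom.app (Q₂.obj Y) ≫
        ((G'.map (Q₁.map f)).app (Q₂.obj Y))⟦n⟧' =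
      (G'.map (Q₁.map f)).app ((Q₂.obj Y)⟦n⟧) ≫
        ((G'.obj (Q₁.obj X')).commShiftIso n).hom.app (Q₂.obj Y) ↔
    Q₃.map (((G.obj X).commShiftIso n).hom.app Y ≫ ((G.map f).app Y)⟦n⟧') =
      Q₃.map ((G.map f).app (Y⟦n⟧) ≫ ((G.obj X').commShiftIso n).hom.app Y) := by
  have h1 := congrArg (fun g => g⟦n⟧') (hθ f Y)
  have h2 := (Q₃.commShiftIso_hom_naturality ((G.map f).app Y) n)
  simp only [Functor.map_comp] at h1
  rw [← cancel_epi ((G'.obj (Q₁.obj X)).map ((Q₂.commShiftIso n).hom.app Y)),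
    ← cancel_mono ((θ X' Y).hom⟦n⟧')]
  have e1 : ((G'.obj (Q₁.obj X)).map ((Q₂.commShiftIso n).hom.app Y) ≫
      ((G'.obj (Q₁.obj X)).commShiftIso n).hom.app (Q₂.obj Y) ≫
        ((G'.map (Q₁.map f)).app (Q₂.obj Y))⟦n⟧') ≫ (θ X' Y).hom⟦n⟧' = (θ X (Y⟦n⟧)).hom ≫
      Q₃.map (((G.obj X).commShiftIso n).hom.app Y ≫ ((G.map f).app Y)⟦n⟧') ≫
        (Q₃.commShiftIso n).hom.app ((G.obj X').obj Y) := by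
    simp only [Category.assoc, Functor.map_comp]
    rw [h1, reassoc_of% hl, h2]
  have e2 : ((G'.obj (Q₁.obj X)).map ((Q₂.commShiftIso n).hom.app Y) ≫
      (G'.map (Q₁.map f)).app ((Q₂.obj Y)⟦n⟧) ≫
        ((G'.obj (Q₁.obj X')).commShiftIso n).hom.app (Q₂.obj Y)) ≫ (θ X' Y).hom⟦n⟧' =
      (θ X (Y⟦n⟧)).hom ≫
      Q₃.map ((G.map f).app (Y⟦n⟧) ≫ ((G.obj X').commShiftIso n).hom.app Y) ≫
        (Q₃.commShiftIso n).hom.app ((G.obj X').obj Y) := by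
    simp only [Category.assoc, Functor.map_comp]
    have h3 := (G'.map (Q₁.map f)).naturality ((Q₂.commShiftIso n).hom.app Y)
    dsimp at h3
    rw [reassoc_of% h3, hl, reassoc_of% hθ f (Y⟦n⟧)]
  rw [e1, e2, cancel_epi, cancel_mono]

end Descent

section HomotopyTensor

variable {C : Type u} [Category.{v} C] [MonoidalCategory C] [Preadditive C] [MonoidalPreadditive C]
  [HasZeroObject C] [HasColimitsOfSize.{0, 0} C]
  [∀ X : C, PreservesColimitsOfSize.{0, 0} ((curriedTensor C).obj X)]
  [∀ X : C, PreservesColimitsOfSize.{0, 0} ((curriedTensor C).flip.obj X)]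

variable (C) in
/-- The projection from complexes to the homotopy category. -/
noncomputable abbrev homQ : CochainComplex C ℤ ⥤ HomotopyCategory C (.up ℤ) :=
  HomotopyCategory.quotient C (.up ℤ)

lemma homotopic_whiskerLeft (X : CochainComplex C ℤ) {Y Z : CochainComplex C ℤ} (f g : Y ⟶ Z)
    (h : homotopic C (.up ℤ) f g) : (homQ C).map (X ◁ f) = (homQ C).map (X ◁ g) := by
  obtain ⟨h⟩ := h
  exact HomotopyCategory.eq_of_homotopy _ _
    (HomologicalComplex.mapBifunctorMapHomotopy₂ (𝟙 X) h (curriedTensor C) (.up ℤ))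

lemma homotopic_whiskerRight {Y Z : CochainComplex C ℤ} (f g : Y ⟶ Z) (X : CochainComplex C ℤ)
    (h : homotopic C (.up ℤ) f g) : (homQ C).map (f ▷ X) = (homQ C).map (g ▷ X) := by
  obtain ⟨h⟩ := h
  exact HomotopyCategory.eq_of_homotopy _ _
    (HomologicalComplex.mapBifunctorMapHomotopy₁ h (𝟙 X) (curriedTensor C) (.up ℤ))

/-- The functor `X ⊗ -` on the homotopy category. -/
noncomputable def homTensorLeft (X : CochainComplex C ℤ) :
    HomotopyCategory C (.up ℤ) ⥤ HomotopyCategory C (.up ℤ) :=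
  CategoryTheory.Quotient.lift _ ((curriedTensor (CochainComplex C ℤ)).obj X ⋙ homQ C)
    fun _ _ f g h => homotopic_whiskerLeft X f g h

/-- The functor `- ⊗ X` on the homotopy category. -/
noncomputable def homTensorRight (X : CochainComplex C ℤ) :
    HomotopyCategory C (.up ℤ) ⥤ HomotopyCategory C (.up ℤ) :=
  CategoryTheory.Quotient.lift _ ((curriedTensor (CochainComplex C ℤ)).flip.obj X ⋙ homQ C)
    fun _ _ f g h => homotopic_whiskerRight f g X h

noncomputable instance : MonoidalCategoryStruct (HomotopyCategory C (.up ℤ)) where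
  tensorObj X Y := (homQ C).obj (X.as ⊗ Y.as)
  whiskerLeft X _ _ f := (homTensorLeft X.as).map f
  whiskerRight f Y := (homTensorRight Y.as).map f
  tensorUnit := (homQ C).obj (𝟙_ _)
  associator X Y Z := (homQ C).mapIso (α_ X.as Y.as Z.as)
  leftUnitor X := (homQ C).mapIso (λ_ X.as)
  rightUnitor X := (homQ C).mapIso (ρ_ X.as)

/-- The tensor product of the homotopy category of complexes. -/
noncomputable instance : MonoidalCategory (HomotopyCategory C (.up ℤ)) where
  tensorHom_def _ _ := rfl
  id_tensorHom_id X Y := by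
    have := congrArg (homQ C).map (id_tensorHom_id X.as Y.as)
    rw [MonoidalCategory.tensorHom_def] at this
    exact this
  tensorHom_comp_tensorHom f₁ f₂ g₁ g₂ := by
    obtain ⟨f₁, rfl⟩ := (homQ C).map_surjective f₁
    obtain ⟨f₂, rfl⟩ := (homQ C).map_surjective f₂
    obtain ⟨g₁, rfl⟩ := (homQ C).map_surjective g₁
    obtain ⟨g₂, rfl⟩ := (homQ C).map_surjective g₂
    have := congrArg (homQ C).map (tensorHom_comp_tensorHom f₁ f₂ g₁ g₂)
    simp only [MonoidalCategory.tensorHom_def] at this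
    exact this
  whiskerLeft_id X Y := (homTensorLeft X.as).map_id Y
  id_whiskerRight X Y := (homTensorRight Y.as).map_id X
  associator_naturality f₁ f₂ f₃ := by
    obtain ⟨f₁, rfl⟩ := (homQ C).map_surjective f₁
    obtain ⟨f₂, rfl⟩ := (homQ C).map_surjective f₂
    obtain ⟨f₃, rfl⟩ := (homQ C).map_surjective f₃
    have := congrArg (homQ C).map (associator_naturality f₁ f₂ f₃)
    simp only [MonoidalCategory.tensorHom_def] at this
    exact this
  leftUnitor_naturality f := by
    obtain ⟨f, rfl⟩ := (homQ C).map_surjective f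
    exact congrArg (homQ C).map (leftUnitor_naturality f)
  rightUnitor_naturality f := by
    obtain ⟨f, rfl⟩ := (homQ C).map_surjective f
    exact congrArg (homQ C).map (rightUnitor_naturality f)
  pentagon V X Y Z := congrArg (homQ C).map (pentagon V.as X.as Y.as Z.as)
  triangle X Y := congrArg (homQ C).map (triangle X.as Y.as)

/-- The braiding of complexes descends to the homotopy category. -/
noncomputable instance [SymmetricCategory C] :
    SymmetricCategory (HomotopyCategory C (.up ℤ)) where
  braiding X Y := (homQ C).mapIso (β_ X.as Y.as)
  braiding_naturality_right X Y Z f := by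
    obtain ⟨f, rfl⟩ := (homQ C).map_surjective f
    exact congrArg (homQ C).map (BraidedCategory.braiding_naturality_right X.as f)
  braiding_naturality_left f Z := by
    obtain ⟨f, rfl⟩ := (homQ C).map_surjective f
    exact congrArg (homQ C).map (BraidedCategory.braiding_naturality_left f Z.as)
  hexagon_forward X Y Z := congrArg (homQ C).map (BraidedCategory.hexagon_forward X.as Y.as Z.as)
  hexagon_reverse X Y Z := congrArg (homQ C).map (BraidedCategory.hexagon_reverse X.as Y.as Z.as)
  symmetry X Y := congrArg (homQ C).map (SymmetricCategory.symmetry X.as Y.as)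

instance : MonoidalPreadditive (CochainComplex C ℤ) where
  whiskerLeft_zero {X Y Z} := by
    ext n
    refine tensor_hom_ext fun p q h => ?_
    rw [tensorι_whiskerLeft, HomologicalComplex.zero_f, HomologicalComplex.zero_f]
    simp
  zero_whiskerRight {X Y Z} := by
    ext n
    refine tensor_hom_ext fun p q h => ?_
    rw [tensorι_whiskerRight, HomologicalComplex.zero_f, HomologicalComplex.zero_f]
    simp
  whiskerLeft_add {X Y Z} f g := by
    ext n
    refine tensor_hom_ext fun p q h => ?_
    rw [tensorι_whiskerLeft, HomologicalComplex.add_f_apply, HomologicalComplex.add_f_apply,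
      Preadditive.comp_add, tensorι_whiskerLeft, tensorι_whiskerLeft]
    simp
  add_whiskerRight {X Y Z} f g := by
    ext n
    refine tensor_hom_ext fun p q h => ?_
    rw [tensorι_whiskerRight, HomologicalComplex.add_f_apply, HomologicalComplex.add_f_apply,
      Preadditive.comp_add, tensorι_whiskerRight, tensorι_whiskerRight]
    simp

instance : MonoidalPreadditive (HomotopyCategory C (.up ℤ)) where
  whiskerLeft_zero {X Y Z} := congrArg (homQ C).map
    (MonoidalPreadditive.whiskerLeft_zero (X := X.as) (Y := Y.as) (Z := Z.as))
  zero_whiskerRight {X Y Z} := congrArg (homQ C).map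
    (MonoidalPreadditive.zero_whiskerRight (X := X.as) (Y := Y.as) (Z := Z.as))
  whiskerLeft_add {X Y Z} f g := by
    obtain ⟨f, rfl⟩ := (homQ C).map_surjective f
    obtain ⟨g, rfl⟩ := (homQ C).map_surjective g
    exact congrArg (homQ C).map (MonoidalPreadditive.whiskerLeft_add (X := X.as) f g)
  add_whiskerRight {X Y Z} f g := by
    obtain ⟨f, rfl⟩ := (homQ C).map_surjective f
    obtain ⟨g, rfl⟩ := (homQ C).map_surjective g
    exact congrArg (homQ C).map (MonoidalPreadditive.add_whiskerRight (X := X.as) f g)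

/-- The commutation of the tensor product of complexes with the shifts in both variables, with the
sign `(-1)^(m * n)` when the two shifts are interchanged. -/
noncomputable instance : (curriedTensor (CochainComplex C ℤ)).CommShift₂Int :=
  inferInstanceAs (curriedTensor C).map₂CochainComplex.CommShift₂Int

noncomputable instance (X : CochainComplex C ℤ) : (homTensorLeft X).CommShift ℤ :=
  CategoryTheory.Quotient.liftCommShift ((curriedTensor (CochainComplex C ℤ)).obj X ⋙ homQ C)
    (homotopic C (.up ℤ)) ℤ _

noncomputable instance (X : CochainComplex C ℤ) : (homTensorRight X).CommShift ℤ :=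
  CategoryTheory.Quotient.liftCommShift ((curriedTensor (CochainComplex C ℤ)).flip.obj X ⋙ homQ C)
    (homotopic C (.up ℤ)) ℤ _

noncomputable instance (X : HomotopyCategory C (.up ℤ)) :
    ((curriedTensor (HomotopyCategory C (.up ℤ))).obj X).CommShift ℤ :=
  inferInstanceAs ((homTensorLeft X.as).CommShift ℤ)

noncomputable instance (X : HomotopyCategory C (.up ℤ)) :
    ((curriedTensor (HomotopyCategory C (.up ℤ))).flip.obj X).CommShift ℤ :=
  inferInstanceAs ((homTensorRight X.as).CommShift ℤ)

omit [MonoidalCategory C] [MonoidalPreadditive C] [HasZeroObject C] [HasColimitsOfSize.{0, 0} C]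
  [∀ X : C, PreservesColimitsOfSize.{0, 0} ((curriedTensor C).obj X)]
  [∀ X : C, PreservesColimitsOfSize.{0, 0} ((curriedTensor C).flip.obj X)] [Preadditive C] in
lemma comp_eq_of_comp_eq_id {X Y Z : C} {f : X ⟶ Y} {g : Y ⟶ X} (h : f ≫ g = 𝟙 X) {r : Y ⟶ Z}
    {s : X ⟶ Z} (hr : r = g ≫ s) {i : Z ⟶ Z} (hi : i = 𝟙 Z) : f ≫ r ≫ i = 𝟙 X ≫ s := by
  rw [hr, hi, Category.comp_id, reassoc_of% h, Category.id_comp]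

lemma commShiftIso_homTensorLeft (X Y : CochainComplex C ℤ) (n : ℤ) :
    ((curriedTensor (HomotopyCategory C (.up ℤ))).obj ((homQ C).obj X)).map
      (((homQ C).commShiftIso n).hom.app Y) ≫
    (((curriedTensor (HomotopyCategory C (.up ℤ))).obj ((homQ C).obj X)).commShiftIso n).hom.app
        ((homQ C).obj Y) ≫ (Iso.refl ((homQ C).obj (X ⊗ Y))).hom⟦n⟧' =
      (Iso.refl _).hom ≫
        (homQ C).map ((((curriedTensor (CochainComplex C ℤ)).obj X).commShiftIso n).hom.app Y) ≫
          ((homQ C).commShiftIso n).hom.app (X ⊗ Y) := by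
  have h := CategoryTheory.Quotient.LiftCommShift.iso_hom_app
    ((curriedTensor (CochainComplex C ℤ)).obj X ⋙ homQ C) (homotopic C (.up ℤ))
    (fun _ _ f g h => homotopic_whiskerLeft X f g h) n Y
  rw [Functor.commShiftIso_comp_hom_app] at h
  refine comp_eq_of_comp_eq_id ?_ h (CategoryTheory.Functor.map_id _ _)
  exact (((homTensorLeft X).mapIso (((homQ C).commShiftIso n).app Y))).hom_inv_id

lemma commShiftIso_homTensorRight (X Y : CochainComplex C ℤ) (n : ℤ) :
    ((curriedTensor (HomotopyCategory C (.up ℤ))).map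
      (((homQ C).commShiftIso n).hom.app X)).app ((homQ C).obj Y) ≫
    (((curriedTensor (HomotopyCategory C (.up ℤ))).flip.obj
      ((homQ C).obj Y)).commShiftIso n).hom.app ((homQ C).obj X) ≫
        (Iso.refl ((homQ C).obj (X ⊗ Y))).hom⟦n⟧' =
      (Iso.refl _).hom ≫ (homQ C).map
          ((((curriedTensor (CochainComplex C ℤ)).flip.obj Y).commShiftIso n).hom.app X) ≫
          ((homQ C).commShiftIso n).hom.app (X ⊗ Y) := by
  have h := CategoryTheory.Quotient.LiftCommShift.iso_hom_app
    ((curriedTensor (CochainComplex C ℤ)).flip.obj Y ⋙ homQ C) (homotopic C (.up ℤ))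
    (fun _ _ f g h => homotopic_whiskerRight f g Y h) n X
  rw [Functor.commShiftIso_comp_hom_app] at h
  refine comp_eq_of_comp_eq_id ?_ h (CategoryTheory.Functor.map_id _ _)
  exact (((homTensorRight Y).mapIso (((homQ C).commShiftIso n).app X))).hom_inv_id

instance {X Y : HomotopyCategory C (.up ℤ)} (f : X ⟶ Y) :
    NatTrans.CommShift ((curriedTensor (HomotopyCategory C (.up ℤ))).map f) ℤ where
  shift_comm n := by
    obtain ⟨f, rfl⟩ := (homQ C).map_surjective (X := X.as) (Y := Y.as) f
    ext Z
    refine (commShift_naturality_left_iff (homQ C) (homQ C) (homQ C) (curriedTensor _)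
      (curriedTensor (HomotopyCategory C (.up ℤ))) (fun X Y => Iso.refl ((homQ C).obj (X ⊗ Y)))
      commShiftIso_homTensorLeft (fun f Y => ?_) f Z.as n).2 ?_
    · exact (Category.comp_id _).trans (Category.id_comp _).symm
    · exact congrArg (homQ C).map (NatTrans.shift_app_comm
        ((curriedTensor (CochainComplex C ℤ)).map f) n Z.as)

instance {X Y : HomotopyCategory C (.up ℤ)} (f : X ⟶ Y) :
    NatTrans.CommShift ((curriedTensor (HomotopyCategory C (.up ℤ))).flip.map f) ℤ where
  shift_comm n := by
    obtain ⟨f, rfl⟩ := (homQ C).map_surjective (X := X.as) (Y := Y.as) f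
    ext Z
    refine (commShift_naturality_left_iff (homQ C) (homQ C) (homQ C) (curriedTensor _).flip
      (curriedTensor (HomotopyCategory C (.up ℤ))).flip
      (fun X Y => Iso.refl ((homQ C).obj (Y ⊗ X)))
      (fun X Y => commShiftIso_homTensorRight Y X) (fun f Y => ?_) f Z.as n).2 ?_
    · exact (Category.comp_id _).trans (Category.id_comp _).symm
    · exact congrArg (homQ C).map (NatTrans.shift_app_comm
        ((curriedTensor (CochainComplex C ℤ)).flip.map f) n Z.as)

/-- The tensor product of the homotopy category commutes with the shifts in both variables. -/
noncomputable instance : (curriedTensor (HomotopyCategory C (.up ℤ))).CommShift₂Int where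
  comm X Y m n := by
    have h := (commShift₂_comm_iff (homQ C) (homQ C) (homQ C) (curriedTensor _)
      (curriedTensor (HomotopyCategory C (.up ℤ))) (fun X Y => Iso.refl ((homQ C).obj (X ⊗ Y)))
      commShiftIso_homTensorLeft commShiftIso_homTensorRight X.as Y.as m n).2 (by
        have := Functor.commShift₂_comm (curriedTensor (CochainComplex C ℤ)) .int X.as Y.as m n
        simp only [CommShift₂Setup.int_ε, CatCenter.app_neg_one_zpow] at this
        exact congrArg (homQ C).map this)
    simp only [CommShift₂Setup.int_ε, CatCenter.app_neg_one_zpow]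
    exact h

end HomotopyTensor

/-! ### Exactness of the tensor product -/

section DegreewiseSplit

variable {C : Type u} [Category.{v} C] [Preadditive C] [HasZeroObject C] [HasBinaryBiproducts C]

/-- A functor on the homotopy category that is induced by a functor of complexes `F` commuting with
the shift is triangulated if `F` preserves degreewise split short exact sequences together with
their classes. -/
lemma isTriangulated_of_degreewiseSplit (F : CochainComplex C ℤ ⥤ CochainComplex C ℤ) [F.Additive]
    [F.CommShift ℤ] (F' : HomotopyCategory C (.up ℤ) ⥤ HomotopyCategory C (.up ℤ)) [F'.CommShift ℤ]
    (e : HomotopyCategory.quotient C (.up ℤ) ⋙ F' ≅ F ⋙ HomotopyCategory.quotient C (.up ℤ))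
    [NatTrans.CommShift e.hom ℤ]
    (hF : ∀ (S : ShortComplex (CochainComplex C ℤ))
      (σ : ∀ n, (S.map (HomologicalComplex.eval C _ n)).Splitting),
      ∃ (τ : ∀ n, ((S.map F).map (HomologicalComplex.eval C _ n)).Splitting),
        CochainComplex.homOfDegreewiseSplit (S.map F) τ =
          F.map (CochainComplex.homOfDegreewiseSplit S σ) ≫
            (F.commShiftIso (1 : ℤ)).hom.app S.X₁) :
    F'.IsTriangulated where
  map_distinguished T hT := by
    rw [HomotopyCategory.distinguished_iff_iso_trianglehOfDegreewiseSplit] at hT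
    obtain ⟨S, σ, ⟨i⟩⟩ := hT
    obtain ⟨τ, hτ⟩ := hF S σ
    rw [HomotopyCategory.distinguished_iff_iso_trianglehOfDegreewiseSplit]
    let j : F.mapTriangle.obj (CochainComplex.triangleOfDegreewiseSplit S σ) ≅
        CochainComplex.triangleOfDegreewiseSplit (S.map F) τ :=
      Triangle.isoMk _ _ (Iso.refl _) (Iso.refl _) (Iso.refl _)
        ((Category.comp_id _).trans (Category.id_comp _).symm)
        ((Category.comp_id _).trans (Category.id_comp _).symm) (by
          refine Eq.trans ?_ (hτ.symm.trans (Category.id_comp _).symm)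
          exact (congrArg (_ ≫ ·) (CategoryTheory.Functor.map_id _ _)).trans (Category.comp_id _))
    exact ⟨_, τ, ⟨F'.mapTriangle.mapIso i ≪≫ (Functor.mapTriangleCompIso _ F').symm.app _ ≪≫
      (Functor.mapTriangleIso e).app _ ≪≫ (Functor.mapTriangleCompIso F _).app _ ≪≫
      (HomotopyCategory.quotient C (.up ℤ)).mapTriangle.mapIso j⟩⟩

end DegreewiseSplit

section TensorSplit

set_option linter.unusedSectionVars false

variable {C : Type u} [Category.{v} C] [MonoidalCategory C] [Preadditive C] [MonoidalPreadditive C]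
  [HasZeroObject C] [HasColimitsOfSize.{0, 0} C]
  [∀ X : C, PreservesColimitsOfSize.{0, 0} ((curriedTensor C).obj X)]
  [∀ X : C, PreservesColimitsOfSize.{0, 0} ((curriedTensor C).flip.obj X)]

/-- The map on the degree `n` parts of tensor products given by families of maps in each degree,
which need not commute with the differentials. -/
noncomputable def gradedTensor {X Y X' Y' : CochainComplex C ℤ} (f : ∀ p, X.X p ⟶ X'.X p)
    (g : ∀ q, Y.X q ⟶ Y'.X q) (n : ℤ) : (X ⊗ Y).X n ⟶ (X' ⊗ Y').X n :=
  HomologicalComplex.mapBifunctorDesc (K₁ := X) (K₂ := Y) (F := curriedTensor C) (c := .up ℤ)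
    (j := n) fun p q h => (f p ⊗ₘ g q) ≫ tensorι X' Y' p q n h

lemma tensorι_gradedTensor {X Y X' Y' : CochainComplex C ℤ} (f : ∀ p, X.X p ⟶ X'.X p)
    (g : ∀ q, Y.X q ⟶ Y'.X q) (p q n : ℤ) (h : p + q = n) :
    tensorι X Y p q n h ≫ gradedTensor f g n = (f p ⊗ₘ g q) ≫ tensorι X' Y' p q n h :=
  HomologicalComplex.ι_mapBifunctorDesc (K₁ := X) (K₂ := Y) (F := curriedTensor C) (c := .up ℤ)
    (j := n) (fun p q h => (f p ⊗ₘ g q) ≫ tensorι X' Y' p q n h) p q h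

/-- The degree `n` part of the canonical map `X ⊗ Y⟦a⟧ ⟶ (X ⊗ Y)⟦a⟧`. -/
noncomputable def shiftHom₂ (X Y : CochainComplex C ℤ) (a n : ℤ) :
    (X ⊗ Y⟦a⟧).X n ⟶ (X ⊗ Y).X (n + a) :=
  ((((curriedTensor (CochainComplex C ℤ)).obj X).commShiftIso a).hom.app Y).f n

/-- The degree `n` part of the canonical map `X⟦a⟧ ⊗ Y ⟶ (X ⊗ Y)⟦a⟧`. -/
noncomputable def shiftHom₁ (X Y : CochainComplex C ℤ) (a n : ℤ) :
    (X⟦a⟧ ⊗ Y).X n ⟶ (X ⊗ Y).X (n + a) :=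
  ((((curriedTensor (CochainComplex C ℤ)).flip.obj Y).commShiftIso a).hom.app X).f n

lemma tensorι_shiftHom₂ (X Y : CochainComplex C ℤ) (a p q n : ℤ) (h : p + q = n) :
    tensorι X (Y⟦a⟧) p q n h ≫ shiftHom₂ X Y a n =
      (p * a).negOnePow • tensorι X Y p (q + a) (n + a) (by lia) := by
  refine (CochainComplex.ι_mapBifunctorShift₂Iso_hom_f X Y (curriedTensor C) a p q n h
    (q + a) (n + a) rfl rfl).trans ?_
  congr 1
  simp only [CochainComplex.shiftFunctorObjXIso, HomologicalComplex.XIsoOfEq_rfl, Iso.refl_hom,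
    Iso.refl_inv]
  refine (congrArg (· ≫ _) (CategoryTheory.Functor.map_id _ _)).trans ?_
  exact (Category.id_comp _).trans (Category.comp_id _)

lemma tensorι_shiftHom₁ (X Y : CochainComplex C ℤ) (a p q n : ℤ) (h : p + q = n) :
    tensorι (X⟦a⟧) Y p q n h ≫ shiftHom₁ X Y a n = tensorι X Y (p + a) q (n + a) (by lia) := by
  refine (CochainComplex.ι_mapBifunctorShift₁Iso_hom_f X Y (curriedTensor C) a p q n h
    (p + a) (n + a) rfl rfl).trans ?_
  simp only [CochainComplex.shiftFunctorObjXIso, HomologicalComplex.XIsoOfEq_rfl, Iso.refl_hom,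
    Iso.refl_inv]
  refine (congrArg (· ≫ _) (congrArg (fun α => NatTrans.app α (Y.X q))
    (CategoryTheory.Functor.map_id (curriedTensor C) _))).trans ?_
  exact (Category.id_comp _).trans (Category.comp_id _)

lemma gradedTensor_comp {X Y X' Y' X'' Y'' : CochainComplex C ℤ} (f : ∀ p, X.X p ⟶ X'.X p)
    (g : ∀ q, Y.X q ⟶ Y'.X q) (f' : ∀ p, X'.X p ⟶ X''.X p) (g' : ∀ q, Y'.X q ⟶ Y''.X q) (n : ℤ) :
    gradedTensor f g n ≫ gradedTensor f' g' n =
      gradedTensor (fun p => f p ≫ f' p) (fun q => g q ≫ g' q) n := by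
  refine tensor_hom_ext fun p q h => ?_
  rw [reassoc_of% tensorι_gradedTensor, tensorι_gradedTensor, tensorι_gradedTensor,
    tensorHom_comp_tensorHom_assoc]

lemma gradedTensor_id (X Y : CochainComplex C ℤ) (n : ℤ) :
    gradedTensor (X := X) (Y := Y) (fun _ => 𝟙 _) (fun _ => 𝟙 _) n = 𝟙 _ := by
  refine tensor_hom_ext fun p q h => ?_
  rw [tensorι_gradedTensor, id_tensorHom_id, Category.id_comp, Category.comp_id]

lemma whiskerLeft_f (X : CochainComplex C ℤ) {Y Y' : CochainComplex C ℤ} (g : Y ⟶ Y') (n : ℤ) :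
    (X ◁ g).f n = gradedTensor (fun _ => 𝟙 _) g.f n := by
  refine tensor_hom_ext fun p q h => ?_
  rw [tensorι_whiskerLeft, tensorι_gradedTensor, id_tensorHom]

lemma whiskerRight_f {X X' : CochainComplex C ℤ} (f : X ⟶ X') (Y : CochainComplex C ℤ) (n : ℤ) :
    (f ▷ Y).f n = gradedTensor f.f (fun _ => 𝟙 _) n := by
  refine tensor_hom_ext fun p q h => ?_
  rw [tensorι_whiskerRight, tensorι_gradedTensor, tensorHom_id]

lemma gradedTensor_add_right {X Y X' Y' : CochainComplex C ℤ} (f : ∀ p, X.X p ⟶ X'.X p)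
    (g g' : ∀ q, Y.X q ⟶ Y'.X q) (n : ℤ) :
    gradedTensor f g n + gradedTensor f g' n = gradedTensor f (fun q => g q + g' q) n := by
  refine tensor_hom_ext fun p q h => ?_
  rw [Preadditive.comp_add, tensorι_gradedTensor, tensorι_gradedTensor, tensorι_gradedTensor,
    MonoidalPreadditive.tensor_add, Preadditive.add_comp]

lemma gradedTensor_add_left {X Y X' Y' : CochainComplex C ℤ} (f f' : ∀ p, X.X p ⟶ X'.X p)
    (g : ∀ q, Y.X q ⟶ Y'.X q) (n : ℤ) :
    gradedTensor f g n + gradedTensor f' g n = gradedTensor (fun p => f p + f' p) g n := by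
  refine tensor_hom_ext fun p q h => ?_
  rw [Preadditive.comp_add, tensorι_gradedTensor, tensorι_gradedTensor, tensorι_gradedTensor,
    MonoidalPreadditive.add_tensor, Preadditive.add_comp]

section

variable {S : ShortComplex (CochainComplex C ℤ)}
  (σ : ∀ n, (S.map (HomologicalComplex.eval C _ n)).Splitting)

/-- The retraction in degree `q` of a degreewise split short exact sequence. -/
def splitR (q : ℤ) : S.X₂.X q ⟶ S.X₁.X q := (σ q).r

/-- The section in degree `q` of a degreewise split short exact sequence. -/
def splitS (q : ℤ) : S.X₃.X q ⟶ S.X₂.X q := (σ q).s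

lemma f_splitR (q : ℤ) : S.f.f q ≫ splitR σ q = 𝟙 _ := (σ q).f_r

lemma splitS_g (q : ℤ) : splitS σ q ≫ S.g.f q = 𝟙 _ := (σ q).s_g

lemma splitS_splitR (q : ℤ) : splitS σ q ≫ splitR σ q = 0 := (σ q).s_r

lemma splitR_f_add (q : ℤ) : splitR σ q ≫ S.f.f q + S.g.f q ≫ splitS σ q = 𝟙 _ := (σ q).id

lemma homOfDegreewiseSplit_f_eq (n : ℤ) : (CochainComplex.homOfDegreewiseSplit S σ).f n =
    splitS σ n ≫ S.X₂.d n (n + 1) ≫ splitR σ (n + 1) :=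
  CochainComplex.homOfDegreewiseSplit_f S σ n

end

/-- Degreewise splittings of `S` give degreewise splittings of `X ⊗ S`. -/
noncomputable def splittingTensorLeft (X : CochainComplex C ℤ)
    (S : ShortComplex (CochainComplex C ℤ))
    (σ : ∀ n, (S.map (HomologicalComplex.eval C _ n)).Splitting) (n : ℤ) :
    ((S.map ((curriedTensor (CochainComplex C ℤ)).obj X)).map
      (HomologicalComplex.eval C _ n)).Splitting where
  r := gradedTensor (X := X) (fun _ => 𝟙 _) (splitR σ) n
  s := gradedTensor (X := X) (fun _ => 𝟙 _) (splitS σ) n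
  f_r := by
    have h : (X ◁ S.f).f n ≫ gradedTensor (fun _ => 𝟙 _) (splitR σ) n = 𝟙 _ := by
      simp only [whiskerLeft_f, gradedTensor_comp, f_splitR, Category.comp_id, gradedTensor_id]
    exact h
  s_g := by
    have h : gradedTensor (fun _ => 𝟙 _) (splitS σ) n ≫ (X ◁ S.g).f n = 𝟙 _ := by
      simp only [whiskerLeft_f, gradedTensor_comp, splitS_g, Category.comp_id, gradedTensor_id]
    exact h
  id := by
    have h : gradedTensor (fun _ => 𝟙 _) (splitR σ) n ≫ (X ◁ S.f).f n +
        (X ◁ S.g).f n ≫ gradedTensor (fun _ => 𝟙 _) (splitS σ) n = 𝟙 _ := by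
      simp only [whiskerLeft_f, gradedTensor_comp, Category.comp_id, gradedTensor_add_right,
        splitR_f_add, gradedTensor_id]
    exact h

/-- The class of the degreewise split sequence `X ⊗ S` is `X` tensored with the class of `S`, up to
the commutation of `X ⊗ -` with the shift. -/
lemma homOfDegreewiseSplit_tensorLeft (X : CochainComplex C ℤ)
    (S : ShortComplex (CochainComplex C ℤ))
    (σ : ∀ n, (S.map (HomologicalComplex.eval C _ n)).Splitting) :
    CochainComplex.homOfDegreewiseSplit _ (splittingTensorLeft X S σ) =
      X ◁ (CochainComplex.homOfDegreewiseSplit S σ) ≫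
        (((curriedTensor (CochainComplex C ℤ)).obj X).commShiftIso (1 : ℤ)).hom.app S.X₁ := by
  ext n
  refine (homOfDegreewiseSplit_f_eq _ n).trans ?_
  suffices key : gradedTensor (fun _ => 𝟙 _) (splitS σ) n ≫ (X ⊗ S.X₂).d n (n + 1) ≫
      gradedTensor (fun _ => 𝟙 _) (splitR σ) (n + 1) =
    (X ◁ CochainComplex.homOfDegreewiseSplit S σ).f n ≫ shiftHom₂ X S.X₁ 1 n from key
  refine tensor_hom_ext fun p q h => ?_
  have h1 : tensorι X S.X₃ p q n h ≫ gradedTensor (fun _ => 𝟙 _) (splitS σ) n ≫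
      (X ⊗ S.X₂).d n (n + 1) ≫ gradedTensor (fun _ => 𝟙 _) (splitR σ) (n + 1) =
      p.negOnePow • X.X p ◁ (splitS σ q ≫ S.X₂.d q (q + 1) ≫ splitR σ (q + 1)) ≫
        tensorι X S.X₁ p (q + 1) (n + 1) (by lia) := by
    rw [reassoc_of% tensorι_gradedTensor, reassoc_of% tensorι_d p q n (n + 1) h rfl,
      Preadditive.add_comp, Category.assoc, tensorι_gradedTensor, Linear.units_smul_comp,
      Category.assoc, tensorι_gradedTensor]
    simp only [id_tensorHom, Preadditive.comp_add, Linear.comp_units_smul]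
    rw [whisker_exchange_assoc, ← whiskerLeft_comp_assoc, splitS_splitR]
    simp
  rw [h1, reassoc_of% tensorι_whiskerLeft, tensorι_shiftHom₂, homOfDegreewiseSplit_f_eq, mul_one]
  exact (Linear.comp_units_smul _ _ _).symm

/-- Degreewise splittings of `S` give degreewise splittings of `S ⊗ X`. -/
noncomputable def splittingTensorRight (X : CochainComplex C ℤ)
    (S : ShortComplex (CochainComplex C ℤ))
    (σ : ∀ n, (S.map (HomologicalComplex.eval C _ n)).Splitting) (n : ℤ) :
    ((S.map ((curriedTensor (CochainComplex C ℤ)).flip.obj X)).map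
      (HomologicalComplex.eval C _ n)).Splitting where
  r := gradedTensor (Y := X) (splitR σ) (fun _ => 𝟙 _) n
  s := gradedTensor (Y := X) (splitS σ) (fun _ => 𝟙 _) n
  f_r := by
    have h : (S.f ▷ X).f n ≫ gradedTensor (splitR σ) (fun _ => 𝟙 _) n = 𝟙 _ := by
      simp only [whiskerRight_f, gradedTensor_comp, f_splitR, Category.comp_id, gradedTensor_id]
    exact h
  s_g := by
    have h : gradedTensor (splitS σ) (fun _ => 𝟙 _) n ≫ (S.g ▷ X).f n = 𝟙 _ := by
      simp only [whiskerRight_f, gradedTensor_comp, splitS_g, Category.comp_id, gradedTensor_id]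
    exact h
  id := by
    have h : gradedTensor (splitR σ) (fun _ => 𝟙 _) n ≫ (S.f ▷ X).f n +
        (S.g ▷ X).f n ≫ gradedTensor (splitS σ) (fun _ => 𝟙 _) n = 𝟙 _ := by
      simp only [whiskerRight_f, gradedTensor_comp, Category.comp_id, gradedTensor_add_left,
        splitR_f_add, gradedTensor_id]
    exact h

/-- The class of the degreewise split sequence `S ⊗ X` is the class of `S` tensored with `X`, up to
the commutation of `- ⊗ X` with the shift. -/
lemma homOfDegreewiseSplit_tensorRight (X : CochainComplex C ℤ)
    (S : ShortComplex (CochainComplex C ℤ))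
    (σ : ∀ n, (S.map (HomologicalComplex.eval C _ n)).Splitting) :
    CochainComplex.homOfDegreewiseSplit _ (splittingTensorRight X S σ) =
      (CochainComplex.homOfDegreewiseSplit S σ) ▷ X ≫
        (((curriedTensor (CochainComplex C ℤ)).flip.obj X).commShiftIso (1 : ℤ)).hom.app S.X₁ := by
  ext n
  refine (homOfDegreewiseSplit_f_eq _ n).trans ?_
  suffices key : gradedTensor (splitS σ) (fun _ => 𝟙 _) n ≫ (S.X₂ ⊗ X).d n (n + 1) ≫
      gradedTensor (splitR σ) (fun _ => 𝟙 _) (n + 1) =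
    (CochainComplex.homOfDegreewiseSplit S σ ▷ X).f n ≫ shiftHom₁ S.X₁ X 1 n from key
  refine tensor_hom_ext fun p q h => ?_
  have h1 : tensorι S.X₃ X p q n h ≫ gradedTensor (splitS σ) (fun _ => 𝟙 _) n ≫
      (S.X₂ ⊗ X).d n (n + 1) ≫ gradedTensor (splitR σ) (fun _ => 𝟙 _) (n + 1) =
      (splitS σ p ≫ S.X₂.d p (p + 1) ≫ splitR σ (p + 1)) ▷ X.X q ≫
        tensorι S.X₁ X (p + 1) q (n + 1) (by lia) := by
    rw [reassoc_of% tensorι_gradedTensor, reassoc_of% tensorι_d p q n (n + 1) h rfl,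
      Preadditive.add_comp, Category.assoc, tensorι_gradedTensor, Linear.units_smul_comp,
      Category.assoc, tensorι_gradedTensor]
    simp only [tensorHom_id, Preadditive.comp_add, Linear.comp_units_smul]
    rw [← whisker_exchange_assoc, ← comp_whiskerRight_assoc (splitS σ p) (splitR σ p),
      splitS_splitR]
    simp
  rw [h1, reassoc_of% tensorι_whiskerRight, tensorι_shiftHom₁, homOfDegreewiseSplit_f_eq]
  rfl

variable [HasBinaryBiproducts C]

instance (X : HomotopyCategory C (.up ℤ)) :
    ((curriedTensor (HomotopyCategory C (.up ℤ))).obj X).IsTriangulated := by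
  let F := (curriedTensor (CochainComplex C ℤ)).obj X.as
  have h : NatTrans.CommShift (CategoryTheory.Quotient.lift.isLift (homotopic C (.up ℤ))
    (F ⋙ homQ C) fun _ _ f g h => homotopic_whiskerLeft X.as f g h).hom ℤ := inferInstance
  exact @isTriangulated_of_degreewiseSplit C _ _ _ _ F _ _ (homTensorLeft X.as) _
    (CategoryTheory.Quotient.lift.isLift _ _ _) h
    fun S σ => ⟨splittingTensorLeft X.as S σ, homOfDegreewiseSplit_tensorLeft X.as S σ⟩

instance (X : HomotopyCategory C (.up ℤ)) :
    ((curriedTensor (HomotopyCategory C (.up ℤ))).flip.obj X).IsTriangulated := by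
  let F := (curriedTensor (CochainComplex C ℤ)).flip.obj X.as
  have h : NatTrans.CommShift (CategoryTheory.Quotient.lift.isLift (homotopic C (.up ℤ))
    (F ⋙ homQ C) fun _ _ f g h => homotopic_whiskerRight f g X.as h).hom ℤ := inferInstance
  exact @isTriangulated_of_degreewiseSplit C _ _ _ _ F _ _ (homTensorRight X.as) _
    (CategoryTheory.Quotient.lift.isLift _ _ _) h
    fun S σ => ⟨splittingTensorRight X.as S σ, homOfDegreewiseSplit_tensorRight X.as S σ⟩

end TensorSplit

/-! ### Duals of bounded complexes -/

section DualComplex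

set_option linter.unusedSectionVars false

variable {C : Type u} [Category.{v} C] [MonoidalCategory C] [Preadditive C] [MonoidalPreadditive C]
  [HasZeroObject C] [HasColimitsOfSize.{0, 0} C]
  [∀ X : C, PreservesColimitsOfSize.{0, 0} ((curriedTensor C).obj X)]
  [∀ X : C, PreservesColimitsOfSize.{0, 0} ((curriedTensor C).flip.obj X)]

lemma tensorι_d' (X Y : CochainComplex C ℤ) (p q n m p' q' : ℤ) (h : p + q = n) (hm : n + 1 = m)
    (hp : p + 1 = p') (hq : q + 1 = q') : tensorι X Y p q n h ≫ (X ⊗ Y).d n m =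
      X.d p p' ▷ Y.X q ≫ tensorι X Y p' q m (by lia) +
        p.negOnePow • X.X p ◁ Y.d q q' ≫ tensorι X Y p q' m (by lia) := by
  subst hp hq
  exact tensorι_d p q n m h hm

/-- The map out of the degree `n` part of a tensor product given by its components. -/
noncomputable def tensorDesc {X Y : CochainComplex C ℤ} {A : C} (n : ℤ)
    (f : ∀ p q, p + q = n → (X.X p ⊗ Y.X q ⟶ A)) : (X ⊗ Y).X n ⟶ A :=
  HomologicalComplex.mapBifunctorDesc (K₁ := X) (K₂ := Y) (F := curriedTensor C) (c := .up ℤ)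
    (j := n) f

lemma tensorι_tensorDesc {X Y : CochainComplex C ℤ} {A : C} (n : ℤ)
    (f : ∀ p q, p + q = n → (X.X p ⊗ Y.X q ⟶ A)) (p q : ℤ) (h : p + q = n) :
    tensorι X Y p q n h ≫ tensorDesc n f = f p q h :=
  HomologicalComplex.ι_mapBifunctorDesc (K₁ := X) (K₂ := Y) (F := curriedTensor C) (c := .up ℤ)
    (j := n) f p q h

variable (C) in
/-- The degree `0` part of the tensor unit. -/
noncomputable abbrev unitX : (𝟙_ (CochainComplex C ℤ)).X 0 ≅ 𝟙_ C :=
  HomologicalComplex.singleObjXSelf (.up ℤ) 0 (𝟙_ C)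

lemma isZero_unit_X {n : ℤ} (hn : n ≠ 0) : IsZero ((𝟙_ (CochainComplex C ℤ)).X n) :=
  HomologicalComplex.isZero_single_obj_X (.up ℤ) 0 (𝟙_ C) n hn

variable {M D : CochainComplex C ℤ}

section

variable (ε : ∀ p q, p + q = 0 → (M.X p ⊗ D.X q ⟶ 𝟙_ C))
    (hε : ∀ p q p' q' (h : p' + q = 0) (h' : p + q' = 0) (_ : p + 1 = p') (_ : q + 1 = q'),
      M.d p p' ▷ D.X q ≫ ε p' q h + p.negOnePow • M.X p ◁ D.d q q' ≫ ε p q' h' = 0)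

/-- The evaluation `M ⊗ D ⟶ 𝟙` of complexes given by evaluations of the components. -/
noncomputable def evComplex : M ⊗ D ⟶ 𝟙_ (CochainComplex C ℤ) :=
  HomologicalComplex.mkHomToSingle (tensorDesc 0 ε) fun i hi => tensor_hom_ext fun p q h => by
    have hi' : i + 1 = 0 := hi
    rw [reassoc_of% tensorι_d' M D p q i 0 (p + 1) (q + 1) h hi' rfl rfl, Preadditive.add_comp,
      Category.assoc, Linear.units_smul_comp, Category.assoc, tensorι_tensorDesc,
      tensorι_tensorDesc, hε p q _ _ _ _ rfl rfl, comp_zero]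

lemma tensorι_evComplex (p q : ℤ) (h : p + q = 0) :
    tensorι M D p q 0 h ≫ (evComplex ε hε).f 0 = ε p q h ≫ (unitX C).inv := by
  have : (evComplex ε hε).f 0 = tensorDesc 0 ε ≫ (unitX C).inv :=
    HomologicalComplex.mkHomToSingle_f _ _
  rw [this, reassoc_of% tensorι_tensorDesc]

lemma evComplex_f_eq_zero {n : ℤ} (hn : n ≠ 0) : (evComplex ε hε).f n = 0 :=
  (isZero_unit_X hn).eq_of_tgt _ _

end

section

variable (η : ∀ q p, q + p = 0 → (𝟙_ C ⟶ D.X q ⊗ M.X p))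
    (hη : ∀ q p q' p' (h : q + p = 0) (h' : q' + p' = 0) (_ : q + 1 = q') (_ : p' + 1 = p),
      η q p h ≫ D.d q q' ▷ M.X p + q'.negOnePow • η q' p' h' ≫ D.X q' ◁ M.d p' p = 0)
    (s : Finset ℤ) (hs : ∀ p ∉ s, IsZero (M.X p))

include hs hη in
/-- The coevaluation is a cocycle: in the differential of `∑ η (-p) p`, the contribution of `d ⊗ 1`
at `p + 1` cancels that of `1 ⊗ d` at `p`. -/
lemma sum_coev_comp_d : (∑ p ∈ s, η (-p) p (neg_add_cancel p) ≫ tensorι D M (-p) p 0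
    (neg_add_cancel p)) ≫ (D ⊗ M).d 0 1 = 0 := by
  let f (p p' : ℤ) (h : p' + 1 = p) : 𝟙_ C ⟶ (D ⊗ M).X 1 := η (-p) p (neg_add_cancel p) ≫
    D.d (-p) (-p') ▷ M.X p ≫ tensorι D M (-p') p 1 (by lia)
  let g (p : ℤ) : 𝟙_ C ⟶ (D ⊗ M).X 1 := (-p).negOnePow • η (-p) p (neg_add_cancel p) ≫
    D.X (-p) ◁ M.d p (p + 1) ≫ tensorι D M (-p) (p + 1) 1 (by lia)
  have hf : ∀ p p' h, p ∉ s → f p p' h = 0 := fun p p' h hp => by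
    dsimp only [f]
    rw [← Category.assoc, ((((curriedTensor C).obj _).map_isZero (hs p hp))).eq_of_tgt
      (η (-p) p (neg_add_cancel p) ≫ D.d (-p) (-p') ▷ M.X p) 0, zero_comp]
  have hg : ∀ p, p ∉ s → g p = 0 := fun p hp => by
    dsimp only [g]
    rw [((((curriedTensor C).obj _).map_isZero (hs p hp))).eq_of_tgt
      (η (-p) p (neg_add_cancel p)) 0, zero_comp, smul_zero]
  have hfg : ∀ p, g p = - f (p + 1) p rfl := fun p => by
    have := hη (-(p + 1)) (p + 1) (-p) p (neg_add_cancel _) (neg_add_cancel _) (by lia) rfl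
    rw [eq_neg_iff_add_eq_zero, add_comm]
    dsimp only [f, g]
    have h2 := congrArg (· ≫ tensorι D M (-p) (p + 1) 1 (by lia)) this
    simpa only [Preadditive.add_comp, Linear.units_smul_comp, Category.assoc, zero_comp] using h2
  have h1 : ∑ p ∈ s, f p (p - 1) (sub_add_cancel p 1) = ∑ᶠ p, f p (p - 1) (sub_add_cancel p 1) := by
    refine (finsum_eq_sum_of_support_subset _ fun p hp => ?_).symm
    by_contra h
    exact hp (hf p _ (sub_add_cancel p 1) h)
  have h2 : ∑ p ∈ s, g p = ∑ᶠ p, g p := by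
    refine (finsum_eq_sum_of_support_subset _ fun p hp => ?_).symm
    by_contra h
    exact hp (hg p h)
  have h3 : ∀ p, g p = - f (p + 1) (p + 1 - 1) (sub_add_cancel (p + 1) 1) := fun p => by
    rw [hfg]
    have : ∀ p' (h : p' + 1 = p + 1), f (p + 1) p rfl = f (p + 1) p' h := fun p' h => by
      obtain rfl : p = p' := by lia
      rfl
    rw [this _ (sub_add_cancel (p + 1) 1)]
  rw [Preadditive.sum_comp]
  refine (Finset.sum_congr rfl fun p _ => ?_ :
    _ = ∑ p ∈ s, (f p (p - 1) (sub_add_cancel p 1) + g p)).trans ?_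
  · rw [Category.assoc, tensorι_d' D M (-p) p 0 1 (-(p - 1)) (p + 1) (by lia) rfl (by lia) rfl,
      Preadditive.comp_add, Linear.comp_units_smul]
  · have h4 := finsum_comp_equiv (Equiv.addRight (1 : ℤ))
      (f := fun p => f p (p - 1) (sub_add_cancel p 1))
    rw [Finset.sum_add_distrib, h1, h2, finsum_congr h3, finsum_neg_distrib, ← h4]
    exact add_neg_cancel _

/-- The coevaluation `𝟙 ⟶ D ⊗ M` of complexes given by coevaluations of the components. -/
noncomputable def coevComplex : 𝟙_ (CochainComplex C ℤ) ⟶ D ⊗ M :=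
  HomologicalComplex.mkHomFromSingle (∑ p ∈ s, η (-p) p (neg_add_cancel p) ≫ tensorι D M (-p) p 0
    (neg_add_cancel p)) fun i hi => by
      obtain rfl : 0 + 1 = i := hi
      exact sum_coev_comp_d η hη s hs

lemma unitX_inv_coevComplex : (unitX C).inv ≫ (coevComplex η hη s hs).f 0 =
    ∑ p ∈ s, η (-p) p (neg_add_cancel p) ≫ tensorι D M (-p) p 0 (neg_add_cancel p) := by
  have : (coevComplex η hη s hs).f 0 = (unitX C).hom ≫ _ :=
    HomologicalComplex.mkHomFromSingle_f _ _
  rw [this, Iso.inv_hom_id_assoc]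

end

/-- Dual objects in each degree, with compatible differentials, define a dual of a bounded
complex. -/
noncomputable abbrev exactPairingComplex (ε : ∀ p q, p + q = 0 → (M.X p ⊗ D.X q ⟶ 𝟙_ C))
    (hε : ∀ p q p' q' (h : p' + q = 0) (h' : p + q' = 0) (_ : p + 1 = p') (_ : q + 1 = q'),
      M.d p p' ▷ D.X q ≫ ε p' q h + p.negOnePow • M.X p ◁ D.d q q' ≫ ε p q' h' = 0)
    (η : ∀ q p, q + p = 0 → (𝟙_ C ⟶ D.X q ⊗ M.X p))
    (hη : ∀ q p q' p' (h : q + p = 0) (h' : q' + p' = 0) (_ : q + 1 = q') (_ : p' + 1 = p),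
      η q p h ≫ D.d q q' ▷ M.X p + q'.negOnePow • η q' p' h' ≫ D.X q' ◁ M.d p' p = 0)
    (s : Finset ℤ) (hs : ∀ p ∉ s, IsZero (M.X p)) (hs' : ∀ p ∉ s, IsZero (D.X (-p)))
    (h₁ : ∀ p q h h', M.X p ◁ η q p h ≫ (α_ _ _ _).inv ≫ ε p q h' ▷ M.X p =
      (ρ_ _).hom ≫ (λ_ _).inv)
    (h₂ : ∀ p q h h', η q p h ▷ D.X q ≫ (α_ _ _ _).hom ≫ D.X q ◁ ε p q h' =
      (λ_ _).hom ≫ (ρ_ _).inv) : ExactPairing D M where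
  coevaluation' := coevComplex η hη s hs
  evaluation' := evComplex ε hε
  coevaluation_evaluation' := by
    rw [← Iso.inv_comp_eq]
    ext n
    by_cases hn : n ∈ s
    swap
    · exact (hs n hn).eq_of_src _ _
    simp only [HomologicalComplex.comp_f]
    rw [rightUnitor_inv_f, leftUnitor_inv_f, Category.assoc, Category.assoc,
      reassoc_of% tensorι_whiskerLeft, ← whiskerLeft_comp_assoc, unitX_inv_coevComplex,
      whiskerLeft_sum, Preadditive.sum_comp, Preadditive.comp_sum, Finset.sum_eq_single n]
    · rw [whiskerLeft_comp_assoc, reassoc_of% tensorι_associator_inv n (-n) n 0 0 n (by lia) (by lia)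
        (by lia), tensorι_whiskerRight, ← comp_whiskerRight_assoc, tensorι_evComplex,
        comp_whiskerRight_assoc, reassoc_of% h₁ n (-n) (by lia) (by lia), Iso.inv_hom_id_assoc]
    · intro p _ hp
      rw [whiskerLeft_comp_assoc, reassoc_of% tensorι_associator_inv n (-p) p (n - p) 0 n (by lia)
        (by lia) (by lia), tensorι_whiskerRight, evComplex_f_eq_zero _ _ (by lia)]
      simp
    · exact fun h => (h hn).elim
  evaluation_coevaluation' := by
    rw [← Iso.inv_comp_eq]
    ext n
    by_cases hn : -n ∈ s
    swap
    · have := hs' _ hn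
      rw [neg_neg] at this
      exact this.eq_of_src _ _
    simp only [HomologicalComplex.comp_f]
    rw [rightUnitor_inv_f, leftUnitor_inv_f, Category.assoc, Category.assoc,
      reassoc_of% tensorι_whiskerRight, ← comp_whiskerRight_assoc, unitX_inv_coevComplex,
      sum_whiskerRight, Preadditive.sum_comp, Preadditive.comp_sum, Finset.sum_eq_single (-n)]
    · have : ∀ q (hq : q + -n = 0), (λ_ (D.X n)).inv ≫ (η q (-n) hq ≫ tensorι D M q (-n) 0 hq) ▷
          D.X n ≫ tensorι (D ⊗ M) D 0 n n (zero_add n) ≫ (α_ D M D).hom.f n ≫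
            (D ◁ evComplex ε hε).f n =
          (ρ_ (D.X n)).inv ≫ D.X n ◁ (unitX C).inv ≫ tensorι D (𝟙_ _) n 0 n (add_zero n) := by
        intro q hq
        obtain rfl : n = q := by lia
        rw [comp_whiskerRight_assoc, reassoc_of% tensorι_associator n (-n) n 0 0 n (by lia) (by lia)
          (by lia), tensorι_whiskerLeft, ← whiskerLeft_comp_assoc, tensorι_evComplex,
          whiskerLeft_comp_assoc, reassoc_of% h₂ (-n) n (by lia) (by lia), Iso.inv_hom_id_assoc]
      exact this _ _
    · intro p _ hp
      rw [comp_whiskerRight_assoc, reassoc_of% tensorι_associator (-p) p n 0 (p + n) n (by lia) rfl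
        (by lia), tensorι_whiskerLeft, evComplex_f_eq_zero _ _ (by lia)]
      simp
    · exact fun h => (h hn).elim

end DualComplex

/-! ### Duals of modules over the group algebra -/

section Antipode

set_option linter.unusedSectionVars false

open TensorProduct

namespace GroupAlgebra

variable {R : Type u} [CommRing R] {B : Type u} [CommRing B] [HopfAlgebra R B] [Module.Finite R B]
  [Module.Projective R B]

lemma toDual_mul' (t : GroupAlgebra R B ⊗[R] GroupAlgebra R B) (x : B) :
    toDual R B (LinearMap.mul' R _ t) x = pairing R B t (Coalgebra.comul x) := by
  induction t with
  | zero => simp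
  | add a b ha hb => simp [ha, hb]
  | tmul f g =>
    rw [LinearMap.mul'_apply, toDual_mul]
    generalize (Coalgebra.comul x : B ⊗[R] B) = y
    induction y with
    | zero => simp
    | add a b ha hb => simp only [map_add, ha, hb]
    | tmul a b => simp

variable (R B) in
/-- The antipode of the group algebra, dual to the antipode of the coordinate ring. -/
noncomputable def antipodeMap : GroupAlgebra R B →ₗ[R] GroupAlgebra R B :=
  (toDual R B).symm.toLinearMap ∘ₗ (HopfAlgebra.antipode R (A := B)).dualMap ∘ₗ
    (toDual R B).toLinearMap

lemma toDual_antipodeMap (f : GroupAlgebra R B) (x : B) :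
    toDual R B (antipodeMap R B f) x = toDual R B f (HopfAlgebra.antipode R x) := by
  simp [antipodeMap]

lemma pairing_rTensor (t : GroupAlgebra R B ⊗[R] GroupAlgebra R B) (y : B ⊗[R] B) :
    pairing R B ((antipodeMap R B).rTensor _ t) y =
      pairing R B t ((HopfAlgebra.antipode R).rTensor _ y) := by
  induction t with
  | zero => simp
  | add a b ha hb => simp [ha, hb]
  | tmul f g =>
    induction y with
    | zero => simp
    | add a b ha hb => simp only [map_add, ha, hb]
    | tmul a b => simp [toDual_antipodeMap]

lemma pairing_lTensor (t : GroupAlgebra R B ⊗[R] GroupAlgebra R B) (y : B ⊗[R] B) :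
    pairing R B ((antipodeMap R B).lTensor _ t) y =
      pairing R B t ((HopfAlgebra.antipode R).lTensor _ y) := by
  induction t with
  | zero => simp
  | add a b ha hb => simp [ha, hb]
  | tmul f g =>
    induction y with
    | zero => simp
    | add a b ha hb => simp only [map_add, ha, hb]
    | tmul a b => simp [toDual_antipodeMap]

lemma pairing_comul' (f : GroupAlgebra R B) (y : B ⊗[R] B) :
    pairing R B (Coalgebra.comul (R := R) f) y = toDual R B f (LinearMap.mul' R B y) := by
  induction y with
  | zero => simp
  | add a b ha hb => simp only [map_add, ha, hb]
  | tmul a b => simp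

lemma toDual_algebraMap (r : R) (x : B) :
    toDual R B (algebraMap R _ r) x = r * Coalgebra.counit (R := R) x := by
  rw [Algebra.algebraMap_eq_smul_one, map_smul, LinearMap.smul_apply, toDual_one, smul_eq_mul]

/-- The group algebra is a Hopf algebra. -/
noncomputable instance : HopfAlgebra R (GroupAlgebra R B) where
  antipode := antipodeMap R B
  mul_antipode_rTensor_comul := by
    ext f
    apply (toDual R B).injective
    ext x
    change toDual R B (LinearMap.mul' R _ ((antipodeMap R B).rTensor _ (Coalgebra.comul f))) x =
      toDual R B (algebraMap R _ (Coalgebra.counit f)) x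
    rw [toDual_mul', pairing_rTensor, pairing_comul', HopfAlgebra.mul_antipode_rTensor_comul_apply,
      toDual_algebraMap, Algebra.algebraMap_eq_smul_one, map_smul, counit_eq, smul_eq_mul, mul_comm]
  mul_antipode_lTensor_comul := by
    ext f
    apply (toDual R B).injective
    ext x
    change toDual R B (LinearMap.mul' R _ ((antipodeMap R B).lTensor _ (Coalgebra.comul f))) x =
      toDual R B (algebraMap R _ (Coalgebra.counit f)) x
    rw [toDual_mul', pairing_lTensor, pairing_comul', HopfAlgebra.mul_antipode_lTensor_comul_apply,
      toDual_algebraMap, Algebra.algebraMap_eq_smul_one, map_smul, counit_eq, smul_eq_mul, mul_comm]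

lemma antipode_antipode_of_comm (x : B) :
    HopfAlgebra.antipode R (HopfAlgebra.antipode R x) = x := by
  have := inv_inv (WithConv.toConv (AlgHom.id R B))
  exact DFunLike.congr_fun (congrArg WithConv.ofConv this) x

lemma antipode_antipode (f : GroupAlgebra R B) :
    HopfAlgebra.antipode R (HopfAlgebra.antipode R f) = f := by
  apply (toDual R B).injective
  ext x
  refine (toDual_antipodeMap _ _).trans ((toDual_antipodeMap _ _).trans ?_)
  rw [antipode_antipode_of_comm]

end GroupAlgebra

end Antipode

section DualRep

open TensorProduct Diagonal

variable {R : Type u} [CommRing R] {H : Type u} [Ring H] [HopfAlgebra R H]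

/-- The action `(h • f) m = f (S h • m)` on the linear dual of a module. -/
noncomputable def dualAct (M : ModuleCat.{u} H) :
    H →ₐ[R] Module.End R (Module.Dual R ((U R H).obj M)) :=
  AlgHom.ofLinearMap
    (Module.Dual.transpose ∘ₗ (act R M).toLinearMap ∘ₗ HopfAlgebra.antipode R)
    (by
      ext f m
      change f (act R M (HopfAlgebra.antipode R 1) m) = f m
      rw [HopfAlgebra.antipode_one, map_one]
      rfl)
    (fun a b => by
      ext f m
      change f (act R M (HopfAlgebra.antipode R (a * b)) m) =
        f (act R M (HopfAlgebra.antipode R b) (act R M (HopfAlgebra.antipode R a) m))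
      rw [HopfAlgebra.antipode_mul_antidistrib, map_mul]
      rfl)

variable (R) in
/-- The dual of a module over a Hopf algebra. -/
noncomputable abbrev dualRep (M : ModuleCat.{u} H) : ModuleCat.{u} H := ofAct (dualAct (R := R) M)

variable (R) in
/-- The linear dual underlying the dual representation. -/
noncomputable def dualEquiv (M : ModuleCat.{u} H) :
    (U R H).obj (dualRep R M) ≃ₗ[R] Module.Dual R ((U R H).obj M) :=
  (ofActEquiv (dualAct (R := R) M)).symm

variable (R) in
/-- The evaluation `m ⊗ f ↦ f m`. -/
noncomputable def evMap (M : ModuleCat.{u} H) :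
    (U R H).obj M ⊗[R] (U R H).obj (dualRep R M) →ₗ[R] R :=
  contractRight R ((U R H).obj M) ∘ₗ
    TensorProduct.map LinearMap.id (dualEquiv R M).toLinearMap

lemma evMap_tmul (M : ModuleCat.{u} H) (m : (U R H).obj M) (f : (U R H).obj (dualRep R M)) :
    evMap R M (m ⊗ₜ f) = dualEquiv R M f m := rfl

/-- The action of `a ⊗ b` on `m ⊗ f` evaluates to `f (S b a m)`. -/
lemma evMap_act₂ (M : ModuleCat.{u} H) (t : H ⊗[R] H)
    (m : (U R H).obj M) (f : (U R H).obj (dualRep R M)) :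
    evMap R M (act₂ R M (dualRep R M) t (m ⊗ₜ f)) =
      evMap R M (act R M (LinearMap.mul' R H ((HopfAlgebra.antipode R).rTensor _
        (TensorProduct.comm R _ _ t))) m ⊗ₜ f) := by
  induction t with
  | zero => simp
  | add a b ha hb => simp only [map_add, LinearMap.add_apply, ha, hb, TensorProduct.add_tmul]
  | tmul a b =>
    rw [TensorProduct.comm_tmul, LinearMap.rTensor_tmul, LinearMap.mul'_apply, map_mul]
    rfl

variable (R) in
/-- The endomorphism `n ↦ f n • m` defined by `f ⊗ m`. -/
noncomputable def dualEnd (M : ModuleCat.{u} H) :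
    (U R H).obj (dualRep R M) ⊗[R] (U R H).obj M →ₗ[R] Module.End R ((U R H).obj M) :=
  dualTensorHom R ((U R H).obj M) ((U R H).obj M) ∘ₗ
    TensorProduct.map (dualEquiv R M).toLinearMap LinearMap.id

lemma dualEnd_tmul (M : ModuleCat.{u} H) (f : (U R H).obj (dualRep R M)) (m n : (U R H).obj M) :
    dualEnd R M (f ⊗ₜ m) n = dualEquiv R M f n • m := rfl

/-- The endomorphism defined by `(a ⊗ b) y` is `b ∘ φ ∘ S a`, where `φ` is the endomorphism
defined by `y`. -/
lemma dualEnd_act₂_tmul (M : ModuleCat.{u} H) (a b : H)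
    (y : (U R H).obj (dualRep R M) ⊗[R] (U R H).obj M) (n : (U R H).obj M) :
    dualEnd R M (act₂ R (dualRep R M) M (a ⊗ₜ b) y) n =
      act R M b (dualEnd R M y (act R M (HopfAlgebra.antipode R a) n)) := by
  induction y with
  | zero => simp
  | add a b ha hb => simp only [map_add, LinearMap.add_apply, ha, hb]
  | tmul f m =>
    rw [dualEnd_tmul, map_smul]
    rfl

lemma dualEnd_act₂ (M : ModuleCat.{u} H) (t : H ⊗[R] H)
    (y : (U R H).obj (dualRep R M) ⊗[R] (U R H).obj M) (hy : dualEnd R M y = LinearMap.id) :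
    dualEnd R M (act₂ R (dualRep R M) M t y) =
      act R M (LinearMap.mul' R H ((HopfAlgebra.antipode R).lTensor _
        (TensorProduct.comm R _ _ t))) := by
  induction t with
  | zero => simp
  | add a b ha hb => simp only [map_add, LinearMap.add_apply, ha, hb]
  | tmul a b =>
    ext n
    rw [dualEnd_act₂_tmul, hy, TensorProduct.comm_tmul, LinearMap.lTensor_tmul,
      LinearMap.mul'_apply, map_mul]
    rfl

lemma evMap_assoc (M : ModuleCat.{u} H) (m : (U R H).obj M)
    (y : (U R H).obj (dualRep R M) ⊗[R] (U R H).obj M) :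
    TensorProduct.map (evMap R M) LinearMap.id ((TensorProduct.assoc R _ _ _).symm (m ⊗ₜ y)) =
      1 ⊗ₜ (dualEnd R M y m) := by
  induction y with
  | zero => simp
  | add a b ha hb => simp only [map_add, LinearMap.add_apply, ha, hb, TensorProduct.tmul_add]
  | tmul f n =>
    rw [dualEnd_tmul, TensorProduct.assoc_symm_tmul, TensorProduct.map_tmul, evMap_tmul,
      TensorProduct.tmul_smul, TensorProduct.smul_tmul', smul_eq_mul, mul_one]
    rfl

lemma evMap_assoc' (M : ModuleCat.{u} H) (f : (U R H).obj (dualRep R M))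
    (y : (U R H).obj (dualRep R M) ⊗[R] (U R H).obj M) :
    TensorProduct.map LinearMap.id (evMap R M) (TensorProduct.assoc R _ _ _ (y ⊗ₜ f)) =
      (dualEquiv R M).symm (dualEquiv R M f ∘ₗ dualEnd R M y) ⊗ₜ[R] (1 : R) := by
  induction y with
  | zero =>
    rw [map_zero, TensorProduct.zero_tmul, map_zero, map_zero, LinearMap.comp_zero, map_zero,
      TensorProduct.zero_tmul]
  | add a b ha hb =>
    rw [map_add, TensorProduct.add_tmul, map_add, map_add, ha, hb, LinearMap.comp_add, map_add,
      TensorProduct.add_tmul]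
  | tmul g n =>
    rw [TensorProduct.assoc_tmul, TensorProduct.map_tmul, evMap_tmul]
    have : dualEquiv R M f ∘ₗ dualEnd R M (g ⊗ₜ n) = dualEquiv R M f n • dualEquiv R M g := by
      ext m
      rw [LinearMap.comp_apply, dualEnd_tmul, map_smul, smul_eq_mul, mul_comm]
      rfl
    rw [this, map_smul, TensorProduct.smul_tmul, smul_eq_mul, mul_one, LinearEquiv.symm_apply_apply]
    rfl

set_option linter.unusedSectionVars false

variable [Coalgebra.IsCocomm R H]

lemma evMap_comul (M : ModuleCat.{u} H) (h : H)
    (x : (U R H).obj M ⊗[R] (U R H).obj (dualRep R M)) :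
    evMap R M (act₂ R M (dualRep R M) (Coalgebra.comul h) x) =
      Coalgebra.counit (R := R) h * evMap R M x := by
  induction x with
  | zero => simp
  | add a b ha hb => simp only [map_add, ha, hb, mul_add]
  | tmul m f =>
    rw [evMap_act₂, Coalgebra.comm_comul, HopfAlgebra.mul_antipode_rTensor_comul_apply,
      AlgHom.commutes, Module.algebraMap_end_apply, ← TensorProduct.smul_tmul', map_smul,
      smul_eq_mul]

section

variable (R) (M : ModuleCat.{u} H) [Module.Finite R ((U R H).obj M)]
  [Module.Projective R ((U R H).obj M)]

lemma dualEnd_bijective : Function.Bijective (dualEnd R M) :=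
  (dualTensorHom_bijective (R := R) (M := (U R H).obj M) (N := (U R H).obj M)).comp
    (TensorProduct.congr (dualEquiv R M) (LinearEquiv.refl R ((U R H).obj M))).bijective

/-- The element `∑ eᵢ^* ⊗ eᵢ` corresponding to the identity. -/
noncomputable def coevElt : (U R H).obj (dualRep R M) ⊗[R] (U R H).obj M :=
  (dualEnd_bijective R M).2 LinearMap.id |>.choose

lemma dualEnd_coevElt : dualEnd R M (coevElt R M) = LinearMap.id :=
  (dualEnd_bijective R M).2 LinearMap.id |>.choose_spec

lemma coevElt_comul (h : H) : act₂ R (dualRep R M) M (Coalgebra.comul h) (coevElt R M) =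
    Coalgebra.counit (R := R) h • coevElt R M := by
  apply (dualEnd_bijective R M).1
  rw [dualEnd_act₂ _ _ _ (dualEnd_coevElt R M), Coalgebra.comm_comul,
    HopfAlgebra.mul_antipode_lTensor_comul_apply, AlgHom.commutes, map_smul, dualEnd_coevElt]
  rfl

end

end DualRep

section DualPairing

open TensorProduct Diagonal

variable {R : Type u} [CommRing R] {B : Type u} [CommRing B] [HopfAlgebra R B] [Module.Finite R B]
  [Module.Projective R B]

/-- The evaluation on a module and its dual. -/
noncomputable def evRep (M : ModuleCat.{u} (GroupAlgebra R B)) : M ⊗ dualRep R M ⟶ 𝟙_ _ :=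
  homOf ((μIso R M (dualRep R M)).inv ≫ ModuleCat.ofHom (evMap R M) ≫ (εIso R _).hom)
    (equivariant_of_act₂ _ fun h x => congrArg (εIso R _).hom (evMap_comul M h x))

/-- The coevaluation of a module that is finitely generated projective over the base. -/
noncomputable def coevRep (M : ModuleCat.{u} (GroupAlgebra R B))
    [Module.Finite R ((U R (GroupAlgebra R B)).obj M)]
    [Module.Projective R ((U R (GroupAlgebra R B)).obj M)] : 𝟙_ _ ⟶ dualRep R M ⊗ M :=
  homOf ((εIso R _).inv ≫ ModuleCat.ofHom (LinearMap.toSpanSingleton R _ (coevElt R M)) ≫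
    (μIso R (dualRep R M) M).hom) fun h r => by
      let r' : R := (εIso R _).inv r
      have h1 : act₂ R (dualRep R M) M (Coalgebra.comul h) (r' • coevElt R M) =
          (Coalgebra.counit (R := R) h * r') • coevElt R M := by
        rw [map_smul, coevElt_comul, smul_smul, mul_comm]
      exact congrArg (μIso R (dualRep R M) M).hom h1.symm

/-- The underlying module of the dual representation is dual to the underlying module. -/
noncomputable abbrev exactPairingU (M : ModuleCat.{u} (GroupAlgebra R B))
    [Module.Finite R ((U R (GroupAlgebra R B)).obj M)]
    [Module.Projective R ((U R (GroupAlgebra R B)).obj M)] :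
    ExactPairing ((U R (GroupAlgebra R B)).obj (dualRep R M))
      ((U R (GroupAlgebra R B)).obj M) where
  coevaluation' := ModuleCat.ofHom (LinearMap.toSpanSingleton R _ (coevElt R M))
  evaluation' := ModuleCat.ofHom (evMap R M)
  coevaluation_evaluation' := by
    refine ModuleCat.MonoidalCategory.tensor_ext fun m (r : R) => ?_
    refine (evMap_assoc M m (r • coevElt R M)).trans ?_
    rw [map_smul, dualEnd_coevElt]
    rfl
  evaluation_coevaluation' := by
    refine ModuleCat.MonoidalCategory.tensor_ext fun (r : R) f => ?_
    refine (evMap_assoc' M f (r • coevElt R M)).trans ?_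
    rw [map_smul, dualEnd_coevElt, LinearMap.comp_smul, map_smul, LinearMap.comp_id,
      LinearEquiv.symm_apply_apply]
    rfl

/-- A module that is finitely generated projective over the base has a dual. -/
noncomputable abbrev exactPairingRep (M : ModuleCat.{u} (GroupAlgebra R B))
    [Module.Finite R ((U R (GroupAlgebra R B)).obj M)]
    [Module.Projective R ((U R (GroupAlgebra R B)).obj M)] : ExactPairing (dualRep R M) M :=
  letI := exactPairingU M
  .ofFaithful (U R (GroupAlgebra R B)) (evRep M) (coevRep M) rfl rfl

end DualPairing

/-! ### The group algebra is a Frobenius algebra -/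

section HopfProjective

set_option linter.unusedSectionVars false

open TensorProduct Diagonal

variable {R : Type u} [CommRing R] {B : Type u} [CommRing B] [HopfAlgebra R B] [Module.Finite R B]
  [Module.Projective R B]

lemma modFinProj_dualRep {M : ModuleCat.{u} (GroupAlgebra R B)} (hM : modFinProj R _ M) :
    modFinProj R _ (dualRep R M) := by
  have := hM.1
  have : Module.Projective R _ := hM.2
  exact ⟨Module.Finite.equiv (dualEquiv R M).symm,
    (Module.Projective.of_equiv (dualEquiv R M).symm : Module.Projective R _)⟩

lemma modFinProj_tensor {M N : ModuleCat.{u} (GroupAlgebra R B)} (hM : modFinProj R _ M)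
    (hN : modFinProj R _ N) : modFinProj R _ (M ⊗ N) := by
  have := hM.1
  have : Module.Projective R _ := hM.2
  have := hN.1
  have : Module.Projective R _ := hN.2
  have e : (U R (GroupAlgebra R B)).obj M ⊗[R] (U R (GroupAlgebra R B)).obj N ≃ₗ[R]
    (U R (GroupAlgebra R B)).obj (M ⊗ N) := (μIso R M N).toLinearEquiv
  exact ⟨Module.Finite.equiv e, (Module.Projective.of_equiv e : Module.Projective R _)⟩

lemma modFinProj_self :
    modFinProj R _ (ModuleCat.of (GroupAlgebra R B) (GroupAlgebra R B)) :=
  modFinProj_of_finProj (R := R) (P := ModuleCat.of (GroupAlgebra R B) (GroupAlgebra R B))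
    ⟨inferInstanceAs (Module.Finite (GroupAlgebra R B) (GroupAlgebra R B)),
      inferInstanceAs (Module.Projective (GroupAlgebra R B) (GroupAlgebra R B))⟩

lemma modFinProj_unit : modFinProj R _ (𝟙_ (ModuleCat.{u} (GroupAlgebra R B))) := by
  have e : R ≃ₗ[R] (U R (GroupAlgebra R B)).obj (𝟙_ (ModuleCat.{u} (GroupAlgebra R B))) :=
    (εIso R (GroupAlgebra R B)).toLinearEquiv
  exact ⟨Module.Finite.equiv e, (Module.Projective.of_equiv e : Module.Projective R _)⟩

/-- Finitely generated `R`-projective modules have duals. -/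
@[reducible]
noncomputable def exactPairingOfModFinProj {M : ModuleCat.{u} (GroupAlgebra R B)}
    (hM : modFinProj R _ M) : ExactPairing (dualRep R M) M :=
  letI := hM.1
  letI : Module.Projective R _ := hM.2
  exactPairingRep M

/-- A projective module that is finitely generated over the base is finitely generated. -/
lemma finProj_of_modFinProj {P : ModuleCat.{u} (GroupAlgebra R B)} (hM : modFinProj R _ P)
    (hP : proj _ P) : finProj _ P := by
  refine ⟨?_, hP⟩
  have : Module.Finite R ((resMod R (GroupAlgebra R B)).obj P) := hM.1
  obtain ⟨s, hs⟩ := this.fg_top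
  refine ⟨⟨(show Finset P from s), top_le_iff.1 fun x _ => ?_⟩⟩
  have h : ∀ y ∈ Submodule.span R (s : Set ((resMod R (GroupAlgebra R B)).obj P)),
      (show P from y) ∈ Submodule.span (GroupAlgebra R B) ((show Finset P from s) : Set P) := fun y hy => by
    induction hy using Submodule.span_induction with
    | mem x h => exact Submodule.subset_span h
    | zero => exact zero_mem _
    | add x y _ _ hx hy => exact add_mem hx hy
    | smul r x _ hx => exact Submodule.smul_mem _ (algebraMap R (GroupAlgebra R B) r) hx
  exact h x (hs ▸ Submodule.mem_top)

/-- The functor `M ⊗ -` preserves projective modules, having an exact right adjoint given by the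
dual of `M`. -/
lemma proj_modFinProj_tensor {M P : ModuleCat.{u} (GroupAlgebra R B)} (hM : modFinProj R _ M)
    (hP : proj _ P) : proj _ (M ⊗ P) := by
  rw [proj_iff_projective] at hP ⊢
  let _ := exactPairingOfModFinProj hM
  have : (tensorLeft (dualRep R M)).PreservesEpimorphisms :=
    inferInstanceAs ((curriedTensor _).obj (dualRep R M)).PreservesEpimorphisms
  exact (tensorLeftAdjunction (dualRep R M) M).map_projective P hP

lemma proj_tensor_modFinProj {M P : ModuleCat.{u} (GroupAlgebra R B)} (hM : modFinProj R _ M)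
    (hP : proj _ P) : proj _ (P ⊗ M) :=
  (proj _).prop_of_iso (β_ M P) (proj_modFinProj_tensor hM hP)

lemma proj_retract {A : Type u} [Ring A] {X Y : ModuleCat.{u} A} (h : Retract X Y)
    (hY : proj A Y) : proj A X := by
  rw [proj_iff_projective] at hY ⊢
  exact h.projective

/-- The tensor product of projective modules is projective: the first factor is a retract of a
coproduct of copies of the regular representation, which is finitely generated projective over `R`.
-/
lemma proj_tensor {P Q : ModuleCat.{u} (GroupAlgebra R B)} (hP : proj _ P) (hQ : proj _ Q) :
    proj _ (P ⊗ Q) := by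
  rw [proj_iff_projective] at hP
  let c : Cofan fun _ : P => ModuleCat.of (GroupAlgebra R B) (GroupAlgebra R B) :=
    Cofan.mk _ (Sigma.ι _)
  have hc : IsColimit c := coproductIsCoproduct _
  let π : c.pt ⟶ P :=
    Cofan.IsColimit.desc hc fun p => ModuleCat.ofHom (LinearMap.toSpanSingleton _ P p)
  have hπ : Epi π := by
    rw [ModuleCat.epi_iff_surjective]
    intro p
    refine ⟨c.inj p (1 : GroupAlgebra R B), ?_⟩
    refine (ConcreteCategory.congr_hom (Cofan.IsColimit.fac hc _ p) (1 : GroupAlgebra R B)).trans ?_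
    exact one_smul _ p
  have r : Retract P c.pt := ⟨Projective.factorThru (𝟙 P) π, π, Projective.factorThru_comp _ _⟩
  refine proj_retract (r.map (tensorRight Q)) ?_
  exact proj_coproduct (Cofan.isColimitMapCoconeEquiv ((curriedTensor _).flip.obj Q) _ c
    (isColimitOfPreserves _ hc)) fun _ => proj_modFinProj_tensor modFinProj_self hQ

lemma finProj_tensor {P Q : ModuleCat.{u} (GroupAlgebra R B)} (hP : finProj _ P)
    (hQ : finProj _ Q) : finProj _ (P ⊗ Q) :=
  finProj_of_modFinProj (modFinProj_tensor (modFinProj_of_finProj hP) (modFinProj_of_finProj hQ))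
    (proj_tensor hP.2 hQ.2)

/-- Precomposition with the antipode identifies the dualising module with the dual of the regular
representation. -/
noncomputable def dualisingIso :
    ModuleCat.of (GroupAlgebra R B) (Dualising R (GroupAlgebra R B)) ≅
      dualRep R (ModuleCat.of _ (GroupAlgebra R B)) := by
  let e : (GroupAlgebra R B) ≃ₗ[R] GroupAlgebra R B :=
    .ofInvolutive (HopfAlgebra.antipode R) GroupAlgebra.antipode_antipode
  let r : GroupAlgebra R B ≃ₗ[R] (U R (GroupAlgebra R B)).obj (ModuleCat.of _ (GroupAlgebra R B)) :=
    { toFun := fun x => x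
      invFun := fun x => x
      left_inv := fun _ => rfl
      right_inv := fun _ => rfl
      map_add' := fun _ _ => rfl
      map_smul' := fun c x => (Algebra.smul_def c x).trans (ModuleCat.restrictScalars.smul_def
        (algebraMap R (GroupAlgebra R B)) (M := ModuleCat.of (GroupAlgebra R B) (GroupAlgebra R B)) c x).symm }
  let i : ModuleCat.of (GroupAlgebra R B) (Dualising R (GroupAlgebra R B)) ≃ₗ[GroupAlgebra R B]
      dualRep R (ModuleCat.of (GroupAlgebra R B) (GroupAlgebra R B)) :=
    { toFun := fun f => (dualEquiv R _).symm ((show GroupAlgebra R B →ₗ[R] R from f) ∘ₗ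
        (r.symm.trans e).toLinearMap)
      invFun := fun f => (dualEquiv R _ f) ∘ₗ (e.trans r).toLinearMap
      left_inv := fun f => LinearMap.ext fun x =>
        congrArg (show GroupAlgebra R B →ₗ[R] R from f) (GroupAlgebra.antipode_antipode x)
      right_inv := fun f => LinearMap.ext fun x =>
        congrArg (dualEquiv R _ f) (GroupAlgebra.antipode_antipode x)
      map_add' := fun _ _ => rfl
      map_smul' := fun a f => by
        refine LinearMap.ext fun x => congrArg (show GroupAlgebra R B →ₗ[R] R from f) ?_
        change HopfAlgebra.antipode R (show GroupAlgebra R B from x) * a =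
          HopfAlgebra.antipode R (HopfAlgebra.antipode R a * (show GroupAlgebra R B from x))
        rw [HopfAlgebra.antipode_mul_antidistrib, GroupAlgebra.antipode_antipode] }
  exact i.toModuleIso

/-- The dual of the regular representation is projective: by the triangle identity it is a direct
summand of its tensor product with a projective module. -/
lemma finProj_dualRep_self :
    finProj _ (dualRep R (ModuleCat.of (GroupAlgebra R B) (GroupAlgebra R B))) := by
  set A := ModuleCat.of (GroupAlgebra R B) (GroupAlgebra R B)
  let _ : ExactPairing (dualRep R A) A := exactPairingOfModFinProj modFinProj_self
  have hD : modFinProj R _ (dualRep R A) := modFinProj_dualRep modFinProj_self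
  have hA : proj _ A := inferInstanceAs (Module.Projective (GroupAlgebra R B) (GroupAlgebra R B))
  refine finProj_of_modFinProj hD (proj_retract (Y := (dualRep R A ⊗ A) ⊗ dualRep R A)
    ⟨(λ_ _).inv ≫ η_ (dualRep R A) A ▷ _, (α_ _ _ _).hom ≫ _ ◁ ε_ (dualRep R A) A ≫ (ρ_ _).hom, ?_⟩
    (proj_tensor_modFinProj hD (proj_modFinProj_tensor hD hA)))
  simp

end HopfProjective

section AddClosure

variable {A : Type u} [Ring A]

/-- A module is in `add M` if and only if its identity is a finite sum of endomorphisms that factor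
through `M`. -/
lemma addClosure_iff {M X : ModuleCat.{u} A} : addClosure M X ↔
    ∃ (ι : Type) (_ : Fintype ι) (a : ι → (X ⟶ M)) (b : ι → (M ⟶ X)), ∑ i, a i ≫ b i = 𝟙 X := by
  constructor
  · rintro ⟨n, ⟨r⟩⟩
    refine ⟨Fin n, inferInstance, fun i => r.i ≫ ModuleCat.ofHom (LinearMap.proj i),
      fun i => ModuleCat.ofHom (LinearMap.single A (fun _ => M) i) ≫ r.r, ?_⟩
    ext x
    have h1 := congrArg r.r (Finset.univ_sum_single (r.i x))
    have h2 : r.r (r.i x) = x := ConcreteCategory.congr_hom r.retract x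
    rw [map_sum, h2] at h1
    rw [ModuleCat.hom_sum, LinearMap.sum_apply]
    exact h1
  · rintro ⟨ι, _, a, b, h⟩
    let e := Fintype.equivFin ι
    refine ⟨Fintype.card ι, ⟨⟨ModuleCat.ofHom (LinearMap.pi fun j => (a (e.symm j)).hom),
      ModuleCat.ofHom (∑ j, (b (e.symm j)).hom ∘ₗ LinearMap.proj j), ?_⟩⟩⟩
    rw [← h, ← e.symm.sum_comp]
    ext x
    simp [ModuleCat.hom_sum, LinearMap.sum_apply]

lemma addClosure_self_of_finProj {P : ModuleCat.{u} A} (hP : finProj A P) :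
    addClosure (ModuleCat.of A A) P := by
  have := hP.1
  have : Module.Projective A P := hP.2
  obtain ⟨n, f, hf⟩ := Module.Finite.exists_fin' A P
  obtain ⟨σ, hσ⟩ := Module.projective_lifting_property f LinearMap.id hf
  exact ⟨n, ⟨⟨ModuleCat.ofHom σ, ModuleCat.ofHom f, by ext1; exact hσ⟩⟩⟩

lemma addClosure_trans {M N X : ModuleCat.{u} A} (hM : addClosure N M) (hX : addClosure M X) :
    addClosure N X := by
  rw [addClosure_iff] at *
  obtain ⟨ι, _, a, b, h⟩ := hM
  obtain ⟨κ, _, c, d, h'⟩ := hX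
  refine ⟨κ × ι, inferInstance, fun i => c i.1 ≫ a i.2, fun i => b i.2 ≫ d i.1, ?_⟩
  rw [← h', Fintype.sum_prod_type]
  refine Finset.sum_congr rfl fun k _ => ?_
  rw [← Category.comp_id (c k), ← h, Preadditive.comp_sum, Preadditive.sum_comp]
  simp

end AddClosure

section HopfFrobenius

variable {C : Type u} [Category.{v} C] [MonoidalCategory C] [Preadditive C] [MonoidalPreadditive C]

lemma leftAdjointMate_sum {X Y : C} [HasLeftDual X] [HasLeftDual Y] {ι : Type*} (s : Finset ι)
    (f : ι → (X ⟶ Y)) : (ᘁ(∑ i ∈ s, f i)) = ∑ i ∈ s, ᘁ(f i) := by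
  simp only [leftAdjointMate, whiskerLeft_sum, sum_whiskerRight, Preadditive.comp_sum,
    Preadditive.sum_comp]

end HopfFrobenius

section

variable (R : Type u) [CommRing R] (B : Type u) [CommRing B] [HopfAlgebra R B] [Module.Finite R B]
  [Module.Projective R B]

/-- The regular representation is dual to its dual, so taking mates exhibits it as a summand of a
power of the dualising module. -/
lemma isFrobenius_groupAlgebra : IsFrobenius R (GroupAlgebra R B) := by
  refine ⟨inferInstance, inferInstance, ?_⟩
  set A := ModuleCat.of (GroupAlgebra R B) (GroupAlgebra R B)
  set ω := ModuleCat.of (GroupAlgebra R B) (Dualising R (GroupAlgebra R B))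
  have h1 : addClosure A (dualRep R A) := addClosure_self_of_finProj finProj_dualRep_self
  have h2 : addClosure (dualRep R A) A := by
    let e : ExactPairing (dualRep R A) A := exactPairingOfModFinProj modFinProj_self
    let e' : ExactPairing A (dualRep R A) := BraidedCategory.exactPairing_swap _ _
    let _ : HasLeftDual A := ⟨dualRep R A⟩
    let _ : HasLeftDual (dualRep R A) := ⟨A⟩
    obtain ⟨ι, _, a, b, h⟩ := addClosure_iff.1 h1
    refine addClosure_iff.2 ⟨ι, inferInstance, fun i => ᘁ(b i), fun i => ᘁ(a i), ?_⟩
    refine Eq.trans ?_ (leftAdjointMate_id (X := dualRep R A))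
    rw [← h, leftAdjointMate_sum]
    exact Finset.sum_congr rfl fun i _ => (comp_leftAdjointMate ..).symm
  have h3 : addClosure (dualRep R A) ω := addClosure_retract (Iso.retract dualisingIso)
    (addClosure_iff.2 ⟨Unit, inferInstance, fun _ => 𝟙 _, fun _ => 𝟙 _, by simp⟩)
  have h4 : addClosure ω (dualRep R A) := addClosure_retract (Iso.retract dualisingIso.symm)
    (addClosure_iff.2 ⟨Unit, inferInstance, fun _ => 𝟙 _, fun _ => 𝟙 _, by simp⟩)
  funext X
  exact propext ⟨fun h => addClosure_trans h1 (addClosure_trans h3 h),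
    fun h => addClosure_trans h4 (addClosure_trans h2 h)⟩

end

/-! ### Terms and coproducts of tensor products -/

section TensorTerms

set_option linter.unusedSectionVars false

variable {C : Type u} [Category.{v} C] [MonoidalCategory C] [Preadditive C] [MonoidalPreadditive C]
  [HasZeroObject C] [HasColimitsOfSize.{0, 0} C]
  [∀ X : C, PreservesColimitsOfSize.{0, 0} ((curriedTensor C).obj X)]
  [∀ X : C, PreservesColimitsOfSize.{0, 0} ((curriedTensor C).flip.obj X)]

/-- The terms of a tensor product of complexes are coproducts. -/
noncomputable abbrev tensorCofan (X Y : CochainComplex C ℤ) (n : ℤ) :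
    Cofan fun i : {i : ℤ × ℤ // i.1 + i.2 = n} => X.X i.1.1 ⊗ Y.X i.1.2 :=
  Cofan.mk ((X ⊗ Y).X n) fun i => tensorι X Y i.1.1 i.1.2 n i.2

/-- The universal property of the terms of a tensor product of complexes. -/
noncomputable def isColimitTensorCofan (X Y : CochainComplex C ℤ) (n : ℤ) :
    IsColimit (tensorCofan X Y n) :=
  Cofan.IsColimit.mk _ (fun s => tensorDesc n fun p q h => s.inj ⟨(p, q), h⟩)
    (fun s i => tensorι_tensorDesc n _ i.1.1 i.1.2 i.2)
    (fun s m hm => tensor_hom_ext fun p q h => by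
      rw [tensorι_tensorDesc]
      exact hm ⟨(p, q), h⟩)

lemma isZero_tensor_left {M : C} (hM : IsZero M) (N : C) : IsZero (M ⊗ N) :=
  ((curriedTensor C).flip.obj N).map_isZero hM

lemma isZero_tensor_right (M : C) {N : C} (hN : IsZero N) : IsZero (M ⊗ N) :=
  ((curriedTensor C).obj M).map_isZero hN

lemma isZero_tensor_X (X Y : CochainComplex C ℤ) (n : ℤ)
    (h : ∀ p q, p + q = n → IsZero (X.X p) ∨ IsZero (Y.X q)) : IsZero ((X ⊗ Y).X n) :=
  (IsZero.iff_id_eq_zero _).2 (tensor_hom_ext fun p q hpq => IsZero.eq_of_src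
    ((h p q hpq).elim (fun h => isZero_tensor_left h _) (fun h => isZero_tensor_right _ h)) _ _)

lemma boundedBelow_tensor {X Y : HomotopyCategory C (.up ℤ)} (hX : boundedBelow C X)
    (hY : boundedBelow C Y) : boundedBelow C (X ⊗ Y) := by
  obtain ⟨N, hN⟩ := hX
  obtain ⟨M, hM⟩ := hY
  refine ⟨N + M, fun n hn => isZero_tensor_X X.as Y.as n fun p q h => ?_⟩
  by_cases hp : p < N
  · exact .inl (hN p hp)
  · exact .inr (hM q (by lia))

lemma bounded_tensor {X Y : HomotopyCategory C (.up ℤ)} (hX : bounded C X)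
    (hY : bounded C Y) : bounded C (X ⊗ Y) := by
  obtain ⟨N, hN⟩ := hX
  obtain ⟨M, hM⟩ := hY
  refine ⟨N + M, fun n hn => isZero_tensor_X X.as Y.as n fun p q h => ?_⟩
  by_cases hp : (N : ℤ) < |p|
  · exact .inl (hN p hp)
  · exact .inr (hM q (by push_cast at hn; grind))

section

variable {D : Type*} [Category* D] [MonoidalCategory D] [Preadditive D] [MonoidalPreadditive D]
  [HasZeroObject D] [HasColimitsOfSize.{0, 0} D]
  [∀ X : D, PreservesColimitsOfSize.{0, 0} ((curriedTensor D).obj X)]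
  [∀ X : D, PreservesColimitsOfSize.{0, 0} ((curriedTensor D).flip.obj X)]
  (F : C ⥤ D) [F.Monoidal] [F.Additive]

open Functor.LaxMonoidal Functor.OplaxMonoidal

/-- The functor `F` applied to complexes. -/
noncomputable abbrev mapC : CochainComplex C ℤ ⥤ CochainComplex D ℤ :=
  F.mapHomologicalComplex (.up ℤ)

/-- The tensorator of `F` on the terms of complexes. -/
noncomputable def mapμ (X Y : CochainComplex C ℤ) (p q : ℤ) :
    ((mapC F).obj X).X p ⊗ ((mapC F).obj Y).X q ≅ F.obj (X.X p ⊗ Y.X q) :=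
  Functor.Monoidal.μIso F (X.X p) (Y.X q)

/-- The inclusion of `F (X p ⊗ Y q)` in the degree `n` part of `F (X ⊗ Y)`. -/
noncomputable def mapι (X Y : CochainComplex C ℤ) (p q n : ℤ) (h : p + q = n) :
    F.obj (X.X p ⊗ Y.X q) ⟶ ((mapC F).obj (X ⊗ Y)).X n :=
  F.map (tensorι X Y p q n h)

lemma mapμ_left (X Y : CochainComplex C ℤ) (p p' q : ℤ) :
    (mapμ F X Y p q).hom ≫ F.map (X.d p p' ▷ Y.X q) =
      ((mapC F).obj X).d p p' ▷ _ ≫ (mapμ F X Y p' q).hom :=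
  (μ_natural_left F (X.d p p') (Y.X q)).symm

lemma mapμ_right (X Y : CochainComplex C ℤ) (p q q' : ℤ) :
    (mapμ F X Y p q).hom ≫ F.map (X.X p ◁ Y.d q q') =
      _ ◁ ((mapC F).obj Y).d q q' ≫ (mapμ F X Y p q').hom :=
  (μ_natural_right F (X.X p) (Y.d q q')).symm

lemma mapι_d (X Y : CochainComplex C ℤ) (p q n m p' q' : ℤ) (h : p + q = n) (hm : n + 1 = m)
    (hp : p + 1 = p') (hq : q + 1 = q') :
    mapι F X Y p q n h ≫ ((mapC F).obj (X ⊗ Y)).d n m =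
      F.map (X.d p p' ▷ Y.X q) ≫ mapι F X Y p' q m (by lia) +
        p.negOnePow • F.map (X.X p ◁ Y.d q q') ≫ mapι F X Y p q' m (by lia) := by
  refine (F.map_comp _ _).symm.trans ((congrArg F.map (tensorι_d' X Y p q n m p' q' h hm hp hq)).trans ?_)
  rw [F.map_add, F.map_units_smul, F.map_comp, F.map_comp]
  rfl

/-- The comparison map `F X ⊗ F Y ⟶ F (X ⊗ Y)` for complexes. -/
noncomputable def mapTensorHom (X Y : CochainComplex C ℤ) :
    (mapC F).obj X ⊗ (mapC F).obj Y ⟶ (mapC F).obj (X ⊗ Y) where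
  f n := tensorDesc n fun p q h => (mapμ F X Y p q).hom ≫ mapι F X Y p q n h
  comm' n m hm := tensor_hom_ext fun p q h => by
    have hm : n + 1 = m := hm
    rw [reassoc_of% tensorι_tensorDesc, Category.assoc, mapι_d F X Y p q n m _ _ h hm rfl rfl,
      reassoc_of% tensorι_d' ((mapC F).obj X) ((mapC F).obj Y) p q n m (p + 1) (q + 1) h hm rfl rfl,
      Preadditive.add_comp, Linear.units_smul_comp, Category.assoc, Category.assoc,
      tensorι_tensorDesc, tensorι_tensorDesc, Preadditive.comp_add, Linear.comp_units_smul,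
      reassoc_of% mapμ_left, reassoc_of% mapμ_right]

lemma tensorι_mapTensorHom (X Y : CochainComplex C ℤ) (p q n : ℤ) (h : p + q = n) :
    tensorι ((mapC F).obj X) ((mapC F).obj Y) p q n h ≫ (mapTensorHom F X Y).f n =
      (mapμ F X Y p q).hom ≫ mapι F X Y p q n h :=
  tensorι_tensorDesc n (fun p q h => (mapμ F X Y p q).hom ≫ mapι F X Y p q n h) p q h

/-- A monoidal functor that preserves colimits commutes with tensor products of complexes. -/
lemma isIso_mapTensorHom [PreservesColimitsOfSize.{0, 0} F] (X Y : CochainComplex C ℤ) :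
    IsIso (mapTensorHom F X Y) := by
  have (n : ℤ) : IsIso ((mapTensorHom F X Y).f n) := by
    have hc : IsColimit (Cofan.mk (f := fun i : {i : ℤ × ℤ // i.1 + i.2 = n} =>
        F.obj (X.X i.1.1 ⊗ Y.X i.1.2)) (((mapC F).obj (X ⊗ Y)).X n)
          fun i => mapι F X Y i.1.1 i.1.2 n i.2) :=
      Cofan.isColimitMapCoconeEquiv F _ _ (isColimitOfPreserves F (isColimitTensorCofan X Y n))
    let g : ((mapC F).obj (X ⊗ Y)).X n ⟶ ((mapC F).obj X ⊗ (mapC F).obj Y).X n :=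
      Cofan.IsColimit.desc hc fun i => (mapμ F X Y _ _).inv ≫ tensorι _ _ _ _ n i.2
    have hg : ∀ p q h, mapι F X Y p q n h ≫ g = (mapμ F X Y p q).inv ≫ tensorι _ _ p q n h :=
      fun p q h => Cofan.IsColimit.fac hc _ ⟨(p, q), h⟩
    refine ⟨g, tensor_hom_ext fun p q h => ?_, Cofan.IsColimit.hom_ext hc _ _ fun i => ?_⟩
    · rw [reassoc_of% tensorι_mapTensorHom, hg, Iso.hom_inv_id_assoc, Category.comp_id]
    · refine ((reassoc_of% hg i.1.1 i.1.2 i.2) _).trans ?_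
      rw [tensorι_mapTensorHom, Iso.inv_hom_id_assoc]
      exact (Category.comp_id _).symm
  exact HomologicalComplex.Hom.isIso_of_components _

lemma nonempty_mapHomotopyCategory_tensor [PreservesColimitsOfSize.{0, 0} F]
    (X Y : HomotopyCategory C (.up ℤ)) :
    Nonempty ((F.mapHomotopyCategory (.up ℤ)).obj X ⊗ (F.mapHomotopyCategory (.up ℤ)).obj Y ≅
      (F.mapHomotopyCategory (.up ℤ)).obj (X ⊗ Y)) := by
  let e : (mapC F).obj X.as ⊗ (mapC F).obj Y.as ≅ (mapC F).obj (X.as ⊗ Y.as) :=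
    @asIso _ _ _ _ _ (isIso_mapTensorHom F X.as Y.as)
  exact ⟨(HomotopyCategory.quotient D (.up ℤ)).mapIso e⟩

end

section Coproducts

variable {J : Type w} [HasCoproductsOfShape J C]

/-- The tensor product of complexes preserves coproducts, degreewise and hence in the homotopy
category. -/
instance (X : HomotopyCategory C (.up ℤ)) [∀ X : C, PreservesColimitsOfShape (Discrete J) ((curriedTensor C).obj X)] :
    PreservesColimitsOfShape (Discrete J) ((curriedTensor (HomotopyCategory C (.up ℤ))).obj X) := by
  suffices ∀ Y : J → HomotopyCategory C (.up ℤ), PreservesColimit (Discrete.functor Y)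
      ((curriedTensor (HomotopyCategory C (.up ℤ))).obj X) from
    preservesColimitsOfShape_of_discrete _
  intro Y
  obtain ⟨c, ⟨hc⟩, ⟨hc'⟩⟩ := exists_cofan_quotient Y
  have hev : ∀ i, IsColimit (Cofan.mk (c.pt.X i) fun j => (c.inj j).f i) := fun i =>
    Cofan.isColimitMapCoconeEquiv (HomologicalComplex.eval C (.up ℤ) i) _ c
      (isColimitOfPreserves _ hc)
  have hT : ∀ p q, IsColimit (Cofan.mk (X.as.X p ⊗ c.pt.X q) fun j => X.as.X p ◁ (c.inj j).f q) :=
    fun p q => Cofan.isColimitMapCoconeEquiv ((curriedTensor C).obj (X.as.X p)) _ _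
      (isColimitOfPreserves _ (hev q))
  have hd : ∀ n, IsColimit (Cofan.mk ((X.as ⊗ c.pt).X n) fun j => (X.as ◁ c.inj j).f n) := fun n =>
    Cofan.IsColimit.mk _ (fun s => tensorDesc n fun p q h => Cofan.IsColimit.desc (hT p q) fun j =>
      tensorι X.as (Y j).as p q n h ≫ s.inj j)
      (fun s j => tensor_hom_ext fun p q h => by
        refine ((reassoc_of% tensorι_whiskerLeft (c.inj j) p q n h) _).trans ?_
        rw [tensorι_tensorDesc]
        exact Cofan.IsColimit.fac (hT p q) _ j)
      (fun s m hm => tensor_hom_ext fun p q h => by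
        rw [tensorι_tensorDesc]
        refine Cofan.IsColimit.hom_ext (hT p q) _ _ fun j => ?_
        rw [Cofan.IsColimit.fac]
        refine ((reassoc_of% tensorι_whiskerLeft (c.inj j) p q n h) _).symm.trans ?_
        exact congrArg (tensorι X.as (Y j).as p q n h ≫ ·) (hm j))
  have hd' : IsColimit (Cofan.mk (X.as ⊗ c.pt) fun j => X.as ◁ c.inj j) := by
    refine HomologicalComplex.isColimitOfEval _ _ fun n => ?_
    exact (Cofan.isColimitMapCoconeEquiv (HomologicalComplex.eval C (.up ℤ) n) _
      (Cofan.mk (X.as ⊗ c.pt) fun j => X.as ◁ c.inj j)).symm (hd n)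
  obtain ⟨h⟩ := nonempty_isColimit_quotient _ _ hd'
  exact preservesColimit_of_preserves_colimit_cocone hc'
    ((Cofan.isColimitMapCoconeEquiv ((curriedTensor (HomotopyCategory C (.up ℤ))).obj X) Y _).symm h)

instance [SymmetricCategory C] (X : HomotopyCategory C (.up ℤ))
    [∀ X : C, PreservesColimitsOfShape (Discrete J) ((curriedTensor C).obj X)] :
    PreservesColimitsOfShape (Discrete J)
      ((curriedTensor (HomotopyCategory C (.up ℤ))).flip.obj X) :=
  preservesColimitsOfShape_of_natIso (BraidedCategory.tensorLeftIsoTensorRight X)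

end Coproducts

end TensorTerms

/-! ### The tensor product on `K^lf(Proj G, R)` -/

section Localising

open scoped ZeroObject

variable {T T' : Type*} [Category.{v} T] [Category.{v} T'] [Preadditive T] [Preadditive T']
  [HasZeroObject T] [HasZeroObject T'] [HasShift T ℤ] [HasShift T' ℤ]
  [∀ n : ℤ, (shiftFunctor T n).Additive] [∀ n : ℤ, (shiftFunctor T' n).Additive]
  [Pretriangulated T] [Pretriangulated T']

lemma isLocalising_inverseImage (F : T ⥤ T') [F.CommShift ℤ] [F.IsTriangulated]
    [∀ J : Type v, PreservesColimitsOfShape (Discrete J) F] {P : ObjectProperty T'}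
    (hP : IsLocalising P) : IsLocalising (P.inverseImage F) := by
  have := hP.isTriangulated
  have := hP.isClosedUnderIsomorphisms
  exact
    { isClosedUnderIsomorphisms := inferInstance
      isTriangulated := inferInstance
      coproducts := fun J Y c hc h => hP.coproducts J _ _
        (Cofan.isColimitMapCoconeEquiv F Y c (isColimitOfPreserves F hc)) h }

lemma isLocalising_isZero : IsLocalising (fun X : T => IsZero X) := by
  let Z : ObjectProperty T := fun X => IsZero X
  have : Z.IsClosedUnderIsomorphisms := ⟨fun e h => IsZero.of_iso h e.symm⟩
  exact
    { isClosedUnderIsomorphisms := this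
      isTriangulated :=
        { exists_zero := ⟨0, isZero_zero _, isZero_zero _⟩
          isStableUnderShiftBy := fun n => ⟨fun X hX => (shiftFunctor T n).map_isZero hX⟩
          toIsTriangulatedClosed₂ := .mk' fun D hD h₁ h₃ =>
            Triangle.isZero₂_of_isZero₁₃ _ hD h₁ h₃ }
      coproducts := fun J Y c hc h =>
        (IsZero.iff_id_eq_zero _).2 (Cofan.IsColimit.hom_ext hc _ _ fun j => (h j).eq_of_src _ _) }

end Localising

section ModuleTensor

variable (R : Type u) [CommRing R]

instance (X : ModuleCat.{u} R) : PreservesColimits ((curriedTensor (ModuleCat.{u} R)).obj X) :=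
  inferInstanceAs (PreservesColimits (tensorLeft X))

instance (X : ModuleCat.{u} R) : PreservesColimits ((curriedTensor (ModuleCat.{u} R)).flip.obj X) :=
  preservesColimits_of_natIso (BraidedCategory.tensorLeftIsoTensorRight X)

instance (X : ModuleCat.{u} R) :
    PreservesColimitsOfSize.{0, 0} ((curriedTensor (ModuleCat.{u} R)).obj X) :=
  preservesColimitsOfSize_shrink _

instance (X : ModuleCat.{u} R) :
    PreservesColimitsOfSize.{0, 0} ((curriedTensor (ModuleCat.{u} R)).flip.obj X) :=
  preservesColimitsOfSize_shrink _

instance : HasColimitsOfSize.{0, 0} (ModuleCat.{u} R) :=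
  hasColimitsOfSizeShrink.{0, 0, u, u} _

instance {H : Type u} [Ring H] [Algebra R H] :
    PreservesColimitsOfSize.{0, 0} (ModuleCat.restrictScalars.{u} (algebraMap R H)) :=
  preservesColimitsOfSize_shrink.{0, u, 0, u} _

variable {R}

lemma Kbp_tensor {X Y : KMod R} (hX : Kbp R X) (hY : Kbp R Y) : Kbp R (X ⊗ Y) := by
  obtain ⟨X', hX', ⟨e⟩⟩ := hX
  obtain ⟨Y', hY', ⟨e'⟩⟩ := hY
  refine ⟨X' ⊗ Y', ⟨fun n => ?_, bounded_tensor hX'.2 hY'.2⟩, ⟨e ⊗ᵢ e'⟩⟩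
  refine proj_coproduct (isColimitTensorCofan X'.as Y'.as n) fun i => ?_
  have : Module.Projective R (X'.as.X i.1.1) := hX'.1 _
  have : Module.Projective R (Y'.as.X i.1.2) := hY'.1 _
  exact inferInstanceAs
    (Module.Projective R (TensorProduct R (X'.as.X i.1.1) (Y'.as.X i.1.2)))

end ModuleTensor

section KlfTensor

set_option linter.unusedSectionVars false

variable {R : Type u} [CommRing R] {B : Type u} [CommRing B] [HopfAlgebra R B] [Module.Finite R B]
  [Module.Projective R B]

variable (R B) in
/-- The homotopy category of complexes of modules over the group algebra. -/
abbrev KRep := KMod (GroupAlgebra R B)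

lemma rContractible_tensor_left {W : KRep R B} (hW : rContractible R _ W) (Y : KRep R B) :
    rContractible R _ (W ⊗ Y) := by
  obtain ⟨e⟩ := nonempty_mapHomotopyCategory_tensor (Diagonal.U R (GroupAlgebra R B)) W Y
  exact (((curriedTensor (KMod R)).flip.obj ((resK R _).obj Y)).map_isZero hW).of_iso e.symm

lemma KProjProp_tensor {X Y : KRep R B} (hX : KProjProp _ X) (hY : KProjProp _ Y) :
    KProjProp _ (X ⊗ Y) := fun n =>
  proj_coproduct (isColimitTensorCofan X.as Y.as n) fun i => proj_tensor (hX i.1.1) (hY i.1.2)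

lemma Kplus_tensor {X Y : KRep R B} (hX : Kplus _ X) (hY : Kplus _ Y) : Kplus _ (X ⊗ Y) := by
  classical
  obtain ⟨X', hX', ⟨e⟩⟩ := hX
  obtain ⟨Y', hY', ⟨e'⟩⟩ := hY
  refine ⟨X' ⊗ Y', ⟨fun n => ?_, boundedBelow_tensor hX'.2 hY'.2⟩, ⟨e ⊗ᵢ e'⟩⟩
  obtain ⟨N, hN⟩ := hX'.2
  obtain ⟨M, hM⟩ := hY'.2
  refine finProj_coproduct (isColimitTensorCofan X'.as Y'.as n)
    ((Finset.Icc N (n - M)).image fun p => ⟨(p, n - p), show p + (n - p) = n by lia⟩) (fun i hi => ?_)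
    fun i => finProj_tensor (hX'.1 i.1.1) (hY'.1 i.1.2)
  obtain ⟨⟨p, q⟩, h⟩ := i
  have h : p + q = n := h
  by_cases hp : p < N
  · exact ((curriedTensor _).flip.obj (Y'.as.X q)).map_isZero (hN p hp)
  · refine ((curriedTensor _).obj (X'.as.X p)).map_isZero (hM q ?_)
    by_contra hq
    refine hi (Finset.mem_image.2 ⟨p, Finset.mem_Icc.2 ⟨by lia, by lia⟩, ?_⟩)
    exact Subtype.ext (Prod.ext rfl (show n - p = q by lia))

/-- The objects of `K^{+,b}(proj A)` are closed under tensor products. Over `R`, the tensor product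
is the tensor product of `R`-modules, which preserves bounded complexes of projective modules. -/
lemma Kpb_tensor {X Y : KRep R B} (hX : Kpb R _ X) (hY : Kpb R _ Y) : Kpb R _ (X ⊗ Y) := by
  obtain ⟨e⟩ := nonempty_mapHomotopyCategory_tensor (Diagonal.U R (GroupAlgebra R B)) X Y
  exact ⟨Kplus_tensor hX.1 hY.1, (Kbp R).prop_of_iso e (Kbp_tensor hX.2 hY.2)⟩

/-- The functor `- ⊗ Y` on the homotopy category of projective modules. -/
noncomputable abbrev projTensorRight (Y : KProj (GroupAlgebra R B)) :
    KProj (GroupAlgebra R B) ⥤ KProj (GroupAlgebra R B) :=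
  (KProjProp _).lift ((KProjProp _).ι ⋙ (curriedTensor (KRep R B)).flip.obj Y.obj)
    fun X => KProjProp_tensor X.property Y.property

/-- The functor `X ⊗ -` on the homotopy category of projective modules. -/
noncomputable abbrev projTensorLeft (X : KProj (GroupAlgebra R B)) :
    KProj (GroupAlgebra R B) ⥤ KProj (GroupAlgebra R B) :=
  (KProjProp _).lift ((KProjProp _).ι ⋙ (curriedTensor (KRep R B)).obj X.obj)
    fun Y => KProjProp_tensor X.property Y.property

instance (J : Type u) (Y : KProj (GroupAlgebra R B)) :
    PreservesColimitsOfShape (Discrete J) (projTensorRight Y) :=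
  have : PreservesColimitsOfShape (Discrete J) (projTensorRight Y ⋙ (KProjProp _).ι) :=
    inferInstanceAs (PreservesColimitsOfShape (Discrete J)
      ((KProjProp _).ι ⋙ (curriedTensor (KRep R B)).flip.obj Y.obj))
  preservesColimitsOfShape_of_reflects_of_preserves _ (KProjProp _).ι

instance (J : Type u) (X : KProj (GroupAlgebra R B)) :
    PreservesColimitsOfShape (Discrete J) (projTensorLeft X) :=
  have : PreservesColimitsOfShape (Discrete J) (projTensorLeft X ⋙ (KProjProp _).ι) :=
    inferInstanceAs (PreservesColimitsOfShape (Discrete J)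
      ((KProjProp _).ι ⋙ (curriedTensor (KRep R B)).obj X.obj))
  preservesColimitsOfShape_of_reflects_of_preserves _ (KProjProp _).ι

/-- The tensor product on the homotopy category of projective modules. -/
noncomputable abbrev projTensor (X Y : KProj (GroupAlgebra R B)) : KProj (GroupAlgebra R B) :=
  ⟨X.obj ⊗ Y.obj, KProjProp_tensor X.property Y.property⟩

lemma isLocalising_klf_tensor_right (Y : KProj (GroupAlgebra R B)) :
    IsLocalising ((KlfProp R (GroupAlgebra R B)).inverseImage (projTensorRight Y)) :=
  isLocalising_inverseImage _ (isLocalising_localisingClosure _)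

lemma isLocalising_klf_tensor_left (X : KProj (GroupAlgebra R B)) :
    IsLocalising ((KlfProp R (GroupAlgebra R B)).inverseImage (projTensorLeft X)) :=
  isLocalising_inverseImage _ (isLocalising_localisingClosure _)

lemma klfProp_tensor_of_kPlusB {X Y : KProj (GroupAlgebra R B)}
    (hX : KlfProp R (GroupAlgebra R B) X) (hY : KPlusB R (GroupAlgebra R B) Y) :
    KlfProp R (GroupAlgebra R B) (projTensor X Y) := by
  refine hX _ (isLocalising_klf_tensor_right Y) fun Z hZ => ?_
  have h : KPlusB R (GroupAlgebra R B) (projTensor Z Y) := by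
    rw [kPlusB_iff] at hZ hY ⊢
    exact Kpb_tensor hZ hY
  exact le_localisingClosure _ _ h

/-- `K^lf(Proj G, R)` is closed under tensor products: the generators are, and in each variable the
objects with this property form a localising subcategory. -/
lemma klfProp_tensor {X Y : KProj (GroupAlgebra R B)} (hX : KlfProp R (GroupAlgebra R B) X)
    (hY : KlfProp R (GroupAlgebra R B) Y) : KlfProp R (GroupAlgebra R B) (projTensor X Y) :=
  hY _ (isLocalising_klf_tensor_left X) fun _ hZ => klfProp_tensor_of_kPlusB hX hZ

/-- `R`-contractible bounded below complexes in `mod(A, R)` are annihilated by the objects of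
`K^lf(Proj A, R)`: it suffices to consider tensor products with bounded below complexes of
projective modules, which are relatively injective. -/
lemma isZero_tensor_klf {W : KRep R B} (hW : rContractible R _ W)
    (hW' : (termwise (modFinProj R _) ⊓ boundedBelow _) W) {Z : KProj (GroupAlgebra R B)}
    (hZ : KlfProp R _ Z) : IsZero (W ⊗ Z.obj) := by
  refine hZ (ObjectProperty.inverseImage (fun X : KRep R B => IsZero X)
    ((KProjProp _).ι ⋙ (curriedTensor (KRep R B)).obj W))
      (isLocalising_inverseImage _ isLocalising_isZero) fun Z hZ => ?_
  rw [kPlusB_iff] at hZ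
  obtain ⟨⟨Z', ⟨hZ', hb⟩, ⟨e⟩⟩, -⟩ := hZ
  -- `W ⊗ Z'` is an `R`-contractible complex of projective modules, so its identity is zero
  have h1 : IsZero (W ⊗ Z') := (IsZero.iff_id_eq_zero _).2
    (rContractible_hom_eq_zero (rContractible_tensor_left hW Z')
      ((isFrobenius_groupAlgebra R B).termRelInj fun n =>
        proj_coproduct (isColimitTensorCofan W.as Z'.as n) fun i =>
          proj_modFinProj_tensor (hW'.1 i.1.1) (hZ' i.1.2).2)
      (.inl (boundedBelow_tensor hW'.2 hb)) _)
  exact h1.of_iso (whiskerLeftIso W e)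

/-- Morphisms from a bounded complex in `mod(A, R)` to an object of `K^{+,b}(proj A)` with
`R`-contractible cone become isomorphisms after tensoring with objects of `K^lf(Proj A, R)`. -/
lemma isIso_whiskerRight_of_trW {M X : KRep R B} (j : M ⟶ X) (hj : (rContractible R _).trW j)
    (hM : KbModProp R _ M) (hX : Kpb R _ X) (Y : Klf R (GroupAlgebra R B)) :
    IsIso (j ▷ Y.obj.obj) := by
  obtain ⟨X', hX', hb, -, ⟨e⟩⟩ := exists_complex_of_Kpb hX
  obtain ⟨W, a, b, hT, hW⟩ := hj
  have := isTriangulated_termwise_inf_boundedBelow (modFinProj R (GroupAlgebra R B))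
    (modFinProj_zero R _) (modFinProj_biprod R _)
  have h : (termwise (modFinProj R (GroupAlgebra R B)) ⊓ boundedBelow _).isoClosure
      ((KMod.quot _).obj X') :=
    ObjectProperty.le_isoClosure _ _ ⟨fun n => modFinProj_of_finProj (hX' n), hb⟩
  have hW' : (termwise (modFinProj R (GroupAlgebra R B)) ⊓ boundedBelow _).isoClosure W :=
    ObjectProperty.ext_of_isTriangulatedClosed₃ _ _ hT
      (ObjectProperty.le_isoClosure _ _ ⟨hM.1, bounded_le_boundedBelow _ hM.2⟩)
      (ObjectProperty.prop_of_iso _ e.symm h)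
  obtain ⟨W', hW', ⟨i⟩⟩ := hW'
  exact (Triangle.isZero₃_iff_isIso₁ _
    (((curriedTensor (KRep R B)).flip.obj Y.obj.obj).map_distinguished _ hT)).1
      ((isZero_tensor_klf ((rContractible R _).prop_of_iso i hW) hW' Y.property).of_iso
        (whiskerRightIso i _))

/-- Objects of the homotopy category in the class `K^{+,b}(proj A)` come from `K^lf(Proj A, R)`. -/
lemma exists_klf_of_Kpb {I : KRep R B} (hI : Kpb R _ I) :
    ∃ E : Klf R (GroupAlgebra R B), Klf.plusB R _ E ∧ Nonempty (E.obj.obj ≅ I) := by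
  obtain ⟨Y, hY, hb, hb', ⟨e⟩⟩ := exists_complex_of_Kpb hI
  let E' : KProj (GroupAlgebra R B) := ⟨(KMod.quot _).obj Y, fun n => (hY n).2⟩
  have hE' : KPlusB R _ E' := ⟨Y, hY, hb, hb', ⟨Iso.refl _⟩⟩
  exact ⟨⟨E', le_localisingClosure _ _ hE'⟩, hE', ⟨e.symm⟩⟩

variable (R B) in
lemma KbModProp_unit : KbModProp R _ (𝟙_ (KRep R B)) := by
  have h : ∀ n : ℤ, n ≠ 0 → IsZero ((𝟙_ (KRep R B)).as.X n) := fun n hn => isZero_unit_X hn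
  refine ⟨fun n => ?_, 0, fun n hn => h n (by rintro rfl; simp at hn)⟩
  by_cases hn : n = 0
  · subst hn
    exact (modFinProj R _).prop_of_iso (unitX _).symm modFinProj_unit
  · exact (modFinProj R _).prop_of_iso (IsZero.iso (isZero_zero _) (h n hn)) (modFinProj_zero R _)

variable (R B) in
/-- The unit of `K^lf(Proj G, R)` is a coresolution of the trivial module. -/
lemma exists_unit : ∃ (E : Klf R (GroupAlgebra R B)) (g : 𝟙_ (KRep R B) ⟶ E.obj.obj),
    Klf.plusB R _ E ∧ (∀ X : Klf R (GroupAlgebra R B), IsIso (g ▷ X.obj.obj)) ∧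
      ∀ X : Klf R (GroupAlgebra R B), IsIso (X.obj.obj ◁ g) := by
  let _ := HasDerivedCategory.standard (ModuleCat.{u} (GroupAlgebra R B))
  obtain ⟨I, g, hI, hg⟩ := (isFrobenius_groupAlgebra R B).exists_coresolution (KbModProp_unit R B)
  obtain ⟨E, hE, ⟨e⟩⟩ := exists_klf_of_Kpb hI
  have hg' : ∀ X : Klf R (GroupAlgebra R B), IsIso ((g ≫ e.inv) ▷ X.obj.obj) := fun X => by
    have := isIso_whiskerRight_of_trW g hg (KbModProp_unit R B) hI X
    rw [comp_whiskerRight]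
    infer_instance
  refine ⟨E, g ≫ e.inv, hE, hg', fun X => ?_⟩
  have := hg' X
  have h : X.obj.obj ◁ (g ≫ e.inv) = (β_ _ _).hom ≫ (g ≫ e.inv) ▷ X.obj.obj ≫ (β_ _ _).inv := by
    rw [← BraidedCategory.braiding_naturality_right_assoc, Iso.hom_inv_id, Category.comp_id]
  rw [h]
  infer_instance

end KlfTensor

/-! ### The symmetric monoidal structure of `K^lf(Proj G, R)` -/

section CommShift

/-- An isomorphism `F ⋙ G ≅ I ⋙ H` of functors commuting with shifts, in components. -/
lemma commShiftIso_comp_iso {C D E D' : Type*} [Category* C] [Category* D] [Category* E]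
    [Category* D'] [HasShift C ℤ] [HasShift D ℤ] [HasShift E ℤ] [HasShift D' ℤ]
    {F : C ⥤ D} [F.CommShift ℤ] {G : D ⥤ E} [G.CommShift ℤ] {I : C ⥤ D'} [I.CommShift ℤ]
    {H : D' ⥤ E} [H.CommShift ℤ] (e : F ⋙ G ≅ I ⋙ H) [NatTrans.CommShift e.hom ℤ] (n : ℤ) (Y : C) :
    H.map ((I.commShiftIso n).hom.app Y) ≫ (H.commShiftIso n).hom.app (I.obj Y) ≫
        (e.inv.app Y)⟦n⟧' =
      e.inv.app (Y⟦n⟧) ≫ G.map ((F.commShiftIso n).hom.app Y) ≫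
        (G.commShiftIso n).hom.app (F.obj Y) := by
  have h := NatTrans.shift_app_comm e.inv n Y
  rw [Functor.commShiftIso_comp_hom_app, Functor.commShiftIso_comp_hom_app, Category.assoc] at h
  exact h

end CommShift

section KlfMonoidal

set_option linter.unusedSectionVars false

variable {R : Type u} [CommRing R] {B : Type u} [CommRing B] [HopfAlgebra R B] [Module.Finite R B]
  [Module.Projective R B]

variable (R B) in
/-- The category `K^lf(Proj G, R)`. -/
abbrev KlfG := Klf R (GroupAlgebra R B)

variable (R B) in
/-- The inclusion of `K^lf(Proj G, R)` in the homotopy category of complexes. -/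
noncomputable abbrev klfι : KlfG R B ⥤ KRep R B := (KlfProp R _).ι ⋙ (KProjProp _).ι

/-- A morphism of `K^lf(Proj G, R)` given by a morphism in the homotopy category of complexes. -/
noncomputable def klfHom {X Y : KlfG R B} (f : X.obj.obj ⟶ Y.obj.obj) : X ⟶ Y :=
  ObjectProperty.homMk (ObjectProperty.homMk f)

lemma klf_hom_ext {X Y : KlfG R B} {f g : X ⟶ Y} (h : f.hom.hom = g.hom.hom) : f = g :=
  (klfι R B).map_injective h

/-- An isomorphism of `K^lf(Proj G, R)` given by one in the homotopy category of complexes. -/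
noncomputable def klfIso {X Y : KlfG R B} (e : X.obj.obj ≅ Y.obj.obj) : X ≅ Y where
  hom := klfHom e.hom
  inv := klfHom e.inv
  hom_inv_id := klf_hom_ext e.hom_inv_id
  inv_hom_id := klf_hom_ext e.inv_hom_id

variable (R B) in
/-- The tensor unit of `K^lf(Proj G, R)`. -/
noncomputable def klfUnit : KlfG R B := (exists_unit R B).choose

variable (R B) in
/-- The coresolution of the trivial module defining the tensor unit of `K^lf(Proj G, R)`. -/
noncomputable def toKlfUnit : 𝟙_ (KRep R B) ⟶ (klfUnit R B).obj.obj :=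
  (exists_unit R B).choose_spec.choose

variable (R B) in
lemma plusB_klfUnit : Klf.plusB R _ (klfUnit R B) := (exists_unit R B).choose_spec.choose_spec.1

instance (X : KlfG R B) : IsIso (toKlfUnit R B ▷ X.obj.obj) :=
  (exists_unit R B).choose_spec.choose_spec.2.1 X

instance (X : KlfG R B) : IsIso (X.obj.obj ◁ toKlfUnit R B) :=
  (exists_unit R B).choose_spec.choose_spec.2.2 X

/-- The tensor product of `K^lf(Proj G, R)`. -/
noncomputable abbrev klfTensor (X Y : KlfG R B) : KlfG R B :=
  ⟨projTensor X.obj Y.obj, klfProp_tensor X.property Y.property⟩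

/-- The tensor product of complexes on `K^lf(Proj G, R)`. The unit is a coresolution `E` of the
trivial module, and the unitors are the inverses of `X ⟶ E ⊗ X` and `X ⟶ X ⊗ E`. -/
noncomputable instance : MonoidalCategoryStruct (KlfG R B) where
  tensorObj X Y := klfTensor X Y
  whiskerLeft X _ _ f := klfHom (X.obj.obj ◁ f.hom.hom)
  whiskerRight f Y := klfHom (f.hom.hom ▷ Y.obj.obj)
  tensorHom f g := klfHom (f.hom.hom ⊗ₘ g.hom.hom)
  tensorUnit := klfUnit R B
  associator X Y Z := klfIso (α_ X.obj.obj Y.obj.obj Z.obj.obj)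
  leftUnitor X := klfIso ((asIso (toKlfUnit R B ▷ X.obj.obj)).symm ≪≫ λ_ X.obj.obj)
  rightUnitor X := klfIso ((asIso (X.obj.obj ◁ toKlfUnit R B)).symm ≪≫ ρ_ X.obj.obj)

lemma leftUnitor_klf (X : KlfG R B) :
    toKlfUnit R B ▷ X.obj.obj ≫ (λ_ X).hom.hom.hom = (λ_ X.obj.obj).hom :=
  (asIso (toKlfUnit R B ▷ X.obj.obj)).hom_inv_id_assoc _

lemma rightUnitor_klf (X : KlfG R B) :
    X.obj.obj ◁ toKlfUnit R B ≫ (ρ_ X).hom.hom.hom = (ρ_ X.obj.obj).hom :=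
  (asIso (X.obj.obj ◁ toKlfUnit R B)).hom_inv_id_assoc _

noncomputable instance : MonoidalCategory (KlfG R B) where
  tensorHom_def f g := klf_hom_ext (MonoidalCategory.tensorHom_def f.hom.hom g.hom.hom)
  id_tensorHom_id X Y := klf_hom_ext (id_tensorHom_id X.obj.obj Y.obj.obj)
  tensorHom_comp_tensorHom f₁ f₂ g₁ g₂ := klf_hom_ext
    (tensorHom_comp_tensorHom f₁.hom.hom f₂.hom.hom g₁.hom.hom g₂.hom.hom)
  whiskerLeft_id X Y := klf_hom_ext (whiskerLeft_id X.obj.obj Y.obj.obj)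
  id_whiskerRight X Y := klf_hom_ext (id_whiskerRight X.obj.obj Y.obj.obj)
  associator_naturality f₁ f₂ f₃ := klf_hom_ext
    (associator_naturality f₁.hom.hom f₂.hom.hom f₃.hom.hom)
  leftUnitor_naturality {X Y} f := klf_hom_ext ((cancel_epi (toKlfUnit R B ▷ X.obj.obj)).1 (by
    have h1 := reassoc_of% (whisker_exchange (toKlfUnit R B) f.hom.hom)
    refine (h1 (λ_ Y).hom.hom.hom).symm.trans ?_
    rw [leftUnitor_klf, leftUnitor_naturality, ← leftUnitor_klf, Category.assoc]
    rfl))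
  rightUnitor_naturality {X Y} f := klf_hom_ext ((cancel_epi (X.obj.obj ◁ toKlfUnit R B)).1 (by
    have h1 := reassoc_of% (whisker_exchange f.hom.hom (toKlfUnit R B))
    refine (h1 (ρ_ Y).hom.hom.hom).trans ?_
    rw [rightUnitor_klf, rightUnitor_naturality, ← rightUnitor_klf, Category.assoc]
    rfl))
  pentagon V X Y Z := klf_hom_ext (pentagon V.obj.obj X.obj.obj Y.obj.obj Z.obj.obj)
  triangle X Y := klf_hom_ext ((cancel_epi ((X.obj.obj ◁ toKlfUnit R B) ▷ Y.obj.obj)).1 (by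
    have h1 := associator_naturality_middle_assoc X.obj.obj (toKlfUnit R B) Y.obj.obj
      (X.obj.obj ◁ (λ_ Y).hom.hom.hom)
    have h2 : (X.obj.obj ◁ toKlfUnit R B) ▷ Y.obj.obj ≫ (ρ_ X).hom.hom.hom ▷ Y.obj.obj =
      (ρ_ X.obj.obj).hom ▷ Y.obj.obj := by
        rw [← comp_whiskerRight, rightUnitor_klf]
    rw [← MonoidalCategory.whiskerLeft_comp, leftUnitor_klf, MonoidalCategory.triangle] at h1
    exact h1.trans h2.symm))

/-- The braiding of `K^lf(Proj G, R)` is that of complexes. -/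
noncomputable instance : SymmetricCategory (KlfG R B) where
  braiding X Y := klfIso (β_ X.obj.obj Y.obj.obj)
  braiding_naturality_right X _ _ f :=
    klf_hom_ext (BraidedCategory.braiding_naturality_right X.obj.obj f.hom.hom)
  braiding_naturality_left f Z :=
    klf_hom_ext (BraidedCategory.braiding_naturality_left f.hom.hom Z.obj.obj)
  hexagon_forward X Y Z :=
    klf_hom_ext (BraidedCategory.hexagon_forward X.obj.obj Y.obj.obj Z.obj.obj)
  hexagon_reverse X Y Z :=
    klf_hom_ext (BraidedCategory.hexagon_reverse X.obj.obj Y.obj.obj Z.obj.obj)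
  symmetry X Y := klf_hom_ext (SymmetricCategory.symmetry X.obj.obj Y.obj.obj)

/-- The inclusion of `K^lf(Proj G, R)` commutes with `X ⊗ -`. -/
noncomputable abbrev klfTensorLeftIso (X : KlfG R B) :
    (curriedTensor (KlfG R B)).obj X ⋙ klfι R B ≅
      klfι R B ⋙ (curriedTensor (KRep R B)).obj X.obj.obj := Iso.refl _

/-- The inclusion of `K^lf(Proj G, R)` commutes with `- ⊗ Y`. -/
noncomputable abbrev klfTensorRightIso (Y : KlfG R B) :
    (curriedTensor (KlfG R B)).flip.obj Y ⋙ klfι R B ≅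
      klfι R B ⋙ (curriedTensor (KRep R B)).flip.obj Y.obj.obj := Iso.refl _

noncomputable instance (X : KlfG R B) : ((curriedTensor (KlfG R B)).obj X).CommShift ℤ :=
  Functor.CommShift.ofComp (klfTensorLeftIso X) ℤ

noncomputable instance (Y : KlfG R B) : ((curriedTensor (KlfG R B)).flip.obj Y).CommShift ℤ :=
  Functor.CommShift.ofComp (klfTensorRightIso Y) ℤ

lemma commShiftIso_klfTensorLeft (X Y : KlfG R B) (n : ℤ) :
    ((curriedTensor (KRep R B)).obj ((klfι R B).obj X)).map
      (((klfι R B).commShiftIso n).hom.app Y) ≫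
    (((curriedTensor (KRep R B)).obj ((klfι R B).obj X)).commShiftIso n).hom.app
        ((klfι R B).obj Y) ≫ (Iso.refl ((klfι R B).obj (X ⊗ Y))).hom⟦n⟧' =
      (Iso.refl _).hom ≫
        (klfι R B).map ((((curriedTensor (KlfG R B)).obj X).commShiftIso n).hom.app Y) ≫
          ((klfι R B).commShiftIso n).hom.app (X ⊗ Y) := by
  have := Functor.CommShift.ofComp_compatibility (klfTensorLeftIso X) ℤ
  exact commShiftIso_comp_iso (klfTensorLeftIso X) n Y

lemma commShiftIso_klfTensorRight (X Y : KlfG R B) (n : ℤ) :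
    ((curriedTensor (KRep R B)).map (((klfι R B).commShiftIso n).hom.app X)).app
      ((klfι R B).obj Y) ≫
    (((curriedTensor (KRep R B)).flip.obj ((klfι R B).obj Y)).commShiftIso n).hom.app
        ((klfι R B).obj X) ≫ (Iso.refl ((klfι R B).obj (X ⊗ Y))).hom⟦n⟧' =
      (Iso.refl _).hom ≫
        (klfι R B).map ((((curriedTensor (KlfG R B)).flip.obj Y).commShiftIso n).hom.app X) ≫
          ((klfι R B).commShiftIso n).hom.app (X ⊗ Y) := by
  have := Functor.CommShift.ofComp_compatibility (klfTensorRightIso Y) ℤ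
  exact commShiftIso_comp_iso (klfTensorRightIso Y) n X

instance {X Y : KlfG R B} (f : X ⟶ Y) :
    NatTrans.CommShift ((curriedTensor (KlfG R B)).map f) ℤ where
  shift_comm n := by
    ext1
    ext1 Z
    refine (klfι R B).map_injective ((commShift_naturality_left_iff (klfι R B) (klfι R B)
      (klfι R B) (curriedTensor _) (curriedTensor (KRep R B))
      (fun X Y => Iso.refl ((klfι R B).obj (X ⊗ Y)))
      commShiftIso_klfTensorLeft (fun f Y => ?_) f Z n).1 ?_)
    · exact (Category.comp_id _).trans (Category.id_comp _).symm
    · exact NatTrans.shift_app_comm ((curriedTensor (KRep R B)).map f.hom.hom) n Z.obj.obj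

instance {X Y : KlfG R B} (f : X ⟶ Y) :
    NatTrans.CommShift ((curriedTensor (KlfG R B)).flip.map f) ℤ where
  shift_comm n := by
    ext1
    ext1 Z
    refine (klfι R B).map_injective ((commShift_naturality_left_iff (klfι R B) (klfι R B)
      (klfι R B) (curriedTensor _).flip (curriedTensor (KRep R B)).flip
      (fun X Y => Iso.refl ((klfι R B).obj (Y ⊗ X)))
      (fun X Y => commShiftIso_klfTensorRight Y X) (fun f Y => ?_) f Z n).1 ?_)
    · exact (Category.comp_id _).trans (Category.id_comp _).symm
    · exact NatTrans.shift_app_comm ((curriedTensor (KRep R B)).flip.map f.hom.hom) n Z.obj.obj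

/-- The commutation of the tensor product with the shifts is that of complexes. -/
noncomputable instance : (curriedTensor (KlfG R B)).CommShift₂Int where
  comm X Y m n := by
    have h := Functor.commShift₂_comm (curriedTensor (KRep R B)) .int X.obj.obj Y.obj.obj m n
    simp only [CommShift₂Setup.int_ε, CatCenter.app_neg_one_zpow] at h ⊢
    exact (klfι R B).map_injective ((commShift₂_comm_iff (klfι R B) (klfι R B) (klfι R B)
      (curriedTensor _) (curriedTensor (KRep R B)) (fun X Y => Iso.refl ((klfι R B).obj (X ⊗ Y)))
      commShiftIso_klfTensorLeft commShiftIso_klfTensorRight X Y m n).1 h)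

end KlfMonoidal

/-! ### Comparison with complexes, and function objects -/

section ToKlf

variable (R : Type u) [CommRing R] (A : Type u) [Ring A] [Algebra R A]

/-- The projection from complexes to `K^lf(Proj A, R)` is induced by the projection to the homotopy
category. -/
noncomputable def toKlfιIso : toKlf R A ⋙ (KlfProp R A).ι ⋙ (KProjProp A).ι ≅
    (lfComplex R A).ι ⋙ HomotopyCategory.quotient (ModuleCat.{u} A) (.up ℤ) :=
  (Functor.associator _ _ _).symm ≪≫
    Functor.isoWhiskerRight ((KlfProp R A).liftCompιIso _ _) (KProjProp A).ι ≪≫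
      (KProjProp A).liftCompιIso _ _

instance : NatTrans.CommShift (toKlfιIso R A).hom ℤ := by
  let F := (KProjProp A).lift ((lfComplex R A).ι ⋙ HomotopyCategory.quotient _ _)
    fun X => X.property.choose
  have h : NatTrans.CommShift
      ((KlfProp R A).liftCompιIso F fun X => X.property.choose_spec).hom ℤ := inferInstance
  have h' : NatTrans.CommShift (Functor.whiskerRight ((KlfProp R A).liftCompιIso F
    fun X => X.property.choose_spec).hom (KProjProp A).ι) ℤ := inferInstance
  have h'' : NatTrans.CommShift ((KProjProp A).liftCompιIso
    ((lfComplex R A).ι ⋙ HomotopyCategory.quotient _ _) fun X => X.property.choose).hom ℤ :=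
    inferInstance
  have h''' : NatTrans.CommShift
    (Functor.associator (toKlf R A) (KlfProp R A).ι (KProjProp A).ι).inv ℤ := inferInstance
  exact @NatTrans.CommShift.comp _ _ _ _ _ _ _ _ _ _ _ _ _ _ _ _ h'''
    (@NatTrans.CommShift.comp _ _ _ _ _ _ _ _ _ _ _ _ _ _ _ _ h' h'')

end ToKlf

section Induced

set_option linter.unusedSectionVars false

variable {R : Type u} [CommRing R] {B : Type u} [CommRing B] [HopfAlgebra R B] [Module.Finite R B]
  [Module.Projective R B]

/-- Complexes in `K^lf(Proj G, R)` are closed under the tensor product. -/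
lemma lfComplex_tensor {X Y : CochainComplex (ModuleCat.{u} (GroupAlgebra R B)) ℤ}
    (hX : lfComplex R (GroupAlgebra R B) X) (hY : lfComplex R (GroupAlgebra R B) Y) :
    lfComplex R (GroupAlgebra R B) (X ⊗ Y) := by
  obtain ⟨h₁, h₁'⟩ := hX
  obtain ⟨h₂, h₂'⟩ := hY
  let X' : KProj (GroupAlgebra R B) := ⟨(homQ _).obj X, h₁⟩
  let Y' : KProj (GroupAlgebra R B) := ⟨(homQ _).obj Y, h₂⟩
  have h := klfProp_tensor (X := X') (Y := Y') h₁' h₂'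
  exact ⟨(projTensor X' Y').property, h⟩

lemma eq_of_comp_eq_id {D : Type*} [Category* D] {X Y Z : D} {f : X ⟶ Y} {g i j c}
    (h : f ≫ g ≫ i = j ≫ c) (hi : i = 𝟙 Z) (hj : j = 𝟙 X) : c = f ≫ g := by
  rw [hi, hj, Category.comp_id, Category.id_comp] at h
  exact h.symm

/-- The commutation of `toKlf` with the shift is induced by that of the projection to the homotopy
category. -/
lemma toKlf_shift (X : LfComplex R B) (n : ℤ) :
    (klfι R B).map (((toKlf R _).commShiftIso n).hom.app X) ≫
        ((klfι R B).commShiftIso n).hom.app ((toKlf R _).obj X) =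
      (homQ _).map (((lfComplex R _).ι.commShiftIso n).hom.app X) ≫
        ((homQ _).commShiftIso n).hom.app X.obj := by
  have h := commShiftIso_comp_iso (toKlfιIso R (GroupAlgebra R B)) n X
  have h1 : ∀ X, (toKlfιIso R (GroupAlgebra R B)).inv.app X = 𝟙 ((homQ _).obj X.obj) := fun X => by
    simp [toKlfιIso]
    rfl
  exact eq_of_comp_eq_id h (((congrArg (fun f => f⟦n⟧') (h1 X)).trans
    (CategoryTheory.Functor.map_id _ _))) (h1 _)

lemma comp_comp_eq_comp_comp {D : Type*} [Category* D] {X Y : D} {a : X ⟶ Y} {i j k l}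
    (hi : i = 𝟙 X) (hj : j = 𝟙 X) (hk : k = 𝟙 Y) (hl : l = 𝟙 Y) : i ≫ j ≫ a = a ≫ k ≫ l := by
  simp [hi, hj, hk, hl]

lemma shift_comp_eq {D : Type*} [Category* D] {X₁ X₂ X₃ X₄ W Z V U : D} {p : X₁ ⟶ X₂}
    {p' : X₂ ⟶ X₁} {a : X₂ ⟶ X₃} {l : X₁ ⟶ X₄} {q : X₄ ⟶ X₃} {m : X₃ ⟶ W} {k : X₂ ⟶ Z}
    {i : Z ⟶ W} {c : X₄ ⟶ V} {r : V ⟶ W} {t : U ⟶ Z} {t' : Z ⟶ U} {s : U ⟶ V} {s' : V ⟶ U}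
    {j₁ j₂ : W ⟶ W} {j₃ : X₂ ⟶ X₂} {j₄ : X₄ ⟶ X₄} {j₅ : Z ⟶ Z} {j₆ : X₁ ⟶ X₁} [Mono i]
    (hp : p' ≫ p = 𝟙 _) (ht : t ≫ t' = 𝟙 _) (hs : s' ≫ s = 𝟙 _) (h₁ : p ≫ a = l ≫ q)
    (h₂ : t ≫ i = s ≫ r) (h₃ : a ≫ m ≫ j₁ = j₃ ≫ k ≫ i) (h₄ : q ≫ m ≫ j₂ = j₄ ≫ c ≫ r)
    (hj₁ : j₁ = 𝟙 _) (hj₂ : j₂ = 𝟙 _) (hj₃ : j₃ = 𝟙 _) (hj₄ : j₄ = 𝟙 _) (hj₅ : j₅ = 𝟙 _)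
    (hj₆ : j₆ = 𝟙 _) :
    k ≫ j₅ ≫ t' = p' ≫ j₆ ≫ (l ≫ c) ≫ s' := by
  subst hj₁ hj₂ hj₃ hj₄ hj₅ hj₆
  simp only [Category.comp_id, Category.id_comp, Category.assoc] at *
  have : k = p' ≫ l ≫ c ≫ s' ≫ t := by
    rw [← cancel_mono i]
    simp only [Category.assoc]
    rw [h₂, reassoc_of% hs, ← h₄, ← reassoc_of% h₁, reassoc_of% hp, h₃]
  rw [this]
  simp only [Category.assoc, ht, Category.comp_id]

variable (R B) in
/-- The structure of `K^lf(Proj G, R)` is induced by the tensor product of complexes. -/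
noncomputable def isInduced : IsInduced R B where
  closed X Y := lfComplex_tensor X.property Y.property
  μ X Y := klfIso (Iso.refl ((homQ _).obj (X.obj ⊗ Y.obj)))
  natural {X X' Y Y'} f g := klf_hom_ext ((Category.comp_id _).trans
    ((congrArg (homQ _).map (MonoidalCategory.tensorHom_def f.hom g.hom)).symm.trans
      (Category.id_comp _).symm))
  associator X Y Z := klf_hom_ext (comp_comp_eq_comp_comp (id_whiskerRight _ _) rfl
    (MonoidalCategory.whiskerLeft_id _ _) rfl)
  braiding X Y := klf_hom_ext ((Category.id_comp _).trans (Category.comp_id _).symm)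
  shift_left X Y n := klf_hom_ext (by
    let Z : LfComplex R B := ⟨X.obj ⊗ Y.obj, lfComplex_tensor X.property Y.property⟩
    let t := (klfι R B).mapIso (((toKlf R _).commShiftIso n).app Z)
    let s := (homQ _).mapIso (((lfComplex R _).ι.commShiftIso n).app Z)
    let p := (klfι R B).mapIso (((toKlf R _).commShiftIso n).app X)
    refine shift_comp_eq (t := t.hom) (t' := t.inv) (s := s.hom) (s' := s.inv)
      (p := p.hom ▷ (homQ _).obj Y.obj) (p' := p.inv ▷ (homQ _).obj Y.obj)
      (l := (homQ _).map (((lfComplex R _).ι.commShiftIso n).hom.app X) ▷ (homQ _).obj Y.obj)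
      (q := ((homQ _).commShiftIso n).hom.app X.obj ▷ (homQ _).obj Y.obj)
      (c := (homQ _).map (CochainComplex.mapBifunctorShift₁Iso X.obj Y.obj (curriedTensor _) n).hom)
      (i := ((klfι R B).commShiftIso n).hom.app ((toKlf R _).obj Z))
      (by rw [← comp_whiskerRight, p.inv_hom_id, id_whiskerRight]) t.hom_inv_id s.inv_hom_id
      ?_ (toKlf_shift Z n) (commShiftIso_klfTensorRight ((toKlf R _).obj X) ((toKlf R _).obj Y) n)
      (commShiftIso_homTensorRight X.obj Y.obj n)
      (CategoryTheory.Functor.map_id _ _) (CategoryTheory.Functor.map_id _ _) rfl rfl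
      (congrArg (fun f => f.hom.hom) (CategoryTheory.Functor.map_id (shiftFunctor (KlfG R B) n)
        ((toKlf R _).obj Z))) rfl
    exact (comp_whiskerRight _ _ _).symm.trans
      ((congrArg (· ▷ (homQ _).obj Y.obj) (toKlf_shift X n)).trans (comp_whiskerRight _ _ _)))
  shift_right X Y n := klf_hom_ext (by
    let Z : LfComplex R B := ⟨X.obj ⊗ Y.obj, lfComplex_tensor X.property Y.property⟩
    let t := (klfι R B).mapIso (((toKlf R _).commShiftIso n).app Z)
    let s := (homQ _).mapIso (((lfComplex R _).ι.commShiftIso n).app Z)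
    let p := (klfι R B).mapIso (((toKlf R _).commShiftIso n).app Y)
    refine shift_comp_eq (t := t.hom) (t' := t.inv) (s := s.hom) (s' := s.inv)
      (p := (homQ _).obj X.obj ◁ p.hom) (p' := (homQ _).obj X.obj ◁ p.inv)
      (l := (homQ _).obj X.obj ◁ (homQ _).map (((lfComplex R _).ι.commShiftIso n).hom.app Y))
      (q := (homQ _).obj X.obj ◁ ((homQ _).commShiftIso n).hom.app Y.obj)
      (c := (homQ _).map (CochainComplex.mapBifunctorShift₂Iso X.obj Y.obj (curriedTensor _) n).hom)
      (i := ((klfι R B).commShiftIso n).hom.app ((toKlf R _).obj Z))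
      (by rw [← MonoidalCategory.whiskerLeft_comp, p.inv_hom_id, MonoidalCategory.whiskerLeft_id]) t.hom_inv_id s.inv_hom_id
      ?_ (toKlf_shift Z n) (commShiftIso_klfTensorLeft ((toKlf R _).obj X) ((toKlf R _).obj Y) n)
      (commShiftIso_homTensorLeft X.obj Y.obj n)
      (CategoryTheory.Functor.map_id _ _) (CategoryTheory.Functor.map_id _ _) rfl rfl
      (congrArg (fun f => f.hom.hom) (CategoryTheory.Functor.map_id (shiftFunctor (KlfG R B) n)
        ((toKlf R _).obj Z))) rfl
    exact (MonoidalCategory.whiskerLeft_comp _ _ _).symm.trans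
      ((congrArg ((homQ _).obj X.obj ◁ ·) (toKlf_shift Y n)).trans (MonoidalCategory.whiskerLeft_comp _ _ _)))

end Induced

section Structure

variable {R : Type u} [CommRing R] {B : Type u} [CommRing B] [HopfAlgebra R B] [Module.Finite R B]
  [Module.Projective R B]

instance : MonoidalPreadditive (KlfG R B) where
  whiskerLeft_zero {X Y Z} := klf_hom_ext (MonoidalPreadditive.whiskerLeft_zero
    (X := X.obj.obj) (Y := Y.obj.obj) (Z := Z.obj.obj))
  zero_whiskerRight {X Y Z} := klf_hom_ext (MonoidalPreadditive.zero_whiskerRight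
    (X := X.obj.obj) (Y := Y.obj.obj) (Z := Z.obj.obj))
  whiskerLeft_add {X _ _} f g := klf_hom_ext (MonoidalPreadditive.whiskerLeft_add
    (X := X.obj.obj) f.hom.hom g.hom.hom)
  add_whiskerRight {X _ _} f g := klf_hom_ext (MonoidalPreadditive.add_whiskerRight
    (X := X.obj.obj) f.hom.hom g.hom.hom)

instance (X : KlfG R B) : ((curriedTensor (KlfG R B)).obj X).IsTriangulated := by
  have := Functor.CommShift.ofComp_compatibility (klfTensorLeftIso X) ℤ
  rw [Functor.isTriangulated_iff_comp_right (klfTensorLeftIso X)]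
  infer_instance

instance (X : KlfG R B) : ((curriedTensor (KlfG R B)).flip.obj X).IsTriangulated := by
  have := Functor.CommShift.ofComp_compatibility (klfTensorRightIso X) ℤ
  rw [Functor.isTriangulated_iff_comp_right (klfTensorRightIso X)]
  infer_instance

instance : IsTensorTriangulated (KlfG R B) where
  left _ := inferInstance
  right _ := inferInstance

instance (J : Type u) (X : KlfG R B) :
    PreservesColimitsOfShape (Discrete J) ((curriedTensor (KlfG R B)).obj X) :=
  have : PreservesColimitsOfShape (Discrete J)
      ((curriedTensor (KlfG R B)).obj X ⋙ (KlfProp R (GroupAlgebra R B)).ι) :=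
    inferInstanceAs (PreservesColimitsOfShape (Discrete J)
      ((KlfProp R (GroupAlgebra R B)).ι ⋙ projTensorLeft X.obj))
  preservesColimitsOfShape_of_reflects_of_preserves _ (KlfProp R (GroupAlgebra R B)).ι

variable (R B) in
lemma isCompactlyGeneratedTri_klfG : IsCompactlyGeneratedTri (KlfG R B) :=
  (isFrobenius_groupAlgebra R B).isCompactlyGeneratedTri

instance (X : KlfG R B) : (tensorLeft X).IsLeftAdjoint :=
  isLeftAdjoint_of_isCompactlyGeneratedTri ((curriedTensor (KlfG R B)).obj X)
    (isCompactlyGeneratedTri_klfG R B)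

/-- Function objects in `K^lf(Proj G, R)`, given by Brown representability. -/
noncomputable instance : MonoidalClosed (KlfG R B) where
  closed X := { rightAdj := (tensorLeft X).rightAdjoint, adj := Adjunction.ofIsLeftAdjoint _ }

lemma compacts_klfUnit : compacts (KlfG R B) (𝟙_ _) :=
  (isFrobenius_groupAlgebra R B).plusB_le_compacts _ (plusB_klfUnit R B)

end Structure

/-! ### Dual complexes and a criterion for rigidity -/

section DualComplex

set_option linter.unusedSectionVars false

variable {C : Type u} [Category.{v} C] [MonoidalCategory C] [Preadditive C] [MonoidalPreadditive C]

lemma leftAdjointMate_zero (X Y : C) [HasLeftDual X] [HasLeftDual Y] : (ᘁ(0 : X ⟶ Y)) = 0 := by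
  simpa using leftAdjointMate_sum (∅ : Finset Unit) fun _ => (0 : X ⟶ Y)

lemma isZero_leftDual {X : C} [HasLeftDual X] (hX : IsZero X) : IsZero (ᘁX) := by
  rw [IsZero.iff_id_eq_zero, ← leftAdjointMate_id, hX.eq_of_src (𝟙 X) 0, leftAdjointMate_zero]

/-- The evaluations on `X` and `Y` are compatible with the differentials `f` and `b • ᘁf` if the
signs `a` and `b` are opposite. -/
lemma leftAdjointMate_ev_eq_zero {X Y : C} [HasLeftDual X] [HasLeftDual Y] (f : X ⟶ Y) {a b : ℤˣ}
    (h : a * b = -1) : f ▷ (ᘁY) ≫ ε_ _ _ + a • X ◁ (b • ᘁf) ≫ ε_ _ _ = 0 := by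
  have : X ◁ (b • ᘁf) = b • X ◁ (ᘁf) := by
    obtain rfl | rfl := Int.units_eq_one_or b
    · simp
    · simpa [Units.smul_def] using (tensorLeft X).map_neg (f := ᘁf)
  rw [this, Linear.units_smul_comp, smul_smul, h, leftAdjointMate_comp_evaluation]
  simp

lemma coev_leftAdjointMate_eq_zero {X Y : C} [HasLeftDual X] [HasLeftDual Y] (f : X ⟶ Y) {a b : ℤˣ}
    (h : b = -a) : η_ (ᘁY) Y ≫ (a • ᘁf) ▷ Y + b • η_ (ᘁX) X ≫ (ᘁX) ◁ f = 0 := by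
  have : (a • ᘁf) ▷ Y = a • (ᘁf) ▷ Y := by
    obtain rfl | rfl := Int.units_eq_one_or a
    · simp
    · simp only [Units.smul_def, Units.val_neg, Units.val_one, neg_smul, one_smul]
      exact eq_neg_of_add_eq_zero_left (by
        rw [← MonoidalPreadditive.add_whiskerRight, neg_add_cancel,
          MonoidalPreadditive.zero_whiskerRight])
  rw [this, Linear.comp_units_smul, h, coevaluation_comp_leftAdjointMate]
  simp

/-- The dual complex `D^n = (M^{-n})^*`, with differential `(-1)^n` times the dual of
`M^{-n-1} ⟶ M^{-n}`. -/
noncomputable def dualComplex (M : CochainComplex C ℤ) [∀ n, HasLeftDual (M.X n)] :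
    CochainComplex C ℤ where
  X n := ᘁ(M.X (-n))
  d q q' := q.negOnePow • ᘁ(M.d (-q') (-q))
  shape q q' h := by
    rw [M.shape _ _ fun h' => h (by change q + 1 = q'; change -q' + 1 = -q at h'; lia),
      leftAdjointMate_zero, smul_zero]
  d_comp_d' p q r _ _ := by
    rw [Linear.units_smul_comp, Linear.comp_units_smul, ← comp_leftAdjointMate, M.d_comp_d,
      leftAdjointMate_zero, smul_zero, smul_zero]

variable [HasZeroObject C] [HasColimitsOfSize.{0, 0} C]
  [∀ X : C, PreservesColimitsOfSize.{0, 0} ((curriedTensor C).obj X)]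
  [∀ X : C, PreservesColimitsOfSize.{0, 0} ((curriedTensor C).flip.obj X)]

/-- A bounded complex of dualisable objects has a dual. -/
@[reducible]
noncomputable def exactPairingDualComplex (M : CochainComplex C ℤ) [∀ n, HasLeftDual (M.X n)]
    (s : Finset ℤ) (hs : ∀ p ∉ s, IsZero (M.X p)) : ExactPairing (dualComplex M) M :=
  exactPairingComplex (D := dualComplex M)
    (fun p q h => (M.XIsoOfEq (show p = -q by lia)).hom ▷ _ ≫ ε_ (ᘁ(M.X (-q))) (M.X (-q)))
    (fun p q p' q' h h' hp hq => by
      obtain rfl : p = -q' := by lia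
      obtain rfl : p' = -q := by lia
      dsimp only [dualComplex]
      simp only [HomologicalComplex.XIsoOfEq_rfl, Iso.refl_hom, id_whiskerRight, Category.id_comp]
      exact leftAdjointMate_ev_eq_zero _ (a := (-q').negOnePow) (b := q.negOnePow) (by
        rw [← Int.negOnePow_add, Int.negOnePow_odd _ ⟨-1, by lia⟩]))
    (fun q p h => η_ (ᘁ(M.X (-q))) (M.X (-q)) ≫ _ ◁ (M.XIsoOfEq (show -q = p by lia)).hom)
    (fun q p q' p' h h' hq hp => by
      obtain rfl : p = -q := by lia
      obtain rfl : p' = -q' := by lia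
      dsimp only [dualComplex]
      simp only [HomologicalComplex.XIsoOfEq_rfl, Iso.refl_hom, MonoidalCategory.whiskerLeft_id,
        Category.comp_id]
      exact coev_leftAdjointMate_eq_zero _ (a := q.negOnePow) (b := q'.negOnePow) (by rw [← hq, Int.negOnePow_succ]))
    s hs (fun p hp => isZero_leftDual (by rw [neg_neg]; exact hs p hp))
    (fun p q h h' => by
      obtain rfl : p = -q := by lia
      simp [dualComplex])
    (fun p q h h' => by
      obtain rfl : p = -q := by lia
      simp [dualComplex])

/-- A dual pair of complexes remains a dual pair in the homotopy category. -/
@[reducible]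
noncomputable def exactPairingHomQ {D M : CochainComplex C ℤ} (e : ExactPairing D M) :
    ExactPairing ((homQ C).obj D) ((homQ C).obj M) where
  coevaluation' := (homQ C).map (η_ D M)
  evaluation' := (homQ C).map (ε_ D M)
  coevaluation_evaluation' := congrArg (homQ C).map (ExactPairing.coevaluation_evaluation D M)
  evaluation_coevaluation' := congrArg (homQ C).map (ExactPairing.evaluation_coevaluation D M)

end DualComplex

section Rigid

variable {K : Type u} [Category.{v} K] [MonoidalCategory K]

/-- Let `D` be dual to `M` and let `j : M ⟶ X` become invertible after tensoring with `W`. Then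
morphisms `W ⟶ (D ⊗ E) ⊗ Y` correspond to morphisms `X ⊗ W ⟶ Y` when `E` acts as a unit on
`Y`. The morphism `e` is the evaluation of the resulting pairing between `X` and `D ⊗ E`. -/
lemma bijective_of_exactPairing {D M X E W Y : K} [ExactPairing D M] (j : M ⟶ X) (l : E ⊗ Y ≅ Y)
    (e : X ⊗ D ⊗ E ⟶ E) (he : j ▷ (D ⊗ E) ≫ e = (α_ M D E).inv ≫ ε_ D M ▷ E ≫ (λ_ E).hom)
    [IsIso (j ▷ W)] :
    Function.Bijective fun f : W ⟶ (D ⊗ E) ⊗ Y =>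
      X ◁ f ≫ (α_ X (D ⊗ E) Y).inv ≫ e ▷ Y ≫ l.hom := by
  have h1 := ((α_ D E Y ≪≫ whiskerLeftIso D l).homToEquiv (Z := W)).trans
    (tensorLeftHomEquiv W D M Y).symm
  refine (Function.Bijective.of_comp_iff' ((asIso (j ▷ W)).homFromEquiv (Z := Y)).symm.bijective
    _).1 (bijective_of_eq (((α_ D E Y ≪≫ whiskerLeftIso D l).homToEquiv (Z := W)).trans
    (tensorLeftHomEquiv W D M Y).symm).bijective fun f => ?_)
  change M ◁ (f ≫ (α_ D E Y).hom ≫ D ◁ l.hom) ≫ (α_ _ _ _).inv ≫ ε_ D M ▷ Y ≫ (λ_ Y).hom =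
    j ▷ W ≫ X ◁ f ≫ (α_ X (D ⊗ E) Y).inv ≫ e ▷ Y ≫ l.hom
  rw [← whisker_exchange_assoc, associator_inv_naturality_left_assoc, ← comp_whiskerRight_assoc, he]
  simp only [MonoidalCategory.whiskerLeft_comp, Category.assoc, comp_whiskerRight,
    associator_inv_naturality_right_assoc, whisker_exchange_assoc, id_whiskerLeft,
    Iso.inv_hom_id, Category.comp_id]
  monoidal

/-- An object is rigid if it has a pairing `e : X ⊗ D ⟶ 𝟙` for which `D ⊗ Y` represents the functor
`Hom(X ⊗ -, Y)`, for all `Y`. -/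
lemma isIso_rigidityMap [MonoidalClosed K] {X D : K} (e : X ⊗ D ⟶ 𝟙_ K)
    (h : ∀ W Y : K, Function.Bijective fun f : W ⟶ D ⊗ Y =>
      X ◁ f ≫ (α_ X D Y).inv ≫ e ▷ Y ≫ (λ_ Y).hom) : IsRigid X := by
  -- by the Yoneda lemma, `D ⊗ Y` is isomorphic to `Hom(X, Y)`; for `Y = 𝟙` this identifies `D` with
  -- `Hom(X, 𝟙)`
  have hr : ∀ Y, IsIso (MonoidalClosed.curry ((α_ X D Y).inv ≫ e ▷ Y ≫ (λ_ Y).hom)) := fun Y => by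
    rw [isIso_iff_yoneda_map_bijective]
    intro W
    refine (Function.Bijective.of_comp_iff'
      ((ihom.adjunction X).homEquiv W Y).symm.bijective _).1 ?_
    exact bijective_of_eq (h W Y) fun f =>
      ((MonoidalClosed.uncurry_natural_left _ _).trans (by rw [MonoidalClosed.uncurry_curry])).symm
  let d : D ⟶ (ihom X).obj (𝟙_ K) := MonoidalClosed.curry e
  have hd : d = (ρ_ D).inv ≫ MonoidalClosed.curry ((α_ X D _).inv ≫ e ▷ _ ≫ (λ_ (𝟙_ K)).hom) := by
    rw [← MonoidalClosed.curry_natural_left]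
    simp [unitors_equal]
    rfl
  have : IsIso d := by
    have := hr (𝟙_ K)
    rw [hd]
    infer_instance
  intro Y
  have h1 : d ▷ Y ≫ rigidityMap X Y =
      MonoidalClosed.curry ((α_ X D Y).inv ≫ e ▷ Y ≫ (λ_ Y).hom) := by
    rw [rigidityMap, ← MonoidalClosed.curry_natural_left, associator_inv_naturality_middle_assoc,
      ← comp_whiskerRight_assoc, ← MonoidalClosed.uncurry_eq, MonoidalClosed.uncurry_curry]
  have := hr Y
  rw [← h1] at this
  exact IsIso.of_isIso_comp_left (d ▷ Y) _

/-- If the unit is compact then rigid objects are compact, because `Hom(X, -)` is isomorphic to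
`Hom(𝟙, Hom(X, 𝟙) ⊗ -)`. -/
lemma compacts_of_isRigid [MonoidalClosed K] [Preadditive K] [MonoidalPreadditive K]
    [∀ (J : Type v) (X : K), PreservesColimitsOfShape (Discrete J) ((curriedTensor K).obj X)]
    (h : compacts K (𝟙_ K)) {X : K} (hX : IsRigid X) : compacts K X := by
  intro J Y c hc f
  have := hX
  let D := (ihom X).obj (𝟙_ K)
  let F := (curriedTensor K).obj D
  have hn : ∀ {Y Z : K} (g : Y ⟶ Z), rigidityMap X Y ≫ (ihom X).map g = D ◁ g ≫ rigidityMap X Z :=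
    fun {Y Z} g => by
      rw [rigidityMap, rigidityMap, ← MonoidalClosed.curry_natural_right,
        ← MonoidalClosed.curry_natural_left]
      congr 1
      rw [associator_inv_naturality_right_assoc, whisker_exchange_assoc]
      change _ = _ ≫ _ ≫ 𝟙_ K ◁ g ≫ _
      simp [D]
  have hr := hX c.pt
  obtain ⟨s, φ, hφ⟩ := h J _ _ (Cofan.isColimitMapCoconeEquiv F Y c (isColimitOfPreserves F hc))
    (MonoidalClosed.curry ((ρ_ X).hom ≫ f) ≫ inv (rigidityMap X c.pt))
  refine ⟨s, fun j => (ρ_ X).inv ≫ MonoidalClosed.uncurry (φ j ≫ rigidityMap X (Y j)), ?_⟩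
  have h1 : f = (ρ_ X).inv ≫ MonoidalClosed.uncurry
      ((MonoidalClosed.curry ((ρ_ X).hom ≫ f) ≫ inv (rigidityMap X c.pt)) ≫
        rigidityMap X c.pt) := by simp
  refine h1.trans ?_
  rw [hφ]
  simp only [Preadditive.sum_comp, MonoidalClosed.uncurry_eq, whiskerLeft_sum, Preadditive.comp_sum,
    Category.assoc]
  refine Finset.sum_congr rfl fun j _ => ?_
  have h2 : (c.inj j : Y j ⟶ c.pt) = c.inj j := rfl
  have h3 := (ihom.ev X).naturality (c.inj j)
  dsimp at h3
  rw [← h3, ← whiskerLeft_comp_assoc, Category.assoc, hn]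
  rfl

end Rigid

/-! ### Rigid objects and compact objects -/

section RigidCompact

variable {R : Type u} [CommRing R] {B : Type u} [CommRing B] [HopfAlgebra R B] [Module.Finite R B]
  [Module.Projective R B]

/-- Bounded complexes in `mod(A, R)` have duals in the homotopy category of complexes. -/
lemma exists_exactPairing {M : KRep R B} (hM : KbModProp R _ M) :
    ∃ D : KRep R B, KbModProp R _ D ∧ Nonempty (ExactPairing D M) := by
  let _ : ∀ n, HasLeftDual (M.as.X n) := fun n =>
    { leftDual := dualRep R (M.as.X n), exact := exactPairingOfModFinProj (hM.1 n) }
  obtain ⟨N, hN⟩ := hM.2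
  refine ⟨(homQ _).obj (dualComplex M.as), ⟨fun n => modFinProj_dualRep (hM.1 (-n)), N,
    fun n hn => isZero_leftDual (hN _ (by rwa [abs_neg]))⟩, ⟨?_⟩⟩
  exact exactPairingHomQ (exactPairingDualComplex M.as (Finset.Icc (-N : ℤ) N) fun p hp =>
    hN p (by rw [Finset.mem_Icc, ← abs_le] at hp; exact not_le.1 hp))

lemma KProjProp_tensor_of_modFinProj {D E : KRep R B} (hD : KbModProp R _ D)
    (hE : KProjProp _ E) : KProjProp _ (D ⊗ E) := fun n =>
  proj_coproduct (isColimitTensorCofan D.as E.as n) fun i =>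
    proj_modFinProj_tensor (hD.1 i.1.1) (hE i.1.2)

/-- A compact object `X` receives a map `j : M ⟶ X` with `R`-contractible cone from a bounded
complex with dual `D`. The dual of `X` is `D ⊗ 𝟙`, where `𝟙` is the unit of `K^lf(Proj G, R)`: it is
a complex of projective modules, and isomorphic to the tensor product of a coresolution of `D` with
`𝟙`. -/
lemma isRigid_of_compacts {X : KlfG R B} (hX : compacts (KlfG R B) X) : IsRigid X := by
  let _ := HasDerivedCategory.standard (ModuleCat.{u} (GroupAlgebra R B))
  have hX' : Kpb R _ X.obj.obj :=
    (kPlusB_iff _).1 (((isFrobenius_groupAlgebra R B).compacts_iff X).1 hX)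
  obtain ⟨M, j, hM, hj, -⟩ := exists_truncation hX' 0
  obtain ⟨D, hD, ⟨_⟩⟩ := exists_exactPairing hM
  -- `D ⊗ E` is in `K^lf(Proj G, R)`: it is isomorphic to `I ⊗ E` for a coresolution `I` of `D`
  obtain ⟨I, g, hI, hg⟩ := (isFrobenius_groupAlgebra R B).exists_coresolution hD
  obtain ⟨I', -, ⟨i⟩⟩ := exists_klf_of_Kpb hI
  let E := klfUnit R B
  have hgE := isIso_whiskerRight_of_trW g hg hD hI E
  let D' : KProj (GroupAlgebra R B) :=
    ⟨D ⊗ E.obj.obj, KProjProp_tensor_of_modFinProj hD E.obj.property⟩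
  have hD' : KlfProp R (GroupAlgebra R B) D' :=
    ObjectProperty.prop_of_iso _ (ObjectProperty.isoMk _
      (whiskerRightIso i E.obj.obj ≪≫ (asIso (g ▷ E.obj.obj)).symm)) (klfTensor I' E).property
  let X' : KlfG R B := ⟨D', hD'⟩
  have hjW := isIso_whiskerRight_of_trW j hj hM hX'
  have := hjW X'
  have hjX : IsIso (j ▷ (D ⊗ E.obj.obj)) := hjW X'
  -- the evaluation `M ⊗ D ⊗ E ⟶ E`, transported along the isomorphism `M ⊗ D ⊗ E ≅ X ⊗ D ⊗ E`
  let e : X.obj.obj ⊗ D ⊗ E.obj.obj ⟶ E.obj.obj := inv (j ▷ (D ⊗ E.obj.obj)) ≫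
    (α_ M D E.obj.obj).inv ≫ ε_ D M ▷ E.obj.obj ≫ (λ_ E.obj.obj).hom
  refine isIso_rigidityMap (D := X') (klfHom e) fun W Y => ?_
  have := hjW W
  have h := bijective_of_exactPairing (W := W.obj.obj) j ((klfι R B).mapIso (λ_ Y)) e
    (IsIso.hom_inv_id_assoc _ _)
  have hι : ∀ V V' : KlfG R B, Function.Bijective ((klfι R B).map : (V ⟶ V') → _) := fun V V' =>
    ⟨(klfι R B).map_injective, (klfι R B).map_surjective⟩
  refine (Function.Bijective.of_comp_iff' (hι _ _) _).1 ?_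
  exact h.comp (hι W (X' ⊗ Y))

variable (R B) in
lemma isRigidlyCompactlyGenerated_klfG : IsRigidlyCompactlyGenerated (KlfG R B) :=
  ⟨isCompactlyGeneratedTri_klfG R B, compacts_klfUnit, inferInstance, fun _ =>
    ⟨isRigid_of_compacts, compacts_of_isRigid compacts_klfUnit⟩⟩

end RigidCompact

end FrobLF

theorem proposition2p10 :
    (∀ (R : Type u) [CommRing R] (A : Type u) [Ring A] [Algebra R A]
      [HasDerivedCategory.{w} (ModuleCat.{u} A)], IsFrobenius R A →
      IsCompactlyGeneratedTri (Klf R A) ∧ (DbMod.can R A).Full ∧ (DbMod.can R A).Faithful ∧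
      ∃ (E : (compacts (Klf R A)).FullSubcategory ≌ DbMod R A) (_ : E.functor.CommShift ℤ)
        (e : E.functor ⋙ DbMod.can R A ≅ (compacts (Klf R A)).ι ⋙ Klf.q R A),
        E.functor.IsTriangulated ∧ NatTrans.CommShift e.hom ℤ) ∧
    (∀ (R : Type u) [CommRing R] [IsNoetherianRing R] (B : Type u) [CommRing B] [HopfAlgebra R B]
      [Module.Finite R B] [Module.Projective R B],
      ∃ (_ : MonoidalCategory (Klf R (GroupAlgebra R B)))
        (_ : SymmetricCategory (Klf R (GroupAlgebra R B)))
        (_ : (curriedTensor (Klf R (GroupAlgebra R B))).CommShift₂Int),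
        Nonempty (IsInduced R B) ∧ IsTensorTriangulated (Klf R (GroupAlgebra R B)) ∧
          IsRigidlyCompactlyGenerated (Klf R (GroupAlgebra R B))) := by
  refine ⟨?_, ?_⟩
  · intro R _ A _ _ _ hA
    exact ⟨hA.isCompactlyGeneratedTri, hA.full_can, hA.faithful_can, hA.exists_equivalence⟩
  · intro R _ _ B _ _ _ _
    exact ⟨inferInstance, inferInstance, inferInstance, ⟨isInduced R B⟩, inferInstance,
      isRigidlyCompactlyGenerated_klfG R B⟩
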